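/- **Setting.** Let $n\ge 1$, let $M$ be a real-analytic manifold (Hausdorff, second countable) of dimension $2n$ and $(M,\Omega,F)$ a real-analytic integrable Hamiltonian system: $\Omega$ is a real-analytic symplectic form, $F=(f_1,\dots,f_n):M\to\mathbb R^n$ is real-analytic (not necessarily proper), the $f_i$ pairwise Poisson commute, and $\operatorname{rank} dF=n$ on a dense set. The Hamiltonian vector field $X_f$ is defined by $\Omega(\cdot,X_f)=df$; flows need not be complete. $\mathcal O_m$ denotes the orbit of $m$ under the local Hamiltonian $\mathbb R^n$-action generated by $f_1,\dots,f_n$. Let $m_0\in M$ be a singular point ($\operatorname{rank} dF(m_0)<n$) with $F(m_0)=0$, and $L_0=F^{-1}(0)$. Suppose that there is a point $m_1\in L_0$ such that (i) $\operatorname{rank} dF(m_1)=n$; (ii) there are a compact trajectory $\gamma_0$ of $X_{f_1}$ (a closed trajectory or an equilibrium) and a continuous family of $2\pi$-periodic trajectories $\gamma_u\subset\mathcal O_{m_1}$, $0<u\le1$, of $X_{f_1}$ with $m_1\in\gamma_1=:\gamma$ and $m_0\in\gamma_0\subset C:=\overline{\bigcup_{0<u\le1}\gamma_u}$; moreover,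 the trajectories of $X_{f_1}$ through the points of $C$ are defined for all times (this is automatic if $C$ is compact). Here a *continuous family of closed curves* $(c_z)_{z\in Z}$, $Z\subset\mathbb R^n$, for a momentum map $F$, means $C^1$ curves $c_z:\mathbb R/2\pi\mathbb Z\to F^{-1}(z)$ consisting of regular points of $F$, with $(z,t)\mapsto c_z(t)$ continuous. All neighbourhoods called $U,V,\tilde U,\tilde V$ are open. **(a)** There are a neighbourhood $U$ of $C$ such that $V=F(U)$ is an open neighbourhood of $0\in\mathbb R^n$, and a real-analytic function $I:V\to\mathbb R$ with $I(z)=z_1+O(|z|^2)$, such that $I\circ F$ generates an $F$-preserving Hamiltonian action of $S^1=\mathbb R/2\pi\mathbb Z$ on $U$. Such an action on $U$, and the function $I$ on $V$, are unique. Moreover $I$ is given by the Mineur–Arnold formula $$I(z)=\frac1{2\pi}\oint_{\gamma_z}\alpha+\mathrm{const}.$$ Namely, there are a continuous family of closed curves $(\gamma_z)_{z\in V}$ for $F$ with $\gamma_{0}=\gamma$ and a real-analytic 1-form $\alpha$ with $d\alpha=\Omega$ on an open set containing all these curves, such that the formula holds for all $z\in V$; and the formula holds, for all $z\in Z$, for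 every connected open $Z\subset V$ with $0\in Z$, every continuous family of closed curves $(\gamma_z)_{z\in Z}$ for $F$ with $\gamma_0=\gamma$, and every real-analytic 1-form $\alpha$ with $d\alpha=\Omega$ on an open set containing these curves. **(b)** The action is persistent under real-analytic integrable perturbations. Let $k\ge2$ be an integer, and let $U'\subset U$ be a neighbourhood of $C$ in $M$ and $V'$ a neighbourhood of $0$ in $\mathbb R^n$ with compact closures $\overline{U'}\subset U$, $\overline{V'}\subset V$. Let $W$ be a neighbourhood of the closed curve $\gamma$ (of the graph of $t\mapsto\gamma(t)$, $0\le t\le2\pi$, in $\mathbb R\times M$). Then there are a compact set $K\subset U$ and a neighbourhood $W'\subset W$ of $\gamma$ such that, for every $C^k$-norm defined by means of finitely many charts and compact subsets of their domains that cover $K$, there are $\varepsilon_0,B,\delta>0$ with $B\varepsilon_0\le\delta$ such that the following holds for every $\varepsilon\in(0,\varepsilon_0]$ and every real-analytic integrable Hamiltonian system $(M,\tilde\Omega,\tilde F)$ that is $\varepsilon$-close to $(M,\Omega,F)$ in this norm. There are an open set $\tilde U\supset U'$ such that $\tilde V=\tilde F(\tilde U)$ is open and $V'\subset\tilde V\subset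 V$, and a real-analytic function $\tilde I:\tilde V\to\mathbb R$ with $\|\tilde I-I\|_{C^k(\tilde V)}\le B\varepsilon$, such that $\tilde I\circ\tilde F$ generates, with respect to $\tilde\Omega$, an $\tilde F$-preserving Hamiltonian $S^1$-action on $\tilde U$. This action is unique, and $\tilde I$ is unique up to an additive constant, among the actions on $\tilde U$ generated by $I'\circ\tilde F$ with $I'$ real-analytic on $\tilde V$ and $\|I'-I\|_{C^k(\tilde V)}\le\delta$. Moreover, $\tilde I(z)=\frac1{2\pi}\oint_{\tilde\gamma_z}\tilde\alpha+\mathrm{const}$: there are a continuous family of closed curves $(\tilde\gamma_z)_{z\in\tilde V}$ for $\tilde F$ with $\tilde\gamma_0$ in $W'$ and a real-analytic 1-form $\tilde\alpha$ with $d\tilde\alpha=\tilde\Omega$ on an open set containing these curves, such that the formula holds for all $z\in\tilde V$; and the formula holds, for all $z\in Z$, for every connected open $Z\subset\tilde V$, every continuous family of closed curves $(\tilde\gamma_z)_{z\in Z}$ for $\tilde F$ of which at least one lies in $W'$, and every real-analytic 1-form $\tilde\alpha$ with $d\tilde\alpha=\tilde\Omega$ on an open set containing these curves. -/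

import Mathlib

open Set Filter Topology Manifold
open scoped ContDiff

noncomputable section

namespace Integrable

/-- The model space `ℝ²ⁿ` of the phase space. -/
abbrev Model (n : ℕ) : Type := EuclideanSpace ℝ (Fin (2 * n))

/-- The target `ℝⁿ` of the momentum map. -/
abbrev Target (n : ℕ) : Type := EuclideanSpace ℝ (Fin n)

section Forms

variable {n : ℕ} {M : Type*} [TopologicalSpace M] [ChartedSpace (Model n) M]

/-- (Not necessarily continuous) differential `k`-forms on a `2n`-dimensional manifold. -/
abbrev DForm (n : ℕ) (M : Type*) [TopologicalSpace M] [ChartedSpace (Model n) M] (k : ℕ) : Type _ :=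
  ∀ m : M, TangentSpace 𝓘(ℝ, Model n) m [⋀^Fin k]→L[ℝ] ℝ

/-- The coordinate representation `(e⁻¹)^* η` of a form in a chart `e`
(meaningful on `e.target`). -/
def formInChart {k : ℕ} (e : OpenPartialHomeomorph M (Model n)) (η : DForm n M k) :
    Model n → Model n [⋀^Fin k]→L[ℝ] ℝ :=
  fun x => (η (e.symm x)).compContinuousLinearMap
    (mfderiv 𝓘(ℝ, Model n) 𝓘(ℝ, Model n) e.symm x)

/-- The form is real-analytic on the open set `G`: its coefficients in all charts are. -/
def FormAnalyticOn {k : ℕ} (η : DForm n M k) (G : Set M) : Prop :=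
  ∀ e ∈ atlas (Model n) M,
    AnalyticOnNhd ℝ (formInChart e η) (e.target ∩ e.symm ⁻¹' G)

/-- `dη = ζ` on the open set `G`. -/
def ExtDerivEqOn {k : ℕ} (η : DForm n M k) (ζ : DForm n M (k + 1)) (G : Set M) : Prop :=
  ∀ e ∈ atlas (Model n) M, ∀ x ∈ e.target ∩ e.symm ⁻¹' G,
    extDeriv (formInChart e η) x = formInChart e ζ x

/-- Real-analytic symplectic forms: analytic, closed and nondegenerate 2-forms. -/
structure IsAnalyticSymplectic (Ω : DForm n M 2) : Prop where
  analytic : FormAnalyticOn Ω univ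
  closed : ExtDerivEqOn Ω 0 univ
  nondegenerate : ∀ (m : M) (v : TangentSpace 𝓘(ℝ, Model n) m),
    (∀ w : TangentSpace 𝓘(ℝ, Model n) m, Ω m ![v, w] = 0) → v = 0

/-- `α` is a real-analytic 1-form on the open set `G` with `dα = Ω` there. -/
def IsAnalyticPrimitiveOn (Ω : DForm n M 2) (α : DForm n M 1) (G : Set M) : Prop :=
  IsOpen G ∧ FormAnalyticOn α G ∧ ExtDerivEqOn α Ω G

/-- The line integral of a 1-form along a `2π`-periodic closed curve, over one period. -/
def loopIntegral (α : DForm n M 1) (c : ℝ → M) : ℝ :=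
  ∫ t in (0 : ℝ)..(2 * Real.pi), α (c t) (fun _ => mfderiv 𝓘(ℝ, ℝ) 𝓘(ℝ, Model n) c t (1 : ℝ))

open Classical in
/-- The Hamiltonian vector field `X_f`, with the sign convention `Ω(v, X_f) = df(v)`.
For a nondegenerate `Ω` there is exactly one such vector. -/
def hamVF (Ω : DForm n M 2) (f : M → ℝ) (m : M) : TangentSpace 𝓘(ℝ, Model n) m :=
  if h : ∃ X : TangentSpace 𝓘(ℝ, Model n) m, ∀ v : TangentSpace 𝓘(ℝ, Model n) m,
      Ω m ![v, X] = mfderiv 𝓘(ℝ, Model n) 𝓘(ℝ, ℝ) f m v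
  then h.choose else 0

/-- The rank of `dF` at `m`. -/
def momentumRank (F : M → Target n) (m : M) : ℕ :=
  Module.finrank ℝ (mfderiv 𝓘(ℝ, Model n) 𝓘(ℝ, Target n) F m).range

/-- Real-analytic integrable Hamiltonian systems `(M, Ω, F)` on the real-analytic manifold `M`:
the components of `F` are analytic, Poisson commute, and are functionally independent on a dense
set. -/
structure IsIntegrableSystem (Ω : DForm n M 2) (F : M → Target n) : Prop where
  symplectic : IsAnalyticSymplectic Ω
  analytic : ContMDiff 𝓘(ℝ, Model n) 𝓘(ℝ, Target n) ω F
  commute : ∀ (i j : Fin n) (m : M),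
    Ω m ![hamVF Ω (fun p => F p i) m, hamVF Ω (fun p => F p j) m] = 0
  independent : Dense {m : M | momentumRank F m = n}

/-- The orbit of `m` under the local Hamiltonian action of `ℝⁿ` generated by `f₁, …, fₙ`: the points
reached from `m` by successively following, for finite times, trajectories of Hamiltonian vector
fields of linear combinations of the `f_j`. -/
def localOrbit (Ω : DForm n M 2) (F : M → Target n) (m : M) : Set M :=
  {m' | Relation.ReflTransGen (fun p q : M => ∃ (a : Fin n → ℝ) (σ : ℝ → M),
    IsMIntegralCurveOn (I := 𝓘(ℝ, Model n)) σ (hamVF Ω (fun x => ∑ j, a j * F x j)) (Icc 0 1) ∧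
      σ 0 = p ∧ σ 1 = q) m m'}

/-- `Φ` is an `F`-preserving Hamiltonian action of the circle `ℝ/2πℤ` on the open set `U`, generated
by the function `H` (only the restriction of `Φ` to `U` matters). -/
structure IsHamiltonianCircleAction (Ω : DForm n M 2) (F : M → Target n) (U : Set M) (H : M → ℝ)
    (Φ : AddCircle (2 * Real.pi) → M → M) : Prop where
  mapsTo : ∀ θ, MapsTo (Φ θ) U U
  zero_act : ∀ m ∈ U, Φ 0 m = m
  add_act : ∀ θ θ', ∀ m ∈ U, Φ (θ + θ') m = Φ θ (Φ θ' m)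
  analytic : ContMDiffOn (𝓘(ℝ, ℝ).prod 𝓘(ℝ, Model n)) 𝓘(ℝ, Model n) ω
    (fun p : ℝ × M => Φ (p.1 : AddCircle (2 * Real.pi)) p.2) (univ ×ˢ U)
  preserves : ∀ θ, ∀ m ∈ U, F (Φ θ m) = F m
  generated : ∀ m ∈ U, IsMIntegralCurve (I := 𝓘(ℝ, Model n))
    (fun t : ℝ => Φ (t : AddCircle (2 * Real.pi)) m) (hamVF Ω H)

/-- A family of `C¹` closed curves `c z`, `z ∈ Z`, each lying in the regular part of the fibre
`F⁻¹(z)`, and depending continuously on `z`. -/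
structure IsClosedCurveFamily (F : M → Target n) (Z : Set (Target n))
    (c : Target n → ℝ → M) : Prop where
  periodic : ∀ z ∈ Z, Function.Periodic (c z) (2 * Real.pi)
  contMDiff : ∀ z ∈ Z, ContMDiff 𝓘(ℝ, ℝ) 𝓘(ℝ, Model n) 1 (c z)
  continuousOn : ContinuousOn (fun p : Target n × ℝ => c p.1 p.2) (Z ×ˢ univ)
  mem_fiber : ∀ z ∈ Z, ∀ t, F (c z t) = z
  regular : ∀ z ∈ Z, ∀ t, momentumRank F (c z t) = n

/-- The Mineur–Arnold formula `J(z) = (1/2π) ∮_{c z} α + const` for `z ∈ Z`. -/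
def MineurArnoldFormula (α : DForm n M 1) (Z : Set (Target n)) (c : Target n → ℝ → M)
    (J : Target n → ℝ) : Prop :=
  ∃ const : ℝ, ∀ z ∈ Z, J z = 1 / (2 * Real.pi) * loopIntegral α (c z) + const

/-- Data for a `C^k`-norm over a compact part of `M`: finitely many compact sets, each of them in
the domain of a chart. -/
structure CompactPieces (n : ℕ) (M : Type*) [TopologicalSpace M] [ChartedSpace (Model n) M] where
  num : ℕ
  chart : Fin num → OpenPartialHomeomorph M (Model n)
  chart_mem : ∀ i, chart i ∈ atlas (Model n) M
  piece : Fin num → Set M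
  isCompact : ∀ i, IsCompact (piece i)
  subset : ∀ i, piece i ⊆ (chart i).source

/-- `(Ω', F')` is `ε`-close to `(Ω, F)` in the `C^k`-norm defined by `P`: in the chosen charts all
partial derivatives of order at most `k` of the differences are at most `ε` on the chosen compact
sets. -/
def SystemCkClose (P : CompactPieces n M) (k : ℕ) (ε : ℝ) (Ω Ω' : DForm n M 2)
    (F F' : M → Target n) : Prop :=
  ∀ i, ∀ p ∈ P.piece i, ∀ j ≤ k,
    ‖iteratedFDeriv ℝ j
        (fun x => formInChart (P.chart i) Ω' x - formInChart (P.chart i) Ω x) (P.chart i p)‖ ≤ ε ∧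
    ‖iteratedFDeriv ℝ j
        (fun x => F' ((P.chart i).symm x) - F ((P.chart i).symm x)) (P.chart i p)‖ ≤ ε

end Forms

/-- `‖J' - J‖_{C^k(V)} ≤ δ`. -/
def FunCkClose {n : ℕ} (V : Set (Target n)) (k : ℕ) (δ : ℝ) (J J' : Target n → ℝ) : Prop :=
  ∀ z ∈ V, ∀ j ≤ k, ‖iteratedFDeriv ℝ j (fun w => J' w - J w) z‖ ≤ δ

/-- The set `C`, the closure of the union of the curves `γ_u`, `0 < u ≤ 1`. -/
def familyClosure {M : Type*} [TopologicalSpace M] (γ : ℝ → ℝ → M) : Set M :=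
  closure (⋃ u ∈ Ioc (0 : ℝ) 1, range (γ u))

end Integrable

end

open Integrable

set_option linter.unusedSectionVars false

noncomputable section

namespace Integrable

open Metric Function MeasureTheory
open ContinuousLinearMap (inl inr fst snd compL opNorm_le_bound opNorm_comp_le norm_inr_le_one)
open scoped Real

/-- The model space of the phase space as a model with corners. -/
notation "𝓘[" n "]" => 𝓘(ℝ, Model n)

/-- The parameter space of a tube. -/
abbrev Coords (n : ℕ) : Type := Target n × Target n

lemma omega_ne_zero : (ω : WithTop ℕ∞) ≠ 0 := by decide

lemma _root_.ContMDiffAt.mdiff {A B H H' P Q : Type*} [NormedAddCommGroup A] [NormedSpace ℝ A]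
    [NormedAddCommGroup B] [NormedSpace ℝ B] [TopologicalSpace H] [TopologicalSpace H']
    [TopologicalSpace P] [ChartedSpace H P] [TopologicalSpace Q] [ChartedSpace H' Q]
    {I : ModelWithCorners ℝ A H} {I' : ModelWithCorners ℝ B H'} {f : P → Q} {x : P}
    (h : ContMDiffAt I I' ω f x) : MDifferentiableAt I I' f x := h.mdifferentiableAt omega_ne_zero

lemma _root_.ContDiffAt.diff {A B : Type*} [NormedAddCommGroup A] [NormedSpace ℝ A]
    [NormedAddCommGroup B] [NormedSpace ℝ B] {f : A → B} {x : A} (h : ContDiffAt ℝ ω f x) :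
    DifferentiableAt ℝ f x :=
  h.differentiableAt omega_ne_zero

variable {n : ℕ} [NeZero n] {M : Type*} [TopologicalSpace M] [ChartedSpace (Model n) M]
  [IsManifold 𝓘[n] ω M] [T2Space M] {X Y Z : Type*} [NormedAddCommGroup X] [NormedSpace ℝ X]
  [NormedAddCommGroup Y] [NormedSpace ℝ Y] [NormedAddCommGroup Z] [NormedSpace ℝ Z]
  {Ω : DForm n M 2} {F : M → Target n} {p r₁ r₂ r L t s : ℝ} {b : Target n → Target n}
  {E : Coords n → M} {x : Coords n} {N U : Set M} {J : Target n → ℝ} {m q : M}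
  {v : M → Model n} {γ c σ : ℝ → M} {τ ζ z : Target n}
  {w : Model n} {k : ℕ} {e : OpenPartialHomeomorph M (Model n)} {G : Set M} {α : DForm n M 1}
  {ρ : ℝ} {I : Set ℝ}

lemma _root_.DifferentiableAt.hasFDerivAt_left {f : X × Y → Z} {x : X} {y : Y} (h : DifferentiableAt
    ℝ f (x, y)) : HasFDerivAt (fun x => f (x, y)) ((fderiv ℝ f (x, y)).comp (inl ℝ X Y)) x :=
  HasFDerivAt.comp (g := f) (f := fun x => (x, y)) x h.hasFDerivAt (hasFDerivAt_prodMk_left _ _)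

lemma _root_.DifferentiableAt.hasFDerivAt_right {f : X × Y → Z} {x : X} {y : Y} (h :
    DifferentiableAt ℝ f (x, y)) : HasFDerivAt (fun y => f (x, y)) ((fderiv ℝ f (x, y)).comp (inr ℝ
    X Y)) y :=
  HasFDerivAt.comp (g := f) (f := fun y => (x, y)) y h.hasFDerivAt (hasFDerivAt_prodMk_right _ _)

lemma _root_.ContinuousAt.left {f : X × Y → Z} {x : X} {y : Y} (h : ContinuousAt f (x, y)) :
    ContinuousAt (fun x => f (x, y)) x :=
  ContinuousAt.comp (g := f) (f := fun x => (x, y)) h (Continuous.prodMk_left y).continuousAt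

lemma mem_ball_prod {x : X × Y} : x ∈ ball 0 ρ ↔ ‖x.1‖ < ρ ∧ ‖x.2‖ < ρ := by
  rw [mem_ball_zero_iff, Prod.norm_def, max_lt_iff]

lemma mk_mem_ball {x : X × Y} (hx : x ∈ ball 0 ρ) {y : X} (hy : y ∈ ball 0 ρ) :
    (y, x.2) ∈ ball (0 : X × Y) ρ :=
  mem_ball_prod.2 ⟨mem_ball_zero_iff.1 hy, (mem_ball_prod.1 hx).2⟩

lemma smul_fst_mem_ball {x : X × Y} (hx : x ∈ ball 0 ρ) (hs : s ∈ Icc (0 : ℝ) 1) :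
    (s • x.1, x.2) ∈ ball (0 : X × Y) ρ := by
  refine mem_ball_prod.2 ⟨?_, (mem_ball_prod.1 hx).2⟩
  rw [norm_smul, Real.norm_of_nonneg hs.1]
  exact (mul_le_of_le_one_left (norm_nonneg _) hs.2).trans_lt (mem_ball_prod.1 hx).1

section Nemytskii
variable {K : Type*} [TopologicalSpace K] [CompactSpace K]

def pointwiseMultilinear (K : Type*) [TopologicalSpace K] [CompactSpace K] {k : ℕ}
    (f : X [×k]→L[ℝ] Y) : C(K, X) [×k]→L[ℝ] C(K, Y) :=
  MultilinearMap.mkContinuous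
    { toFun := fun u => ⟨fun s => f (fun i => u i s), by fun_prop⟩
      map_update_add' := by
        intro _ m i x y
        ext s
        have h : ∀ z : C(K, X), (fun j => (update m i z) j s)
            = update (fun j => m j s) i (z s) := by
          intro z; ext j; by_cases hj : j = i
          · subst hj; simp
          · simp [hj]
        simp [h]
      map_update_smul' := by
        intro _ m i c x
        ext s
        have h : ∀ z : C(K, X), (fun j => (update m i z) j s)
            = update (fun j => m j s) i (z s) := by
          intro z; ext j; by_cases hj : j = i
          · subst hj; simp
          · simp [hj]
        simp [h] } ‖f‖ (by
    intro m
    rw [ContinuousMap.norm_le _ (by positivity)]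
    intro s
    refine (f.le_opNorm _).trans ?_
    gcongr with i
    exact (m i).norm_coe_le_norm s)

lemma norm_pointwiseMultilinear_le (f : X [×k]→L[ℝ] Y) : ‖pointwiseMultilinear K f‖ ≤ ‖f‖ :=
  MultilinearMap.mkContinuous_norm_le _ (norm_nonneg _) _

/-- The superposition operator of an analytic function is analytic near constant functions. -/
theorem exists_superposition [CompleteSpace Y] {f : X → Y} {x₀ : X} (hf : AnalyticAt ℝ f x₀) : ∃ r >
    0, ∃ Nf : C(K, X) → C(K, Y), AnalyticOnNhd ℝ Nf (ball 0 r) ∧ ∀ u ∈ ball (0 : C(K, X)) r, ∀ s, Nf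
    u s = f (x₀ + u s) := by
  obtain ⟨p, ρ, hp⟩ := hf
  let P : FormalMultilinearSeries ℝ C(K, X) C(K, Y) := fun k => pointwiseMultilinear K (p k)
  have hrad : p.radius ≤ P.radius := by
    refine ENNReal.le_of_forall_nnreal_lt fun r hr => ?_
    obtain ⟨C, _, hC⟩ := p.norm_mul_pow_le_of_lt_radius hr
    exact P.le_radius_of_bound C fun k => le_trans (by
      gcongr; exact norm_pointwiseMultilinear_le _) (hC k)
  have hρ : ρ ≤ P.radius := hp.r_le.trans hrad
  have hP := P.hasFPowerSeriesOnBall (hp.r_pos.trans_le hρ)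
  obtain ⟨r, hr0, hr⟩ := ENNReal.lt_iff_exists_nnreal_btwn.1 hp.r_pos
  have hr0' : (0 : ℝ) < r := by exact_mod_cast hr0
  refine ⟨r, hr0', P.sum, ?_, ?_⟩
  · intro u hu
    refine hP.analyticAt_of_mem ?_
    rw [mem_eball, edist_nndist]
    refine lt_of_lt_of_le ?_ (hr.le.trans hρ)
    have : nndist u 0 < r := by exact_mod_cast (mem_ball.1 hu)
    exact_mod_cast this
  · intro u hu s
    have hu' : ‖u‖ < r := by simpa using hu
    have hmem : ∀ c : NNReal, (c : ℝ) < r → (c : ENNReal) < ρ := fun c hc =>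
      lt_of_lt_of_le (by exact_mod_cast hc) hr.le
    have h1 := hP.hasSum (y := u) (eball_subset_eball hρ (by
      rw [mem_eball, edist_nndist]; exact hmem _ (by simpa using hu')))
    rw [zero_add] at h1
    have h2 := (ContinuousMap.evalCLM ℝ s : C(K, Y) →L[ℝ] Y).hasSum h1
    have h3 := hp.hasSum (y := u s) (by
      rw [mem_eball, edist_nndist]
      exact hmem _ (by simpa using lt_of_le_of_lt (u.norm_coe_le_norm s) hu'))
    exact h2.unique h3
end Nemytskii

section LocalFlow
variable {E : Type*} [NormedAddCommGroup E] [NormedSpace ℝ E]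

def unitPrimitive (E : Type*) [NormedAddCommGroup E] [NormedSpace ℝ E] :
    C(Icc (0 : ℝ) 1, E) →L[ℝ] C(Icc (0 : ℝ) 1, E) :=
  LinearMap.mkContinuous
    { toFun := fun w => ⟨fun s => ∫ τ in (0 : ℝ)..s, IccExtend zero_le_one w τ, by
        have : Continuous (IccExtend (zero_le_one : (0 : ℝ) ≤ 1) w) := w.continuous.Icc_extend'
        exact (intervalIntegral.continuous_primitive
          (fun a b => this.intervalIntegrable a b) 0).comp continuous_subtype_val⟩
      map_add' := fun w w' => by
        ext s
        have h : ∀ w : C(Icc (0 : ℝ) 1, E), Continuous (IccExtend (zero_le_one : (0 : ℝ) ≤ 1) w) :=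
          fun w => w.continuous.Icc_extend'
        exact intervalIntegral.integral_add ((h w).intervalIntegrable _ _)
          ((h w').intervalIntegrable _ _)
      map_smul' := fun c w => by
        ext s
        exact intervalIntegral.integral_smul c _ } 1 (by
    intro w
    rw [one_mul, ContinuousMap.norm_le _ (norm_nonneg _)]
    intro s
    refine (intervalIntegral.norm_integral_le_of_norm_le_const (C := ‖w‖) ?_).trans ?_
    · intro x _
      exact w.norm_coe_le_norm _
    · rw [sub_zero, abs_of_nonneg s.2.1]
      exact mul_le_of_le_one_right (norm_nonneg _) s.2.2)

lemma unitPrimitive_apply (w : C(Icc (0 : ℝ) 1, E)) (s : Icc (0 : ℝ) 1) : unitPrimitive E w s = ∫ τ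
    in (0 : ℝ)..s, IccExtend zero_le_one w τ := rfl

abbrev FlowSpace (E : Type*) [TopologicalSpace E] := ℝ × E × C(Icc (0 : ℝ) 1, E)

/-- Analytic vector fields have analytic local flows. -/
theorem exists_analytic_flow [CompleteSpace E] {f : E → E} {x₀ : E} (hf : AnalyticAt ℝ f x₀) {O :
    Set E} (hO : O ∈ 𝓝 x₀) : ∃ r > 0, ∃ φ : ℝ × E → E, AnalyticOnNhd ℝ φ (Ioo (-r) r ×ˢ ball x₀ r) ∧
    ∀ x ∈ ball x₀ r, φ (0, x) = x ∧ ∀ t ∈ Ioo (-r) r, φ (t, x) ∈ O ∧ HasDerivAt (fun t => φ (t, x))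
    (f (φ (t, x))) t := by
  obtain ⟨ε, hε, a, R, L, Kc, hR, hPL⟩ := IsPicardLindelof.of_contDiffAt_one
    (hf.contDiffAt (n := 1))
  obtain ⟨α, hα, hαc⟩ := (hPL 0).exists_forall_mem_closedBall_eq_hasDerivWithinAt_continuousOn
  simp only [zero_sub, zero_add] at hα hαc
  have hR' : (0 : ℝ) < R := hR
  obtain ⟨ρ, hρ, Nf, hNf, hNe⟩ := exists_superposition (K := Icc (0 : ℝ) 1) hf
  let I01 := Icc (0 : ℝ) 1
  let Lc : ℝ × E → C(I01, E) → C(I01, E) := fun q u =>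
    u - ContinuousLinearMap.const ℝ I01 (q.2 - x₀) - q.1 • unitPrimitive E (Nf u)
  let H : FlowSpace E → FlowSpace E := fun q => (q.1, q.2.1, Lc (q.1, q.2.1) q.2.2)
  let a₀ : FlowSpace E := (0, x₀, 0)
  have hNf0 : AnalyticAt ℝ Nf 0 := hNf 0 (mem_ball_self hρ)
  have hNfa : AnalyticAt ℝ (fun q : FlowSpace E => Nf q.2.2) a₀ :=
    AnalyticAt.comp (g := Nf) (f := fun q : FlowSpace E => q.2.2) hNf0
      (analyticAt_snd.comp analyticAt_snd)
  have hB : AnalyticAt ℝ (fun q : FlowSpace E => unitPrimitive E (Nf q.2.2)) a₀ :=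
    ((unitPrimitive E).analyticAt _).comp hNfa
  have hHa : ContDiffAt ℝ ω H a₀ := by
    have h2 : ContDiffAt ℝ ω (fun q : FlowSpace E => ContinuousLinearMap.const ℝ I01 (q.2.1 - x₀)) a₀ :=
      (ContinuousLinearMap.contDiff _).contDiffAt.comp (f := fun q : FlowSpace E =>
        q.2.1 - x₀) a₀ (by fun_prop)
    have h3 : ContDiffAt ℝ ω (fun q : FlowSpace E => q.1) a₀ := contDiffAt_fst
    have h4 : ContDiffAt ℝ ω (fun q : FlowSpace E => q.2) a₀ := contDiffAt_snd
    exact h3.prodMk (h4.fst.prodMk ((h4.snd.sub h2).sub (h3.smul hB.contDiffAt)))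
  let ℓ : FlowSpace E →L[ℝ] (FlowSpace E) := (inr ℝ ℝ _).comp ((inr ℝ E _).comp ((ContinuousLinearMap.const ℝ I01).comp
    ((fst ℝ E C(I01, E)).comp (snd ℝ ℝ _)) + (fst ℝ ℝ _).smulRight (unitPrimitive E (Nf 0))))
  let A : FlowSpace E ≃L[ℝ] (FlowSpace E) := ContinuousLinearEquiv.equivOfInverse (.id ℝ (FlowSpace E) - ℓ) (.id ℝ (FlowSpace E) + ℓ)
    (fun q => by ext <;> simp [ℓ])
    (fun q => by ext <;> simp [ℓ])
  have hHd : HasFDerivAt H (A : FlowSpace E →L[ℝ] (FlowSpace E)) a₀ := by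
    have e1 : HasFDerivAt (fun q : FlowSpace E => q.1)
      (fst ℝ ℝ (E × C(I01, E))) a₀ := hasFDerivAt_fst
    have e2 : HasFDerivAt (fun q : FlowSpace E => q.2)
      (snd ℝ ℝ (E × C(I01, E))) a₀ := hasFDerivAt_snd
    have e3 := (hasFDerivAt_fst (𝕜 := ℝ) (E := E) (F := C(I01, E)) (p := a₀.2)).comp a₀ e2
    have e4 := (hasFDerivAt_snd (𝕜 := ℝ) (E := E) (F := C(I01, E)) (p := a₀.2)).comp a₀ e2
    have e5 := ((ContinuousLinearMap.const ℝ I01 : E →L[ℝ] C(I01, E)).hasFDerivAt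
      (x := a₀.2.1 - x₀)).comp a₀ (e3.sub_const x₀)
    have e6 := e1.smul hB.differentiableAt.hasFDerivAt
    refine (e1.prodMk (e3.prodMk ((e4.sub e5).sub e6))).congr_fderiv ?_
    ext q <;> simp [A, ℓ, a₀, sub_sub]
  let Ψ := hHa.toOpenPartialHomeomorph H hHd omega_ne_zero
  have hsrc : Ψ.source ∈ 𝓝 a₀ := Ψ.open_source.mem_nhds
    (hHa.mem_toOpenPartialHomeomorph_source hHd omega_ne_zero)
  have hloc : ContDiffAt ℝ ω (hHa.localInverse hHd omega_ne_zero) (H a₀) := hHa.to_localInverse hHd omega_ne_zero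
  have hHa0 : H a₀ = (0, x₀, 0) := by simp [H, Lc, a₀]
  rw [hHa0] at hloc
  let G : ℝ × E → E := fun q =>
    x₀ + (hHa.localInverse hHd omega_ne_zero (q.1, q.2, 0)).2.2 ⟨1, right_mem_Icc.2 zero_le_one⟩
  have hG : AnalyticAt ℝ G (0, x₀) := by
    refine ContDiffAt.analyticAt ?_
    have h1 : ContDiffAt ℝ ω (fun q : ℝ × E =>
        hHa.localInverse hHd omega_ne_zero (q.1, q.2, (0 : C(I01, E)))) (0, x₀) :=
      ContDiffAt.comp (0, x₀) (f := fun q : ℝ × E => (q.1, q.2, (0 : C(I01, E)))) hloc (by fun_prop)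
    have h2 : ContDiffAt ℝ ω (fun q : ℝ × E =>
        (hHa.localInverse hHd omega_ne_zero (q.1, q.2, (0 : C(I01, E)))).2.2) (0, x₀) :=
      h1.snd.snd
    exact contDiffAt_const.add
      ((ContinuousMap.evalCLM ℝ (⟨1, right_mem_Icc.2 zero_le_one⟩ : I01) : C(I01, E) →L[ℝ] E).contDiff.contDiffAt.comp
        _ h2)
  have hαx : α (x₀, 0) = x₀ := (hα x₀ (mem_closedBall_self hR'.le)).1
  have hαat : ContinuousAt α (x₀, 0) := hαc.continuousAt
    (prod_mem_nhds (closedBall_mem_nhds _ hR') (Icc_mem_nhds (by linarith) hε))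
  obtain ⟨η, hη, hηs⟩ := Metric.mem_nhds_iff.1 hsrc
  have hev : ∀ᶠ q : ℝ × E in 𝓝 (0, x₀), α (q.2, q.1) ∈ O ∩ ball x₀ (min η ρ) ∧
      AnalyticAt ℝ G q := by
    refine Filter.Eventually.and ?_ hG.eventually_analyticAt
    have hsw : Tendsto (fun q : ℝ × E => α (q.2, q.1)) (𝓝 (0, x₀)) (𝓝 x₀) := by
      have h := hαat.tendsto.comp ((continuous_swap (X := ℝ) (Y := E)).tendsto (0, x₀))
      rwa [hαx] at h
    exact hsw (inter_mem hO (ball_mem_nhds _ (lt_min hη hρ)))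
  obtain ⟨r₁, hr₁, hr₁s⟩ := eventually_nhds_iff_ball.1 hev
  let r := min (min r₁ η) (min ε R)
  have hr : 0 < r := lt_min (lt_min hr₁ hη) (lt_min hε hR')
  have hkey : ∀ t ∈ Ioo (-r) r, ∀ x ∈ ball x₀ r, (t, x) ∈ ball ((0 : ℝ), x₀) r := by
    intro t ht x hx
    rw [← ball_prod_same]
    exact ⟨by simpa [abs_lt] using ht, hx⟩
  have hrr₁ : r ≤ r₁ := (min_le_left _ _).trans (min_le_left _ _)
  have hrη : r ≤ η := (min_le_left _ _).trans (min_le_right _ _)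
  have hrε : r ≤ ε := (min_le_right _ _).trans (min_le_left _ _)
  have hrR : r ≤ R := (min_le_right _ _).trans (min_le_right _ _)
  have hder : ∀ t ∈ Ioo (-r) r, ∀ x ∈ ball x₀ r,
      HasDerivAt (fun t => α (x, t)) (f (α (x, t))) t := by
    intro t ht x hx
    refine ((hα x (ball_subset_closedBall (ball_subset_ball hrR hx))).2 t
      ⟨by linarith [ht.1], by linarith [ht.2]⟩).hasDerivAt
      (Icc_mem_nhds (by linarith [ht.1]) (by linarith [ht.2]))
  have heq : ∀ t ∈ Ioo (-r) r, ∀ x ∈ ball x₀ r, α (x, t) = G (t, x) := by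
    intro t ht x hx
    have hts : ∀ s ∈ Icc (0 : ℝ) 1, t * s ∈ Ioo (-r) r := by
      intro s hs
      have h1 : |t| < r := abs_lt.2 ht
      have h2 : |t * s| < r := by
        rw [abs_mul, abs_of_nonneg hs.1]
        exact (mul_le_of_le_one_right (abs_nonneg t) hs.2).trans_lt h1
      exact abs_lt.1 h2
    have hcd : ∀ s ∈ Icc (0 : ℝ) 1, HasDerivAt (fun s => α (x, t * s) - x₀)
        (t • f (α (x, t * s))) s := by
      intro s hs
      have h1 := (hder _ (hts s hs) x hx).scomp s ((hasDerivAt_id s).const_mul t)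
      simpa using h1.sub_const x₀
    let w : C(I01, E) := ⟨fun s => α (x, t * s) - x₀, by
      rw [continuous_iff_continuousAt]
      intro s
      exact ((hcd s s.2).continuousAt).comp continuous_subtype_val.continuousAt⟩
    have hw : ‖w‖ < min η ρ := by
      rw [ContinuousMap.norm_lt_iff _ (lt_min hη hρ)]
      intro s
      have := (hr₁s _ (ball_subset_ball hrr₁ (hkey _ (hts s s.2) x hx))).1.2
      simpa [w, dist_eq_norm] using this
    have hws : (t, x, w) ∈ Ψ.source := by
      apply hηs
      rw [mem_ball, Prod.dist_eq, Prod.dist_eq]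
      refine max_lt ?_ (max_lt ((mem_ball.1 hx).trans_le hrη) ?_)
      · simpa [a₀] using (abs_lt.2 ht).trans_le hrη
      · simpa [a₀] using hw.trans_le (min_le_left _ _)
    have hHw : H (t, x, w) = (t, x, 0) := by
      refine Prod.ext rfl (Prod.ext rfl ?_)
      ext s
      have hNw : ∀ σ : I01, Nf w σ = f (α (x, t * σ)) := by
        intro σ
        rw [hNe w (by simpa using hw.trans_le (min_le_right _ _)) σ]
        simp [w]
      have hint := intervalIntegral.integral_eq_sub_of_hasDerivAt (a := (0 : ℝ)) (b := s)
        (f := fun s => α (x, t * s) - x₀)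
        (f' := fun σ => t • IccExtend (zero_le_one : (0 : ℝ) ≤ 1) (Nf w) σ) (by
          intro σ hσ
          rw [uIcc_of_le s.2.1] at hσ
          have hσ' : σ ∈ Icc (0 : ℝ) 1 := ⟨hσ.1, hσ.2.trans s.2.2⟩
          rw [IccExtend_of_mem _ _ hσ', hNw]
          exact hcd σ hσ')
        ((((Nf w).continuous.Icc_extend').const_smul t).intervalIntegrable _ _)
      rw [intervalIntegral.integral_smul] at hint
      have h0 : α (x, 0) = x := (hα x (ball_subset_closedBall (ball_subset_ball hrR hx))).1
      have hint' : t • unitPrimitive E (Nf w) s = α (x, t * s) - x₀ - (x - x₀) := by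
        rw [unitPrimitive_apply, hint, mul_zero, h0]
      change w s - (x - x₀) - t • unitPrimitive E (Nf w) s = 0
      rw [hint']
      simp [w]
    have h3 : hHa.localInverse hHd omega_ne_zero (H (t, x, w)) = (t, x, w) := Ψ.left_inv hws
    rw [hHw] at h3
    simp only [G, h3]
    simp [w]
  refine ⟨r, hr, fun q => α (q.2, q.1), ?_, ?_⟩
  · rintro ⟨t, x⟩ ⟨ht, hx⟩
    refine (hr₁s _ (ball_subset_ball hrr₁ (hkey t ht x hx))).2.congr ?_
    filter_upwards [(isOpen_Ioo.prod isOpen_ball).mem_nhds ⟨ht, hx⟩] with q hq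
    exact (heq q.1 hq.1 q.2 hq.2).symm
  · intro x hx
    refine ⟨(hα x (ball_subset_closedBall (ball_subset_ball hrR hx))).1, ?_⟩
    intro t ht
    exact ⟨(hr₁s _ (ball_subset_ball hrr₁ (hkey t ht x hx))).1.1, hder t ht x hx⟩
end LocalFlow

section ParametricIntegral
variable [CompleteSpace Y]

/-- Integrals of analytic functions depend analytically on parameters. -/
theorem analyticAt_intervalIntegral {f : ℝ × X → Y} {a b : ℝ} {x₀ : X} (hf : ∀ s ∈ uIcc a b,
    AnalyticAt ℝ f (s, x₀)) : AnalyticAt ℝ (fun x => ∫ s in a..b, f (s, x)) x₀ := by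
  have hcont : ∀ᶠ x in 𝓝 x₀, ContinuousOn (fun s => f (s, x)) (uIcc a b) := by
    have h1 : ∀ᶠ x in 𝓝 x₀, ∀ s ∈ uIcc a b, ContinuousAt f (s, x) := by
      refine (isCompact_uIcc (a := a) (b := b)).eventually_forall_of_forall_eventually ?_
      intro s hs
      have := (hf s hs).eventually_analyticAt.mono fun q hq => hq.continuousAt
      exact (continuous_swap.tendsto ((x₀, s) : X × ℝ)).eventually this
    filter_upwards [h1] with x hx s hs
    exact ((hx s hs).comp (f := fun s => (s, x)) (by fun_prop)).continuousWithinAt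
  have hii : ∀ c ∈ uIcc a b, ∀ d ∈ uIcc a b,
      ∀ᶠ x in 𝓝 x₀, IntervalIntegrable (fun s => f (s, x)) volume c d := by
    intro c hc d hd
    filter_upwards [hcont] with x hx
    exact (hx.mono (uIcc_subset_uIcc hc hd)).intervalIntegrable
  refine (isPreconnected_uIcc (a := a) (b := b)).induction₂
    (fun c d => AnalyticAt ℝ (fun x => ∫ s in c..d, f (s, x)) x₀) ?_ ?_ ?_ left_mem_uIcc
    right_mem_uIcc
  · intro c hc
    let I := Icc (0 : ℝ) 1
    obtain ⟨r, hr, Nf, hNf, hNe⟩ := exists_superposition (K := I) (hf c hc)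
    have hd : ∀ᶠ d in 𝓝[uIcc a b] c, |d - c| < r := by
      refine nhdsWithin_le_nhds ?_
      filter_upwards [ball_mem_nhds c hr] with d hd
      simpa [Real.dist_eq] using hd
    filter_upwards [hd] with d hd
    let w₀ : C(I, ℝ × X) := ⟨fun s => (s * (d - c), 0), by fun_prop⟩
    let ℓ : X →L[ℝ] C(I, ℝ × X) :=
      (ContinuousLinearMap.const ℝ I).comp (inr ℝ ℝ X)
    let Lu : X → C(I, ℝ × X) := fun x => w₀ + ℓ (x - x₀)
    have hLu : ∀ x, ‖x - x₀‖ < r → ‖Lu x‖ < r := by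
      intro x hx
      rw [ContinuousMap.norm_lt_iff _ hr]
      intro s
      have : Lu x s = (s * (d - c), x - x₀) := by simp [Lu, w₀, ℓ]
      rw [this, Prod.norm_def]
      refine max_lt ?_ hx
      rw [Real.norm_eq_abs, abs_mul, abs_of_nonneg s.2.1]
      exact (mul_le_of_le_one_left (abs_nonneg _) s.2.2).trans_lt hd
    have hLa : AnalyticAt ℝ Lu x₀ :=
      analyticAt_const.add ((ℓ.analyticAt _).comp (f := fun x => x - x₀)
        (analyticAt_id.sub analyticAt_const))
    have hcomp : AnalyticAt ℝ (fun x => (d - c) •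
        (ContinuousMap.evalCLM ℝ (⟨1, right_mem_Icc.2 zero_le_one⟩ : I) : C(I, Y) →L[ℝ] Y)
          (unitPrimitive Y (Nf (Lu x)))) x₀ := by
      have h1 : AnalyticAt ℝ (fun x => Nf (Lu x)) x₀ :=
        (hNf _ (by simpa using hLu x₀ (by simpa using hr))).comp hLa
      exact analyticAt_const.smul ((ContinuousLinearMap.analyticAt _ _).comp
        (((unitPrimitive Y).analyticAt _).comp h1))
    refine hcomp.congr ?_
    filter_upwards [ball_mem_nhds x₀ hr] with x hx
    have hx' : ‖x - x₀‖ < r := by simpa [dist_eq_norm] using hx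
    have h2 : ∀ s : I, Nf (Lu x) s = f (c + s * (d - c), x) := by
      intro s
      rw [hNe _ (by simpa using hLu x hx')]
      simp [Lu, w₀, ℓ]
    change (d - c) • unitPrimitive Y (Nf (Lu x)) ⟨1, right_mem_Icc.2 zero_le_one⟩ = _
    rw [unitPrimitive_apply]
    have h3 : ∫ s in (0 : ℝ)..1, IccExtend (zero_le_one : (0 : ℝ) ≤ 1) (Nf (Lu x)) s
        = ∫ s in (0 : ℝ)..1, f (c + s * (d - c), x) := by
      refine intervalIntegral.integral_congr ?_
      intro s hs
      rw [uIcc_of_le zero_le_one] at hs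
      simp only [IccExtend_of_mem _ _ hs, h2]
    rw [h3]
    have h4 := intervalIntegral.smul_integral_comp_add_mul (f := fun s => f (s, x))
      (a := 0) (b := 1) (d - c) c
    simp only [mul_comm (d - c), zero_mul, add_zero, one_mul, add_sub_cancel] at h4
    exact h4
  · intro u v w hu hv hw h1 h2
    refine (h1.add h2).congr ?_
    filter_upwards [hii u hu v hv, hii v hv w hw] with x h3 h4
    exact intervalIntegral.integral_add_adjacent_intervals h3 h4
  · intro u v _ _ h
    refine h.neg.congr (Eventually.of_forall fun x => ?_)
    exact (intervalIntegral.integral_symm _ _).symm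
end ParametricIntegral

section AlternatingMaps
variable [FiniteDimensional ℝ X]

instance finiteDimensional_alternating (k : ℕ) : FiniteDimensional ℝ (X [⋀^Fin k]→L[ℝ] ℝ) := by
  let T : (X [⋀^Fin k]→L[ℝ] ℝ) →ₗ[ℝ] MultilinearMap ℝ (fun _ : Fin k => X) ℝ :=
    { toFun := fun η => η.toMultilinearMap
      map_add' := fun _ _ => rfl
      map_smul' := fun _ _ => rfl }
  refine FiniteDimensional.of_injective T fun η η' h => ?_
  ext v
  exact congrArg (fun m : MultilinearMap ℝ (fun _ : Fin k => X) ℝ => m v) h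

lemma contDiffAt_alternating {r : WithTop ℕ∞} {η : Z → X [⋀^Fin k]→L[ℝ] ℝ} {z : Z} (h : ∀ v,
    ContDiffAt ℝ r (fun z => η z v) z) : ContDiffAt ℝ r η z := by
  let b := Module.finBasis ℝ X
  let T : (X [⋀^Fin k]→L[ℝ] ℝ) →ₗ[ℝ] ((Fin k → Fin (Module.finrank ℝ X)) → ℝ) :=
    { toFun := fun η i => η (fun j => b (i j))
      map_add' := fun _ _ => rfl
      map_smul' := fun _ _ => rfl }
  have hT : T.ker = ⊥ := by
    rw [LinearMap.ker_eq_bot]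
    intro η η' h
    refine ContinuousAlternatingMap.toAlternatingMap_injective ?_
    refine Module.Basis.ext_alternating b fun v _ => congrFun h v
  obtain ⟨S, hS⟩ := T.exists_leftInverse_of_injective hT
  have h1 : ContDiffAt ℝ r (fun z => S.toContinuousLinearMap (T (η z))) z := by
    refine S.toContinuousLinearMap.contDiff.contDiffAt.comp z (f := fun z => T (η z)) ?_
    rw [contDiffAt_pi]
    exact fun i => h _
  refine h1.congr_of_eventuallyEq (Eventually.of_forall fun z => ?_)
  exact (LinearMap.congr_fun hS (η z)).symm

lemma contDiffAt_alternating_apply {η : Z → X [⋀^Fin k]→L[ℝ] ℝ} {w : Z → Fin k → X} {z : Z} (h :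
    ContDiffAt ℝ ω η z) (hw : ContDiffAt ℝ ω w z) : ContDiffAt ℝ ω (fun z => η z (w z)) z := by
  have h1 := ContinuousLinearMap.analyticAt_uncurry_of_multilinear
    (ContinuousAlternatingMap.toContinuousMultilinearMapCLM (𝕜 := ℝ) (E := X) (F := ℝ)
      (ι := Fin k) ℝ) (x := (η z, w z))
  exact (h1.contDiffAt (n := ω)).comp z (h.prodMk hw)

lemma contDiffAt_alternating_pullback {η : Y → X [⋀^Fin k]→L[ℝ] ℝ} {φ : Z → Y} [FiniteDimensional ℝ
    Z] {A : Z → Z →L[ℝ] X} {z : Z} (h : ContDiffAt ℝ ω η (φ z)) (hφ : ContDiffAt ℝ ω φ z) (hA :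
    ContDiffAt ℝ ω A z) : ContDiffAt ℝ ω (fun z => (η (φ z)).compContinuousLinearMap (A z)) z := by
  refine contDiffAt_alternating fun v => ?_
  refine contDiffAt_alternating_apply (η := fun z => η (φ z)) (w := fun z i => A z (v i))
    (h.comp z hφ) ?_
  rw [contDiffAt_pi]
  exact fun i => hA.clm_apply contDiffAt_const

omit [FiniteDimensional ℝ X] in
lemma update_pair_zero (a u v : X) : update ![a, v] 0 u = ![u, v] := by ext i; fin_cases i <;> simp

omit [FiniteDimensional ℝ X] in
lemma update_pair_one (a u v : X) : update ![u, a] 1 v = ![u, v] := by ext i; fin_cases i <;> simp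

def bilinOfForm (η : X [⋀^Fin 2]→L[ℝ] ℝ) : X →ₗ[ℝ] X →ₗ[ℝ] ℝ :=
  LinearMap.mk₂ ℝ (fun u v => η ![u, v]) (fun u u' v => by
      simpa only [update_pair_zero] using η.map_update_add ![0, v] 0 u u')
    (fun c u v => by simpa only [update_pair_zero] using η.map_update_smul ![0, v] 0 c u)
    (fun u v v' => by simpa only [update_pair_one] using η.map_update_add ![u, 0] 1 v v')
    (fun c u v => by simpa only [update_pair_one] using η.map_update_smul ![u, 0] 1 c v)

def bilinOfFormCLM (η : X [⋀^Fin 2]→L[ℝ] ℝ) : X →L[ℝ] X →L[ℝ] ℝ := LinearMap.toContinuousLinearMap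
    ((LinearMap.toContinuousLinearMap (𝕜 := ℝ) (E := X) (F' := ℝ)).toLinearMap ∘ₗ bilinOfForm η)

def toBilin (X : Type*) [NormedAddCommGroup X] [NormedSpace ℝ X] [FiniteDimensional ℝ X] :
    (X [⋀^Fin 2]→L[ℝ] ℝ) →L[ℝ] X →L[ℝ] X →L[ℝ] ℝ :=
  LinearMap.toContinuousLinearMap
    { toFun := bilinOfFormCLM
      map_add' := fun _ _ => by ext u v; rfl
      map_smul' := fun _ _ => by ext u v; rfl }

lemma toBilin_apply (η : X [⋀^Fin 2]→L[ℝ] ℝ) (u v : X) : toBilin X η u v = η ![u, v] := rfl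

lemma norm_toBilin_le (η : X [⋀^Fin 2]→L[ℝ] ℝ) : ‖toBilin X η‖ ≤ ‖η‖ := by
  refine ContinuousLinearMap.opNorm_le_bound₂ _ (norm_nonneg _) fun u v => ?_
  rw [toBilin_apply]
  refine (η.le_opNorm _).trans_eq ?_
  simp [Fin.prod_univ_two, mul_assoc]

lemma contDiffAt_toBilin {r : WithTop ℕ∞} {η : Z → X [⋀^Fin 2]→L[ℝ] ℝ} {z : Z} (h : ContDiffAt ℝ r η
    z) : ContDiffAt ℝ r (fun z => toBilin X (η z)) z := by
  have h1 : ContDiff ℝ r (fun η : X [⋀^Fin 2]→L[ℝ] ℝ => toBilin X η) :=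
    IsBoundedLinearMap.contDiff ⟨⟨map_add _, map_smul _⟩, 1, one_pos, fun η => by
      rw [one_mul]; exact norm_toBilin_le η⟩
  exact h1.contDiffAt.comp z h

omit [FiniteDimensional ℝ X] in
lemma alternating_swap (η : X [⋀^Fin 2]→L[ℝ] ℝ) (u v : X) : η ![u, v] = - η ![v, u] := by
  have h := η.map_swap ![v, u] (i := 0) (j := 1) (by decide)
  refine Eq.trans ?_ h
  change η _ = η _
  congr 1
  ext i
  fin_cases i <;> simp

/-- The solution of a nondegenerate analytic family of linear equations is analytic. -/
lemma exists_contDiffAt_bilin_solve {B : Z → X →L[ℝ] X →L[ℝ] ℝ} {l : Z → X →L[ℝ] ℝ} {z : Z} (hB :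
    ContDiffAt ℝ ω B z) (hl : ContDiffAt ℝ ω l z) (hnd : ∀ v, (∀ u, B z u v = 0) → v = 0) :
    ContDiffAt ℝ ω (fun z => (B z).flip.inverse (l z)) z ∧ ∀ᶠ z' in 𝓝 z, ∀ u, B z' u ((B
    z').flip.inverse (l z')) = l z' u := by
  have hinj : Injective (B z).flip := by
    rw [injective_iff_map_eq_zero]
    intro v hv
    exact hnd v fun u => by simpa using DFunLike.congr_fun hv u
  have hdim : Module.finrank ℝ X = Module.finrank ℝ (X →L[ℝ] ℝ) := by
    rw [← (LinearMap.toContinuousLinearMap (𝕜 := ℝ) (E := X) (F' := ℝ)).finrank_eq]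
    simp
  let e : X ≃L[ℝ] (X →L[ℝ] ℝ) := LinearEquiv.toContinuousLinearEquiv
    (LinearMap.linearEquivOfInjective (B z).flip.toLinearMap hinj hdim)
  have he : (e : X →L[ℝ] X →L[ℝ] ℝ) = (B z).flip := by ext v u; rfl
  have hfl : ContDiff ℝ ω (fun b : X →L[ℝ] X →L[ℝ] ℝ => b.flip) := by
    refine IsBoundedLinearMap.contDiff ?_
    exact ⟨⟨fun _ _ => rfl, fun _ _ => rfl⟩, 1, one_pos, fun b => by
      rw [one_mul, ContinuousLinearMap.opNorm_flip]⟩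
  have hBf : ContDiffAt ℝ ω (fun z => (B z).flip) z := hfl.contDiffAt.comp z hB
  have hinv : ContDiffAt ℝ ω (fun z => (B z).flip.inverse) z := by
    have := contDiffAt_map_inverse (n := ω) e
    rw [he] at this
    exact this.comp z hBf
  refine ⟨hinv.clm_apply hl, ?_⟩
  have hev : ∀ᶠ z' in 𝓝 z, (B z').flip ∈ range ((↑) : (X ≃L[ℝ] (X →L[ℝ] ℝ)) → _) :=
    hBf.continuousAt.eventually (by
      change ∀ᶠ y in 𝓝 (B z).flip, _
      rw [← he]; exact ContinuousLinearEquiv.nhds e)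
  filter_upwards [hev] with z' hz' u
  obtain ⟨e', he'⟩ := hz'
  rw [← he', ContinuousLinearMap.inverse_equiv]
  change B z' u (e'.symm (l z')) = _
  have h1 : (B z').flip (e'.symm (l z')) = l z' := by rw [← he']; exact e'.apply_symm_apply _
  exact DFunLike.congr_fun h1 u
end AlternatingMaps

def formAt {k : ℕ} (η : DForm n M k) (m : M) : Model n [⋀^Fin k]→L[ℝ] ℝ := η m

variable (n) in
def dParam (E : X → M) (x : X) : X →L[ℝ] Model n := mfderiv 𝓘(ℝ, X) 𝓘[n] E x

variable (n) in
def dFun (g : M → X) (m : M) : Model n →L[ℝ] X := mfderiv 𝓘[n] 𝓘(ℝ, X) g m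

variable (n) in
def dMap (g : M → M) (m : M) : Model n →L[ℝ] Model n := mfderiv 𝓘[n] 𝓘[n] g m

def hamField (Ω : DForm n M 2) (f : M → ℝ) (m : M) : Model n := hamVF Ω f m

lemma dParam_comp {E : X → M} {φ : Z → X} {z : Z} (hE : MDifferentiableAt 𝓘(ℝ, X) 𝓘[n] E (φ z)) (hφ
    : DifferentiableAt ℝ φ z) : dParam n (fun z => E (φ z)) z = (dParam n E (φ z)).comp (fderiv ℝ φ
    z) := by
  have h := mfderiv_comp z hE hφ.mdifferentiableAt
  rw [mfderiv_eq_fderiv] at h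
  exact h

lemma fderiv_fun_comp_param {E : X → M} {g : M → Z} {x : X} (hE : MDifferentiableAt 𝓘(ℝ, X) 𝓘[n] E
    x) (hg : MDifferentiableAt 𝓘[n] 𝓘(ℝ, Z) g (E x)) : fderiv ℝ (fun x => g (E x)) x = (dFun n g (E
    x)).comp (dParam n E x) := by
  rw [← mfderiv_eq_fderiv]
  exact mfderiv_comp x hg hE

def pullForm {k : ℕ} (E : X → M) (η : DForm n M k) (x : X) : X [⋀^Fin k]→L[ℝ] ℝ :=
  (formAt η (E x)).compContinuousLinearMap (dParam n E x)

lemma pullForm_apply_two (E : X → M) (η : DForm n M 2) (x u v : X) : pullForm E η x ![u, v] = formAt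
    η (E x) ![dParam n E x u, dParam n E x v] := by
  unfold pullForm
  rw [ContinuousAlternatingMap.compContinuousLinearMap_apply]
  congr 1
  ext i
  fin_cases i <;> rfl

lemma pullForm_apply_one (E : X → M) (η : DForm n M 1) (x v : X) : pullForm E η x (fun _ => v) =
    formAt η (E x) (fun _ => dParam n E x v) := rfl

lemma pullForm_comp {E : X → M} {η : DForm n M k} {φ : Z → X} {z : Z} (hE : MDifferentiableAt 𝓘(ℝ,
    X) 𝓘[n] E (φ z)) (hφ : DifferentiableAt ℝ φ z) : pullForm (E ∘ φ) η z = (pullForm E η (φ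
    z)).compContinuousLinearMap (fderiv ℝ φ z) := by
  unfold pullForm
  rw [show E ∘ φ = fun z => E (φ z) from rfl, dParam_comp hE hφ]
  rfl

lemma pullForm_congr {E E' : X → M} {η : DForm n M k} {x : X} (h : E =ᶠ[𝓝 x] E') : pullForm E η x =
    pullForm E' η x := by
  unfold pullForm dParam
  rw [h.mfderiv_eq, h.eq_of_nhds]

lemma eventually_eq_chart_symm_comp {E : X → M} {x : X} (hE : ContinuousAt E x) (hx : E x ∈
    e.source) : E =ᶠ[𝓝 x] e.symm ∘ (fun x => e (E x)) := by
  filter_upwards [hE.preimage_mem_nhds (e.open_source.mem_nhds hx)] with y hy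
  exact (e.left_inv hy).symm

lemma contDiffAt_chart_comp {E : X → M} {x : X} {r : WithTop ℕ∞} (hr : r ≤ ω) (he : e ∈ atlas (Model
    n) M) (hE : ContMDiffAt 𝓘(ℝ, X) 𝓘[n] r E x) (hx : E x ∈ e.source) : ContDiffAt ℝ r (fun x => e
    (E x)) x := by
  rw [← contMDiffAt_iff_contDiffAt]
  have h1 := (contMDiffOn_of_mem_maximalAtlas (I := 𝓘[n]) (n := ω)
    (IsManifold.subset_maximalAtlas he)).contMDiffAt (e.open_source.mem_nhds hx)
  exact (h1.of_le hr).comp x hE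

lemma contMDiffAt_chart_symm (he : e ∈ atlas (Model n) M) {y : Model n} (hy : y ∈ e.target) :
    ContMDiffAt 𝓘[n] 𝓘[n] ω e.symm y :=
  (contMDiffOn_symm_of_mem_maximalAtlas (I := 𝓘[n]) (n := ω)
    (IsManifold.subset_maximalAtlas he)).contMDiffAt (e.open_target.mem_nhds hy)

lemma pullForm_eventuallyEq_chart {E : X → M} {η : DForm n M k} {x : X} (he : e ∈ atlas (Model n) M)
    (hE : ContMDiffAt 𝓘(ℝ, X) 𝓘[n] ω E x) (hx : E x ∈ e.source) : pullForm E η =ᶠ[𝓝 x] fun x =>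
    (formInChart e η (e (E x))).compContinuousLinearMap (fderiv ℝ (fun x => e (E x)) x) := by
  have h1 := (eventually_eq_chart_symm_comp hE.continuousAt hx).eventuallyEq_nhds
  have h2 := (hE.continuousAt.preimage_mem_nhds (e.open_source.mem_nhds hx))
  have h3 : ∀ᶠ y in 𝓝 x, DifferentiableAt ℝ (fun x => e (E x)) y := by
    have := ((contDiffAt_chart_comp le_rfl he hE hx).of_le (m := 1) (by simp)).eventually (by simp)
    exact this.mono fun y hy => hy.differentiableAt (by simp)
  filter_upwards [h1, h2, h3] with y h1 h2 h3
  rw [pullForm_congr h1, pullForm_comp (φ := fun x => e (E x)) _ h3]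
  · rfl
  · exact (contMDiffAt_chart_symm he (e.map_source h2)).mdiff

lemma contDiffAt_pullForm [FiniteDimensional ℝ X] {E : X → M} {η : DForm n M k} {x : X} (hη :
    FormAnalyticOn η G) (hG : E x ∈ G) (hE : ContMDiffAt 𝓘(ℝ, X) 𝓘[n] ω E x) : ContDiffAt ℝ ω
    (pullForm E η) x := by
  have he := chart_mem_atlas (Model n) (E x)
  have hx := mem_chart_source (Model n) (E x)
  have hφ := contDiffAt_chart_comp le_rfl he hE hx
  refine ContDiffAt.congr_of_eventuallyEq ?_ (pullForm_eventuallyEq_chart he hE hx)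
  refine contDiffAt_alternating_pullback (η := formInChart _ η)
    (AnalyticAt.contDiffAt ?_) hφ (hφ.analyticAt.fderiv.contDiffAt)
  exact hη _ he _ ⟨(chartAt (Model n) (E x)).map_source hx, by simpa using hG⟩

lemma extDeriv_pullForm [FiniteDimensional ℝ X] {E : X → M} {η : DForm n M k} {ζ : DForm n M (k +
    1)} {x₀ : X} (hη : FormAnalyticOn η G) (hηζ : ExtDerivEqOn η ζ G) (hG : E x₀ ∈ G) (hE :
    ContMDiffAt 𝓘(ℝ, X) 𝓘[n] ω E x₀) : extDeriv (pullForm E η) x₀ = pullForm E ζ x₀ := by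
  have he := chart_mem_atlas (Model n) (E x₀)
  have hx := mem_chart_source (Model n) (E x₀)
  have hφ := contDiffAt_chart_comp le_rfl he hE hx
  have hmem : chartAt (Model n) (E x₀) (E x₀) ∈ (chartAt (Model n) (E x₀)).target ∩
      (chartAt (Model n) (E x₀)).symm ⁻¹' G :=
    ⟨(chartAt (Model n) (E x₀)).map_source hx, by simpa using hG⟩
  rw [(pullForm_eventuallyEq_chart he hE hx).extDeriv_eq,
    (pullForm_eventuallyEq_chart he hE hx).eq_of_nhds,
    extDeriv_pullback (r := ω) (f := fun x => chartAt (Model n) (E x₀) (E x)) (hη _ he _ hmem).differentiableAt hφ (by simp), hηζ _ he _ hmem]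

/-- The curve `c` has the velocity `w` at time `t`. -/
def HasVelocityAt (c : ℝ → M) (t : ℝ) (w : Model n) : Prop := HasMFDerivAt 𝓘(ℝ, ℝ) 𝓘[n] c t
    ((1 : ℝ →L[ℝ] ℝ).smulRight (w : TangentSpace 𝓘[n] (c t)))

lemma HasVelocityAt.continuousAt (h : HasVelocityAt (n := n) c t w) : ContinuousAt c t := by
  unfold HasVelocityAt at h
  exact h.1

lemma HasVelocityAt.comp_param {E : X → M} {x : ℝ → X} {x' : X} (hE : MDifferentiableAt 𝓘(ℝ, X) 𝓘[n]
    E (x t)) (hx : HasDerivAt x x' t) : HasVelocityAt (n := n) (fun t => E (x t)) t (dParam n E (x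
    t) x') := by
  have h := hE.hasMFDerivAt.comp t hx.hasFDerivAt.hasMFDerivAt
  refine HasMFDerivAt.congr_mfderiv h ?_
  refine ContinuousLinearMap.ext fun r => ?_
  change dParam n E (x t) ((show ℝ from r) • x') = (show ℝ from r) • dParam n E (x t) x'
  rw [map_smul]

lemma HasVelocityAt.hasDerivAt_comp (h : HasVelocityAt c t w) {g : M → X} (hg : MDifferentiableAt
    𝓘[n] 𝓘(ℝ, X) g (c t)) : HasDerivAt (fun t => g (c t)) (dFun n g (c t) w) t :=
    by
  have h1 := hg.hasMFDerivAt.comp t h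
  have h2 : HasFDerivAt (fun t => g (c t)) ((1 : ℝ →L[ℝ] ℝ).smulRight (dFun n g (c t) w)) t := by
    refine (hasMFDerivAt_iff_hasFDerivAt.1 h1).congr_fderiv ?_
    refine ContinuousLinearMap.ext fun r => ?_
    change dFun n g (c t) ((show ℝ from r) • w) = (show ℝ from r) • dFun n g (c t) w
    rw [map_smul]
  have h3 := h2.hasDerivAt
  simpa using h3

lemma HasVelocityAt.comp_map (h : HasVelocityAt c t w) {g : M → M} (hg : MDifferentiableAt 𝓘[n] 𝓘[n]
    g (c t)) : HasVelocityAt (fun t => g (c t)) t (dMap n g (c t) w) :=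
    by
  have h1 := hg.hasMFDerivAt.comp t h
  refine HasMFDerivAt.congr_mfderiv h1 ?_
  refine ContinuousLinearMap.ext fun r => ?_
  change dMap n g (c t) ((show ℝ from r) • w) = (show ℝ from r) • dMap n g (c t) w
  rw [map_smul]

lemma HasVelocityAt.mfderiv_one (h : HasVelocityAt c t w) : mfderiv 𝓘(ℝ, ℝ) 𝓘[n] c t (1 : ℝ) = (w :
    TangentSpace 𝓘[n] (c t)) := by
  rw [HasMFDerivAt.mfderiv h]
  exact one_smul ℝ (w : Model n)

lemma HasVelocityAt.congr {c' : ℝ → M} (h : HasVelocityAt c t w) (hc : c' =ᶠ[𝓝 t] c) : HasVelocityAt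
    c' t w :=
  HasMFDerivAt.congr_of_eventuallyEq (I := 𝓘(ℝ, ℝ)) (I' := 𝓘[n]) (f := c) h hc

lemma HasVelocityAt.comp_add (h : HasVelocityAt (n := n) c (t + s) w) : HasVelocityAt (fun t => c (t
    + s)) t w := by
  have h1 : HasMFDerivAt 𝓘(ℝ, ℝ) 𝓘(ℝ, ℝ) (fun t : ℝ => t + s) t (ContinuousLinearMap.id ℝ ℝ) :=
    ((hasFDerivAt_id t).add_const s).hasMFDerivAt
  exact HasMFDerivAt.comp (I' := 𝓘(ℝ, ℝ)) (g := c) (f := fun t => t + s) t h h1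

lemma mdifferentiable_chart (he : e ∈ atlas (Model n) M) : e.MDifferentiable 𝓘[n] 𝓘[n] :=
  haveI : IsManifold 𝓘[n] 1 M := IsManifold.of_le (n := ω) (by simp)
  mdifferentiable_of_mem_atlas he

lemma bijective_mfderiv_chart_symm (he : e ∈ atlas (Model n) M) {y : Model n} (hy : y ∈ e.target) :
    Bijective (mfderiv 𝓘[n] 𝓘[n] e.symm y) :=
  (mdifferentiable_chart he).symm.mfderiv_bijective hy

lemma exists_local_inverse [CompleteSpace X] {E : X → M} {x₀ : X} (hE : ContMDiffAt 𝓘(ℝ, X) 𝓘[n] ω E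
    x₀) (hb : Bijective (mfderiv 𝓘(ℝ, X) 𝓘[n] E x₀)) : ∃ g : M → X, ContMDiffAt 𝓘[n] 𝓘(ℝ, X) ω g (E
    x₀) ∧ g (E x₀) = x₀ ∧ (∀ᶠ m in 𝓝 (E x₀), E (g m) = m) ∧ ∀ᶠ x in 𝓝 x₀, g (E x) = x := by
  have he := chart_mem_atlas (Model n) (E x₀)
  have hx := mem_chart_source (Model n) (E x₀)
  set e := chartAt (Model n) (E x₀)
  have hφ := contDiffAt_chart_comp le_rfl he hE hx
  have hed := (mdifferentiable_chart he).mdifferentiableAt hx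
  have hd : fderiv ℝ (fun x => e (E x)) x₀ = (mfderiv 𝓘[n] 𝓘[n] e (E x₀)).comp
        (mfderiv 𝓘(ℝ, X) 𝓘[n] E x₀) := by
    rw [← mfderiv_eq_fderiv]
    exact mfderiv_comp x₀ hed (hE.mdiff)
  have hbij : Bijective (fderiv ℝ (fun x => e (E x)) x₀) := by
    rw [hd]
    exact ((mdifferentiable_chart he).mfderiv_bijective hx).comp hb
  let A : X ≃L[ℝ] Model n := ContinuousLinearEquiv.ofBijective (fderiv ℝ (fun x => e (E x)) x₀)
    (LinearMap.ker_eq_bot.2 hbij.1) (LinearMap.range_eq_top.2 hbij.2)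
  have hA : HasFDerivAt (fun x => e (E x)) (A : X →L[ℝ] Model n) x₀ :=
    (hφ.diff).hasFDerivAt
  let Ψ := hφ.toOpenPartialHomeomorph _ hA omega_ne_zero
  have hΨ0 : x₀ ∈ Ψ.source := hφ.mem_toOpenPartialHomeomorph_source hA omega_ne_zero
  have hΨe : ∀ x, Ψ x = e (E x) := fun x => rfl
  have hloc : ContDiffAt ℝ ω Ψ.symm (e (E x₀)) := hφ.to_localInverse hA omega_ne_zero
  have hge : ∀ᶠ m in 𝓝 (E x₀), m ∈ e.source ∧ e m ∈ Ψ.target ∧ E (Ψ.symm (e m)) ∈ e.source := by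
    have h1 := e.open_source.mem_nhds hx
    have hec : ContinuousAt e (E x₀) := e.continuousAt hx
    have h2 : Ψ.target ∈ 𝓝 (e (E x₀)) := Ψ.open_target.mem_nhds (Ψ.map_source hΨ0)
    have h3 : ContinuousAt (fun m => E (Ψ.symm (e m))) (E x₀) := by
      have h4 : ContinuousAt (fun m => Ψ.symm (e m)) (E x₀) :=
        ContinuousAt.comp (g := Ψ.symm) (hloc.continuousAt) hec
      refine ContinuousAt.comp (g := E) ?_ h4
      have : Ψ.symm (e (E x₀)) = x₀ := Ψ.left_inv hΨ0
      rw [this]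
      exact hE.continuousAt
    have h5 : E (Ψ.symm (e (E x₀))) = E x₀ := by
      rw [show Ψ.symm (e (E x₀)) = x₀ from Ψ.left_inv hΨ0]
    filter_upwards [h1, hec.preimage_mem_nhds h2, h3.preimage_mem_nhds (by rw [h5]; exact h1)]
      with m h6 h7 h8
    exact ⟨h6, h7, h8⟩
  refine ⟨fun m => Ψ.symm (e m), ?_, Ψ.left_inv hΨ0, ?_, ?_⟩
  · have h1 := (contMDiffOn_of_mem_maximalAtlas (I := 𝓘[n]) (n := ω)
      (IsManifold.subset_maximalAtlas he)).contMDiffAt (e.open_source.mem_nhds hx)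
    exact ContMDiffAt.comp (g := Ψ.symm) (E x₀) (contMDiffAt_iff_contDiffAt.2 hloc) h1
  · filter_upwards [hge] with m hm
    refine e.injOn hm.2.2 hm.1 ?_
    rw [← hΨe]
    exact Ψ.right_inv hm.2.1
  · filter_upwards [Ψ.open_source.mem_nhds hΨ0] with x hx
    exact Ψ.left_inv hx

lemma hamField_spec (hΩ : IsAnalyticSymplectic Ω) (f : M → ℝ) (m : M) (v : Model n) : formAt Ω m
    ![v, hamField Ω f m] = dFun n f m v := by
  have hex : ∃ X : Model n, ∀ v : Model n, formAt Ω m ![v, X] = dFun n f m v := by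
    have hnd : ∀ v, (∀ u, toBilin (Model n) (formAt Ω m) u v = 0) → v = 0 := by
      intro v hv
      refine hΩ.nondegenerate m v fun w => ?_
      have : formAt Ω m ![(show Model n from w), v] = 0 := hv w
      rw [alternating_swap, neg_eq_zero] at this
      exact this
    have h := (exists_contDiffAt_bilin_solve (Z := ℝ) (B := fun _ => toBilin (Model n) (formAt Ω m))
      (l := fun _ => dFun n f m) (z := 0) contDiffAt_const contDiffAt_const hnd).2.self_of_nhds
    exact ⟨_, h⟩
  have hex' : ∃ X : TangentSpace 𝓘[n] m, ∀ v : TangentSpace 𝓘[n] m,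
      Ω m ![v, X] = mfderiv 𝓘[n] 𝓘(ℝ, ℝ) f m v := hex
  have h1 : hamVF Ω f m = hex'.choose := by
    unfold hamVF
    rw [dif_pos hex']
  change Ω m ![v, hamVF Ω f m] = _
  rw [h1]
  exact hex'.choose_spec v

lemma formAt_nondegenerate (hΩ : IsAnalyticSymplectic Ω) {v : Model n} (h : ∀ u, formAt Ω m ![u, v]
    = 0) : v = 0 := by
  refine hΩ.nondegenerate m v fun w => ?_
  have : formAt Ω m ![(show Model n from w), v] = 0 := h w
  rw [alternating_swap, neg_eq_zero] at this
  exact this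

lemma hamField_unique (hΩ : IsAnalyticSymplectic Ω) {f : M → ℝ} (h : ∀ v, formAt Ω m ![v, w] = dFun
    n f m v) : hamField Ω f m = w := by
  rw [← sub_eq_zero]
  refine formAt_nondegenerate hΩ (m := m) fun v => ?_
  rw [← toBilin_apply, map_sub, toBilin_apply, toBilin_apply, hamField_spec hΩ, h, sub_self]

/-- A vector field is analytic at a point if its coordinate representation is. -/
def VFAnalyticAt (v : M → Model n) (p : M) : Prop :=
  ∃ f : Model n → Model n, AnalyticAt ℝ f (chartAt (Model n) p p) ∧
    ∀ᶠ y in 𝓝 (chartAt (Model n) p p), v ((chartAt (Model n) p).symm y) =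
      dParam n (chartAt (Model n) p).symm y (f y)

lemma vfAnalyticAt_hamField (hΩ : IsAnalyticSymplectic Ω) {H : M → ℝ} {p : M} (hH : ContMDiffAt 𝓘[n]
    𝓘(ℝ, ℝ) ω H p) : VFAnalyticAt (hamField Ω H) p := by
  have he := chart_mem_atlas (Model n) p
  have hx := mem_chart_source (Model n) p
  unfold VFAnalyticAt
  set e := chartAt (Model n) p
  have hep : e p ∈ e.target := e.map_source hx
  have hesp : e.symm (e p) = p := e.left_inv hx
  have hH' : ContDiffAt ℝ ω (fun y => H (e.symm y)) (e p) := by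
    rw [← contMDiffAt_iff_contDiffAt]
    refine ContMDiffAt.comp (g := H) (e p) ?_ (contMDiffAt_chart_symm he hep)
    rw [hesp]; exact hH
  have hB : ContDiffAt ℝ ω (fun y => toBilin (Model n) (pullForm e.symm Ω y)) (e p) :=
    contDiffAt_toBilin (contDiffAt_pullForm hΩ.analytic (mem_univ _)
      (contMDiffAt_chart_symm he hep))
  have hnd : ∀ v, (∀ u, toBilin (Model n) (pullForm e.symm Ω (e p)) u v = 0) → v = 0 := by
    intro v hv
    have hbij : Bijective (dParam n e.symm (e p)) := bijective_mfderiv_chart_symm he hep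
    apply (map_eq_zero_iff _ hbij.1).1
    refine formAt_nondegenerate hΩ (m := e.symm (e p)) fun w => ?_
    obtain ⟨u, rfl⟩ := hbij.2 w
    have := hv u
    rwa [toBilin_apply, pullForm_apply_two] at this
  obtain ⟨h1, h2⟩ := exists_contDiffAt_bilin_solve hB (hH'.analyticAt.fderiv.contDiffAt) hnd
  refine ⟨_, h1.analyticAt, ?_⟩
  have hH'' : ∀ᶠ y in 𝓝 (e p), ContMDiffAt 𝓘[n] 𝓘(ℝ, ℝ) 1 H (e.symm y) := by
    have h3 : ∀ᶠ m in 𝓝 p, ContMDiffAt 𝓘[n] 𝓘(ℝ, ℝ) 1 H m := by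
      have : IsManifold 𝓘[n] 1 M := IsManifold.of_le (n := ω) (by simp)
      exact (contMDiffAt_iff_contMDiffAt_nhds (by simp)).1 (hH.of_le (by simp))
    have h4 : Tendsto e.symm (𝓝 (e p)) (𝓝 p) := by
      have := e.continuousAt_symm hep
      rwa [ContinuousAt, hesp] at this
    exact h4.eventually h3
  filter_upwards [h2, e.open_target.mem_nhds hep, hH''] with y hy hyt hHy
  refine hamField_unique hΩ fun w => ?_
  have hbij : Bijective (dParam n e.symm y) := bijective_mfderiv_chart_symm he hyt
  obtain ⟨u, rfl⟩ := hbij.2 w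
  have h5 := hy u
  rw [toBilin_apply, pullForm_apply_two] at h5
  refine h5.trans ?_
  rw [fderiv_fun_comp_param (n := n) (E := e.symm) (g := H)
    ((contMDiffAt_chart_symm he hyt).mdiff)
    (hHy.mdifferentiableAt (by simp))]
  rfl

/-- `σ` is an integral curve of `v` on `I` that stays in `N`. -/
def IsFlowCurve (v : M → Model n) (N : Set M) (I : Set ℝ) (σ : ℝ → M) : Prop :=
  ∀ t ∈ I, σ t ∈ N ∧ HasVelocityAt σ t (v (σ t))

lemma IsFlowCurve.mono {J : Set ℝ} (h : IsFlowCurve v N J σ) (hIJ : I ⊆ J) : IsFlowCurve v N I σ :=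
    fun t ht => h t (hIJ ht)

lemma IsFlowCurve.congr {τ : ℝ → M} (h : IsFlowCurve v N I σ) (hI : IsOpen I) (hτ : EqOn τ σ I) :
    IsFlowCurve v N I τ := by
  intro t ht
  have h1 := h t ht
  rw [hτ ht]
  exact ⟨h1.1, h1.2.congr (hτ.eventuallyEq_of_mem (hI.mem_nhds ht))⟩

lemma IsFlowCurve.shift (s : ℝ) (h : IsFlowCurve v N I σ) : IsFlowCurve v N {t | t + s ∈ I} (fun t
    => σ (t + s)) :=
  fun _ ht => ⟨(h _ ht).1, (h _ ht).2.comp_add⟩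

def flowDomain (v : M → Model n) (N : Set M) : Set (ℝ × M) :=
  {q | ∃ a b : ℝ, 0 ∈ Ioo a b ∧ q.1 ∈ Ioo a b ∧
    ∃ σ : ℝ → M, σ 0 = q.2 ∧ IsFlowCurve v N (Ioo a b) σ}

open Classical in
def localFlow (v : M → Model n) (N : Set M) (q : ℝ × M) : M :=
  if h : q ∈ flowDomain v N then h.choose_spec.choose_spec.2.2.choose q.1 else q.2

lemma dFun_chart_dParam_symm (he : e ∈ atlas (Model n) M) {y : Model n} (hy : y ∈ e.target) (u :
    Model n) : dFun n e (e.symm y) (dParam n e.symm y u) = u :=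
    by
  have h := (mdifferentiable_chart he).comp_symm_deriv hy
  exact congrArg (fun L => (L : Model n →L[ℝ] Model n) u) h

lemma mdifferentiableAt_chart (he : e ∈ atlas (Model n) M) (hm : m ∈ e.source) : MDifferentiableAt
    𝓘[n] 𝓘[n] e m :=
  (mdifferentiable_chart he).mdifferentiableAt hm

lemma contMDiffAt_chart (he : e ∈ atlas (Model n) M) (hm : m ∈ e.source) : ContMDiffAt 𝓘[n] 𝓘[n] ω e
    m :=
  (contMDiffOn_of_mem_maximalAtlas (I := 𝓘[n]) (n := ω)
      (IsManifold.subset_maximalAtlas he)).contMDiffAt (e.open_source.mem_nhds hm)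

lemma eventuallyEq_of_hasVelocityAt {τ : ℝ → M} {t₀ : ℝ} (hv : VFAnalyticAt v (σ t₀)) (hσ : ∀ᶠ t in
    𝓝 t₀, HasVelocityAt σ t (v (σ t))) (hτ : ∀ᶠ t in 𝓝 t₀, HasVelocityAt τ t (v (τ t))) (h0 : σ t₀ =
    τ t₀) : σ =ᶠ[𝓝 t₀] τ := by
  obtain ⟨f, hf, hvf⟩ := hv
  have he := chart_mem_atlas (Model n) (σ t₀)
  have hx := mem_chart_source (Model n) (σ t₀)
  set e := chartAt (Model n) (σ t₀) with hedef
  obtain ⟨K, S, hS, hK⟩ := (hf.contDiffAt (n := 1)).exists_lipschitzOnWith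
  have key : ∀ ρ : ℝ → M, (∀ᶠ t in 𝓝 t₀, HasVelocityAt ρ t (v (ρ t))) → ρ t₀ = σ t₀ →
      ∀ᶠ t in 𝓝 t₀, (HasDerivAt (fun t => e (ρ t)) (f (e (ρ t))) t ∧ e (ρ t) ∈ S) ∧
        ρ t ∈ e.source := by
    intro ρ hρ hρ0
    have hc : ContinuousAt ρ t₀ := hρ.self_of_nhds.continuousAt
    have hes : ρ t₀ ∈ e.source := by rw [hρ0]; exact hx
    have hec : Tendsto (fun t => e (ρ t)) (𝓝 t₀) (𝓝 (e (σ t₀))) := by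
      rw [← hρ0]
      exact ContinuousAt.comp (g := e) (e.continuousAt hes) hc
    filter_upwards [hρ, hc.preimage_mem_nhds (e.open_source.mem_nhds hes), hec.eventually hvf,
      hec.eventually hS] with t h1 h2 h3 h4
    refine ⟨⟨?_, h4⟩, h2⟩
    have h5 := h1.hasDerivAt_comp (mdifferentiableAt_chart he h2)
    rw [e.left_inv h2] at h3
    have h6 := dFun_chart_dParam_symm he (e.map_source h2) (f (e (ρ t)))
    rw [e.left_inv h2, ← h3] at h6
    rwa [h6] at h5
  have h1 := key σ hσ rfl
  have h2 := key τ hτ h0.symm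
  have h3 := ODE_solution_unique_of_eventually (v := fun _ => f) (s := fun _ => S) (K := K)
    (Eventually.of_forall fun _ => hK) (h1.mono fun t h => h.1) (h2.mono fun t h => h.1)
    (by rw [h0])
  filter_upwards [h1, h2, h3] with t h4 h5 h6
  exact e.injOn h4.2 h5.2 h6

lemma exists_localFlow_near (hN : IsOpen N) {p : M} (hp : p ∈ N) (hv : VFAnalyticAt v p) : ∃ r > 0,
    ∃ O ∈ 𝓝 p, ∃ φ : ℝ × M → M, IsOpen O ∧ (∀ q ∈ Ioo (-r) r ×ˢ O, ContMDiffAt (𝓘(ℝ, ℝ).prod 𝓘[n])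
    𝓘[n] ω φ q) ∧ ∀ m ∈ O, φ (0, m) = m ∧ IsFlowCurve v N (Ioo (-r) r) (fun t => φ (t, m)) := by
  obtain ⟨f, hf, hvf⟩ := hv
  have he := chart_mem_atlas (Model n) p
  have hx := mem_chart_source (Model n) p
  set e := chartAt (Model n) p with hedef
  have hep : e p ∈ e.target := e.map_source hx
  have hO : {y | y ∈ e.target ∧ e.symm y ∈ N ∧
      v (e.symm y) = dParam n e.symm y (f y)} ∈ 𝓝 (e p) := by
    have h1 : e.symm ⁻¹' N ∈ 𝓝 (e p) := (e.continuousAt_symm hep).preimage_mem_nhds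
      (by rw [e.left_inv hx]; exact hN.mem_nhds hp)
    filter_upwards [e.open_target.mem_nhds hep, h1, hvf] with y h1 h2 h3
    exact ⟨h1, h2, h3⟩
  obtain ⟨r, hr, φ, hφ, hφ'⟩ := exists_analytic_flow hf hO
  have hmem : ∀ t ∈ Ioo (-r) r, ∀ m, e m ∈ ball (e p) r → φ (t, e m) ∈ e.target ∧
      e.symm (φ (t, e m)) ∈ N ∧ v (e.symm (φ (t, e m))) =
        dParam n e.symm (φ (t, e m)) (f (φ (t, e m))) :=
    fun t ht m hm => ((hφ' _ hm).2 t ht).1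
  refine ⟨r, hr, e.source ∩ e ⁻¹' ball (e p) r, ?_, fun q => e.symm (φ (q.1, e q.2)),
    e.isOpen_inter_preimage isOpen_ball, ?_, ?_⟩
  · exact (e.isOpen_inter_preimage isOpen_ball).mem_nhds ⟨hx, mem_ball_self hr⟩
  · rintro ⟨t, m⟩ ⟨ht, hm⟩
    have h1 : ContMDiffAt (𝓘(ℝ, ℝ).prod 𝓘[n]) 𝓘[n] ω (fun q : ℝ × M => e q.2) (t, m) :=
      ContMDiffAt.comp (g := e) (f := Prod.snd) (t, m) (contMDiffAt_chart he hm.1) contMDiffAt_snd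
    have h2 : ContMDiffAt (𝓘(ℝ, ℝ).prod 𝓘[n]) 𝓘[n] ω (fun q : ℝ × M => φ (q.1, e q.2)) (t, m) :=
      ContDiffAt.comp_contMDiffAt (g := φ) (f := fun q : ℝ × M => (q.1, e q.2)) (x := (t, m))
        (hφ (t, e m) ⟨ht, hm.2⟩).contDiffAt (ContMDiffAt.prodMk_space contMDiffAt_fst h1)
    have h3 := contMDiffAt_chart_symm he (hmem t ht m hm.2).1
    exact ContMDiffAt.comp (g := e.symm) (f := fun q : ℝ × M => φ (q.1, e q.2)) (t, m) h3 h2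
  · intro m hm
    have h1 := hφ' _ hm.2
    refine ⟨by simp only [h1.1]; exact e.left_inv hm.1, fun t ht => ?_⟩
    have h2 := hmem t ht m hm.2
    refine ⟨h2.2.1, ?_⟩
    rw [show v (e.symm (φ (t, e m))) = _ from h2.2.2]
    exact HasVelocityAt.comp_param (X := Model n) (E := e.symm) (x := fun t => φ (t, e m))
      ((contMDiffAt_chart_symm he h2.1).mdiff) (h1.2 t ht).2

lemma IsFlowCurve.eqOn {τ : ℝ → M} (hv : ∀ p ∈ N, VFAnalyticAt v p) (hσ : IsFlowCurve v N I σ) (hτ :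
    IsFlowCurve v N I τ) (hI : IsOpen I) (hIc : IsPreconnected I) {t₀ : ℝ} (ht₀ : t₀ ∈ I) (h0 : σ t₀
    = τ t₀) : EqOn σ τ I := by
  have hloc : ∀ t ∈ I, σ t = τ t → σ =ᶠ[𝓝 t] τ := fun t ht h =>
    eventuallyEq_of_hasVelocityAt (hv _ (hσ t ht).1)
      (eventually_of_mem (hI.mem_nhds ht) fun s hs => (hσ s hs).2)
      (eventually_of_mem (hI.mem_nhds ht) fun s hs => (hτ s hs).2) h
  have h := hIc.subset_of_closure_inter_subset (u := {t | σ =ᶠ[𝓝 t] τ})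
    (isOpen_iff_mem_nhds.2 fun t ht => eventually_eventually_nhds.2 ht) ⟨t₀, ht₀, hloc _ ht₀ h0⟩ ?_
  · exact fun t ht => (h ht).self_of_nhds
  rintro t ⟨ht, htI⟩
  refine hloc t htI ?_
  have hne : (𝓝[{t | σ =ᶠ[𝓝 t] τ}] t).NeBot := mem_closure_iff_nhdsWithin_neBot.1 ht
  refine tendsto_nhds_unique_of_eventuallyEq (l := 𝓝[{t | σ =ᶠ[𝓝 t] τ}] t)
    ((hσ t htI).2.continuousAt.tendsto.mono_left nhdsWithin_le_nhds)
    ((hτ t htI).2.continuousAt.tendsto.mono_left nhdsWithin_le_nhds) ?_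
  filter_upwards [self_mem_nhdsWithin] with s hs
  exact Eventually.self_of_nhds (p := fun u => σ u = τ u) hs

lemma IsFlowCurve.mem_flowDomain {a b : ℝ} (hσ : IsFlowCurve v N (Ioo a b) σ) (h0 : (0 : ℝ) ∈ Ioo a
    b) (ht : t ∈ Ioo a b) : (t, σ 0) ∈ flowDomain v N :=
  ⟨a, b, h0, ht, σ, rfl, hσ⟩

lemma IsFlowCurve.localFlow_eq {a b : ℝ} (hv : ∀ p ∈ N, VFAnalyticAt v p) (hσ : IsFlowCurve v N (Ioo
    a b) σ) (h0 : (0 : ℝ) ∈ Ioo a b) (ht : t ∈ Ioo a b) : localFlow v N (t, σ 0) = σ t := by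
  have h : (t, σ 0) ∈ flowDomain v N := hσ.mem_flowDomain h0 ht
  rw [localFlow, dif_pos h]
  set τ := h.choose_spec.choose_spec.2.2.choose
  have hs := h.choose_spec.choose_spec.2.2.choose_spec
  set a' := h.choose
  set b' := h.choose_spec.choose
  have h0' : (0 : ℝ) ∈ Ioo a' b' := h.choose_spec.choose_spec.1
  have ht' : t ∈ Ioo a' b' := h.choose_spec.choose_spec.2.1
  have h1 := IsFlowCurve.eqOn (I := Ioo a b ∩ Ioo a' b') hv (hs.2.mono inter_subset_right)
    (hσ.mono inter_subset_left) (isOpen_Ioo.inter isOpen_Ioo)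
    (ordConnected_Ioo.inter ordConnected_Ioo).isPreconnected ⟨h0, h0'⟩ hs.1
  exact h1 ⟨ht, ht'⟩

lemma exists_isFlowCurve_localFlow (hv : ∀ p ∈ N, VFAnalyticAt v p) (h : (t, m) ∈ flowDomain v N) :
    ∃ a b : ℝ, 0 ∈ Ioo a b ∧ t ∈ Ioo a b ∧ localFlow v N (0, m) = m ∧ IsFlowCurve v N (Ioo a b) (fun
    t => localFlow v N (t, m)) := by
  obtain ⟨a, b, h0, ht, σ, rfl, hσ⟩ := h
  exact ⟨a, b, h0, ht, hσ.localFlow_eq hv h0 h0,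
    hσ.congr isOpen_Ioo fun s hs => hσ.localFlow_eq hv h0 hs⟩

lemma mem_flowDomain_zero (hN : IsOpen N) (hv : ∀ p ∈ N, VFAnalyticAt v p) (hm : m ∈ N) : ((0 : ℝ),
    m) ∈ flowDomain v N := by
  obtain ⟨r, hr, O, hO, φ, -, -, hφ⟩ := exists_localFlow_near hN hm (hv m hm)
  have h := hφ m (mem_of_mem_nhds hO)
  exact ⟨-r, r, by simp [hr], by simp [hr], fun t => φ (t, m), h.1, h.2⟩

lemma localFlow_zero (m : M) (hv : ∀ p ∈ N, VFAnalyticAt v p) : localFlow v N (0, m) = m := by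
  by_cases h : ((0 : ℝ), m) ∈ flowDomain v N
  · exact (exists_isFlowCurve_localFlow hv h).choose_spec.choose_spec.2.2.1
  · rw [localFlow, dif_neg h]

lemma localFlow_add (hv : ∀ p ∈ N, VFAnalyticAt v p) (hs : (s, m) ∈ flowDomain v N) (ht : (t,
    localFlow v N (s, m)) ∈ flowDomain v N) : (t + s, m) ∈ flowDomain v N ∧ localFlow v N (t + s, m)
    = localFlow v N (t, localFlow v N (s, m)) := by
  obtain ⟨a, b, h0, hsI, hz, hσ⟩ := exists_isFlowCurve_localFlow hv hs
  obtain ⟨c, d, h0', htI, hz', hτ⟩ := exists_isFlowCurve_localFlow hv ht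
  set σ := fun t => localFlow v N (t, m) with hσdef
  set τ := fun t => localFlow v N (t, localFlow v N (s, m)) with hτdef
  have hτs := hτ.shift (-s)
  have hset : {t | t + -s ∈ Ioo c d} = Ioo (c + s) (d + s) := by
    ext u; simp only [mem_ofPred_eq, mem_Ioo]; constructor <;> rintro ⟨h1, h2⟩ <;> constructor <;>
      linarith
  rw [hset] at hτs
  simp only [mem_Ioo] at *
  have hagree : EqOn (fun t => τ (t + -s)) σ (Ioo a b ∩ Ioo (c + s) (d + s)) := by
    refine IsFlowCurve.eqOn hv (hτs.mono inter_subset_right) (hσ.mono inter_subset_left)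
      (isOpen_Ioo.inter isOpen_Ioo)
      (ordConnected_Ioo.inter ordConnected_Ioo).isPreconnected (t₀ := s)
      ⟨hsI, by constructor <;> linarith⟩ ?_
    simp only [add_neg_cancel]
    exact hz'
  classical
  set ρ : ℝ → M := fun u => if u ∈ Ioo a b then σ u else τ (u + -s) with hρ
  have h1 : EqOn ρ σ (Ioo a b) := fun u hu => if_pos hu
  have h2 : EqOn ρ (fun t => τ (t + -s)) (Ioo (c + s) (d + s)) := by
    intro u hu
    by_cases hu' : u ∈ Ioo a b
    · rw [h1 hu']; exact (hagree ⟨hu', hu⟩).symm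
    · exact if_neg hu'
  have h3 : IsFlowCurve v N (Ioo (min a (c + s)) (max b (d + s))) ρ := by
    intro u hu
    by_cases hu' : u ∈ Ioo a b
    · exact hσ.congr isOpen_Ioo h1 u hu'
    · refine hτs.congr isOpen_Ioo h2 u ?_
      simp only [mem_Ioo, not_and_or, not_lt, min_lt_iff, lt_max_iff] at *
      constructor
      · rcases hu.1 with h | h
        · rcases hu' with h' | h' <;> linarith
        · exact h
      · rcases hu.2 with h | h
        · rcases hu' with h' | h' <;> linarith
        · exact h
  have h00 : (0 : ℝ) ∈ Ioo (min a (c + s)) (max b (d + s)) :=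
    ⟨min_lt_of_left_lt h0.1, lt_max_of_lt_left h0.2⟩
  have hts : t + s ∈ Ioo (min a (c + s)) (max b (d + s)) :=
    ⟨min_lt_of_right_lt (by linarith), lt_max_of_lt_right (by linarith)⟩
  have hρ0 : ρ 0 = m := (h1 h0).trans hz
  have h4 := h3.mem_flowDomain h00 hts
  have h5 := h3.localFlow_eq hv h00 hts
  rw [hρ0] at h4 h5
  refine ⟨h4, h5.trans ?_⟩
  rw [h2 (show t + s ∈ Ioo (c + s) (d + s) by constructor <;> linarith)]
  simp [τ]

lemma localFlow_mem (hv : ∀ p ∈ N, VFAnalyticAt v p) {q : ℝ × M} (h : q ∈ flowDomain v N) :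
    localFlow v N q ∈ N := by
  obtain ⟨a, b, h0, ht, hz, hσ⟩ := exists_isFlowCurve_localFlow hv (t := q.1) (m := q.2) h
  exact (hσ _ ht).1

lemma eventually_mem_flowDomain (hN : IsOpen N) (hv : ∀ p ∈ N, VFAnalyticAt v p) {q₀ : ℝ × M} (h :
    q₀ ∈ flowDomain v N) : ∀ᶠ q in 𝓝 q₀, q ∈ flowDomain v N ∧ ContMDiffAt (𝓘(ℝ, ℝ).prod 𝓘[n]) 𝓘[n] ω
    (localFlow v N) q := by
  obtain ⟨t₀, m₀⟩ := q₀
  obtain ⟨a, b, h0, ht, hz, hσ⟩ := exists_isFlowCurve_localFlow hv h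
  set σ := fun t => localFlow v N (t, m₀) with hσdef
  set good : ℝ × M → Prop := fun q => q ∈ flowDomain v N ∧
      ContMDiffAt (𝓘(ℝ, ℝ).prod 𝓘[n]) 𝓘[n] ω (localFlow v N) q with hgood
  have hstep : ∀ s ∈ Ioo a b, ∃ δ > 0, ∀ s₁ ∈ Ioo a b, |s₁ - s| < δ →
      (∀ᶠ m in 𝓝 m₀, (s₁, m) ∈ flowDomain v N ∧
        ContMDiffAt 𝓘[n] 𝓘[n] ω (fun m => localFlow v N (s₁, m)) m) →
      ∀ s₂, |s₂ - s| < δ → ∀ᶠ q in 𝓝 (s₂, m₀), good q := by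
    intro s hs
    obtain ⟨r, hr, O, hO, φ, hOo, hφ, hφ'⟩ := exists_localFlow_near hN (hσ s hs).1
      (hv _ (hσ s hs).1)
    have hc := (hσ s hs).2.continuousAt
    obtain ⟨δ', hδ', hδO⟩ := Metric.eventually_nhds_iff.1 (hc.eventually hO)
    refine ⟨min δ' (r / 2), by positivity, fun s₁ hs₁ h₁ hG s₂ h₂ => ?_⟩
    have hO₁ : σ s₁ ∈ O := hδO (by rw [Real.dist_eq]; exact h₁.trans_le (min_le_left _ _))
    have h₁' := h₁.trans_le (min_le_right _ _)
    have h₂' := h₂.trans_le (min_le_right _ _)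
    have h12 : s₂ - s₁ ∈ Ioo (-r) r := by rw [abs_lt] at h₁' h₂'; constructor <;> linarith
    have hc1 : ContinuousAt (fun m => localFlow v N (s₁, m)) m₀ := hG.self_of_nhds.2.continuousAt
    have hev : ∀ᶠ q : ℝ × M in 𝓝 (s₂, m₀), ((s₁, q.2) ∈ flowDomain v N ∧
        ContMDiffAt 𝓘[n] 𝓘[n] ω (fun m => localFlow v N (s₁, m)) q.2) ∧
        localFlow v N (s₁, q.2) ∈ O ∧ q.1 - s₁ ∈ Ioo (-r) r := by
      have e1 : Tendsto (Prod.snd : ℝ × M → M) (𝓝 (s₂, m₀)) (𝓝 m₀) := continuousAt_snd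
      have e2 : Tendsto (fun q : ℝ × M => q.1 - s₁) (𝓝 (s₂, m₀)) (𝓝 (s₂ - s₁)) :=
        (continuous_fst.sub continuous_const).continuousAt
      exact (e1.eventually hG).and ((e1.eventually (hc1.preimage_mem_nhds
        (hOo.mem_nhds hO₁))).and (e2.eventually (isOpen_Ioo.mem_nhds h12)))
    have heq : ∀ q : ℝ × M, ((s₁, q.2) ∈ flowDomain v N ∧
        ContMDiffAt 𝓘[n] 𝓘[n] ω (fun m => localFlow v N (s₁, m)) q.2) ∧
        localFlow v N (s₁, q.2) ∈ O ∧ q.1 - s₁ ∈ Ioo (-r) r → q ∈ flowDomain v N ∧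
          localFlow v N q = φ (q.1 - s₁, localFlow v N (s₁, q.2)) := by
      rintro ⟨t, m⟩ ⟨⟨g1, -⟩, g2, g3⟩
      have k := hφ' _ g2
      have k0 : (0 : ℝ) ∈ Ioo (-r) r := by simp [hr]
      have k1 := k.2.mem_flowDomain k0 g3
      have k2 := k.2.localFlow_eq hv k0 g3
      simp only [k.1] at k1 k2
      have k3 := localFlow_add hv g1 k1
      simp only [sub_add_cancel] at k3
      exact ⟨k3.1, k3.2.trans k2⟩
    filter_upwards [hev.eventually_nhds] with q hq
    have hq0 := hq.self_of_nhds
    refine ⟨(heq q hq0).1, ?_⟩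
    have hE : localFlow v N =ᶠ[𝓝 q] fun q => φ (q.1 - s₁, localFlow v N (s₁, q.2)) :=
      hq.mono fun q' h' => (heq q' h').2
    refine ContMDiffAt.congr_of_eventuallyEq ?_ hE
    have e1 : ContMDiffAt (𝓘(ℝ, ℝ).prod 𝓘[n]) 𝓘(ℝ, ℝ) ω (fun q : ℝ × M => q.1 - s₁) q := by
      have : ContMDiffAt 𝓘(ℝ, ℝ) 𝓘(ℝ, ℝ) ω (fun t : ℝ => t - s₁) q.1 :=
        contMDiffAt_iff_contDiffAt.2 (contDiffAt_id.sub contDiffAt_const)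
      exact ContMDiffAt.comp (g := fun t : ℝ => t - s₁) (f := Prod.fst) q this contMDiffAt_fst
    have e2 : ContMDiffAt (𝓘(ℝ, ℝ).prod 𝓘[n]) 𝓘[n] ω (fun q : ℝ × M => localFlow v N (s₁, q.2)) q :=
      ContMDiffAt.comp (g := fun m => localFlow v N (s₁, m)) (f := Prod.snd) q hq0.1.2
        contMDiffAt_snd
    exact ContMDiffAt.comp (g := φ) (f := fun q : ℝ × M => (q.1 - s₁, localFlow v N (s₁, q.2))) q
      (hφ _ ⟨hq0.2.2, hq0.2.1⟩) (e1.prodMk e2)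
  have hGG : ∀ s, (∀ᶠ q in 𝓝 (s, m₀), good q) → (∀ᶠ m in 𝓝 m₀, (s, m) ∈ flowDomain v N ∧
        ContMDiffAt 𝓘[n] 𝓘[n] ω (fun m => localFlow v N (s, m)) m) := by
    intro s hs
    have e1 : Tendsto (fun m : M => (s, m)) (𝓝 m₀) (𝓝 (s, m₀)) :=
      (Continuous.prodMk_right s).continuousAt
    filter_upwards [e1.eventually hs] with m hm
    refine ⟨hm.1, ?_⟩
    exact ContMDiffAt.comp (g := localFlow v N) (f := fun m : M => (s, m)) m hm.2
      (contMDiffAt_const.prodMk contMDiffAt_id)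
  have hm₀ : m₀ ∈ N := by have : localFlow v N (0, m₀) ∈ N := (hσ 0 h0).1; rwa [hz] at this
  have hG0 : ∀ᶠ m in 𝓝 m₀, ((0 : ℝ), m) ∈ flowDomain v N ∧
        ContMDiffAt 𝓘[n] 𝓘[n] ω (fun m => localFlow v N (0, m)) m := by
    filter_upwards [hN.mem_nhds hm₀] with m hm
    refine ⟨mem_flowDomain_zero hN hv hm, ?_⟩
    simp only [localFlow_zero _ hv]
    exact contMDiffAt_id
  have := isPreconnected_Ioo.subset_of_closure_inter_subset (s := Ioo a b)
    (u := {s | ∀ᶠ q in 𝓝 (s, m₀), good q}) ?_ ⟨0, h0, ?_⟩ ?_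
  · exact this ht
  · refine isOpen_iff_mem_nhds.2 fun s hs => ?_
    have e1 : Tendsto (fun s : ℝ => (s, m₀)) (𝓝 s) (𝓝 (s, m₀)) :=
      (Continuous.prodMk_left m₀).continuousAt
    exact e1.eventually (eventually_eventually_nhds.2 hs)
  · obtain ⟨δ, hδ, h1⟩ := hstep 0 h0
    exact h1 0 h0 (by simpa using hδ) hG0 0 (by simpa using hδ)
  · rintro s ⟨hs, hsI⟩
    obtain ⟨δ, hδ, h1⟩ := hstep s hsI
    have hnb : {u | u ∈ Ioo a b ∧ |u - s| < δ} ∈ 𝓝 s := inter_mem (isOpen_Ioo.mem_nhds hsI) (by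
        filter_upwards [ball_mem_nhds s hδ] with u hu
        rwa [mem_ball, Real.dist_eq] at hu)
    obtain ⟨u, ⟨hu1, hu2⟩, hu3⟩ := mem_closure_iff_nhds.1 hs _ hnb
    exact h1 u hu1 hu2 (hGG u hu3) s (by simpa using hδ)

lemma isOpen_flowDomain (hN : IsOpen N) (hv : ∀ p ∈ N, VFAnalyticAt v p) : IsOpen (flowDomain v N)
    :=
  isOpen_iff_mem_nhds.2 fun _ h => (eventually_mem_flowDomain hN hv h).mono fun _ h => h.1

lemma contMDiffAt_localFlow (hN : IsOpen N) (hv : ∀ p ∈ N, VFAnalyticAt v p) {q : ℝ × M} (h : q ∈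
    flowDomain v N) : ContMDiffAt (𝓘(ℝ, ℝ).prod 𝓘[n]) 𝓘[n] ω (localFlow v N) q :=
  (eventually_mem_flowDomain hN hv h).self_of_nhds.2

lemma hasVelocityAt_localFlow (hv : ∀ p ∈ N, VFAnalyticAt v p) (h : (t, m) ∈ flowDomain v N) :
    HasVelocityAt (fun t => localFlow v N (t, m)) t (v (localFlow v N (t, m))) := by
  obtain ⟨a, b, h0, ht, hz, hσ⟩ := exists_isFlowCurve_localFlow hv h
  exact (hσ _ ht).2

section Analysis
variable [CompleteSpace Y]

lemma hasFDerivAt_intervalIntegral_of_continuousAt {f : ℝ × X → Y} {F' : ℝ × X → X →L[ℝ] Y} {a b :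
    ℝ} {x₀ : X} (hf : ∀ s ∈ uIcc a b, ∀ᶠ q in 𝓝 (s, x₀), ContinuousAt f q ∧ HasFDerivAt (fun x => f
    (q.1, x)) (F' q) q.2) (hF' : ∀ s ∈ uIcc a b, ContinuousAt F' (s, x₀)) : HasFDerivAt (fun x => ∫
    s in a..b, f (s, x)) (∫ s in a..b, F' (s, x₀)) x₀ := by
  have e : ∀ s : ℝ, Tendsto (fun z : X × ℝ => (z.2, z.1)) (𝓝 (x₀, s)) (𝓝 (s, x₀)) := fun s =>
    (continuous_snd.prodMk continuous_fst).continuousAt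
  have h1 : ∀ᶠ x in 𝓝 x₀, ∀ s ∈ uIcc a b, ContinuousAt f (s, x) ∧
      HasFDerivAt (fun x => f (s, x)) (F' (s, x)) x :=
    isCompact_uIcc.eventually_forall_of_forall_eventually fun s hs => (e s).eventually (hf s hs)
  have hc : ∀ s ∈ uIcc a b, ContinuousAt (fun s => F' (s, x₀)) s := fun s hs =>
    ContinuousAt.comp (g := F') (f := fun s : ℝ => (s, x₀)) (hF' s hs)
      (Continuous.prodMk_left x₀).continuousAt
  obtain ⟨C, hC⟩ := (isCompact_uIcc (a := a) (b := b)).exists_bound_of_continuousOn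
    (f := fun s => F' (s, x₀)) fun s hs => (hc s hs).continuousWithinAt
  have h2 : ∀ᶠ x in 𝓝 x₀, ∀ s ∈ uIcc a b, ‖F' (s, x)‖ ≤ C + 1 := by
    refine isCompact_uIcc.eventually_forall_of_forall_eventually fun s hs => ?_
    have h3 := (e s).eventually ((hF' s hs).norm.eventually
      (gt_mem_nhds (show ‖F' (s, x₀)‖ < C + 1 by have := hC s hs; linarith)))
    exact h3.mono fun z hz => hz.le
  have hcont : ∀ x, (∀ s ∈ uIcc a b, ContinuousAt f (s, x)) →
      ContinuousOn (fun s => f (s, x)) (uIcc a b) := fun x hx s hs =>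
    (ContinuousAt.comp (g := f) (f := fun s : ℝ => (s, x))
        (hx s hs) (Continuous.prodMk_left x).continuousAt).continuousWithinAt
  refine intervalIntegral.hasFDerivAt_integral_of_dominated_of_fderiv_le (F := fun x s => f (s, x))
    (F' := fun x s => F' (s, x)) (bound := fun _ => C + 1) (h1.and h2) ?_ ?_ ?_ ?_ ?_ ?_
  · filter_upwards [h1] with x hx
    exact ((hcont x fun s hs => (hx s hs).1).mono uIoc_subset_uIcc).aestronglyMeasurable
      measurableSet_uIoc
  · exact (hcont x₀ fun s hs => (h1.self_of_nhds s hs).1).intervalIntegrable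
  · exact ContinuousOn.aestronglyMeasurable
      (fun s hs => (hc s (uIoc_subset_uIcc hs)).continuousWithinAt) measurableSet_uIoc
  · exact Eventually.of_forall fun s hs x hx => hx.2 s (uIoc_subset_uIcc hs)
  · exact intervalIntegrable_const
  · exact Eventually.of_forall fun s hs x hx => (hx.1 s (uIoc_subset_uIcc hs)).2

lemma hasFDerivAt_intervalIntegral_of_analytic {f : ℝ × X → Y} {a b : ℝ} {x₀ : X} (hf : ∀ s ∈ uIcc a
    b, AnalyticAt ℝ f (s, x₀)) : HasFDerivAt (fun x => ∫ s in a..b, f (s, x)) (∫ s in a..b, (fderiv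
    ℝ f (s, x₀)).comp (inr ℝ ℝ X)) x₀ := by
  refine hasFDerivAt_intervalIntegral_of_continuousAt
    (F' := fun q => (fderiv ℝ f q).comp (inr ℝ ℝ X)) (fun s hs => ?_)
    fun s hs => (hf s hs).fderiv.continuousAt.clm_comp continuousAt_const
  filter_upwards [(hf s hs).eventually_analyticAt] with q hq
  exact ⟨hq.continuousAt,
    hq.differentiableAt.hasFDerivAt.comp q.2 (hasFDerivAt_prodMk_right q.1 q.2)⟩

variable {T : Type*} [NormedAddCommGroup T] [InnerProductSpace ℝ T] [FiniteDimensional ℝ T]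

/-- The mixed part of a 2-form on `T × T`, as an operator on `T`. -/
def fiberMap (η : (T × T) [⋀^Fin 2]→L[ℝ] ℝ) : T →L[ℝ] T := LinearMap.toContinuousLinearMap
    { toFun := fun u => (InnerProductSpace.toDual ℝ T).symm
        (((toBilin (T × T) η).flip (u, 0)).comp (inr ℝ T T))
      map_add' := fun u v => by
        rw [← map_add, show (u + v, (0 : T)) = (u, 0) + (v, 0) by simp, map_add,
          ContinuousLinearMap.add_comp]
      map_smul' := fun c u => by
        rw [RingHom.id_apply, show (c • u, (0 : T)) = c • (u, 0) by simp, map_smul,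
          ContinuousLinearMap.smul_comp, map_smulₛₗ]
        simp }

lemma inner_fiberMap (η : (T × T) [⋀^Fin 2]→L[ℝ] ℝ) (u w : T) : inner ℝ (fiberMap η u) w = η ![(0,
    w), (u, 0)] :=
  InnerProductSpace.toDual_symm_apply (𝕜 := ℝ) (E := T) (x := w)
    (y := ((toBilin (T × T) η).flip (u, 0)).comp (inr ℝ T T))

lemma norm_fiberMap_le (η : (T × T) [⋀^Fin 2]→L[ℝ] ℝ) : ‖fiberMap η‖ ≤ ‖η‖ := by
  refine opNorm_le_bound _ (norm_nonneg η) fun u => ?_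
  have h1 : ‖fiberMap η u‖ * ‖fiberMap η u‖ ≤ (‖η‖ * ‖u‖) * ‖fiberMap η u‖ := by
    rw [← real_inner_self_eq_norm_mul_norm, inner_fiberMap]
    refine (le_abs_self _).trans ((η.le_opNorm _).trans (le_of_eq ?_))
    rw [Fin.prod_univ_two]
    simp [Prod.norm_def]
    ring
  by_cases h : ‖fiberMap η u‖ = 0
  · rw [h]; positivity
  · exact le_of_mul_le_mul_right h1 (lt_of_le_of_ne (norm_nonneg _) (Ne.symm h))

lemma isBoundedLinearMap_fiberMap : IsBoundedLinearMap ℝ (fun η : (T × T) [⋀^Fin 2]→L[ℝ] ℝ =>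
    fiberMap η) := by
  refine ⟨⟨fun η η' => ?_, fun c η => ?_⟩, 1, one_pos, fun η => by
    rw [one_mul]; exact norm_fiberMap_le η⟩
  · refine ContinuousLinearMap.ext fun u => ext_inner_right ℝ fun w => ?_
    rw [add_apply, inner_add_left, inner_fiberMap, inner_fiberMap, inner_fiberMap]
    rfl
  · refine ContinuousLinearMap.ext fun u => ext_inner_right ℝ fun w => ?_
    rw [smul_apply, real_inner_smul_left, inner_fiberMap, inner_fiberMap]
    rfl

lemma contDiffAt_fiberMap {η : Z → (T × T) [⋀^Fin 2]→L[ℝ] ℝ} {z : Z} {r : WithTop ℕ∞} (h :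
    ContDiffAt ℝ r η z) : ContDiffAt ℝ r (fun z => fiberMap (η z)) z :=
  ContDiffAt.comp (g := fun η : (T × T) [⋀^Fin 2]→L[ℝ] ℝ => fiberMap η) z
    (IsBoundedLinearMap.contDiff (f := fun η : (T × T) [⋀^Fin 2]→L[ℝ] ℝ => fiberMap η)
      isBoundedLinearMap_fiberMap).contDiffAt h

/-- The coordinates on the fibres of a Lagrangian fibration that are obtained by integration of
the mixed part of a closed 2-form. -/
def fiberPeriod (θ : T × T → (T × T) [⋀^Fin 2]→L[ℝ] ℝ) (x : T × T) : T :=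
  ∫ s in (0 : ℝ)..1, fiberMap (θ (s • x.1, x.2)) x.1

/-- The 2-form vanishes on the directions of the first factor. -/
def FiberIsotropic (η : (T × T) [⋀^Fin 2]→L[ℝ] ℝ) : Prop := ∀ u v : T, η ![(u, 0), (v, 0)] = 0

lemma analyticAt_fiberPeriod {θ : T × T → (T × T) [⋀^Fin 2]→L[ℝ] ℝ} {x : T × T} (h : ∀ s ∈ Icc (0 :
    ℝ) 1, AnalyticAt ℝ θ (s • x.1, x.2)) : AnalyticAt ℝ (fiberPeriod θ) x := by
  refine analyticAt_intervalIntegral (f := fun q : ℝ × (T × T) =>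
    fiberMap (θ (q.1 • q.2.1, q.2.2)) q.2.1) fun s hs => ?_
  rw [uIcc_of_le zero_le_one] at hs
  have e : ContDiffAt ℝ ω (fun q : ℝ × (T × T) => (q.1 • q.2.1, q.2.2)) (s, x) := by fun_prop
  have e1 : ContDiffAt ℝ ω (fun q : ℝ × (T × T) => q.2.1) (s, x) := by fun_prop
  have e2 : ContDiffAt ℝ ω (fun q : ℝ × (T × T) => θ (q.1 • q.2.1, q.2.2)) (s, x) :=
    ContDiffAt.comp (g := θ) (s, x) (h s hs).contDiffAt e
  exact ((contDiffAt_fiberMap e2).clm_apply e1).analyticAt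

lemma extDeriv_two_apply {θ : X → X [⋀^Fin 2]→L[ℝ] ℝ} {x : X} (h : DifferentiableAt ℝ θ x) (u v w :
    X) : extDeriv θ x ![u, v, w] = fderiv ℝ (fun y => θ y ![v, w]) x u - fderiv ℝ (fun y => θ y ![u,
    w]) x v + fderiv ℝ (fun y => θ y ![u, v]) x w := by
  have e0 : (0 : Fin 3).removeNth ![u, v, w] = ![v, w] := by ext i; fin_cases i <;> rfl
  have e1 : (1 : Fin 3).removeNth ![u, v, w] = ![u, w] := by ext i; fin_cases i <;> rfl
  have e2 : (2 : Fin 3).removeNth ![u, v, w] = ![u, v] := by ext i; fin_cases i <;> rfl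
  rw [extDeriv_apply h, Fin.sum_univ_three, e0, e1, e2]
  simp [sub_eq_add_neg]

lemma hasFDerivAt_fiberPeriod {θ : T × T → (T × T) [⋀^Fin 2]→L[ℝ] ℝ} {S : Set T} {ζ : T} (hS :
    Convex ℝ S) (hSo : IsOpen S) (h0 : (0 : T) ∈ S) (hd : ∀ τ ∈ S, DifferentiableAt ℝ θ (τ, ζ)) (hcl
    : ∀ τ ∈ S, extDeriv θ (τ, ζ) = 0) (hiso : ∀ τ ∈ S, ∀ᶠ x in 𝓝 (τ, ζ), FiberIsotropic (θ x)) {τ :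
    T} (hτ : τ ∈ S) : HasFDerivAt (fun τ => fiberPeriod θ (τ, ζ)) (fiberMap (θ (τ, ζ))) τ := by
  set A : T → T →L[ℝ] T := fun τ => fiberMap (θ (τ, ζ))
  have hpair : ∀ τ ∈ S, ∀ u w : T, HasFDerivAt (fun τ => inner ℝ (A τ u) w)
      ((fderiv ℝ (fun x => θ x ![(0, w), (u, 0)]) (τ, ζ)).comp (inl ℝ T T)) τ := by
    intro τ hτ u w
    have h1 : DifferentiableAt ℝ (fun x => θ x ![(0, w), (u, 0)]) (τ, ζ) :=
      ((hd τ hτ).hasFDerivAt.continuousAlternatingMap_apply_const _).differentiableAt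
    have h2 := HasFDerivAt.comp (𝕜 := ℝ) (E := T) (F := T × T) (G := ℝ) (f := fun e => (e, ζ))
      (g := fun x => θ x ![(0, w), (u, 0)]) τ h1.hasFDerivAt (hasFDerivAt_prodMk_left τ ζ)
    refine h2.congr_of_eventuallyEq (Eventually.of_forall fun τ' => ?_)
    simp only [A, inner_fiberMap, Function.comp]
  have hAd : ∀ τ ∈ S, HasFDerivAt A (fderiv ℝ A τ) τ := by
    intro τ hτ
    refine DifferentiableAt.hasFDerivAt ?_
    have h1 : DifferentiableAt ℝ (fun τ => θ (τ, ζ)) τ :=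
      DifferentiableAt.comp (𝕜 := ℝ) (E := T) (F := T × T) (G := (T × T) [⋀^Fin 2]→L[ℝ] ℝ)
        (f := fun e => (e, ζ)) (g := θ) τ (hd τ hτ) (hasFDerivAt_prodMk_left τ ζ).differentiableAt
    exact DifferentiableAt.comp (g := fun η : (T × T) [⋀^Fin 2]→L[ℝ] ℝ => fiberMap η) τ
      (IsBoundedLinearMap.differentiableAt (f := fun η : (T × T) [⋀^Fin 2]→L[ℝ] ℝ => fiberMap η)
        isBoundedLinearMap_fiberMap) h1
  have hsym : ∀ τ ∈ S, ∀ u v : T, fderiv ℝ A τ u v = fderiv ℝ A τ v u := by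
    intro τ hτ
    have key : ∀ u v w : T, inner ℝ (fderiv ℝ A τ u v) w =
        fderiv ℝ (fun x => θ x ![(0, w), (v, 0)]) (τ, ζ) (u, 0) := by
      intro u v w
      have h1 : HasFDerivAt (fun τ => inner ℝ (A τ v) w)
          ((innerSL ℝ w).comp ((ContinuousLinearMap.apply ℝ T v).comp (fderiv ℝ A τ))) τ := by
        have h2 := (innerSL ℝ w).hasFDerivAt.comp τ
          ((ContinuousLinearMap.apply ℝ T v).hasFDerivAt.comp τ (hAd τ hτ))
        refine h2.congr_of_eventuallyEq (Eventually.of_forall fun τ' => ?_)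
        simp [real_inner_comm]
      have h3 := congrArg (fun L => L u) (h1.unique (hpair τ hτ v w))
      simp only [ContinuousLinearMap.comp_apply, ContinuousLinearMap.apply_apply,
        innerSL_apply_apply, ContinuousLinearMap.inl_apply] at h3
      rw [real_inner_comm]; exact h3
    intro u v
    refine ext_inner_right ℝ fun w => ?_
    rw [key, key]
    have h1 := congrArg (fun η => η ![(u, (0 : T)), (v, 0), (0, w)]) (hcl τ hτ)
    rw [extDeriv_two_apply (hd τ hτ)] at h1
    replace h1 : _ = (0 : ℝ) := h1
    have h2 : fderiv ℝ (fun y => θ y ![(u, (0 : T)), (v, 0)]) (τ, ζ) = 0 := by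
      have : (fun y => θ y ![(u, (0 : T)), (v, 0)]) =ᶠ[𝓝 (τ, ζ)] fun _ => (0 : ℝ) :=
        (hiso τ hτ).mono fun x hx => hx u v
      rw [this.fderiv_eq]; simp
    have hsw : ∀ a : T, (fun y => θ y ![(a, (0 : T)), (0, w)]) =
        fun y => - θ y ![(0, w), (a, 0)] := fun a => funext fun y => alternating_swap _ _ _
    rw [h2, hsw, hsw, fderiv_fun_neg, fderiv_fun_neg] at h1
    simp at h1
    linarith
  have h := hS.hasFDerivWithinAt_curveIntegral_segment_of_hasFDerivWithinAt_symmetric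
    (fun x hx => (hAd x hx).hasFDerivWithinAt) (fun a ha x _ y _ => hsym a ha x y) h0 hτ
  refine (h.hasFDerivAt (hSo.mem_nhds hτ)).congr_of_eventuallyEq (Eventually.of_forall fun τ' => ?_)
  simp only [curveIntegral_segment, fiberPeriod, sub_zero, A, AffineMap.lineMap_apply_module,
    smul_zero, zero_add]
end Analysis

lemma dFun_comp {g : M → X} {φ : X → Z} (hφ : DifferentiableAt ℝ φ (g m)) (hg : MDifferentiableAt
    𝓘[n] 𝓘(ℝ, X) g m) : dFun n (fun m => φ (g m)) m = (fderiv ℝ φ (g m)).comp (dFun n g m) := by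
  rw [← mfderiv_eq_fderiv]
  exact mfderiv_comp m hφ.mdifferentiableAt hg

/-- The Hamiltonian vector field of the linear combination `⟪a, F⟫` of the components of `F`. -/
def hamDir (Ω : DForm n M 2) (F : M → Target n) (a : Target n) (m : M) : Model n :=
  hamField Ω (fun p => inner ℝ a (F p)) m

lemma IsIntegrableSystem.mdifferentiableAt (h : IsIntegrableSystem Ω F) (m : M) : MDifferentiableAt
    𝓘[n] 𝓘(ℝ, Target n) F m :=
  h.analytic.contMDiffAt.mdiff

lemma formAt_hamDir (h : IsIntegrableSystem Ω F) (a : Target n) (m : M) (v : Model n) : formAt Ω m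
    ![v, hamDir Ω F a m] = inner ℝ a (dFun n F m v) := by
  rw [hamDir, hamField_spec h.symplectic,
    dFun_comp (n := n) (φ := fun z => inner ℝ a z) (innerSL ℝ a).differentiableAt
      (h.mdifferentiableAt m)]
  rw [ContinuousLinearMap.comp_apply]
  have : fderiv ℝ (fun z => inner ℝ a z) (F m) = innerSL ℝ a := (innerSL ℝ a).fderiv
  rw [this]; rfl

lemma hamDir_unique (h : IsIntegrableSystem Ω F) {a : Target n} (hw : ∀ v, formAt Ω m ![v, w] =
    inner ℝ a (dFun n F m v)) : hamDir Ω F a m = w := by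
  rw [← sub_eq_zero]
  refine formAt_nondegenerate h.symplectic (m := m) fun v => ?_
  rw [← toBilin_apply, map_sub, toBilin_apply, toBilin_apply, formAt_hamDir h, hw, sub_self]

lemma hamDir_add (h : IsIntegrableSystem Ω F) (a b : Target n) (m : M) : hamDir Ω F (a + b) m =
    hamDir Ω F a m + hamDir Ω F b m := by
  refine hamDir_unique h fun v => ?_
  rw [← toBilin_apply, map_add, toBilin_apply, toBilin_apply, formAt_hamDir h, formAt_hamDir h,
    inner_add_left]

lemma hamDir_smul (h : IsIntegrableSystem Ω F) (c : ℝ) (a : Target n) (m : M) : hamDir Ω F (c • a) m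
    = c • hamDir Ω F a m := by
  refine hamDir_unique h fun v => ?_
  rw [← toBilin_apply, map_smul, toBilin_apply, formAt_hamDir h, real_inner_smul_left]
  rfl

def hamLin (h : IsIntegrableSystem Ω F) (m : M) : Target n →ₗ[ℝ] Model n where
  toFun a := hamDir Ω F a m
  map_add' a b := hamDir_add h a b m
  map_smul' c a := hamDir_smul h c a m

lemma hamLin_apply (h : IsIntegrableSystem Ω F) (m : M) (a : Target n) : hamLin h m a = hamDir Ω F a
    m := rfl

lemma hamField_comp (h : IsIntegrableSystem Ω F) (hJ : DifferentiableAt ℝ J (F m)) : hamField Ω (fun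
    p => J (F p)) m = hamDir Ω F (gradient J (F m)) m := by
  refine hamField_unique h.symplectic fun v => ?_
  rw [formAt_hamDir h, dFun_comp (n := n) hJ (h.mdifferentiableAt m), gradient,
    InnerProductSpace.toDual_symm_apply]
  rfl

lemma hamDir_single (i : Fin n) (m : M) : hamDir Ω F (EuclideanSpace.single i 1) m = hamField Ω (fun
    p => F p i) m := by
  unfold hamDir
  congr 1
  funext p
  simp [EuclideanSpace.inner_single_left]

lemma hamDir_eq_sum (h : IsIntegrableSystem Ω F) (a : Target n) (m : M) : hamDir Ω F a m = ∑ i, a i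
    • hamField Ω (fun p => F p i) m := by
  have h1 : a = ∑ i, a i • EuclideanSpace.single i (1 : ℝ) := by
    ext j
    simp [Finset.sum_apply, Pi.single_apply]
  conv_lhs => rw [h1, ← hamLin_apply h]
  rw [map_sum]
  refine Finset.sum_congr rfl fun i _ => ?_
  rw [map_smul, hamLin_apply, hamDir_single]

lemma dFun_hamDir (h : IsIntegrableSystem Ω F) (a : Target n) (m : M) : dFun n F m (hamDir Ω F a m)
    = 0 := by
  ext i
  have h1 : (dFun n F m (hamDir Ω F a m)) i =
      inner ℝ (EuclideanSpace.single i (1 : ℝ)) (dFun n F m (hamDir Ω F a m)) := by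
    simp [EuclideanSpace.inner_single_left]
  rw [h1, ← formAt_hamDir h, hamDir_single, hamDir_eq_sum h, alternating_swap, ← toBilin_apply,
    map_sum]
  rw [Finset.sum_eq_zero fun j _ => ?_]
  · simp
  rw [map_smul, toBilin_apply]
  rw [show formAt Ω m ![hamField Ω (fun p => F p i) m, hamField Ω (fun p => F p j) m] = 0 from
    h.commute i j m]
  simp

lemma momentumRank_eq_iff : momentumRank F m = n ↔ Surjective (dFun n F m) := by
  have h1 : momentumRank F m = Module.finrank ℝ (LinearMap.range (dFun n F m).toLinearMap) := rfl
  rw [h1]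
  constructor
  · intro h2
    have h3 := Submodule.eq_top_of_finrank_eq (K := ℝ) (V := Target n)
      (S := LinearMap.range (dFun n F m).toLinearMap) (by rw [h2]; simp)
    exact LinearMap.range_eq_top.1 h3
  · intro h2
    rw [LinearMap.range_eq_top.2 h2, finrank_top]
    simp

lemma hamDir_injective (h : IsIntegrableSystem Ω F) (hm : Surjective (dFun n F m)) {a : Target n}
    (ha : hamDir Ω F a m = 0) : a = 0 := by
  obtain ⟨v, hv⟩ := hm a
  have h1 := formAt_hamDir h a m v
  rw [ha, hv, ← toBilin_apply, map_zero] at h1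
  exact inner_self_eq_zero.1 h1.symm

lemma exists_hamDir_eq (h : IsIntegrableSystem Ω F) (hm : Surjective (dFun n F m)) (hw : dFun n F m
    w = 0) : ∃ a, hamDir Ω F a m = w := by
  have hle : LinearMap.range (hamLin h m) ≤ LinearMap.ker (dFun n F m).toLinearMap := by
    rintro _ ⟨a, rfl⟩
    exact dFun_hamDir h a m
  have hinj : Injective (hamLin h m) :=
    (injective_iff_map_eq_zero _).2 fun a ha => hamDir_injective h hm ha
  have h1 := LinearMap.finrank_range_of_inj hinj
  have h2 := LinearMap.finrank_range_add_finrank_ker (dFun n F m).toLinearMap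
  rw [LinearMap.range_eq_top.2 hm, finrank_top] at h2
  simp only [finrank_euclideanSpace, Fintype.card_fin] at h1 h2
  have h3 := Submodule.eq_of_le_of_finrank_eq hle (by omega)
  have h4 : w ∈ LinearMap.range (hamLin h m) := by rw [h3]; exact hw
  exact h4

lemma formAt_eq_zero_of_dFun (h : IsIntegrableSystem Ω F) (hm : Surjective (dFun n F m)) {v : Model
    n} (hv : dFun n F m v = 0) (hw : dFun n F m w = 0) : formAt Ω m ![v, w] = 0 := by
  obtain ⟨a, rfl⟩ := exists_hamDir_eq h hm hw
  rw [formAt_hamDir h, hv, inner_zero_right]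

/-- At `x` the map `E` from the product `ℝⁿ × ℝⁿ` is differentiable, and the differential of `F`
reads in these coordinates as the second projection. -/
def IsFiberedAt (F : M → Target n) (E : Coords n → M) (x : Coords n) :
    Prop :=
  MDifferentiableAt 𝓘(ℝ, Coords n) 𝓘[n] E x ∧ ∀ v, dFun n F (E x) (dParam n E x v) = v.2

lemma isFiberedAt_of_eventually (hF : MDifferentiableAt 𝓘[n] 𝓘(ℝ, Target n) F (E x)) (hE :
    MDifferentiableAt 𝓘(ℝ, Coords n) 𝓘[n] E x) {c : Target n} (hc : ∀ᶠ y in 𝓝 x, F (E y) = c + y.2)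
    : IsFiberedAt F E x := by
  refine ⟨hE, fun v => ?_⟩
  have h1 := fderiv_fun_comp_param hE hF
  have h2 : HasFDerivAt (fun y => F (E y)) (snd ℝ (Target n) (Target n)) x :=
    ((hasFDerivAt_snd).const_add c).congr_of_eventuallyEq hc
  rw [h2.fderiv] at h1
  exact (congrArg (fun L => L v) h1).symm

lemma IsFiberedAt.surjective (hE : IsFiberedAt F E x) : Surjective (dFun n F (E x)) :=
  fun w => ⟨dParam n E x (0, w), hE.2 _⟩

lemma IsFiberedAt.bijective (hE : IsFiberedAt F E x) (hinj : ∀ u, dParam n E x (u, 0) = 0 → u = 0) :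
    Bijective (dParam n E x) := by
  have h1 : Injective (dParam n E x) := by
    refine (injective_iff_map_eq_zero _).2 fun v hv => ?_
    have h2 := hE.2 v
    rw [hv, map_zero] at h2
    obtain ⟨u, w⟩ := v
    simp only at h2
    subst h2
    rw [hinj u hv]; rfl
  refine ⟨h1, ?_⟩
  have h2 := (LinearMap.injective_iff_surjective_of_finrank_eq_finrank
    (f := (dParam n E x).toLinearMap) (by simp; omega)).1 h1
  exact h2

lemma IsFiberedAt.isotropic (h : IsIntegrableSystem Ω F) (hE : IsFiberedAt F E x) : FiberIsotropic
    (pullForm E Ω x) := by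
  intro u v
  rw [pullForm_apply_two]
  exact formAt_eq_zero_of_dFun h hE.surjective (hE.2 _) (hE.2 _)

lemma IsFiberedAt.dParam_eq_hamDir (h : IsIntegrableSystem Ω F) (hE : IsFiberedAt F E x) (hb :
    Bijective (dParam n E x)) (u : Target n) : dParam n E x (u, 0) = hamDir Ω F (fiberMap (pullForm
    E Ω x) u) (E x) := by
  refine (hamDir_unique h fun v => ?_).symm
  obtain ⟨⟨a, w⟩, rfl⟩ := hb.2 v
  rw [hE.2, inner_fiberMap, ← pullForm_apply_two, ← toBilin_apply, ← toBilin_apply,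
    show ((a, w) : Coords n) = (a, 0) + (0, w) by simp, map_add]
  simp only [add_apply]
  rw [toBilin_apply, hE.isotropic h, zero_add]
  simp

lemma VFAnalyticAt.smul {c : M → ℝ} {p : M} (hv : VFAnalyticAt v p) (hc : ContMDiffAt 𝓘[n] 𝓘(ℝ, ℝ) ω
    c p) : VFAnalyticAt (fun m => c m • v m) p := by
  obtain ⟨f, hf, hvf⟩ := hv
  have he := chart_mem_atlas (Model n) p
  have hx := mem_chart_source (Model n) p
  refine ⟨fun y => c ((chartAt (Model n) p).symm y) • f y, ?_, ?_⟩
  · have h1 : ContDiffAt ℝ ω (fun y => c ((chartAt (Model n) p).symm y))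
        (chartAt (Model n) p p) := by
      rw [← contMDiffAt_iff_contDiffAt]
      refine ContMDiffAt.comp (g := c) _ ?_
        (contMDiffAt_chart_symm he ((chartAt (Model n) p).map_source hx))
      rw [(chartAt (Model n) p).left_inv hx]; exact hc
    exact (h1.smul hf.contDiffAt).analyticAt
  · filter_upwards [hvf] with y hy
    rw [hy, map_smul]

lemma VFAnalyticAt.sum {ι : Type*} (s : Finset ι) {v : ι → M → Model n} {p : M} (hv : ∀ i ∈ s,
    VFAnalyticAt (v i) p) : VFAnalyticAt (fun m => ∑ i ∈ s, v i m) p := by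
  classical
  choose! f hf hvf using hv
  refine ⟨fun y => ∑ i ∈ s, f i y, Finset.analyticAt_fun_sum s hf, ?_⟩
  filter_upwards [(Filter.eventually_all_finset s).2 hvf] with y hy
  rw [map_sum]
  exact Finset.sum_congr rfl hy

lemma vfAnalyticAt_hamDir (h : IsIntegrableSystem Ω F) {p : M} (hb : AnalyticAt ℝ b (F p)) :
    VFAnalyticAt (fun m => hamDir Ω F (b (F m)) m) p := by
  simp only [hamDir_eq_sum h]
  refine VFAnalyticAt.sum _ fun i _ => VFAnalyticAt.smul ?_ ?_
  · refine vfAnalyticAt_hamField h.symplectic ?_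
    exact ContDiffAt.comp_contMDiffAt (g := fun z : Target n => z i)
      (by fun_prop) h.analytic.contMDiffAt
  · have h1 : ContDiffAt ℝ ω (fun z => b z i) (F p) := by
      have := hb.contDiffAt (n := ω)
      fun_prop
    exact ContDiffAt.comp_contMDiffAt (g := fun z : Target n => b z i) h1 h.analytic.contMDiffAt

section LocalInverse
variable [CompleteSpace X] [CompleteSpace Y]

lemma exists_analytic_inverse {f : X → Y} {x₀ : X} (hf : ContDiffAt ℝ ω f x₀) (hb : Bijective
    (fderiv ℝ f x₀)) : ∃ g : Y → X, ContDiffAt ℝ ω g (f x₀) ∧ g (f x₀) = x₀ ∧ (∀ᶠ y in 𝓝 (f x₀), f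
    (g y) = y) ∧ ∀ᶠ x in 𝓝 x₀, g (f x) = x := by
  let A : X ≃L[ℝ] Y := ContinuousLinearEquiv.ofBijective (fderiv ℝ f x₀)
    (LinearMap.ker_eq_bot.2 hb.1) (LinearMap.range_eq_top.2 hb.2)
  have hA : HasFDerivAt f (A : X →L[ℝ] Y) x₀ := (hf.diff).hasFDerivAt
  let Ψ := hf.toOpenPartialHomeomorph _ hA omega_ne_zero
  have hΨ0 : x₀ ∈ Ψ.source := hf.mem_toOpenPartialHomeomorph_source hA omega_ne_zero
  have hloc : ContDiffAt ℝ ω Ψ.symm (f x₀) := hf.to_localInverse hA omega_ne_zero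
  refine ⟨Ψ.symm, hloc, Ψ.left_inv hΨ0, ?_, ?_⟩
  · filter_upwards [Ψ.open_target.mem_nhds (Ψ.map_source hΨ0)] with y hy
    exact Ψ.right_inv hy
  · filter_upwards [Ψ.open_source.mem_nhds hΨ0] with x hx
    exact Ψ.left_inv hx
end LocalInverse

lemma eventually_contMDiffAt [FiniteDimensional ℝ X] {E : X → M} {x : X} (h : ContMDiffAt 𝓘(ℝ, X)
    𝓘[n] ω E x) : ∀ᶠ y in 𝓝 x, ContMDiffAt 𝓘(ℝ, X) 𝓘[n] ω E y := by
  have he := chart_mem_atlas (Model n) (E x)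
  have hx := mem_chart_source (Model n) (E x)
  set e := chartAt (Model n) (E x)
  have h1 := contDiffAt_chart_comp le_rfl he h hx
  have h2 : ∀ᶠ y in 𝓝 x, ∀ᶠ z in 𝓝 y, E z ∈ e.source :=
    eventually_eventually_nhds.2 (h.continuousAt.preimage_mem_nhds (e.open_source.mem_nhds hx))
  filter_upwards [h1.analyticAt.eventually_analyticAt, h2] with y hy hy'
  have h3 : ContMDiffAt 𝓘(ℝ, X) 𝓘[n] ω (fun z => e.symm (e (E z))) y :=
    ContMDiffAt.comp (g := e.symm) (f := fun z => e (E z)) y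
      (contMDiffAt_chart_symm he (e.map_source hy'.self_of_nhds))
      (contMDiffAt_iff_contDiffAt.2 hy.contDiffAt)
  exact h3.congr_of_eventuallyEq (hy'.mono fun z hz => (e.left_inv hz).symm)

/-- Analytic coordinates, in which the momentum map is a linear projection. -/
lemma exists_fibered_chart (h : IsIntegrableSystem Ω F) {p : M} (hp : Surjective (dFun n F p)) : ∃ ψ
    : Coords n → M, ψ 0 = p ∧ ContMDiffAt 𝓘(ℝ, Coords n) 𝓘[n] ω ψ 0 ∧ (∀ᶠ x in 𝓝 0, F (ψ x) = F p +
    x.2) ∧ Bijective (dParam n ψ 0) := by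
  have he := chart_mem_atlas (Model n) p
  have hx := mem_chart_source (Model n) p
  set e := chartAt (Model n) p
  have hep : e p ∈ e.target := e.map_source hx
  have hesp : e.symm (e p) = p := e.left_inv hx
  have hes := contMDiffAt_chart_symm he hep
  have hFe : ContDiffAt ℝ ω (fun y => F (e.symm y)) (e p) := by
    rw [← contMDiffAt_iff_contDiffAt]
    exact ContMDiffAt.comp (g := F) (e p) h.analytic.contMDiffAt hes
  have hA : fderiv ℝ (fun y => F (e.symm y)) (e p) = (dFun n F p).comp (dParam n e.symm (e p)) := by
    have := fderiv_fun_comp_param (hes.mdiff)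
      (h.mdifferentiableAt (e.symm (e p)))
    rwa [hesp] at this
  set A := fderiv ℝ (fun y => F (e.symm y)) (e p)
  have hbij : Bijective (dParam n e.symm (e p)) := bijective_mfderiv_chart_symm he hep
  have hAs : Surjective A := by rw [hA]; exact hp.comp hbij.2
  have hk := LinearMap.finrank_range_add_finrank_ker A.toLinearMap
  rw [LinearMap.range_eq_top.2 hAs, finrank_top] at hk
  simp only [finrank_euclideanSpace, Fintype.card_fin] at hk
  let κ : LinearMap.ker A.toLinearMap ≃ₗ[ℝ] Target n :=
    LinearEquiv.ofFinrankEq _ _ (by simp only [finrank_euclideanSpace, Fintype.card_fin]; omega)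
  obtain ⟨P₀, hP⟩ := LinearMap.exists_extend κ.toLinearMap
  let P : Model n →L[ℝ] Target n := LinearMap.toContinuousLinearMap P₀
  let G : Model n → Coords n := fun y => (P (y - e p), F (e.symm y) - F p)
  have hG : ContDiffAt ℝ ω G (e p) :=
    ContDiffAt.prodMk (P.contDiff.contDiffAt.comp _ (contDiffAt_id.sub contDiffAt_const))
      (hFe.sub contDiffAt_const)
  have hG' : HasFDerivAt G (P.prod A) (e p) := by
    refine HasFDerivAt.prodMk ?_ ?_
    · exact HasFDerivAt.comp (f := fun y => y - e p) (g := P) (f' := ContinuousLinearMap.id ℝ _)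
        (e p) P.hasFDerivAt ((hasFDerivAt_id (e p)).sub_const (e p))
    · exact ((hFe.diff).hasFDerivAt).sub_const _
  have hinj : Injective (P.prod A) := by
    refine (injective_iff_map_eq_zero _).2 fun v hv => ?_
    have h1 : P v = 0 := congrArg Prod.fst hv
    have h2 : A v = 0 := congrArg Prod.snd hv
    have h3 : κ ⟨v, h2⟩ = 0 := by
      have := congrArg (fun L => L ⟨v, h2⟩) hP
      exact this.symm.trans h1
    have h4 := (map_eq_zero_iff κ κ.injective).1 h3
    exact congrArg Subtype.val h4
  have hGb : Bijective (fderiv ℝ G (e p)) := by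
    rw [hG'.fderiv]
    refine ⟨hinj, ?_⟩
    exact (LinearMap.injective_iff_surjective_of_finrank_eq_finrank
      (f := (P.prod A).toLinearMap) (by simp; omega)).1 hinj
  obtain ⟨H, hH, hH0, hGH, hHG⟩ := exists_analytic_inverse hG hGb
  have hG0 : G (e p) = 0 := by simp [G, hesp]
  rw [hG0] at hH hH0 hGH
  have hψ : ContMDiffAt 𝓘(ℝ, Coords n) 𝓘[n] ω (fun x => e.symm (H x)) 0 := by
    refine ContMDiffAt.comp (g := e.symm) (f := H) 0 ?_ (contMDiffAt_iff_contDiffAt.2 hH)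
    rw [hH0]; exact hes
  refine ⟨fun x => e.symm (H x), by simp only [hH0, hesp], hψ, ?_, ?_⟩
  · filter_upwards [hGH] with x hx
    have := congrArg Prod.snd hx
    simp only [G] at this
    rw [← this]; abel
  · have hHd := hH.differentiableAt (by decide : (ω : WithTop ℕ∞) ≠ 0)
    rw [dParam_comp (by rw [hH0]; exact hes.mdiff) hHd, hH0]
    have h1 : Injective (fderiv ℝ H 0) := by
      have hG'' : DifferentiableAt ℝ G (H 0) := by rw [hH0]; exact hG'.differentiableAt
      have h2 : (fderiv ℝ G (H 0)).comp (fderiv ℝ H 0) = ContinuousLinearMap.id ℝ _ := by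
        rw [← fderiv_comp 0 hG'' hHd]
        have : (G ∘ H) =ᶠ[𝓝 0] id := hGH
        rw [this.fderiv_eq, fderiv_id]
      exact LeftInverse.injective (g := fderiv ℝ G (H 0)) fun v => congrArg (fun L => L v) h2
    have h2 : Surjective (fderiv ℝ H 0) := (LinearMap.injective_iff_surjective_of_finrank_eq_finrank
        (f := (fderiv ℝ H 0).toLinearMap) (by simp; omega)).1 h1
    exact hbij.comp ⟨h1, h2⟩

/-- The flow box theorem: near a regular point there are analytic coordinates, in which the momentum
map is a projection and the Hamiltonian flows are translations. -/
theorem exists_flowBox (h : IsIntegrableSystem Ω F) {p : M} (hp : Surjective (dFun n F p)) : ∃ E :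
    Coords n → M, E 0 = p ∧ ∀ᶠ x in 𝓝 0, ContMDiffAt 𝓘(ℝ, Coords n) 𝓘[n] ω E x ∧ F (E x) = F p + x.2
    ∧ ∀ u, dParam n E x (u, 0) = hamDir Ω F u (E x) := by
  obtain ⟨ψ, hψ0, hψ, hFψ, hψb⟩ := exists_fibered_chart h hp
  set θ := pullForm ψ Ω with hθ
  have hθc : ∀ {x}, ContMDiffAt 𝓘(ℝ, Coords n) 𝓘[n] ω ψ x →
      ContDiffAt ℝ ω θ x := fun hx => contDiffAt_pullForm h.symplectic.analytic (mem_univ _) hx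
  have hgood : ∀ᶠ x in 𝓝 0, ContMDiffAt 𝓘(ℝ, Coords n) 𝓘[n] ω ψ x ∧
      IsFiberedAt F ψ x ∧ F (ψ x) = F p + x.2 := by
    filter_upwards [eventually_contMDiffAt hψ, hFψ.eventually_nhds] with x hx hx'
    exact ⟨hx, isFiberedAt_of_eventually (h.mdifferentiableAt _)
      (hx.mdiff) hx', hx'.self_of_nhds⟩
  obtain ⟨r, hr, hball⟩ := eventually_nhds_iff_ball.1 hgood
  have hP : ∀ x ∈ ball (0 : Coords n) r, AnalyticAt ℝ (fiberPeriod θ) x :=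
    fun x hx => analyticAt_fiberPeriod fun s hs => (hθc (hball _ (smul_fst_mem_ball hx hs)).1).analyticAt
  have hPd : ∀ x ∈ ball (0 : Coords n) r, ∀ u,
      fderiv ℝ (fiberPeriod θ) x (u, 0) = fiberMap (θ x) u := by
    rintro ⟨τ, ζ⟩ hx u
    have hm : ∀ τ' ∈ ball (0 : Target n) r, (τ', ζ) ∈ ball (0 : Coords n) r := fun τ' => mk_mem_ball hx
    have h1 := hasFDerivAt_fiberPeriod (θ := θ) (S := ball (0 : Target n) r) (ζ := ζ)
      (convex_ball _ _) isOpen_ball (mem_ball_self hr)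
      (fun τ' h' => (hθc (hball _ (hm τ' h')).1).diff) (fun τ' h' => by
        rw [hθ, extDeriv_pullForm h.symplectic.analytic h.symplectic.closed (mem_univ _)
          (hball _ (hm τ' h')).1]
        ext v
        rfl)
      (fun τ' h' => by
        filter_upwards [isOpen_ball.mem_nhds (hm τ' h')] with y hy
        exact (hball y hy).2.1.isotropic h)
      (mem_ball_zero_iff.2 (mem_ball_prod.1 hx).1)
    have h2 := (hP _ hx).differentiableAt.hasFDerivAt_left
    exact congrArg (fun L => L u) (h2.unique h1)
  set R : Coords n → Coords n := fun x => (fiberPeriod θ x, x.2) with hR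
  have h0 : (0 : Coords n) ∈ ball (0 : Coords n) r := mem_ball_self hr
  have hRc : ∀ x ∈ ball (0 : Coords n) r, ContDiffAt ℝ ω R x := fun x hx =>
    (hP x hx).contDiffAt.prodMk contDiffAt_snd
  have hRd : ∀ x ∈ ball (0 : Coords n) r, ∀ v,
      fderiv ℝ R x v = (fderiv ℝ (fiberPeriod θ) x v, v.2) := by
    intro x hx v
    have h1 : HasFDerivAt R ((fderiv ℝ (fiberPeriod θ) x).prod
        (snd ℝ (Target n) (Target n))) x :=
      (hP x hx).differentiableAt.hasFDerivAt.prodMk hasFDerivAt_snd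
    rw [h1.fderiv]; rfl
  have hΘ0 : ∀ u, fiberMap (θ 0) u = 0 → u = 0 := by
    intro u hu
    have h1 := (hball 0 h0).2.1.dParam_eq_hamDir h hψb u
    rw [← hθ, hu] at h1
    have h2 : hamDir Ω F 0 (ψ 0) = 0 := (hamLin h (ψ 0)).map_zero
    rw [h2] at h1
    have h3 := hψb.1 (h1.trans (map_zero _).symm)
    exact congrArg Prod.fst h3
  have hRi : Injective (fderiv ℝ R 0) := by
    refine (injective_iff_map_eq_zero _).2 fun v hv => ?_
    rw [hRd 0 h0] at hv
    obtain ⟨u, w⟩ := v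
    have hw : w = 0 := congrArg Prod.snd hv
    subst hw
    have hu := congrArg Prod.fst hv
    simp only [hPd 0 h0] at hu
    rw [hΘ0 u hu]; rfl
  have hRb : Bijective (fderiv ℝ R 0) :=
    ⟨hRi, (LinearMap.injective_iff_surjective (f := (fderiv ℝ R 0).toLinearMap)).1 hRi⟩
  have hR0 : R 0 = 0 := by simp [hR, fiberPeriod]
  obtain ⟨Q, hQ, hQ0, hRQ, -⟩ := exists_analytic_inverse (hRc 0 h0) hRb
  rw [hR0] at hQ hQ0 hRQ
  have hQcont : Tendsto Q (𝓝 0) (𝓝 0) := by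
    have := hQ.continuousAt
    rwa [ContinuousAt, hQ0] at this
  refine ⟨fun x => ψ (Q x), by simp only [hQ0, hψ0], ?_⟩
  have hbij : ∀ᶠ x in 𝓝 (0 : Coords n), ∀ u, fiberMap (θ x) u = 0 → u = 0 := by
    have hinj : Injective (fiberMap (θ 0)) := (injective_iff_map_eq_zero _).2 hΘ0
    have h1 : ContinuousAt (fun x => fiberMap (θ x)) 0 :=
      (contDiffAt_fiberMap (hθc (hball 0 h0).1)).continuousAt
    filter_upwards [h1.preimage_mem_nhds (ContinuousLinearMap.isOpen_injective.mem_nhds hinj)]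
      with x hx using (injective_iff_map_eq_zero _).1 hx
  have hRQ' : ∀ᶠ x in 𝓝 (0 : Coords n), ∀ᶠ y in 𝓝 x, R (Q y) = y := eventually_eventually_nhds.2 hRQ
  filter_upwards [hQcont.eventually (isOpen_ball.mem_nhds h0), hRQ',
    hQ.analyticAt.eventually_analyticAt, hQcont.eventually hbij] with x hx hxR hxQ hxb
  have hxψ := hball _ hx
  have hQ2 : (Q x).2 = x.2 := by
    have h1 : (fiberPeriod θ (Q x), (Q x).2) = x := hxR.self_of_nhds
    have h2 := congrArg Prod.snd h1
    exact h2
  refine ⟨ContMDiffAt.comp (g := ψ) (f := Q) x hxψ.1 (contMDiffAt_iff_contDiffAt.2 hxQ.contDiffAt),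
    by rw [hxψ.2.2, hQ2], fun u => ?_⟩
  rw [dParam_comp hxψ.2.1.1 hxQ.differentiableAt]
  have h1 : fderiv ℝ R (Q x) (fderiv ℝ Q x (u, 0)) = (u, 0) := by
    have h2 : (fderiv ℝ R (Q x)).comp (fderiv ℝ Q x) = ContinuousLinearMap.id ℝ _ := by
      rw [← fderiv_comp x ((hRc _ hx).diff) hxQ.differentiableAt]
      have : (R ∘ Q) =ᶠ[𝓝 x] id := hxR
      rw [this.fderiv_eq, fderiv_id]
    exact congrArg (fun L => L (u, 0)) h2
  rw [hRd _ hx] at h1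
  rcases hv : fderiv ℝ Q x (u, 0) with ⟨ξ, w⟩
  rw [hv] at h1
  have hw : w = 0 := congrArg Prod.snd h1
  subst hw
  have hu : fiberMap (θ (Q x)) ξ = u := by rw [← hPd _ hx]; exact congrArg Prod.fst h1
  rw [ContinuousLinearMap.comp_apply, hv]
  refine (hxψ.2.1.dParam_eq_hamDir h (hxψ.2.1.bijective fun u' hu' => ?_) ξ).trans ?_
  · refine hxb u' (ext_inner_right ℝ fun w => ?_)
    rw [inner_fiberMap, hθ, pullForm_apply_two, hu', ← toBilin_apply, map_zero, inner_zero_left]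
  · rw [← hθ, hu]

lemma HasVelocityAt.unique {w' : Model n} (h : HasVelocityAt c t w) (h' : HasVelocityAt c t w') : w
    = w' :=
  (h.mfderiv_one).symm.trans h'.mfderiv_one

lemma dMap_comp {f g : M → M} (hg : MDifferentiableAt 𝓘[n] 𝓘[n] g (f m)) (hf : MDifferentiableAt
    𝓘[n] 𝓘[n] f m) : dMap n (fun m => g (f m)) m = (dMap n g (f m)).comp (dMap n f m) :=
  mfderiv_comp m hg hf

lemma dMap_congr {f g : M → M} (h : f =ᶠ[𝓝 m] g) : dMap n f m = dMap n g m := by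
  unfold dMap
  rw [h.mfderiv_eq]

lemma dFun_comp_map {f : M → M} {g : M → Z} (hg : MDifferentiableAt 𝓘[n] 𝓘(ℝ, Z) g (f m)) (hf :
    MDifferentiableAt 𝓘[n] 𝓘[n] f m) : dFun n (fun m => g (f m)) m = (dFun n g (f m)).comp (dMap n f
    m) :=
  mfderiv_comp m hg hf

/-- The vector field, tangent to the fibres, that is given on the fibre over `z` by the Hamiltonian
vector field of `⟪b z, F⟫`. -/
def fiberField (Ω : DForm n M 2) (F : M → Target n) (b : Target n → Target n) (m : M) : Model n :=
  hamDir Ω F (b (F m)) m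

lemma IsFlowCurve.momentum_eq (h : IsIntegrableSystem Ω F) (hI : IsOpen I) (hIc : IsPreconnected I)
    (hσ : IsFlowCurve (fiberField Ω F b) N I σ) (hs : s ∈ I) (ht : t ∈ I) : F (σ s) = F (σ t) := by
  have hd : ∀ u ∈ I, HasDerivAt (fun t => F (σ t)) 0 u := by
    intro u hu
    have := (hσ u hu).2.hasDerivAt_comp (h.mdifferentiableAt (σ u))
    rwa [fiberField, dFun_hamDir h] at this
  exact hI.is_const_of_deriv_eq_zero hIc
    (fun u hu => (hd u hu).differentiableAt.differentiableWithinAt)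
    (fun u hu => (hd u hu).deriv) hs ht

lemma vfAnalyticAt_fiberField (h : IsIntegrableSystem Ω F) {p : M} (hb : AnalyticAt ℝ b (F p)) :
    VFAnalyticAt (fiberField Ω F b) p := vfAnalyticAt_hamDir h hb

lemma hasDerivAt_line (x : Coords n) (u : Target n) (t : ℝ) :
    HasDerivAt (fun s : ℝ => ((x.1 + s • u, x.2) : Coords n)) (u, 0) t := by
  refine HasDerivAt.prodMk ?_ (hasDerivAt_const _ _)
  simpa using ((hasDerivAt_id t).smul_const u).const_add x.1

lemma hasVelocityAt_line (hE : MDifferentiableAt 𝓘(ℝ, Coords n) 𝓘[n] E x) (u : Target n) :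
    HasVelocityAt (n := n) (fun s : ℝ => E (x.1 + s • u, x.2)) 0 (dParam n E x (u, 0)) := by
  simpa using HasVelocityAt.comp_param (E := E) (t := 0) (by simpa using hE) (hasDerivAt_line x u 0)

/-- `E` is analytic at `x`, the momentum map is the second coordinate up to the constant `c`, and
the Hamiltonian directions are the coordinate directions. -/
def IsBoxAt (Ω : DForm n M 2) (F : M → Target n) (E : Coords n → M) (c : Target n) (x : Coords n) :
    Prop :=
  ContMDiffAt 𝓘(ℝ, Coords n) 𝓘[n] ω E x ∧ F (E x) = c + x.2 ∧ IsFiberedAt F E x ∧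
    ∀ u, dParam n E x (u, 0) = hamDir Ω F u (E x)

lemma IsBoxAt.bijective (hE : IsBoxAt Ω F E z x) (h : IsIntegrableSystem Ω F) :
    Bijective (dParam n E x) :=
  hE.2.2.1.bijective fun u hu => hamDir_injective h hE.2.2.1.surjective (hE.2.2.2 u ▸ hu)

lemma exists_isBoxAt (h : IsIntegrableSystem Ω F) {p : M} (hp : Surjective (dFun n F p)) :
    ∃ E : Coords n → M, E 0 = p ∧ ∀ᶠ x in 𝓝 0, IsBoxAt Ω F E (F p) x := by
  obtain ⟨E, hE0, hE⟩ := exists_flowBox h hp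
  refine ⟨E, hE0, ?_⟩
  filter_upwards [hE.eventually_nhds] with x hx
  obtain ⟨h1, h2, h3⟩ := hx.self_of_nhds
  exact ⟨h1, h2, isFiberedAt_of_eventually (h.mdifferentiableAt _) h1.mdiff
    (hx.mono fun y hy => hy.2.1), h3⟩

lemma exists_flowBox_translation (h : IsIntegrableSystem Ω F) {p : M} (hp : Surjective (dFun n F p))
    (hN : IsOpen N) (hpN : p ∈ N) (hb : AnalyticAt ℝ b (F p)) : ∃ E : Coords n → M, E 0 = p ∧
    ∃ ρ > 0, ∀ x ∈ ball 0 ρ, IsBoxAt Ω F E (F p) x ∧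
      (∀ t ∈ Ioo (-ρ) ρ, IsBoxAt Ω F E (F p) (x.1 + t • b (F p + x.2), x.2)) ∧
      IsFlowCurve (fiberField Ω F b) N (Ioo (-ρ) ρ) (fun t => E (x.1 + t • b (F p + x.2), x.2)) := by
  obtain ⟨E, hE0, hE⟩ := exists_isBoxAt h hp
  refine ⟨E, hE0, ?_⟩
  have hgood := hE.and (hE.self_of_nhds.1.continuousAt.preimage_mem_nhds
    (hN.mem_nhds (by rw [hE0]; exact hpN)))
  have hb' : ContinuousAt (fun q : ℝ × (Coords n) => b (F p + q.2.2)) (0, 0) :=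
    ContinuousAt.comp (g := b) (f := fun q : ℝ × (Coords n) => F p + q.2.2)
      (by simpa using hb.continuousAt) (by fun_prop)
  have hcont : ContinuousAt (fun q : ℝ × (Coords n) =>
      ((q.2.1 + q.1 • b (F p + q.2.2), q.2.2) : Coords n)) (0, 0) :=
    (continuous_snd.fst.continuousAt.add (continuousAt_fst.smul hb')).prodMk
      continuous_snd.snd.continuousAt
  rw [ContinuousAt] at hcont
  simp only [Prod.fst_zero, Prod.snd_zero, zero_smul, add_zero] at hcont
  obtain ⟨ρ, hρ, hball⟩ := eventually_nhds_iff_ball.1 ((hcont.eventually hgood).and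
    ((continuous_snd.continuousAt (x := ((0 : ℝ), (0 : Coords n)))).eventually hgood))
  have hmem : ∀ t ∈ Ioo (-ρ) ρ, ∀ x ∈ ball (0 : Coords n) ρ,
      (t, x) ∈ ball ((0 : ℝ), (0 : Coords n)) ρ := fun t ht x hx => by
    rw [mem_ball, Prod.dist_eq, max_lt_iff, Real.dist_eq, sub_zero, abs_lt]
    exact ⟨ht, hx⟩
  refine ⟨ρ, hρ, fun x hx => ⟨(hball _ (hmem 0 (by simp [hρ]) x hx)).2.1,
    fun t ht => (hball _ (hmem t ht x hx)).1.1, fun t ht => ?_⟩⟩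
  obtain ⟨⟨h1, h2⟩, -⟩ := hball _ (hmem t ht x hx)
  refine ⟨h2, ?_⟩
  have h3 := HasVelocityAt.comp_param (n := n) h1.1.mdiff (hasDerivAt_line x (b (F p + x.2)) t)
  rw [h1.2.2.2] at h3
  rw [fiberField, h1.2.1]
  exact h3

lemma contMDiffAt_localFlow_snd (hN : IsOpen N) (hv : ∀ p ∈ N, VFAnalyticAt v p) (h : (t, m) ∈
    flowDomain v N) : ContMDiffAt 𝓘[n] 𝓘[n] ω (fun m => localFlow v N (t, m)) m :=
  ContMDiffAt.comp (g := localFlow v N) (f := fun m : M => (t, m)) m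
    (contMDiffAt_localFlow hN hv h) (contMDiffAt_const.prodMk contMDiffAt_id)

lemma mdifferentiableAt_localFlow_snd (hN : IsOpen N) (hv : ∀ p ∈ N, VFAnalyticAt v p) (h : (t, m) ∈
    flowDomain v N) : MDifferentiableAt 𝓘[n] 𝓘[n] (fun m => localFlow v N (t, m)) m :=
  (contMDiffAt_localFlow_snd hN hv h).mdiff

lemma momentum_localFlow (h : IsIntegrableSystem Ω F) (hb : ∀ p ∈ N, AnalyticAt ℝ b (F p)) (q : ℝ ×
    M) : F (localFlow (fiberField Ω F b) N q) = F q.2 := by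
  have hv := fun p hp => vfAnalyticAt_fiberField h (hb p hp)
  by_cases hq : q ∈ flowDomain (fiberField Ω F b) N
  · obtain ⟨a, c, h0, ht, hz, hσ⟩ := exists_isFlowCurve_localFlow hv (t := q.1) (m := q.2) hq
    have h1 := hσ.momentum_eq h isOpen_Ioo isPreconnected_Ioo ht h0
    simp only [hz] at h1
    exact h1
  · rw [localFlow, dif_neg hq]

lemma surjective_dFun_localFlow (h : IsIntegrableSystem Ω F) (hN : IsOpen N) (hb : ∀ p ∈ N,
    AnalyticAt ℝ b (F p)) (hq : (t, m) ∈ flowDomain (fiberField Ω F b) N) (hm : Surjective (dFun n F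
    m)) : Surjective (dFun n F (localFlow (fiberField Ω F b) N (t, m))) := by
  have hv := fun p hp => vfAnalyticAt_fiberField h (hb p hp)
  have h1 := dFun_comp_map (n := n) (g := F) (h.mdifferentiableAt _)
    (mdifferentiableAt_localFlow_snd hN hv hq)
  simp only [momentum_localFlow h hb] at h1
  intro w
  obtain ⟨v, hv⟩ := hm w
  refine ⟨dMap n (fun m => localFlow (fiberField Ω F b) N (t, m)) m v, ?_⟩
  rw [← hv]
  exact (congrArg (fun L => L v) h1).symm

lemma dMap_localFlow_hamDir_near (h : IsIntegrableSystem Ω F) (hN : IsOpen N) (hb : ∀ p ∈ N,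
    AnalyticAt ℝ b (F p)) {p : M} (hpN : p ∈ N) (hp : Surjective (dFun n F p)) : ∃ δ > 0, ∀ᶠ m in 𝓝
    p, ∀ t ∈ Ioo (-δ) δ, (t, m) ∈ flowDomain (fiberField Ω F b) N ∧ ∀ u, dMap n (fun m => localFlow
    (fiberField Ω F b) N (t, m)) m (hamDir Ω F u m) = hamDir Ω F u (localFlow (fiberField Ω F b) N
    (t, m)) := by
  have hv := fun p hp => vfAnalyticAt_fiberField h (hb p hp)
  obtain ⟨E, hE0, ρ, hρ, hE⟩ := exists_flowBox_translation h hp hN hpN (hb p hpN)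
  have h0 := mem_ball_self (x := (0 : Coords n)) hρ
  obtain ⟨g, hg, hg0, hEg, -⟩ := exists_local_inverse (hE 0 h0).1.1 ((hE 0 h0).1.bijective h)
  rw [hE0] at hg hg0 hEg
  have hgt : ∀ᶠ m in 𝓝 p, g m ∈ ball 0 ρ :=
    hg.continuousAt.preimage_mem_nhds (by rw [hg0]; exact ball_mem_nhds _ hρ)
  refine ⟨ρ, hρ, ?_⟩
  filter_upwards [hgt, hEg] with m hm hEm t ht
  have h00 : (0 : ℝ) ∈ Ioo (-ρ) ρ := by simp [hρ]
  have hloc : ∀ x ∈ ball (0 : Coords n) ρ, (t, E x) ∈ flowDomain (fiberField Ω F b) N ∧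
      localFlow (fiberField Ω F b) N (t, E x) = E (x.1 + t • b (F p + x.2), x.2) := by
    intro x hx
    have h1 := (hE x hx).2.2.mem_flowDomain h00 ht
    have h2 := (hE x hx).2.2.localFlow_eq hv h00 ht
    simp only [zero_smul, add_zero] at h1 h2
    exact ⟨h1, h2⟩
  rw [← hEm]
  refine ⟨(hloc _ hm).1, fun u => ?_⟩
  obtain ⟨hx, hxt, -⟩ := hE _ hm
  set x := g m
  have h2 := hasVelocityAt_line hx.1.mdiff u
  rw [hx.2.2.2] at h2
  have h3 := h2.comp_map (g := fun m => localFlow (fiberField Ω F b) N (t, m)) (by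
    simpa using mdifferentiableAt_localFlow_snd hN hv (hloc _ hm).1)
  simp only [zero_smul, add_zero] at h3
  have h4 := hasVelocityAt_line (hxt t ht).1.mdiff u
  rw [(hxt t ht).2.2.2] at h4
  have h5 : ∀ᶠ s : ℝ in 𝓝 0, ((x.1 + s • u, x.2) : Coords n) ∈ ball 0 ρ :=
    (hasDerivAt_line x u 0).continuousAt.eventually (isOpen_ball.mem_nhds (by simpa using hm))
  rw [(hloc _ hm).2]
  refine h3.unique (h4.congr ?_)
  filter_upwards [h5] with s hs
  rw [(hloc _ hs).2, add_right_comm]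

/-- The flows of fibre fields preserve the Hamiltonian vector fields of the components of `F`. -/
theorem dMap_localFlow_hamDir (h : IsIntegrableSystem Ω F) (hN : IsOpen N) (hb : ∀ p ∈ N, AnalyticAt
    ℝ b (F p)) (hq : (t, m) ∈ flowDomain (fiberField Ω F b) N) (hm : Surjective (dFun n F m)) (u :
    Target n) : dMap n (fun m => localFlow (fiberField Ω F b) N (t, m)) m (hamDir Ω F u m) = hamDir
    Ω F u (localFlow (fiberField Ω F b) N (t, m)) := by
  have hv := fun p hp => vfAnalyticAt_fiberField h (hb p hp)
  obtain ⟨a, c, h0, ht, hz, hσ⟩ := exists_isFlowCurve_localFlow hv hq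
  set fl := localFlow (fiberField Ω F b) N with hfl
  have hdom : ∀ s ∈ Ioo a c, (s, m) ∈ flowDomain (fiberField Ω F b) N := by
    intro s hs
    have := hσ.mem_flowDomain h0 hs
    rwa [hz] at this
  set P : ℝ → Prop := fun s => dMap n (fun m => fl (s, m)) m (hamDir Ω F u m) =
      hamDir Ω F u (fl (s, m)) with hP
  have hstep : ∀ s ∈ Ioo a c, ∀ᶠ s' in 𝓝[Ioo a c] s, (P s → P s') ∧ (P s' → P s) := by
    intro s hs
    obtain ⟨δ, hδ, hO⟩ := dMap_localFlow_hamDir_near h hN hb (hσ s hs).1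
      (surjective_dFun_localFlow h hN hb (hdom s hs) hm)
    have hc := (hσ s hs).2.continuousAt
    have key : ∀ s₁ ∈ Ioo a c, ∀ s₂ ∈ Ioo a c, |s₂ - s₁| < δ →
        (∀ᶠ m' in 𝓝 (fl (s₁, m)), ∀ t ∈ Ioo (-δ) δ, (t, m') ∈ flowDomain (fiberField Ω F b) N ∧
          ∀ u, dMap n (fun m => fl (t, m)) m' (hamDir Ω F u m') = hamDir Ω F u (fl (t, m'))) →
        P s₁ → P s₂ := by
      intro s₁ hs₁ s₂ hs₂ h12 hev hP₁
      have h12' : s₂ - s₁ ∈ Ioo (-δ) δ := abs_lt.1 h12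
      have hc1 := (contMDiffAt_localFlow_snd hN hv (hdom s₁ hs₁)).continuousAt
      have hev1 : (fun m' => fl (s₂, m')) =ᶠ[𝓝 m] fun m' => fl (s₂ - s₁, fl (s₁, m')) := by
        have hopen : ∀ᶠ m' in 𝓝 m, (s₁, m') ∈ flowDomain (fiberField Ω F b) N :=
          (Continuous.prodMk_right s₁).continuousAt.eventually
            ((isOpen_flowDomain hN hv).mem_nhds (hdom s₁ hs₁))
        filter_upwards [hopen, hc1.eventually hev] with m' h1 h2
        have h3 := (localFlow_add hv h1 (h2 _ h12').1).2
        rw [sub_add_cancel] at h3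
        exact h3
      have h2 := hev.self_of_nhds _ h12'
      have h3 : fl (s₂, m) = fl (s₂ - s₁, fl (s₁, m)) := hev1.self_of_nhds
      rw [hP]
      simp only
      rw [dMap_congr hev1, h3, dMap_comp (mdifferentiableAt_localFlow_snd hN hv h2.1)
        (mdifferentiableAt_localFlow_snd hN hv (hdom s₁ hs₁)), ContinuousLinearMap.comp_apply]
      rw [show dMap n (fun m => fl (s₁, m)) m (hamDir Ω F u m) = hamDir Ω F u (fl (s₁, m)) from hP₁]
      exact h2.2 u
    have hO' : ∀ᶠ s' in 𝓝 s, ∀ᶠ m' in 𝓝 (fl (s', m)), ∀ t ∈ Ioo (-δ) δ,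
          (t, m') ∈ flowDomain (fiberField Ω F b) N ∧
          ∀ u, dMap n (fun m => fl (t, m)) m' (hamDir Ω F u m') = hamDir Ω F u (fl (t, m')) :=
      hc.eventually hO.eventually_nhds
    have hd : ∀ᶠ s' in 𝓝 s, |s' - s| < δ := by
      filter_upwards [ball_mem_nhds s hδ] with s' hs'
      rwa [mem_ball, Real.dist_eq] at hs'
    filter_upwards [mem_nhdsWithin_of_mem_nhds hO', mem_nhdsWithin_of_mem_nhds hd,
      self_mem_nhdsWithin] with s' h1 h2 h3
    exact ⟨key s hs s' h3 h2 hO, key s' h3 s hs (by rwa [abs_sub_comm]) h1⟩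
  have hmN : m ∈ N := by
    have : fl (0, m) ∈ N := (hσ 0 h0).1
    rwa [hz] at this
  have hP0 : P 0 := by
    have h1 : (fun m' => fl (0, m')) = fun m' => m' := funext fun m' => localFlow_zero m' hv
    have h2 : dMap n (fun m' : M => m') m = ContinuousLinearMap.id ℝ (Model n) := mfderiv_id
    rw [hP]
    simp only
    rw [h1, h2, hz]
    rfl
  exact isPreconnected_Ioo.induction₂' (fun s s' => P s → P s')
    (fun s hs => (hstep s hs)) (fun x y z _ _ _ h1 h2 h3 => h2 (h1 h3)) h0 ht hP0

lemma IsBoxAt.dParam_localFlow (hE : IsBoxAt Ω F E z x) (h : IsIntegrableSystem Ω F) (hN : IsOpen N)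
    (hb : ∀ p ∈ N, AnalyticAt ℝ b (F p)) (hq : (t, E x) ∈ flowDomain (fiberField Ω F b) N)
    (u : Target n) : MDifferentiableAt 𝓘(ℝ, Coords n) 𝓘[n]
      (fun y => localFlow (fiberField Ω F b) N (t, E y)) x ∧
    dParam n (fun y => localFlow (fiberField Ω F b) N (t, E y)) x (u, 0) =
      hamDir Ω F u (localFlow (fiberField Ω F b) N (t, E x)) := by
  have h1 := mdifferentiableAt_localFlow_snd hN
    (fun p hp => vfAnalyticAt_fiberField h (hb p hp)) hq
  refine ⟨h1.comp x hE.1.mdiff, ?_⟩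
  rw [← dMap_localFlow_hamDir h hN hb hq hE.2.2.1.surjective, ← hE.2.2.2]
  exact congrArg (fun L => L (u, 0)) (mfderiv_comp x h1 hE.1.mdiff)

lemma hasVelocityAt_const (m : M) (t : ℝ) : HasVelocityAt (n := n) (fun _ => m) t 0 := by
  have h := hasMFDerivAt_const (I := 𝓘(ℝ, ℝ)) (I' := 𝓘[n]) m t
  refine HasMFDerivAt.congr_mfderiv h ?_
  refine ContinuousLinearMap.ext fun r => ?_
  exact (smul_zero (show ℝ from r)).symm

lemma exists_minimal_period (hv : ∀ p, VFAnalyticAt v p) (hγ : IsFlowCurve v univ univ γ) {T : ℝ}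
    (hT : 0 < T) (hper : Periodic γ T) (hne : v (γ 0) ≠ 0) : ∃ p > 0, Periodic γ p ∧ (∃ N : ℕ, 0 < N
    ∧ T = N * p) ∧ ∀ s t, γ s = γ t → ∃ k : ℤ, s - t = k * p := by
  have hcont : Continuous γ := continuous_iff_continuousAt.2 fun t => (hγ t trivial).2.continuousAt
  have hst : ∀ s t, γ s = γ t → Periodic γ (s - t) := by
    intro s t hst u
    have h1 := IsFlowCurve.eqOn (N := univ) (fun p _ => hv p)
      ((hγ.shift s).mono (I := univ) fun _ _ => trivial)
      ((hγ.shift t).mono (I := univ) fun _ _ => trivial) isOpen_univ isPreconnected_univ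
      (t₀ := 0) trivial (by simpa using hst) (mem_univ (u - t))
    simp only at h1
    rw [show u + (s - t) = u - t + s by ring, h1, sub_add_cancel]
  let G : AddSubgroup ℝ :=
    { carrier := {t | Periodic γ t}
      add_mem' := fun h1 h2 => h1.add_period h2
      zero_mem' := fun u => by simp
      neg_mem' := fun h1 => h1.neg }
  rcases AddSubgroup.dense_or_cyclic G with hd | ⟨a, ha⟩
  · exfalso
    have hconst : γ = fun _ => γ 0 := by
      refine Continuous.ext_on hd hcont continuous_const fun t ht => ?_
      have h1 : Periodic γ t := ht
      have h2 := h1 0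
      rwa [zero_add] at h2
    have h1 := (hγ 0 trivial).2
    have h2 : HasVelocityAt γ 0 (0 : Model n) := by rw [hconst]; exact hasVelocityAt_const _ _
    exact hne (h1.unique h2)
  have hmem : ∀ t, Periodic γ t → ∃ k : ℤ, t = k * a := by
    intro t ht
    have h1 : t ∈ G := ht
    rw [ha, AddSubgroup.mem_closure_singleton] at h1
    obtain ⟨k, hk⟩ := h1
    exact ⟨k, by rw [← hk]; simp⟩
  have haG : Periodic γ a := by
    have : a ∈ G := by rw [ha]; exact AddSubgroup.subset_closure rfl
    exact this
  obtain ⟨k, hk⟩ := hmem T hper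
  have ha0 : a ≠ 0 := by rintro rfl; simp at hk; linarith
  have habs : ∀ k : ℤ, ∃ j : ℤ, (k : ℝ) * a = j * |a| := by
    intro k
    rcases abs_choice a with h | h
    · exact ⟨k, by rw [h]⟩
    · exact ⟨-k, by rw [h]; push_cast; ring⟩
  refine ⟨|a|, abs_pos.2 ha0, ?_, ?_, ?_⟩
  · rcases abs_choice a with h | h
    · rwa [h]
    · rw [h]; exact haG.neg
  · obtain ⟨j, hj⟩ := habs k
    rw [hj] at hk
    have hj0 : 0 < j := by
      have h1 : (0 : ℝ) < j * |a| := hk ▸ hT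
      have h2 : (0 : ℝ) < j := by
        by_contra h3
        exact absurd h1 (not_lt.2 (mul_nonpos_of_nonpos_of_nonneg (not_lt.1 h3) (abs_nonneg a)))
      exact_mod_cast h2
    refine ⟨j.toNat, by omega, ?_⟩
    rw [hk]
    congr 1
    exact_mod_cast (Int.toNat_of_nonneg hj0.le).symm
  · intro s t h
    obtain ⟨k, hk⟩ := hmem _ (hst s t h)
    rw [hk]
    exact habs k

/-- The return map of a Hamiltonian flow near a closed trajectory is a translation on the
fibres in flow box coordinates. -/
lemma exists_return_shift (h : IsIntegrableSystem Ω F) {a : Target n} (hp : (p, q) ∈ flowDomain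
    (fiberField Ω F fun _ => a) univ) (hpq : localFlow (fiberField Ω F fun _ => a) univ (p, q) = q)
    (hE0 : E 0 = q) (hE : ∀ᶠ x in 𝓝 0, IsBoxAt Ω F E z x) : ∃ κ : Target n → Target n, κ 0 = 0 ∧
    AnalyticAt ℝ κ 0 ∧ ∀ᶠ x in 𝓝 0, localFlow (fiberField Ω F fun _ => a) univ (p, E x) =
    E (x.1 - κ x.2, x.2) := by
  have hb : ∀ p ∈ (univ : Set M), AnalyticAt ℝ (fun _ : Target n => a) (F p) :=
    fun _ _ => analyticAt_const
  have hv : ∀ p ∈ (univ : Set M), VFAnalyticAt (fiberField Ω F fun _ => a) p :=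
    fun p hp => vfAnalyticAt_fiberField h (hb p hp)
  set fl := localFlow (fiberField Ω F fun _ => a) univ with hfl
  have hE' := hE.self_of_nhds
  obtain ⟨g, hg, hg0, hEg, hgE⟩ := exists_local_inverse hE'.1 (hE'.bijective h)
  rw [hE0] at hg hg0 hEg
  set R : Coords n → Coords n := fun x => g (fl (p, E x)) with hR
  have hflE : ContMDiffAt 𝓘(ℝ, Coords n) 𝓘[n] ω (fun x => fl (p, E x)) 0 := by
    refine ContMDiffAt.comp (g := fun m => fl (p, m)) (f := E) 0 ?_ hE'.1
    rw [hE0]; exact contMDiffAt_localFlow_snd isOpen_univ hv hp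
  have hflE0 : fl (p, E 0) = q := by rw [hE0]; exact hpq
  have hRc : ContDiffAt ℝ ω R 0 := by
    rw [← contMDiffAt_iff_contDiffAt]
    refine ContMDiffAt.comp (g := g) (f := fun x => fl (p, E x)) 0 ?_ hflE
    rw [hflE0]; exact hg
  have hR0 : R 0 = 0 := by simp only [hR, hflE0, hg0]
  have hRt : Tendsto R (𝓝 0) (𝓝 0) := by simpa only [ContinuousAt, hR0] using hRc.continuousAt
  have hflt : Tendsto (fun x => fl (p, E x)) (𝓝 0) (𝓝 q) := by
    simpa only [ContinuousAt, hflE0] using hflE.continuousAt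
  have hdom : ∀ᶠ x in 𝓝 (0 : Coords n), (p, E x) ∈ flowDomain (fiberField Ω F fun _ => a) univ :=
    (continuousAt_const.prodMk hE'.1.continuousAt).eventually
      ((isOpen_flowDomain isOpen_univ hv).mem_nhds (by simpa only [hE0] using hp))
  have hev : ∀ᶠ x in 𝓝 (0 : Coords n), AnalyticAt ℝ R x ∧ E (R x) = fl (p, E x) ∧
      (R x).2 = x.2 ∧ ∀ u, fderiv ℝ R x (u, 0) = (u, 0) := by
    filter_upwards [hRc.analyticAt.eventually_analyticAt, (hflt.eventually hEg).eventually_nhds,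
      hE, hRt.eventually hE, hdom] with x h1 h2 h3 h4 h5
    have h6 : E (R x) = fl (p, E x) := h2.self_of_nhds
    refine ⟨h1, h6, ?_, fun u => ?_⟩
    · rw [← add_right_inj z, ← h4.2.1, h6, momentum_localFlow h hb, h3.2.1]
    · have h7 : (fun x => E (R x)) =ᶠ[𝓝 x] fun x => fl (p, E x) := h2
      have h8 := dParam_comp (n := n) (E := E) (φ := R) (z := x) h4.1.mdiff h1.differentiableAt
      have h9 := (h3.dParam_localFlow h isOpen_univ hb h5 u).2
      rw [dParam, ← h7.mfderiv_eq, ← dParam, h8, ← hfl, ← h6, ← h4.2.2.2] at h9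
      exact (h4.bijective h).1 h9
  obtain ⟨r, hr, hball⟩ := eventually_nhds_iff_ball.1 hev
  refine ⟨fun ζ => -(R (0, ζ)).1, ?_, ?_, ?_⟩
  · have : ((0 : Target n), (0 : Target n)) = 0 := rfl
    simp [this, hR0]
  · have h1 : ContDiffAt ℝ ω (fun ζ : Target n => R (0, ζ)) 0 :=
      ContDiffAt.comp (g := R) (f := fun ζ : Target n => ((0 : Target n), ζ)) 0 hRc
        (contDiffAt_const.prodMk contDiffAt_id)
    exact (ContDiffAt.neg (contDiffAt_fst.comp (0 : Target n) h1)).analyticAt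
  · filter_upwards [ball_mem_nhds _ hr] with x hx
    have hm : ∀ τ ∈ ball (0 : Target n) r, (τ, x.2) ∈ ball (0 : Coords n) r := fun τ => mk_mem_ball hx
    have hd : ∀ τ ∈ ball (0 : Target n) r,
        HasFDerivAt (fun τ => (R (τ, x.2)).1 - τ) (0 : Target n →L[ℝ] Target n) τ := by
      intro τ hτ
      have h1 := hball _ (hm τ hτ)
      have h3 := (hasFDerivAt_fst (𝕜 := ℝ)).comp τ h1.1.differentiableAt.hasFDerivAt_left
      refine (h3.sub (hasFDerivAt_id τ)).congr_fderiv ?_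
      refine ContinuousLinearMap.ext fun u => ?_
      have h4 := congrArg Prod.fst (h1.2.2.2 u)
      simpa using sub_eq_zero.2 h4
    have hconst := (convex_ball (0 : Target n) r).is_const_of_fderivWithin_eq_zero (𝕜 := ℝ)
      (f := fun τ => (R (τ, x.2)).1 - τ)
      (fun τ hτ => (hd τ hτ).differentiableAt.differentiableWithinAt) (fun τ hτ => by
        rw [fderivWithin_of_isOpen isOpen_ball hτ]; exact (hd τ hτ).fderiv)
      (mem_ball_zero_iff.2 (mem_ball_prod.1 hx).1) (mem_ball_self hr)
    simp only [sub_zero, Prod.mk.eta] at hconst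
    have h1 := hball x hx
    rw [← h1.2.1]
    congr 1
    refine Prod.ext ?_ h1.2.2.1
    simp only
    rw [← hconst]; abel

section Axis
variable (n)

def axis : Target n := EuclideanSpace.single 0 1

def offAxis : Target n →L[ℝ] Target n :=
  ContinuousLinearMap.id ℝ _ - (EuclideanSpace.proj (0 : Fin n)).smulRight (axis n)

variable {n}

lemma axis_zero : axis n 0 = 1 := by simp [axis]

lemma axis_ne_zero : axis n ≠ 0 := fun h => by
  have := congrArg (fun v : Target n => v 0) h
  simp [axis_zero] at this

lemma offAxis_apply (τ : Target n) : offAxis n τ = τ - τ 0 • axis n := rfl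

lemma offAxis_zero (τ : Target n) : offAxis n τ 0 = 0 := by simp [offAxis_apply, axis_zero]

lemma offAxis_axis : offAxis n (axis n) = 0 := by simp [offAxis_apply, axis_zero]

lemma offAxis_of_zero (h : τ 0 = 0) : offAxis n τ = τ := by simp [offAxis_apply, h]

lemma offAxis_add_axis (τ : Target n) : offAxis n τ + τ 0 • axis n = τ := by simp [offAxis_apply]

def tubeDom (r₁ r₂ : ℝ) : Set (Coords n) :=
  {x | ‖offAxis n x.1‖ < r₁ ∧ ‖x.2‖ < r₂}

lemma isOpen_tubeDom (r₁ r₂ : ℝ) : IsOpen (tubeDom (n := n) r₁ r₂) :=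
  IsOpen.inter (s := {x : Coords n | ‖offAxis n x.1‖ < r₁}) (t := {x : Coords n | ‖x.2‖ < r₂})
    (isOpen_lt (by fun_prop) continuous_const) (isOpen_lt (by fun_prop) continuous_const)
end Axis

lemma tubeDom_add_axis (hx : x ∈ tubeDom r₁ r₂) (c : ℝ) : ((x.1 + c • axis n, x.2) : Coords n) ∈
    tubeDom r₁ r₂ := by
  refine ⟨?_, hx.2⟩
  simpa [offAxis_axis] using hx.1

lemma mem_tubeDom_axis (h₁ : 0 < r₁) (c : ℝ) (hζ : ‖ζ‖ < r₂) : ((c • axis n, ζ) : Coords n) ∈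
    tubeDom r₁ r₂ := by
  refine ⟨?_, hζ⟩
  simpa [offAxis_axis] using h₁

lemma periodic_int {Y : Type*} {E : Coords n → Y} (hE : ∀ x ∈ tubeDom r₁ r₂, E (x.1 + p • axis n, x.2) = E x)
    (hx : x ∈ tubeDom r₁ r₂) (k : ℤ) : E (x.1 + (k * p) • axis n, x.2) = E x := by
  induction k using Int.induction_on with
  | zero => simp
  | succ k ih =>
    have h1 := hE _ (tubeDom_add_axis hx (((k : ℤ) : ℝ) * p))
    rw [← ih, ← h1]
    push_cast
    rw [add_mul, one_mul, add_smul, add_assoc]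
  | pred k ih =>
    have h1 := hE _ (tubeDom_add_axis hx ((-(k : ℝ) - 1) * p))
    rw [← ih]
    push_cast
    rw [← h1]
    congr 2
    rw [add_assoc, ← add_smul]
    congr 2
    ring

lemma norm_axis : ‖axis n‖ = 1 := by simp [axis]

lemma IsFlowCurve.mem_flowDomain_of_univ (hv : ∀ p ∈ N, VFAnalyticAt v p)
    (hσ : IsFlowCurve v N univ σ) (t : ℝ) :
    (t, σ 0) ∈ flowDomain v N ∧ localFlow v N (t, σ 0) = σ t := by
  have h1 : IsFlowCurve v N (Ioo (-(|t| + 1)) (|t| + 1)) σ := hσ.mono (subset_univ _)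
  have h0 : (0 : ℝ) ∈ Ioo (-(|t| + 1)) (|t| + 1) := by constructor <;> linarith [abs_nonneg t]
  have ht : t ∈ Ioo (-(|t| + 1)) (|t| + 1) := by
    constructor <;> linarith [neg_abs_le t, le_abs_self t]
  exact ⟨h1.mem_flowDomain h0 ht, h1.localFlow_eq hv h0 ht⟩

lemma isFiberedAt_of_mem_tubeDom (h : IsIntegrableSystem Ω F) (hx : x ∈ tubeDom r₁ r₂)
    (hE : ContMDiffAt 𝓘(ℝ, Coords n) 𝓘[n] ω E x) (hF : ∀ y ∈ tubeDom r₁ r₂, F (E y) = y.2) :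
    IsFiberedAt F E x := by
  refine isFiberedAt_of_eventually (c := 0) (h.mdifferentiableAt _) hE.mdiff ?_
  filter_upwards [(isOpen_tubeDom r₁ r₂).mem_nhds hx] with y hy
  rw [hF y hy, zero_add]

lemma hasVelocityAt_localFlow_comp (hN : IsOpen N) (hv : ∀ p ∈ N, VFAnalyticAt v p) (hq : (t, c t) ∈
    flowDomain v N) (hc : HasVelocityAt c t w) : HasVelocityAt (fun s => localFlow v N (s, c s)) t
    (v (localFlow v N (t, c t)) + dMap n (fun m => localFlow v N (t, m)) (c t) w) :=
    by
  have h1 : HasMFDerivAt 𝓘(ℝ, ℝ) (𝓘(ℝ, ℝ).prod 𝓘[n]) (fun s => (s, c s)) t _ :=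
    (hasMFDerivAt_id (I := 𝓘(ℝ, ℝ)) t).prodMk hc
  have h2 := (contMDiffAt_localFlow hN hv hq).mdiff
  have h3 := h2.hasMFDerivAt.comp t h1
  refine HasMFDerivAt.congr_mfderiv h3 ?_
  let L : ℝ →L[ℝ] Model n := mfderiv 𝓘(ℝ, ℝ) 𝓘[n] (fun s => localFlow v N (s, c t)) t
  have h5 : L 1 = v (localFlow v N (t, c t)) := (hasVelocityAt_localFlow hv hq).mfderiv_one
  have key : ∀ r : ℝ, L r + dMap n (fun m => localFlow v N (t, m)) (c t) (r • w) =
      r • (v (localFlow v N (t, c t)) + dMap n (fun m => localFlow v N (t, m)) (c t) w) := by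
    intro r
    have h6 : L r = r • L 1 := by
      have := L.map_smul r 1
      rwa [smul_eq_mul, mul_one] at this
    rw [map_smul, smul_add, ← h5, h6]
  refine ContinuousLinearMap.ext fun r => ?_
  have h4 := mfderiv_prod_eq_add_apply h2 (v := ((show ℝ from r), (show ℝ from r) • w))
  exact h4.trans (key r)

lemma flow_periodic (hv : ∀ p ∈ N, VFAnalyticAt v p) (hp : 0 < p) (hdom : ∀ t ∈ Icc (-p) p, (t, m) ∈
    flowDomain v N) (hpm : localFlow v N (p, m) = m) : ∀ t, (t, m) ∈ flowDomain v N ∧ localFlow v N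
    (t + p, m) = localFlow v N (t, m) := by
  have hneg : localFlow v N (-p, m) = m := by
    have h1 := localFlow_add hv (s := p) (t := -p) (m := m) (hdom p ⟨by linarith, le_rfl⟩)
      (by rw [hpm]; exact hdom _ ⟨le_rfl, by linarith⟩)
    rw [hpm, neg_add_cancel, localFlow_zero _ hv] at h1
    exact h1.2.symm
  have key : ∀ s, (s = p ∨ s = -p) → ∀ k : ℕ, (k * s, m) ∈ flowDomain v N ∧
      localFlow v N (k * s, m) = m := by
    intro s hs k
    have hsI : s ∈ Icc (-p) p := by rcases hs with rfl | rfl <;> constructor <;> linarith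
    have hsm : localFlow v N (s, m) = m := by rcases hs with rfl | rfl <;> assumption
    induction k with
    | zero =>
      simp only [Nat.cast_zero, zero_mul]
      exact ⟨hdom 0 ⟨by linarith, hp.le⟩, localFlow_zero m hv⟩
    | succ k ih =>
      have h1 := localFlow_add hv (s := s) (t := k * s) (m := m) (hdom s hsI)
        (by rw [hsm]; exact ih.1)
      rw [hsm, ih.2] at h1
      have h2 : ((k + 1 : ℕ) : ℝ) * s = k * s + s := by push_cast; ring
      rw [h2]; exact h1
  have hint : ∀ k : ℤ, (k * p, m) ∈ flowDomain v N ∧ localFlow v N (k * p, m) = m := by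
    intro k
    obtain ⟨j, rfl | rfl⟩ := k.eq_nat_or_neg
    · simpa using key p (Or.inl rfl) j
    · simpa using key (-p) (Or.inr rfl) j
  have hall : ∀ t, (t, m) ∈ flowDomain v N := by
    intro t
    have h1 := hint ⌊t / p⌋
    have h2 : t - ⌊t / p⌋ * p ∈ Icc (-p) p := by
      have e1 := Int.floor_le (t / p)
      have e2 := Int.lt_floor_add_one (t / p)
      rw [le_div_iff₀ hp] at e1
      rw [div_lt_iff₀ hp] at e2
      constructor <;> nlinarith
    have h3 := localFlow_add hv h1.1 (t := t - ⌊t / p⌋ * p) (by rw [h1.2]; exact hdom _ h2)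
    rw [sub_add_cancel] at h3
    exact h3.1
  refine fun t => ⟨hall t, ?_⟩
  have h1 := localFlow_add hv (hall p) (t := t) (by rw [hpm]; exact hall t)
  rw [h1.2, hpm]

/-- A closed trajectory of the first Hamiltonian vector field through a regular point has a
neighbourhood which is parametrised by `(τ, ζ)`, where `ζ` is the value of the momentum map, the
directions `τ` are Hamiltonian, and the parametrisation is periodic along the first axis. -/
structure IsTube (Ω : DForm n M 2) (F : M → Target n) (p r₁ r₂ : ℝ) (b : Target n → Target n)
    (E : Coords n → M) : Prop where
  period_pos : 0 < p
  width_pos : 0 < r₁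
  base_pos : 0 < r₂
  drift_near : ∀ ζ, ‖ζ‖ < r₂ → ‖b ζ - axis n‖ ≤ 1 / 2
  drift_analytic : ∀ ζ, ‖ζ‖ < r₂ → AnalyticAt ℝ b ζ
  analytic : ∀ x ∈ tubeDom r₁ r₂, ContMDiffAt 𝓘(ℝ, Coords n) 𝓘[n] ω E x
  momentum : ∀ x ∈ tubeDom r₁ r₂, F (E x) = x.2
  dParam_eq : ∀ x ∈ tubeDom r₁ r₂, ∀ u,
    dParam n E x (u, 0) = hamDir Ω F (u 0 • b x.2 + offAxis n u) (E x)
  periodic : ∀ x ∈ tubeDom r₁ r₂, E (x.1 + p • axis n, x.2) = E x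
  injective : ∀ x ∈ tubeDom r₁ r₂, ∀ y ∈ tubeDom r₁ r₂, E x = E y →
    x.2 = y.2 ∧ ∃ k : ℤ, x.1 - y.1 = (k * p) • axis n

lemma exists_drift_flow (h : IsIntegrableSystem Ω F)
    (hγ : IsFlowCurve (fiberField Ω F fun _ => axis n) univ univ γ)
    (hreg : Surjective (dFun n F (γ 0))) (hF0 : F (γ 0) = 0) (hp : 0 < p) (hper : Periodic γ p) :
    ∃ (b : Target n → Target n) (E : Coords n → M) (r : ℝ), 0 < r ∧ b 0 = axis n ∧
      (∀ ζ, ‖ζ‖ < r → AnalyticAt ℝ b ζ) ∧ E 0 = γ 0 ∧ ∀ᶠ x in 𝓝 0, IsBoxAt Ω F E 0 x ∧ ∀ t,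
        (t, E x) ∈ flowDomain (fiberField Ω F b) (F ⁻¹' ball 0 r) ∧
        localFlow (fiberField Ω F b) (F ⁻¹' ball 0 r) (t + p, E x) =
          localFlow (fiberField Ω F b) (F ⁻¹' ball 0 r) (t, E x) := by
  have hb₁ : ∀ q ∈ (univ : Set M), AnalyticAt ℝ (fun _ : Target n => axis n) (F q) :=
    fun _ _ => analyticAt_const
  have hv₁ : ∀ q ∈ (univ : Set M), VFAnalyticAt (fiberField Ω F fun _ => axis n) q :=
    fun q hq => vfAnalyticAt_fiberField h (hb₁ q hq)
  set v₁ := fiberField Ω F fun _ => axis n with hv₁def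
  obtain ⟨E, hE0, hE⟩ := exists_isBoxAt h hreg
  rw [hF0] at hE
  have hγdom := hγ.mem_flowDomain_of_univ hv₁
  obtain ⟨κ, hκ0, hκ, hret⟩ := exists_return_shift h (hγdom p).1
    ((hγdom p).2.trans (by simpa using hper 0)) hE0 hE
  obtain ⟨r, hr, hκr⟩ := eventually_nhds_iff_ball.1 hκ.eventually_analyticAt
  set b : Target n → Target n := fun ζ => axis n + p⁻¹ • κ ζ with hbdef
  have hbr : ∀ ζ, ‖ζ‖ < r → AnalyticAt ℝ b ζ := fun ζ hζ =>
    analyticAt_const.add (AnalyticAt.fun_smul analyticAt_const (hκr ζ (mem_ball_zero_iff.2 hζ)))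
  set N : Set M := F ⁻¹' ball 0 r with hN
  have hv : ∀ q ∈ N, VFAnalyticAt (fiberField Ω F b) q :=
    fun q hq => vfAnalyticAt_fiberField h (hbr _ (mem_ball_zero_iff.1 hq))
  have hdom₁ : ∀ᶠ y in 𝓝 (0 : Coords n), ∀ t ∈ Icc (-(2 * p)) (2 * p),
      (t, E y) ∈ flowDomain v₁ univ :=
    isCompact_Icc.eventually_forall_of_forall_eventually fun t _ =>
      (continuousAt_snd.prodMk (ContinuousAt.comp (g := E) (f := Prod.fst)
        hE.self_of_nhds.1.continuousAt continuousAt_fst)).eventually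
        ((isOpen_flowDomain isOpen_univ hv₁).mem_nhds (by
          simpa only [comp_apply, hE0] using (hγdom t).1))
  obtain ⟨ρ, hρ, hball⟩ := eventually_nhds_iff_ball.1 ((hE.and hret).and hdom₁)
  have hκt : ∀ᶠ x in 𝓝 (0 : Coords n), κ x.2 ∈ ball 0 (ρ / 4) :=
    (ContinuousAt.comp (g := κ) (x := (0 : Coords n)) hκ.continuousAt
      continuousAt_snd).preimage_mem_nhds (by simpa [hκ0] using ball_mem_nhds _ (by positivity))
  refine ⟨b, E, r, hr, by simp [hbdef, hκ0], hbr, hE0, ?_⟩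
  filter_upwards [hκt, ball_mem_nhds (0 : Coords n) (lt_min (half_pos hρ) hr)] with x hκx hxρ
  rw [mem_ball_zero_iff] at hκx
  rw [mem_ball_zero_iff, Prod.norm_def, max_lt_iff, lt_min_iff, lt_min_iff] at hxρ
  set w := p⁻¹ • κ x.2 with hw
  have hmem : ∀ t ∈ Icc (-(2 * p)) (2 * p), ((x.1 + t • w, x.2) : Coords n) ∈ ball 0 ρ := by
    intro t ht
    have h1 : ‖t • w‖ ≤ 2 * ‖κ x.2‖ := by
      rw [hw, smul_smul, norm_smul, Real.norm_eq_abs, ← div_eq_mul_inv, abs_div, abs_of_pos hp]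
      exact mul_le_mul_of_nonneg_right ((div_le_iff₀ hp).2 (abs_le.2 ht)) (norm_nonneg _)
    exact mem_ball_prod.2 ⟨by linarith [norm_add_le x.1 (t • w)], by linarith⟩
  have hx0 := hball x (by simpa using hmem 0 ⟨by linarith, by linarith⟩)
  refine ⟨hx0.1.1, ?_⟩
  have hcurve : IsFlowCurve (fiberField Ω F b) N (Ioo (-(2 * p)) (2 * p))
      (fun t => localFlow v₁ univ (t, E (x.1 + t • w, x.2))) := by
    intro t ht
    obtain ⟨⟨hg, -⟩, hdom⟩ := hball _ (hmem t (Ioo_subset_Icc_self ht))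
    have hFl : F (localFlow v₁ univ (t, E (x.1 + t • w, x.2))) = x.2 := by
      rw [hv₁def, momentum_localFlow h hb₁, hg.2.1, zero_add]
    refine ⟨mem_preimage.2 (by rw [hFl]; exact mem_ball_zero_iff.2 hxρ.2.2), ?_⟩
    have h2 := HasVelocityAt.comp_param (n := n) hg.1.mdiff (hasDerivAt_line x w t)
    rw [hg.2.2.2] at h2
    have h3 := hasVelocityAt_localFlow_comp isOpen_univ hv₁
      (c := fun t : ℝ => E (x.1 + t • w, x.2)) (hdom t (Ioo_subset_Icc_self ht)) h2
    rw [hv₁def, dMap_localFlow_hamDir h isOpen_univ hb₁ (hdom t (Ioo_subset_Icc_self ht))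
      hg.2.2.1.surjective w, ← hv₁def] at h3
    have h5 : fiberField Ω F b (localFlow v₁ univ (t, E (x.1 + t • w, x.2))) =
        v₁ (localFlow v₁ univ (t, E (x.1 + t • w, x.2))) + hamDir Ω F w
          (localFlow v₁ univ (t, E (x.1 + t • w, x.2))) := by
      rw [hv₁def, fiberField, fiberField, hFl, hbdef, hamDir_add h]
    rw [h5]
    exact h3
  have h0 : (0 : ℝ) ∈ Ioo (-(2 * p)) (2 * p) := by constructor <;> linarith
  have hc0 : localFlow v₁ univ (0, E (x.1 + (0 : ℝ) • w, x.2)) = E x := by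
    rw [localFlow_zero _ hv₁]; simp
  refine flow_periodic hv hp (fun t ht => ?_) ?_
  · simpa only [hc0] using
      hcurve.mem_flowDomain h0 (t := t) ⟨by linarith [ht.1], by linarith [ht.2]⟩
  · have h1 := hcurve.localFlow_eq hv h0 (t := p) ⟨by linarith, by linarith⟩
    have h2 := (hball _ (hmem p ⟨by linarith, by linarith⟩)).1.2
    simp only [hc0] at h1
    rw [h1, h2, hw, smul_smul, mul_inv_cancel₀ hp.ne', one_smul, add_sub_cancel_right]

theorem exists_tube (h : IsIntegrableSystem Ω F)
    (hγ : IsFlowCurve (fiberField Ω F fun _ => axis n) univ univ γ)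
    (hreg : Surjective (dFun n F (γ 0))) (hF0 : F (γ 0) = 0) (hL : 0 < L) (hper : Periodic γ L) :
    ∃ p r₁ r₂ b E, IsTube Ω F p r₁ r₂ b E ∧ b 0 = axis n ∧ (∃ N : ℕ, 0 < N ∧ L = N * p) ∧
      ∀ t : ℝ, E (t • axis n, 0) = γ t := by
  obtain ⟨p, hp, hpp, hN, hinj⟩ := exists_minimal_period
    (fun q => vfAnalyticAt_fiberField h analyticAt_const) hγ hL hper
    (fun h0 => axis_ne_zero (hamDir_injective h hreg h0))
  obtain ⟨b, E₀, r, hr, hb0, hba, hE0, hE⟩ := exists_drift_flow h hγ hreg hF0 hp hpp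
  set N : Set M := F ⁻¹' ball 0 r with hNdef
  have hNo : IsOpen N := isOpen_ball.preimage h.analytic.continuous
  have hb : ∀ q ∈ N, AnalyticAt ℝ b (F q) := fun q hq => hba _ (mem_ball_zero_iff.1 hq)
  have hv : ∀ q ∈ N, VFAnalyticAt (fiberField Ω F b) q :=
    fun q hq => vfAnalyticAt_fiberField h (hb q hq)
  obtain ⟨r', hr', hball⟩ := eventually_nhds_iff_ball.1 hE
  set E : Coords n → M := fun x =>
    localFlow (fiberField Ω F b) N (x.1 0, E₀ (offAxis n x.1, x.2)) with hEdef
  have hin : ∀ x ∈ tubeDom (n := n) r' r',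
      ((offAxis n x.1, x.2) : Coords n) ∈ ball (0 : Coords n) r' := fun x hx => mem_ball_prod.2 hx
  have hEan : ∀ x ∈ tubeDom (n := n) r' r', ContMDiffAt 𝓘(ℝ, Coords n) 𝓘[n] ω E x := by
    intro x hx
    have h1 := hball _ (hin x hx)
    have h2 : ContMDiffAt 𝓘(ℝ, Coords n) 𝓘[n] ω (fun x : Coords n => E₀ (offAxis n x.1, x.2)) x :=
      ContMDiffAt.comp (g := E₀) (f := fun x : Coords n => ((offAxis n x.1, x.2) : Coords n)) x
        h1.1.1 (contMDiffAt_iff_contDiffAt.2 (by fun_prop))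
    have h3 : ContMDiffAt 𝓘(ℝ, Coords n) 𝓘(ℝ, ℝ) ω (fun x : Coords n => x.1 0) x :=
      contMDiffAt_iff_contDiffAt.2 (by fun_prop)
    exact ContMDiffAt.comp (g := localFlow (fiberField Ω F b) N)
      (f := fun x : Coords n => (x.1 0, E₀ (offAxis n x.1, x.2))) x
      (contMDiffAt_localFlow hNo hv (h1.2 (x.1 0)).1) (h3.prodMk h2)
  have hEmom : ∀ x ∈ tubeDom (n := n) r' r', F (E x) = x.2 := fun x hx =>
    (momentum_localFlow h hb _).trans ((hball _ (hin x hx)).1.2.1.trans (zero_add _))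
  have hEd : ∀ x ∈ tubeDom (n := n) r' r', ∀ u,
      dParam n E x (u, 0) = hamDir Ω F (u 0 • b x.2 + offAxis n u) (E x) := by
    intro x hx u
    obtain ⟨h1, h1'⟩ := hball _ (hin x hx)
    have hmd := (hEan x hx).mdiff
    rw [show ((u, 0) : Coords n) = u 0 • (axis n, 0) + (offAxis n u, 0) by
      rw [Prod.smul_mk, Prod.mk_add_mk, smul_zero, add_zero, add_comm, offAxis_add_axis],
      map_add, map_smul, hamDir_add h, hamDir_smul h]
    congr 2
    · have k3 := HasVelocityAt.comp_add (c := fun t => localFlow (fiberField Ω F b) N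
        (t, E₀ (offAxis n x.1, x.2))) (t := 0) (s := x.1 0) (by
          rw [zero_add]; exact hasVelocityAt_localFlow hv (h1' (x.1 0)).1)
      have k4 : (fun t => localFlow (fiberField Ω F b) N (t + x.1 0, E₀ (offAxis n x.1, x.2))) =
          fun s : ℝ => E (x.1 + s • axis n, x.2) := by
        funext s
        simp [hEdef, axis_zero, offAxis_axis, add_comm]
      rw [k4] at k3
      rw [(hasVelocityAt_line hmd _).unique k3, fiberField]
      congr 2
      exact hEmom x hx
    · obtain ⟨k1, k2⟩ := h1.dParam_localFlow h hNo hb (h1' (x.1 0)).1 (offAxis n u)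
      have k3 := hasVelocityAt_line k1 (offAxis n u)
      have k4 : (fun s : ℝ => localFlow (fiberField Ω F b) N
          (x.1 0, E₀ (offAxis n x.1 + s • offAxis n u, x.2))) =
          fun s : ℝ => E (x.1 + s • offAxis n u, x.2) := by
        funext s
        have e1 : (x.1 + s • offAxis n u) 0 = x.1 0 := by simp [offAxis_zero]
        simp only [hEdef, e1, map_add, map_smul, offAxis_of_zero (offAxis_zero u)]
      rw [k2, k4] at k3
      exact (hasVelocityAt_line hmd _).unique k3
  have hEper : ∀ x ∈ tubeDom (n := n) r' r', E (x.1 + p • axis n, x.2) = E x := fun x hx =>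
    Eq.trans (by simp [hEdef, axis_zero, offAxis_axis]) ((hball _ (hin x hx)).2 (x.1 0)).2
  have hEγ : ∀ t : ℝ, E (t • axis n, 0) = γ t := by
    intro t
    have hγY : IsFlowCurve (fiberField Ω F b) N univ γ := by
      intro s _
      have h1 : F (γ s) = 0 := by
        rw [← hF0]; exact hγ.momentum_eq h isOpen_univ isPreconnected_univ trivial trivial
      refine ⟨mem_preimage.2 (by rw [h1]; exact mem_ball_self hr), ?_⟩
      have h2 := (hγ s trivial).2
      rw [fiberField] at h2 ⊢
      rwa [h1, hb0]
    have h3 : E₀ (offAxis n (t • axis n), 0) = γ 0 := by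
      rw [map_smul, offAxis_axis, smul_zero]; exact hE0
    simp only [hEdef, h3]
    rw [← (hγY.mem_flowDomain_of_univ hv t).2]
    simp [axis_zero]
  have hinjloc : ∀ᶠ z in 𝓝 (0 : (Coords n) × (Coords n)),
      ∀ s ∈ (Icc 0 p ×ˢ Icc (-(p / 2)) (p / 2) : Set (ℝ × ℝ)),
      E (z.1.1 + s.1 • axis n, z.1.2) = E (z.2.1 + (s.1 + s.2) • axis n, z.2.2) →
        z.1.1 + s.1 • axis n = z.2.1 + (s.1 + s.2) • axis n ∧ z.1.2 = z.2.2 := by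
    refine (isCompact_Icc.prod isCompact_Icc).eventually_forall_of_forall_eventually ?_
    rintro ⟨s, d⟩ ⟨hs, hd⟩
    simp only at hs hd
    have hx1 : ContinuousAt (fun z : ((Coords n) × (Coords n)) × (ℝ × ℝ) =>
        ((z.1.1.1 + z.2.1 • axis n, z.1.1.2) : Coords n)) (0, (s, d)) := by fun_prop
    have hx2 : ContinuousAt (fun z : ((Coords n) × (Coords n)) × (ℝ × ℝ) =>
        ((z.1.2.1 + (z.2.1 + z.2.2) • axis n, z.1.2.2) : Coords n)) (0, (s, d)) := by fun_prop
    rw [ContinuousAt] at hx1 hx2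
    simp only [Prod.fst_zero, Prod.snd_zero, zero_add] at hx1 hx2
    have hmem : ∀ s : ℝ, ((s • axis n, 0) : Coords n) ∈ tubeDom (n := n) r' r' := fun s =>
      mem_tubeDom_axis hr' s (by simpa using hr')
    by_cases hd0 : d = 0
    · subst hd0
      rw [add_zero] at hx2
      have hf := isFiberedAt_of_mem_tubeDom h (hmem s) (hEan _ (hmem s)) hEmom
      obtain ⟨g, -, -, -, hg⟩ := exists_local_inverse (hEan _ (hmem s)) (hf.bijective fun u hu => by
        simp only [hEd _ (hmem s), hb0] at hu
        rw [add_comm, offAxis_add_axis] at hu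
        exact hamDir_injective h hf.surjective hu)
      filter_upwards [hx1.eventually hg, hx2.eventually hg] with z h1 h2 heq
      exact Prod.ext_iff.1 (h1.symm.trans ((congrArg g heq).trans h2))
    · have hne : E (s • axis n, 0) ≠ E ((s + d) • axis n, 0) := by
        rw [hEγ, hEγ]
        intro heq
        obtain ⟨k, hk⟩ := hinj s (s + d) heq
        rw [sub_add_cancel_left] at hk
        have h1 : |(k : ℝ)| * p ≤ p / 2 := by
          rw [← abs_of_pos hp, ← abs_mul, ← hk, abs_neg, abs_of_pos hp]; exact abs_le.2 hd
        have h3 : k = 0 := by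
          rw [← Int.abs_lt_one_iff]
          exact_mod_cast (by nlinarith : |(k : ℝ)| < 1)
        simp [h3, hd0] at hk
      have c3 := (((hEan _ (hmem s)).continuousAt.tendsto.comp hx1).prodMk_nhds
        ((hEan _ (hmem (s + d))).continuousAt.tendsto.comp hx2)).eventually
        (isClosed_diagonal.isOpen_compl.mem_nhds hne)
      filter_upwards [c3] with z hz heq
      exact absurd heq hz
  have hnear : ∀ᶠ z in 𝓝 (0 : (Coords n) × (Coords n)), ‖b z.1.2 - axis n‖ < 1 / 2 := by
    have h2 : ContinuousAt (fun z : (Coords n) × (Coords n) => b z.1.2) 0 :=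
      ContinuousAt.comp (g := b) (hba 0 (by simpa using hr)).continuousAt
        continuous_fst.snd.continuousAt
    exact (h2.sub continuousAt_const).norm.eventually_lt continuousAt_const (by simp [hb0])
  obtain ⟨r₀, hr₀, hinj0⟩ := eventually_nhds_iff_ball.1 (hinjloc.and hnear)
  set ρ := min r' (min r r₀)
  have hρ : ρ ≤ r' ∧ ρ ≤ r ∧ ρ ≤ r₀ := by simp [ρ]
  have hsub : ∀ x ∈ tubeDom (n := n) ρ ρ, x ∈ tubeDom r' r' := fun x hx =>
    ⟨hx.1.trans_le hρ.1, hx.2.trans_le hρ.1⟩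
  have hρ0 : 0 < ρ := lt_min hr' (lt_min hr hr₀)
  refine ⟨p, ρ, ρ, b, E, ⟨hp, hρ0, hρ0, fun ζ hζ => ?_, fun ζ hζ => hba ζ (hζ.trans_le hρ.2.1),
    fun x hx => hEan x (hsub x hx), fun x hx => hEmom x (hsub x hx),
    fun x hx => hEd x (hsub x hx), fun x hx => hEper x (hsub x hx), ?_⟩, hb0, hN, hEγ⟩
  · refine (hinj0 ((0, ζ), 0) ?_).2.le
    rw [mem_ball_zero_iff]
    simpa [Prod.norm_def, hr₀] using hζ.trans_le hρ.2.2
  intro x hx y hy hxy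
  obtain ⟨j, hj, -⟩ := existsUnique_add_zsmul_mem_Ico hp (x.1 0) 0
  obtain ⟨i, hi, -⟩ := existsUnique_add_zsmul_mem_Ico hp (y.1 0 - (x.1 0 + j • p)) (-(p / 2))
  have hz : (((offAxis n x.1, x.2), (offAxis n y.1, y.2)) :
      (Coords n) × (Coords n)) ∈ ball 0 r₀ := by
    rw [mem_ball_zero_iff]
    simp only [Prod.norm_def, max_lt_iff]
    exact ⟨⟨hx.1.trans_le hρ.2.2, hx.2.trans_le hρ.2.2⟩,
      hy.1.trans_le hρ.2.2, hy.2.trans_le hρ.2.2⟩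
  have hadd : ∀ (τ : Target n) (k : ℤ), offAxis n τ + (τ 0 + k • p) • axis n =
      τ + (k * p) • axis n := fun τ k => by
    rw [zsmul_eq_mul, add_smul, ← add_assoc, offAxis_add_axis]
  have h1 := (hinj0 _ hz).1 (x.1 0 + j • p, y.1 0 - (x.1 0 + j • p) + i • p)
    ⟨⟨hj.1, by linarith [hj.2]⟩, hi.1, by linarith [hi.2]⟩
  simp only [show x.1 0 + j • p + (y.1 0 - (x.1 0 + j • p) + i • p) = y.1 0 + i • p by abel,
    hadd] at h1
  rw [periodic_int hEper (hsub x hx), periodic_int hEper (hsub y hy)] at h1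
  obtain ⟨h2, h3⟩ := h1 hxy
  refine ⟨h3, i - j, ?_⟩
  rw [Int.cast_sub, sub_mul, sub_smul, sub_eq_sub_iff_add_eq_add, h2, add_comm]

section HomotopyPrimitive
variable [FiniteDimensional ℝ X]

lemma fderiv_form_apply {θ : X → X [⋀^Fin 2]→L[ℝ] ℝ} {x : X} (h : DifferentiableAt ℝ θ x) (u a b :
    X) : fderiv ℝ (fun y => θ y ![a, b]) x u = toBilin X (fderiv ℝ θ x u) a b := by
  have h1 := h.hasFDerivAt.continuousAlternatingMap_apply_const ![a, b]
  rw [h1.fderiv]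
  rfl

lemma toBilin_closed {θ : X → X [⋀^Fin 2]→L[ℝ] ℝ} {x : X} (h : DifferentiableAt ℝ θ x) (hc :
    extDeriv θ x = 0) (a b c : X) : toBilin X (fderiv ℝ θ x a) b c - toBilin X (fderiv ℝ θ x b) a c
    + toBilin X (fderiv ℝ θ x c) a b = 0 := by
  have h1 := extDeriv_two_apply h a b c
  rw [hc, fderiv_form_apply h, fderiv_form_apply h, fderiv_form_apply h] at h1
  exact h1.symm

lemma hasFDerivAt_toBilin {θ : Z → X [⋀^Fin 2]→L[ℝ] ℝ} {θ' : Z →L[ℝ] X [⋀^Fin 2]→L[ℝ] ℝ} {z : Z} (h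
    : HasFDerivAt θ θ' z) : HasFDerivAt (fun z => toBilin X (θ z)) ((toBilin X).comp θ') z := by
  have h3 := IsBoundedLinearMap.hasFDerivAt (𝕜 := ℝ) (E := X [⋀^Fin 2]→L[ℝ] ℝ)
    (F := X →L[ℝ] X →L[ℝ] ℝ) (f := fun η => toBilin X η) (x := θ z)
    ⟨⟨fun a b => (toBilin X).map_add a b, fun a b => (toBilin X).map_smul a b⟩, 1, one_pos, fun η => by rw [one_mul]; exact norm_toBilin_le η⟩
  exact HasFDerivAt.comp (g := fun η => toBilin X η) z h3 h

def linRetract (Q : X →L[ℝ] X) (s : ℝ) : X →L[ℝ] X := ContinuousLinearMap.id ℝ X - Q + s • Q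

lemma linRetract_apply (Q : X →L[ℝ] X) (s : ℝ) (x : X) : linRetract Q s x = x - Q x + s • Q x := rfl

lemma linRetract_one (Q : X →L[ℝ] X) (x : X) : linRetract Q 1 x = x := by simp [linRetract_apply]

lemma hasDerivAt_linRetract (Q : X →L[ℝ] X) (x : X) (s : ℝ) : HasDerivAt (fun s => linRetract Q s x)
    (Q x) s := by
  simp only [linRetract_apply]
  simpa using ((hasDerivAt_id s).smul_const (Q x)).const_add (x - Q x)

/-- A primitive of a closed 2-form obtained from a linear homotopy. -/
def homotopyPrimitive (Q : X →L[ℝ] X) (θ : X → X [⋀^Fin 2]→L[ℝ] ℝ) (x : X) : X [⋀^Fin 1]→L[ℝ] ℝ :=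
  ∫ s in (0 : ℝ)..1, ContinuousAlternatingMap.ofSubsingleton ℝ X ℝ (0 : Fin 1)
    ((toBilin X (θ (linRetract Q s x)) (Q x)).comp (linRetract Q s))

variable {Q : X →L[ℝ] X} {θ : X → X [⋀^Fin 2]→L[ℝ] ℝ}

lemma contDiffAt_linRetract (s : ℝ) (x : X) : ContDiffAt ℝ ω (fun q : ℝ × X => linRetract Q q.1 q.2)
    (s, x) := by
  simp only [linRetract_apply]
  have h1 : ContDiffAt ℝ ω (fun q : ℝ × X => Q q.2) (s, x) :=
    Q.contDiff.contDiffAt.comp _ contDiffAt_snd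
  exact (contDiffAt_snd.sub h1).add (contDiffAt_fst.smul h1)

lemma contDiffAt_homotopy_pairing {x : X} (h : AnalyticAt ℝ θ (linRetract Q s x)) (v : X) :
    ContDiffAt ℝ ω (fun q : ℝ × X => toBilin X (θ (linRetract Q q.1 q.2)) (Q q.2) (linRetract Q q.1
    v)) (s, x) := by
  refine ((contDiffAt_toBilin (ContDiffAt.comp (g := θ) (s, x) h.contDiffAt
    (contDiffAt_linRetract s x))).clm_apply (Q.contDiff.contDiffAt.comp _ contDiffAt_snd)).clm_apply ?_
  simp only [linRetract_apply]
  exact contDiffAt_const.add (contDiffAt_fst.smul contDiffAt_const)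

lemma analyticAt_homotopy_integrand {x : X} (h : AnalyticAt ℝ θ (linRetract Q s x)) : AnalyticAt ℝ
    (fun q : ℝ × X => ContinuousAlternatingMap.ofSubsingleton ℝ X ℝ (0 : Fin 1) ((toBilin X (θ
    (linRetract Q q.1 q.2)) (Q q.2)).comp (linRetract Q q.1))) (s, x) :=
  ContDiffAt.analyticAt (contDiffAt_alternating fun v => contDiffAt_homotopy_pairing h (v 0))

lemma analyticAt_homotopyPrimitive {x : X} (h : ∀ s ∈ Icc (0 : ℝ) 1, AnalyticAt ℝ θ (linRetract Q s
    x)) : AnalyticAt ℝ (homotopyPrimitive Q θ) x := by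
  refine analyticAt_intervalIntegral (f := fun q : ℝ × X =>
    ContinuousAlternatingMap.ofSubsingleton ℝ X ℝ (0 : Fin 1)
      ((toBilin X (θ (linRetract Q q.1 q.2)) (Q q.2)).comp (linRetract Q q.1))) fun s hs => ?_
  rw [uIcc_of_le zero_le_one] at hs
  exact analyticAt_homotopy_integrand (h s hs)

lemma homotopyPrimitive_apply {x : X} (h : ∀ s ∈ Icc (0 : ℝ) 1, AnalyticAt ℝ θ (linRetract Q s x))
    (v : X) : homotopyPrimitive Q θ x (fun _ => v) = ∫ s in (0 : ℝ)..1, toBilin X (θ (linRetract Q s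
    x)) (Q x) (linRetract Q s v) := by
  let ev : (X [⋀^Fin 1]→L[ℝ] ℝ) →L[ℝ] ℝ := LinearMap.toContinuousLinearMap
      { toFun := fun η => η (fun _ => v)
        map_add' := fun _ _ => rfl
        map_smul' := fun _ _ => rfl }
  have hint : IntervalIntegrable (fun s : ℝ =>
      ContinuousAlternatingMap.ofSubsingleton ℝ X ℝ (0 : Fin 1)
      ((toBilin X (θ (linRetract Q s x)) (Q x)).comp (linRetract Q s))) volume 0 1 := by
    refine ContinuousOn.intervalIntegrable fun s hs => ?_
    rw [uIcc_of_le zero_le_one] at hs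
    exact (analyticAt_homotopy_integrand (h s hs)).continuousAt.left.continuousWithinAt
  exact (ev.intervalIntegral_comp_comm hint).symm

lemma extDeriv_one_apply {β : X → X [⋀^Fin 1]→L[ℝ] ℝ} {x : X} (h : DifferentiableAt ℝ β x) (u v : X)
    : extDeriv β x ![u, v] = fderiv ℝ (fun y => β y (fun _ => v)) x u - fderiv ℝ (fun y => β y (fun
    _ => u)) x v := by
  have e0 : (0 : Fin 2).removeNth ![u, v] = fun _ => v := by ext i; fin_cases i; rfl
  have e1 : (1 : Fin 2).removeNth ![u, v] = fun _ => u := by ext i; fin_cases i; rfl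
  rw [extDeriv_apply h, Fin.sum_univ_two, e0, e1]
  simp [sub_eq_add_neg]

theorem extDeriv_homotopyPrimitive {x : X} (h : ∀ s ∈ Icc (0 : ℝ) 1, AnalyticAt ℝ θ (linRetract Q s
    x)) (hcl : ∀ s ∈ Icc (0 : ℝ) 1, extDeriv θ (linRetract Q s x) = 0) (hP : ∀ u v, toBilin X (θ
    (linRetract Q 0 x)) (linRetract Q 0 u) (linRetract Q 0 v) = 0) : extDeriv (homotopyPrimitive Q
    θ) x = θ x := by
  set W : ℝ → X →L[ℝ] X [⋀^Fin 2]→L[ℝ] ℝ := fun s => fderiv ℝ θ (linRetract Q s x)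
  let f : X → ℝ × X → ℝ := fun v q =>
    toBilin X (θ (linRetract Q q.1 q.2)) (Q q.2) (linRetract Q q.1 v)
  have hI : uIcc (0 : ℝ) 1 = Icc 0 1 := uIcc_of_le zero_le_one
  rw [← hI] at h hcl
  have hf : ∀ v, ∀ s ∈ uIcc (0 : ℝ) 1, AnalyticAt ℝ (f v) (s, x) := fun v s hs =>
    (contDiffAt_homotopy_pairing (h s hs) v).analyticAt
  have hfc : ∀ v, ContinuousOn (fun s => fderiv ℝ (f v) (s, x)) (uIcc 0 1) := fun v s hs =>
    (hf v s hs).fderiv.continuousAt.left.continuousWithinAt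
  have hII : ∀ u v, IntervalIntegrable (fun s => fderiv ℝ (f v) (s, x) (0, u)) volume 0 1 :=
    fun u v => ((hfc v).clm_apply continuousOn_const).intervalIntegrable
  have hd : ∀ u v, fderiv ℝ (fun y => homotopyPrimitive Q θ y (fun _ => v)) x u =
      ∫ s in (0 : ℝ)..1, fderiv ℝ (f v) (s, x) (0, u) := by
    intro u v
    have hev : ∀ᶠ y in 𝓝 x, ∀ s ∈ uIcc (0 : ℝ) 1, AnalyticAt ℝ θ (linRetract Q s y) := by
      refine isCompact_uIcc.eventually_forall_of_forall_eventually fun s hs => ?_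
      have e : Tendsto (fun z : X × ℝ => linRetract Q z.2 z.1) (𝓝 (x, s))
          (𝓝 (linRetract Q s x)) := by
        have h2 : ContinuousAt (fun z : X × ℝ => linRetract Q z.2 z.1) (x, s) := by
          simp only [linRetract_apply]
          fun_prop
        exact h2
      exact e.eventually (h s hs).eventually_analyticAt
    have h2 : (fun y => homotopyPrimitive Q θ y (fun _ => v)) =ᶠ[𝓝 x]
        fun y => ∫ s in (0 : ℝ)..1, f v (s, y) := by
      filter_upwards [hev] with y hy
      exact homotopyPrimitive_apply (hI ▸ hy) v
    rw [h2.fderiv_eq, (hasFDerivAt_intervalIntegral_of_analytic (hf v)).fderiv,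
      ContinuousLinearMap.intervalIntegral_apply
        ((hfc v).clm_comp continuousOn_const).intervalIntegrable]
    rfl
  have hfd : ∀ u v, ∀ s ∈ uIcc (0 : ℝ) 1, fderiv ℝ (f v) (s, x) (0, u) =
      toBilin X (W s (linRetract Q s u)) (Q x) (linRetract Q s v) +
        toBilin X (θ (linRetract Q s x)) (Q u) (linRetract Q s v) := by
    intro u v s hs
    have h3 := (hf v s hs).differentiableAt.hasFDerivAt.comp x
      (hasFDerivAt_prodMk_right (𝕜 := ℝ) s x)
    have h4 : HasFDerivAt (fun y => θ (linRetract Q s y)) ((W s).comp (linRetract Q s)) x :=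
      HasFDerivAt.comp (g := θ) x (h s hs).differentiableAt.hasFDerivAt
        (linRetract Q s).hasFDerivAt
    have h6 := ((hasFDerivAt_toBilin h4).clm_apply Q.hasFDerivAt).clm_apply
      (hasFDerivAt_const (linRetract Q s v) x)
    refine (congrArg (fun L => L u) (h3.unique h6)).trans ?_
    simp [add_comm]
  have hmain : ∀ u v, extDeriv (homotopyPrimitive Q θ) x ![u, v] = θ x ![u, v] := by
    intro u v
    rw [extDeriv_one_apply (analyticAt_homotopyPrimitive (hI ▸ h)).differentiableAt, hd, hd,
      ← intervalIntegral.integral_sub (hII u v) (hII v u)]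
    have hder : ∀ s ∈ uIcc (0 : ℝ) 1, HasDerivAt
        (fun s => toBilin X (θ (linRetract Q s x)) (linRetract Q s u) (linRetract Q s v))
        (fderiv ℝ (f v) (s, x) (0, u) - fderiv ℝ (f u) (s, x) (0, v)) s := by
      intro s hs
      rw [hfd u v s hs, hfd v u s hs]
      have h1 : HasDerivAt (fun s => θ (linRetract Q s x)) (W s (Q x)) s :=
        HasFDerivAt.comp_hasDerivAt (l := θ) s (h s hs).differentiableAt.hasFDerivAt
          (hasDerivAt_linRetract Q x s)
      have h2 : HasDerivAt (fun s => toBilin X (θ (linRetract Q s x))) (toBilin X (W s (Q x))) s := by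
        have := (hasFDerivAt_toBilin h1.hasFDerivAt).hasDerivAt
        simpa using this
      have h3 := (h2.clm_apply (hasDerivAt_linRetract Q u s)).clm_apply
        (hasDerivAt_linRetract Q v s)
      refine h3.congr_deriv ?_
      have h4 := toBilin_closed (h s hs).differentiableAt (hcl s hs) (linRetract Q s u) (Q x)
        (linRetract Q s v)
      have h5 : toBilin X (θ (linRetract Q s x)) (Q v) (linRetract Q s u) =
          - toBilin X (θ (linRetract Q s x)) (linRetract Q s u) (Q v) := alternating_swap _ _ _
      have h6 : toBilin X (W s (linRetract Q s v)) (linRetract Q s u) (Q x) =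
          - toBilin X (W s (linRetract Q s v)) (Q x) (linRetract Q s u) := alternating_swap _ _ _
      simp only [add_apply]
      rw [h5]
      change toBilin X (W s (linRetract Q s u)) (Q x) (linRetract Q s v) -
        toBilin X (W s (Q x)) (linRetract Q s u) (linRetract Q s v) +
        toBilin X (W s (linRetract Q s v)) (linRetract Q s u) (Q x) = 0 at h4
      rw [h6] at h4
      linarith
    rw [intervalIntegral.integral_eq_sub_of_hasDerivAt hder ((hII u v).sub (hII v u)), hP,
      sub_zero, linRetract_one, linRetract_one, linRetract_one]
    rfl
  ext w
  have : w = ![w 0, w 1] := by ext i; fin_cases i <;> rfl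
  rw [this]
  exact hmain _ _
end HomotopyPrimitive

section FiberIntegration
def oneForm (X : Type*) [NormedAddCommGroup X] [NormedSpace ℝ X] [FiniteDimensional ℝ X] :
    (X [⋀^Fin 1]→L[ℝ] ℝ) →L[ℝ] X →L[ℝ] ℝ :=
  LinearMap.toContinuousLinearMap
    { toFun := (ContinuousAlternatingMap.ofSubsingleton ℝ X ℝ (0 : Fin 1)).symm
      map_add' := fun _ _ => rfl
      map_smul' := fun _ _ => rfl }

lemma oneForm_apply [FiniteDimensional ℝ X] (η : X [⋀^Fin 1]→L[ℝ] ℝ) (v : X) : oneForm X η v = η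
    (fun _ => v) := by
  refine congrArg η (funext fun i => ?_)
  fin_cases i; rfl

lemma extDeriv_one_eq [FiniteDimensional ℝ X] {β : X → X [⋀^Fin 1]→L[ℝ] ℝ} {x : X} (h :
    DifferentiableAt ℝ β x) (u v : X) : extDeriv β x ![u, v] = oneForm X (fderiv ℝ β x u) v -
    oneForm X (fderiv ℝ β x v) u := by
  rw [extDeriv_one_apply h, (h.hasFDerivAt.continuousAlternatingMap_apply_const _).fderiv,
    (h.hasFDerivAt.continuousAlternatingMap_apply_const _).fderiv, oneForm_apply, oneForm_apply]
  rfl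

variable {T : Type*} [NormedAddCommGroup T] [InnerProductSpace ℝ T] [FiniteDimensional ℝ T]

def fiberIntegral (η : T × T → (T × T) [⋀^Fin 1]→L[ℝ] ℝ) (x : T × T) : ℝ :=
  ∫ s in (0 : ℝ)..1, oneForm (T × T) (η (s • x.1, x.2)) (x.1, 0)

lemma analyticAt_fiberIntegral {η : T × T → (T × T) [⋀^Fin 1]→L[ℝ] ℝ} {x : T × T} (h : ∀ s ∈ Icc (0
    : ℝ) 1, AnalyticAt ℝ η (s • x.1, x.2)) : AnalyticAt ℝ (fiberIntegral η) x := by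
  refine analyticAt_intervalIntegral (f := fun q : ℝ × (T × T) =>
    oneForm (T × T) (η (q.1 • q.2.1, q.2.2)) (q.2.1, 0)) fun s hs => ?_
  rw [uIcc_of_le zero_le_one] at hs
  have e : ContDiffAt ℝ ω (fun q : ℝ × (T × T) => (q.1 • q.2.1, q.2.2)) (s, x) := by fun_prop
  have e1 : ContDiffAt ℝ ω (fun q : ℝ × (T × T) => (q.2.1, (0 : T))) (s, x) := by fun_prop
  have e2 : ContDiffAt ℝ ω (fun q : ℝ × (T × T) => η (q.1 • q.2.1, q.2.2)) (s, x) :=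
    ContDiffAt.comp (g := η) (s, x) (h s hs).contDiffAt e
  exact (((oneForm (T × T)).contDiff.contDiffAt.comp (s, x) e2).clm_apply e1).analyticAt

lemma hasFDerivAt_fiberIntegral {η : T × T → (T × T) [⋀^Fin 1]→L[ℝ] ℝ} {S : Set T} {ζ : T} (hS :
    Convex ℝ S) (hSo : IsOpen S) (h0 : (0 : T) ∈ S) (hd : ∀ τ ∈ S, DifferentiableAt ℝ η (τ, ζ)) (hcl
    : ∀ τ ∈ S, ∀ u v : T, extDeriv η (τ, ζ) ![(u, 0), (v, 0)] = 0) {τ : T} (hτ : τ ∈ S) :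
    HasFDerivAt (fun τ => fiberIntegral η (τ, ζ)) ((oneForm (T × T) (η (τ, ζ))).comp (inl ℝ T T)) τ
    := by
  set A : T → T →L[ℝ] ℝ := fun τ => (oneForm (T × T) (η (τ, ζ))).comp
    (inl ℝ T T)
  set A' : T → T →L[ℝ] T →L[ℝ] ℝ := fun τ =>
    ((compL ℝ T (T × T) ℝ).flip (inl ℝ T T)).comp
      ((oneForm (T × T)).comp ((fderiv ℝ η (τ, ζ)).comp (inl ℝ T T)))
  have hAd : ∀ τ ∈ S, HasFDerivAt A (A' τ) τ := by
    intro τ hτ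
    exact (((compL ℝ T (T × T) ℝ).flip (inl ℝ T T)).hasFDerivAt).comp τ
      ((oneForm (T × T)).hasFDerivAt.comp τ (hd τ hτ).hasFDerivAt_left)
  have hsym : ∀ τ ∈ S, ∀ u v : T, A' τ u v = A' τ v u := by
    intro τ hτ u v
    have h1 := hcl τ hτ u v
    rw [extDeriv_one_eq (hd τ hτ)] at h1
    exact sub_eq_zero.1 h1
  have h := hS.hasFDerivWithinAt_curveIntegral_segment_of_hasFDerivWithinAt_symmetric
    (fun x hx => (hAd x hx).hasFDerivWithinAt) (fun a ha x _ y _ => hsym a ha x y) h0 hτ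
  refine (h.hasFDerivAt (hSo.mem_nhds hτ)).congr_of_eventuallyEq (Eventually.of_forall fun τ' => ?_)
  simp only [curveIntegral_segment, fiberIntegral, sub_zero, A, AffineMap.lineMap_apply_module,
    smul_zero, zero_add]
  rfl
end FiberIntegration

lemma exists_flowBox_chart (h : IsIntegrableSystem Ω F) {p : M} (hp : Surjective (dFun n F p))
    (hG : G ∈ 𝓝 p) : ∃ (E : Coords n → M) (g : M → Coords n) (ρ : ℝ), 0 < ρ ∧ E 0 = p ∧
    (∀ x ∈ ball 0 ρ, ContMDiffAt 𝓘(ℝ, Coords n) 𝓘[n] ω E x ∧ F (E x) = F p + x.2 ∧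
      IsFiberedAt F E x ∧ Bijective (dParam n E x) ∧ E x ∈ G ∧ g (E x) = x) ∧
    ∀ᶠ m in 𝓝 p, g m ∈ ball 0 ρ ∧ E (g m) = m ∧ ContMDiffAt 𝓘[n] 𝓘(ℝ, Coords n) ω g m := by
  obtain ⟨E, hE0, hE⟩ := exists_isBoxAt h hp
  have hE' := hE.self_of_nhds
  obtain ⟨g, hg, hg0, hEg, hgE⟩ := exists_local_inverse hE'.1 (hE'.bijective h)
  have hGE : ∀ᶠ x in 𝓝 (0 : Coords n), E x ∈ G :=
    hE'.1.continuousAt.preimage_mem_nhds (by rwa [hE0])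
  obtain ⟨ρ, hρ, hball⟩ := eventually_nhds_iff_ball.1 (hE.and (hgE.and hGE))
  rw [hE0] at hg hg0 hEg
  refine ⟨E, g, ρ, hρ, hE0, fun x hx => ?_, ?_⟩
  · obtain ⟨h1, h3, h4⟩ := hball x hx
    exact ⟨h1.1, h1.2.1, h1.2.2.1, h1.bijective h, h4, h3⟩
  · filter_upwards [hg.continuousAt.preimage_mem_nhds (by rw [hg0]; exact ball_mem_nhds _ hρ), hEg,
      (contMDiffAt_iff_contMDiffAt_nhds (by decide)).1 hg] with m a1 a2 a3 using ⟨a1, a2, a3⟩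

/-- Near `q`, the differential of `g` agrees with `α` along the fibres of `F`. -/
def IsFiberPrimitiveAt (F : M → Target n) (α : DForm n M 1) (g : M → ℝ) (q : M) : Prop :=
  ∀ᶠ m in 𝓝 q, ContMDiffAt 𝓘[n] 𝓘(ℝ, ℝ) ω g m ∧
    ∀ v, dFun n F m v = 0 → dFun n g m v = formAt α m (fun _ => v)

lemma exists_fiberPrimitive (h : IsIntegrableSystem Ω F) (hα : IsAnalyticPrimitiveOn Ω α G) (hq : q
    ∈ G) (hreg : Surjective (dFun n F q)) : ∃ g, IsFiberPrimitiveAt F α g q := by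
  obtain ⟨E, e, ρ, hρ, hE0, hE, he⟩ := exists_flowBox_chart h hreg (hα.1.mem_nhds hq)
  set η := pullForm E α
  have hη : ∀ x ∈ ball (0 : Coords n) ρ, AnalyticAt ℝ η x := fun x hx =>
    (contDiffAt_pullForm hα.2.1 (hE x hx).2.2.2.2.1 (hE x hx).1).analyticAt
  have han : ∀ x ∈ ball (0 : Coords n) ρ, AnalyticAt ℝ (fiberIntegral η) x :=
    fun x hx => analyticAt_fiberIntegral fun s hs => hη _ (smul_fst_mem_ball hx hs)
  have hder : ∀ x ∈ ball (0 : Coords n) ρ, ∀ u : Target n,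
      fderiv ℝ (fiberIntegral η) x (u, 0) = η x (fun _ => (u, 0)) := by
    rintro ⟨τ, ζ⟩ hx u
    have hmem : ∀ σ ∈ ball (0 : Target n) ρ, (σ, ζ) ∈ ball (0 : Coords n) ρ := fun σ => mk_mem_ball hx
    have h1 := hasFDerivAt_fiberIntegral (η := η) (ζ := ζ) (convex_ball 0 ρ) isOpen_ball
      (mem_ball_self hρ) (fun σ hσ => (hη _ (hmem σ hσ)).differentiableAt) (fun σ hσ u v => by
        have a1 := hE _ (hmem σ hσ)
        rw [extDeriv_pullForm hα.2.1 hα.2.2 a1.2.2.2.2.1 a1.1]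
        exact a1.2.2.1.isotropic h u v) (τ := τ) (by simpa using (mem_ball_prod.1 hx).1)
    have h2 := (han _ hx).differentiableAt.hasFDerivAt_left
    have h3 := congrArg (fun L => L u) (h2.unique h1)
    exact h3.trans (oneForm_apply _ _)
  refine ⟨fun m => fiberIntegral η (e m), ?_⟩
  filter_upwards [he] with m hm
  have hx := hE _ hm.1
  have hgm : ContMDiffAt 𝓘[n] 𝓘(ℝ, ℝ) ω (fun m => fiberIntegral η (e m)) m :=
    ContDiffAt.comp_contMDiffAt (g := fiberIntegral η) (f := e) (x := m)
      (han _ hm.1).contDiffAt hm.2.2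
  refine ⟨hgm, fun v hv => ?_⟩
  obtain ⟨⟨u, w⟩, hw⟩ := hx.2.2.2.1.2 v
  rw [hm.2.1] at hx
  have hw0 : w = 0 := by
    have h1 := hx.2.2.1.2 (u, w)
    rw [hm.2.1, hw, hv] at h1
    exact h1.symm
  subst hw0
  have h1 := fderiv_fun_comp_param (n := n) (E := E) (g := fun m => fiberIntegral η (e m))
    (x := e m) (hx.1.mdiff) (by rw [hm.2.1]; exact hgm.mdiff)
  have h2 : (fun x => fiberIntegral η (e (E x))) =ᶠ[𝓝 (e m)] fiberIntegral η := by
    filter_upwards [isOpen_ball.mem_nhds hm.1] with x hx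
    rw [(hE x hx).2.2.2.2.2]
  rw [h2.fderiv_eq] at h1
  have h3 := congrArg (fun L => L (u, 0)) h1
  simp only [ContinuousLinearMap.comp_apply] at h3
  rw [hder _ hm.1, hw, hm.2.1] at h3
  rw [← h3, pullForm_apply_one, hw, hm.2.1]

lemma exists_eq_comp_momentum (h : IsIntegrableSystem Ω F) {f : M → ℝ} (hreg : Surjective (dFun n F
    q)) (hf : ∀ᶠ m in 𝓝 q, ContMDiffAt 𝓘[n] 𝓘(ℝ, ℝ) ω f m ∧ ∀ v, dFun n F m v = 0 → dFun n f m v =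
    0) : ∃ k : Target n → ℝ, AnalyticAt ℝ k (F q) ∧ ∀ᶠ m in 𝓝 q, f m = k (F m) := by
  obtain ⟨E, e, ρ, hρ, hE0, hE, he⟩ := exists_flowBox_chart h hreg hf
  have h00 := mem_ball_self (x := (0 : Coords n)) hρ
  have hfE : ∀ x ∈ ball (0 : Coords n) ρ, ContDiffAt ℝ ω (fun x => f (E x)) x := fun x hx =>
    contMDiffAt_iff_contDiffAt.1 (ContMDiffAt.comp (g := f) (f := E) x
      (hE x hx).2.2.2.2.1.1 (hE x hx).1)
  have hconst : ∀ x ∈ ball (0 : Coords n) ρ, f (E x) = f (E (0, x.2)) := by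
    rintro ⟨τ, ζ⟩ hx
    have hmem : ∀ σ ∈ ball (0 : Target n) ρ, (σ, ζ) ∈ ball (0 : Coords n) ρ := fun σ => mk_mem_ball hx
    have hd : ∀ σ ∈ ball (0 : Target n) ρ,
        HasFDerivAt (fun σ => f (E (σ, ζ))) (0 : Target n →L[ℝ] ℝ) σ := by
      intro σ hσ
      have a1 := hE _ (hmem σ hσ)
      refine (hfE _ (hmem σ hσ)).diff.hasFDerivAt_left.congr_fderiv
        (ContinuousLinearMap.ext fun u => ?_)
      rw [fderiv_fun_comp_param (n := n) (a1.1.mdiff)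
        (a1.2.2.2.2.1.1.mdiff)]
      exact a1.2.2.2.2.1.2 _ (a1.2.2.1.2 (u, 0))
    refine isOpen_ball.is_const_of_fderiv_eq_zero (𝕜 := ℝ) (f := fun σ => f (E (σ, ζ)))
      (convex_ball (0 : Target n) ρ).isPreconnected
      (fun σ hσ => (hd σ hσ).differentiableAt.differentiableWithinAt) (fun σ hσ => (hd σ hσ).fderiv)
      (by simpa using (mem_ball_prod.1 hx).1) (mem_ball_self hρ)
  refine ⟨fun z => f (E (0, z - F q)), ?_, ?_⟩
  · have h1 : ContDiffAt ℝ ω (fun x => f (E x)) ((0 : Target n), F q - F q) := by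
      rw [sub_self]; exact hfE 0 h00
    have h2 : ContDiffAt ℝ ω (fun z : Target n => ((0 : Target n), z - F q)) (F q) := by fun_prop
    exact (ContDiffAt.comp (g := fun x => f (E x)) (F q) h1 h2).analyticAt
  · filter_upwards [he] with m hm
    have h1 := hconst _ hm.1
    rw [hm.2.1] at h1
    have h2 := (hE _ hm.1).2.1
    rw [hm.2.1] at h2
    rw [h1, h2, add_sub_cancel_left]

/-- A closed `C¹` curve in the fibre over `z`. -/
structure IsFiberLoop (F : M → Target n) (z : Target n) (c : ℝ → M) : Prop where
  periodic : Periodic c (2 * π)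
  contMDiff : ContMDiff 𝓘(ℝ, ℝ) 𝓘[n] 1 c
  mem_fiber : ∀ t, F (c t) = z

def loopIntegrand (α : DForm n M 1) (c : ℝ → M) (t : ℝ) : ℝ :=
  formAt α (c t) (fun _ => dParam n c t 1)

lemma loopIntegral_eq (α : DForm n M 1) (c : ℝ → M) : loopIntegral α c = ∫ t in (0 : ℝ)..(2 * π),
    loopIntegrand α c t := rfl

lemma hasVelocityAt_dParam (h : MDifferentiableAt 𝓘(ℝ, ℝ) 𝓘[n] c t) : HasVelocityAt c t (dParam n c
    t 1) := by
  refine HasMFDerivAt.congr_mfderiv h.hasMFDerivAt (ContinuousLinearMap.ext fun r => ?_)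
  change dParam n c t (show ℝ from r) = (show ℝ from r) • dParam n c t 1
  rw [← map_smul, smul_eq_mul, mul_one]

lemma IsFiberLoop.dFun_eq_zero (h : IsIntegrableSystem Ω F) (hc : IsFiberLoop F z c) (t : ℝ) : dFun
    n F (c t) (dParam n c t 1) = 0 := by
  have h1 := (hasVelocityAt_dParam (hc.contMDiff.mdifferentiable one_ne_zero _)).hasDerivAt_comp
    (h.mdifferentiableAt (c t))
  rw [funext hc.mem_fiber] at h1
  exact h1.unique (hasDerivAt_const t z)

lemma IsFiberLoop.integral_eq_sub (h : IsIntegrableSystem Ω F) (hc : IsFiberLoop F z c) {g : M → ℝ}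
    (hN : IsOpen N) (hg : ∀ m ∈ N, ContMDiffAt 𝓘[n] 𝓘(ℝ, ℝ) ω g m ∧ ∀ v, dFun n F m v = 0 → dFun n g
    m v = formAt α m (fun _ => v)) (hst : ∀ r ∈ uIcc s t, c r ∈ N) : IntervalIntegrable
    (loopIntegrand α c) volume s t ∧ ∫ r in s..t, loopIntegrand α c r = g (c t) - g (c s) := by
  have hder : ∀ r, c r ∈ N → HasDerivAt (fun r => g (c r)) (loopIntegrand α c r) r := by
    intro r hr
    have h1 := (hasVelocityAt_dParam (hc.contMDiff.mdifferentiable one_ne_zero _)).hasDerivAt_comp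
      (hg _ hr).1.mdiff
    rwa [(hg _ hr).2 _ (hc.dFun_eq_zero h r)] at h1
  have hO : IsOpen {r | c r ∈ N} := hN.preimage hc.contMDiff.continuous
  have hC : ContDiffOn ℝ 1 (fun r => g (c r)) {r | c r ∈ N} := fun r hr =>
    (contMDiffAt_iff_contDiffAt.1 (ContMDiffAt.comp (g := g) (f := c) r
      ((hg _ hr).1.of_le le_top) hc.contMDiff.contMDiffAt)).contDiffWithinAt
  have hint : IntervalIntegrable (loopIntegrand α c) volume s t := by
    refine ContinuousOn.intervalIntegrable ?_
    refine ((hC.continuousOn_deriv_of_isOpen hO le_rfl).mono hst).congr fun r hr => ?_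
    exact (hder r (hst r hr)).deriv.symm
  exact ⟨hint, intervalIntegral.integral_eq_sub_of_hasDerivAt (fun r hr => hder r (hst r hr)) hint⟩

lemma isOpen_forall_mem (hN : IsOpen N) {A : Set ℝ} (hA : IsClosed A) : IsOpen {q : ℝ × M | q.1 ∈ A
    → q.2 ∈ N} := by
  have : {q : ℝ × M | q.1 ∈ A → q.2 ∈ N} = (Prod.fst ⁻¹' Aᶜ) ∪ (Prod.snd ⁻¹' N) := by
    ext q
    simp [imp_iff_not_or]
  rw [this]
  exact (hA.isOpen_compl.preimage continuous_fst).union (hN.preimage continuous_snd)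

theorem exists_loopIntegral_eq (h : IsIntegrableSystem Ω F) (hα : IsAnalyticPrimitiveOn Ω α G) {z₀ :
    Target n} {c₀ : ℝ → M} (hc₀ : IsFiberLoop F z₀ c₀) (hG : ∀ t, c₀ t ∈ G) (hreg : ∀ t, Surjective
    (dFun n F (c₀ t))) : ∃ (k : Target n → ℝ) (W : Set (ℝ × M)), AnalyticAt ℝ k z₀ ∧ IsOpen W ∧ (∀ t
    ∈ Icc 0 (2 * π), (t, c₀ t) ∈ W) ∧ ∀ z c, IsFiberLoop F z c → (∀ t ∈ Icc 0 (2 * π), (t, c t) ∈ W)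
    → loopIntegral α c = k z := by
  have hcont := hc₀.contMDiff.continuous
  choose g hg using fun t => exists_fiberPrimitive h hα (hG t) (hreg t)
  have hdiff : ∀ s t q, q = c₀ t → IsFiberPrimitiveAt F α (g s) q → IsFiberPrimitiveAt F α (g t) q →
      ∃ k : Target n → ℝ, AnalyticAt ℝ k z₀ ∧ ∃ N, IsOpen N ∧ q ∈ N ∧
        ∀ m ∈ N, g t m - g s m = k (F m) := by
    rintro s t q rfl hs ht
    obtain ⟨k, hk, hk'⟩ := exists_eq_comp_momentum h (f := fun m => g t m - g s m) (hreg t) (by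
      filter_upwards [hs, ht] with m h1 h2
      refine ⟨h2.1.sub h1.1, fun v hv => ?_⟩
      have h3 : dFun n (fun m => g t m - g s m) m = dFun n (g t) m - dFun n (g s) m :=
        mfderiv_sub (h2.1.mdiff) (h1.1.mdiff)
      rw [h3]
      exact (congrArg₂ (· - ·) (h2.2 v hv) (h1.2 v hv)).trans (sub_self _))
    obtain ⟨N, hN, hNo, hq⟩ := eventually_nhds_iff.1 hk'
    rw [hc₀.mem_fiber] at hk
    exact ⟨k, hk, N, hNo, hq, hN⟩
  set R : ℝ → ℝ → Prop := fun s t => ∃ (k : Target n → ℝ) (W : Set (ℝ × M)), AnalyticAt ℝ k z₀ ∧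
    IsOpen W ∧ (∀ t ∈ Icc 0 (2 * π), (t, c₀ t) ∈ W) ∧
    ∀ z c, IsFiberLoop F z c → (∀ t ∈ Icc 0 (2 * π), (t, c t) ∈ W) →
      IntervalIntegrable (loopIntegrand α c) volume s t ∧
      ∫ r in s..t, loopIntegrand α c r = g t (c t) - g s (c s) + k z with hR
  have hsymm : ∀ s t, R s t → R t s := by
    rintro s t ⟨k, W, hk, hW, hW0, hkc⟩
    refine ⟨fun z => - k z, W, hk.neg, hW, hW0, fun z c hc hcW => ?_⟩
    obtain ⟨h1, h2⟩ := hkc z c hc hcW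
    refine ⟨h1.symm, ?_⟩
    rw [intervalIntegral.integral_symm, h2]
    ring
  have hloc : ∀ s ∈ Icc 0 (2 * π), ∀ᶠ t in 𝓝[Icc 0 (2 * π)] s, R s t := by
    intro s hs
    obtain ⟨N, hN, hNo, hsN⟩ := eventually_nhds_iff.1 (hg s)
    obtain ⟨δ, hδ, hball⟩ := eventually_nhds_iff_ball.1
      (hcont.continuousAt.preimage_mem_nhds (hNo.mem_nhds hsN))
    filter_upwards [self_mem_nhdsWithin, mem_nhdsWithin_of_mem_nhds (ball_mem_nhds s hδ)]
      with t ht htδ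
    have hsub : ∀ r ∈ uIcc s t, c₀ r ∈ N := fun r hr =>
      hball r ((convex_ball s δ).ordConnected.uIcc_subset (mem_ball_self hδ) htδ hr)
    obtain ⟨k, hk, N', hN', htN', hkN'⟩ := hdiff s t (c₀ t) rfl
      (by filter_upwards [hNo.mem_nhds (hsub t right_mem_uIcc)] with m hm using hN m hm) (hg t)
    refine ⟨fun z => - k z, {q | q.1 ∈ uIcc s t → q.2 ∈ N} ∩ {q | q.1 ∈ ({t} : Set ℝ) → q.2 ∈ N'},
      hk.neg, (isOpen_forall_mem hNo isClosed_Icc).inter (isOpen_forall_mem hN' isClosed_singleton),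
      fun r _ => ⟨fun hr => hsub r hr, fun hr => ?_⟩, fun z c hc hcW => ?_⟩
    · have hr' : r = t := hr
      simp only [hr']; exact htN'
    · have hsub' : uIcc s t ⊆ Icc 0 (2 * π) := uIcc_subset_Icc hs ht
      obtain ⟨h1, h2⟩ := hc.integral_eq_sub h hNo hN (s := s) (t := t)
        (fun r hr => (hcW r (hsub' hr)).1 hr)
      refine ⟨h1, ?_⟩
      have h3 := hkN' _ ((hcW t ht).2 rfl)
      rw [hc.mem_fiber] at h3
      rw [h2]
      linarith
  have h0 : (0 : ℝ) ∈ Icc 0 (2 * π) := ⟨le_rfl, Real.two_pi_pos.le⟩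
  have h1 : 2 * π ∈ Icc 0 (2 * π) := ⟨Real.two_pi_pos.le, le_rfl⟩
  obtain ⟨k, W, hk, hW, hW0, hkc⟩ : R 0 (2 * π) := by
    refine isPreconnected_Icc.induction₂ R hloc ?_ (fun s t _ _ => hsymm s t) h0 h1
    rintro r s t - - - ⟨k, W, hk, hW, hW0, hkc⟩ ⟨k', W', hk', hW', hW0', hkc'⟩
    refine ⟨fun z => k z + k' z, W ∩ W', hk.add hk', hW.inter hW',
      fun r hr => ⟨hW0 r hr, hW0' r hr⟩, fun z c hc hcW => ?_⟩
    obtain ⟨a1, a2⟩ := hkc z c hc fun r hr => (hcW r hr).1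
    obtain ⟨b1, b2⟩ := hkc' z c hc fun r hr => (hcW r hr).2
    refine ⟨a1.trans b1, ?_⟩
    rw [← intervalIntegral.integral_add_adjacent_intervals a1 b1, a2, b2]
    ring
  have hper : c₀ (2 * π) = c₀ 0 := by simpa using hc₀.periodic 0
  obtain ⟨k', hk', N, hN, hN0, hkN⟩ := hdiff 0 (2 * π) (c₀ 0) hper.symm (hg 0)
    (by rw [← hper]; exact hg _)
  refine ⟨fun z => k z + k' z, W ∩ {q | q.1 ∈ ({0} : Set ℝ) → q.2 ∈ N}, hk.add hk',
    hW.inter (isOpen_forall_mem hN isClosed_singleton), fun r hr => ⟨hW0 r hr, fun hr0 => ?_⟩,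
    fun z c hc hcW => ?_⟩
  · have hr' : r = 0 := hr0
    simp only [hr']; exact hN0
  · obtain ⟨a1, a2⟩ := hkc z c hc fun r hr => (hcW r hr).1
    have h2 : c (2 * π) = c 0 := by simpa using hc.periodic 0
    have h3 := hkN _ ((hcW 0 h0).2 rfl)
    rw [hc.mem_fiber] at h3
    rw [loopIntegral_eq, a2, h2]
    linarith

section LoopDerivative
variable {T : Type*} [NormedAddCommGroup T] [InnerProductSpace ℝ T] [FiniteDimensional ℝ T]

lemma hasGradientAt_integral_oneForm {η : T × T → (T × T) [⋀^Fin 1]→L[ℝ] ℝ} {z₀ : T} {τ : ℝ → T} {a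
    b : ℝ} {L : T →L[ℝ] T} (hτ : ContDiff ℝ 1 τ) (hη : ∀ t ∈ uIcc a b, AnalyticAt ℝ η (τ t, z₀))
    (hext : ∀ t ∈ uIcc a b, ∀ u w : T, extDeriv η (τ t, z₀) ![(0, w), (u, 0)] = inner ℝ (L u) w)
    (hper : η (τ b, z₀) = η (τ a, z₀)) : HasGradientAt (fun z => ∫ t in a..b, oneForm (T × T) (η (τ
    t, z)) (deriv τ t, 0)) (L (τ b - τ a)) z₀ := by
  have hτ' : Continuous (deriv τ) := hτ.continuous_deriv le_rfl
  have hpair : ∀ q : ℝ × T, ContinuousAt (fun q : ℝ × T => (τ q.1, q.2)) q := fun q =>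
    ((hτ.continuous.comp continuous_fst).prodMk continuous_snd).continuousAt
  set F' : ℝ × T → T →L[ℝ] ℝ := fun q => (((oneForm (T × T)).comp
    (fderiv ℝ η (τ q.1, q.2))).flip (deriv τ q.1, 0)).comp (inr ℝ T T) with hF'
  have hF'app : ∀ t w, F' (t, z₀) w =
      oneForm (T × T) (fderiv ℝ η (τ t, z₀) (0, w)) (deriv τ t, 0) := fun t w => rfl
  have hvel : Continuous fun q : ℝ × T => ((deriv τ q.1, 0) : T × T) := by fun_prop
  have hF'c : ∀ t ∈ uIcc a b, ContinuousAt F' (t, z₀) := by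
    intro t ht
    have h1 : ContinuousAt (fun q : ℝ × T => fderiv ℝ η (τ q.1, q.2)) (t, z₀) :=
      ContinuousAt.comp (g := fderiv ℝ η) (hη t ht).fderiv.continuousAt (hpair _)
    have h2 : ContinuousAt (fun q : ℝ × T => ((oneForm (T × T)).comp
        (fderiv ℝ η (τ q.1, q.2))).flip) (t, z₀) :=
      (ContinuousLinearMap.flipₗᵢ ℝ (T × T) (T × T) ℝ).continuous.continuousAt.comp
        (continuousAt_const.clm_comp h1)
    exact (h2.clm_apply hvel.continuousAt).clm_comp continuousAt_const
  have hmain := hasFDerivAt_intervalIntegral_of_continuousAt (a := a) (b := b) (x₀ := z₀)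
    (f := fun q : ℝ × T => oneForm (T × T) (η (τ q.1, q.2)) (deriv τ q.1, 0)) (F' := F')
    (fun t ht => by
      filter_upwards [(hpair (t, z₀)).eventually (hη t ht).eventually_analyticAt] with q hq
      have h1 : ContinuousAt (fun q : ℝ × T => η (τ q.1, q.2)) q :=
        ContinuousAt.comp (g := η) hq.continuousAt (hpair q)
      refine ⟨((oneForm (T × T)).continuous.continuousAt.comp h1).clm_apply hvel.continuousAt, ?_⟩
      have h2 := hq.differentiableAt.hasFDerivAt_right
      have h3 := ((oneForm (T × T)).hasFDerivAt.comp q.2 h2).clm_apply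
        (hasFDerivAt_const ((deriv τ q.1, 0) : T × T) q.2)
      refine h3.congr_fderiv (ContinuousLinearMap.ext fun w => ?_)
      simp [hF']) hF'c
  rw [hasGradientAt_iff_hasFDerivAt]
  refine hmain.congr_fderiv (ContinuousLinearMap.ext fun w => ?_)
  have hFc : ContinuousOn (fun t => F' (t, z₀)) (uIcc a b) := fun t ht =>
    (hF'c t ht).left.continuousWithinAt
  rw [ContinuousLinearMap.intervalIntegral_apply hFc.intervalIntegrable, InnerProductSpace.toDual_apply_apply]
  have hder : ∀ t ∈ uIcc a b, HasDerivAt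
      (fun t => inner ℝ (L (τ t)) w + oneForm (T × T) (η (τ t, z₀)) (0, w)) (F' (t, z₀) w) t := by
    intro t ht
    have ht' : HasDerivAt τ (deriv τ t) t := (hτ.differentiable (by decide) t).hasDerivAt
    have h1 : HasDerivAt (fun t => inner ℝ (L (τ t)) w) (inner ℝ (L (deriv τ t)) w) t := by
      have := (L.hasFDerivAt.comp_hasDerivAt t ht').inner ℝ (hasDerivAt_const t w)
      simpa using this
    have h2 : HasDerivAt (fun t => η (τ t, z₀)) (fderiv ℝ η (τ t, z₀) (deriv τ t, 0)) t :=
      HasFDerivAt.comp_hasDerivAt (l := η) (f := fun t => (τ t, z₀)) t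
        (hη t ht).differentiableAt.hasFDerivAt (ht'.prodMk (hasDerivAt_const t z₀))
    have h3 := ((oneForm (T × T)).hasFDerivAt.comp_hasDerivAt t h2).clm_apply
      (hasDerivAt_const t ((0, w) : T × T))
    refine (h1.add h3).congr_deriv ?_
    have h4 := hext t ht (deriv τ t) w
    rw [extDeriv_one_eq (hη t ht).differentiableAt] at h4
    rw [← h4, hF'app]
    simp
  rw [intervalIntegral.integral_eq_sub_of_hasDerivAt hder
    (hFc.clm_apply continuousOn_const).intervalIntegrable, hper, map_sub, inner_sub_left]
  ring
end LoopDerivative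

/-- The linear map that fixes the off-axis directions and sends the first axis to `β`. -/
def driftMap (β : Target n) : Target n →L[ℝ] Target n :=
  (EuclideanSpace.proj (0 : Fin n)).smulRight β + offAxis n

lemma driftMap_apply (β u : Target n) : driftMap β u = u 0 • β + offAxis n u := rfl

lemma driftMap_axis (β : Target n) (c : ℝ) : driftMap β (c • axis n) = c • β := by
  simp [driftMap_apply, offAxis_axis, axis_zero]

lemma abs_apply_zero_le (u : Target n) : |u 0| ≤ ‖u‖ := by simpa using PiLp.norm_apply_le u 0

lemma norm_offAxis_le (u : Target n) : ‖offAxis n u‖ ≤ 2 * ‖u‖ := by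
  rw [offAxis_apply]
  refine (norm_sub_le _ _).trans ?_
  rw [norm_smul, norm_axis, mul_one, Real.norm_eq_abs]
  linarith [abs_apply_zero_le u]

lemma IsTube.drift_zero_pos (ht : IsTube Ω F p r₁ r₂ b E) (hζ : ‖ζ‖ < r₂) : 1 / 2 ≤ b ζ 0 := by
  have h1 := abs_apply_zero_le (b ζ - axis n)
  have h2 := h1.trans (ht.drift_near ζ hζ)
  simp only [PiLp.sub_apply, axis_zero] at h2
  linarith [(abs_le.1 h2).1]

lemma IsTube.driftMap_injective (ht : IsTube Ω F p r₁ r₂ b E) (hζ : ‖ζ‖ < r₂) {u : Target n} (hu :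
    driftMap (b ζ) u = 0) : u = 0 := by
  have h1 := ht.drift_zero_pos hζ
  have h2 := congrArg (fun v : Target n => v 0) hu
  simp only [driftMap_apply, PiLp.add_apply, PiLp.smul_apply, offAxis_zero, smul_eq_mul, add_zero,
    PiLp.zero_apply, mul_eq_zero] at h2
  have h3 : u 0 = 0 := h2.resolve_right (by linarith)
  rw [driftMap_apply, h3, zero_smul, zero_add, offAxis_of_zero h3] at hu
  exact hu

lemma IsTube.isFiberedAt (ht : IsTube Ω F p r₁ r₂ b E) (h : IsIntegrableSystem Ω F)
    (hx : x ∈ tubeDom r₁ r₂) : IsFiberedAt F E x :=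
  isFiberedAt_of_mem_tubeDom h hx (ht.analytic x hx) ht.momentum

lemma IsTube.bijective (ht : IsTube Ω F p r₁ r₂ b E) (h : IsIntegrableSystem Ω F) (hx : x ∈ tubeDom
    r₁ r₂) : Bijective (dParam n E x) := by
  have h1 := ht.isFiberedAt h hx
  refine h1.bijective fun u hu => ht.driftMap_injective hx.2 ?_
  rw [ht.dParam_eq x hx] at hu
  exact hamDir_injective h h1.surjective hu

lemma IsTube.fiberMap_eq (ht : IsTube Ω F p r₁ r₂ b E) (h : IsIntegrableSystem Ω F) (hx : x ∈
    tubeDom r₁ r₂) : fiberMap (pullForm E Ω x) = driftMap (b x.2) := by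
  refine ContinuousLinearMap.ext fun u => ?_
  have h1 := (ht.isFiberedAt h hx).dParam_eq_hamDir h (ht.bijective h hx) u
  rw [ht.dParam_eq x hx] at h1
  have h2 : hamDir Ω F (fiberMap (pullForm E Ω x) u - driftMap (b x.2) u) (E x) = 0 := by
    rw [sub_eq_add_neg, hamDir_add h, ← neg_one_smul ℝ, hamDir_smul h, ← h1, driftMap_apply,
      neg_one_smul, add_neg_cancel]
  exact sub_eq_zero.1 (hamDir_injective h (ht.isFiberedAt h hx).surjective h2)

lemma IsTube.periodic_int (ht : IsTube Ω F p r₁ r₂ b E) (hx : x ∈ tubeDom r₁ r₂) (k : ℤ) : E (x.1 +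
    (k * p) • axis n, x.2) = E x :=
  Integrable.periodic_int ht.periodic hx k

lemma pullForm_periodic (ha : ∀ x ∈ tubeDom r₁ r₂, ContMDiffAt 𝓘(ℝ, Coords n) 𝓘[n] ω E x) (hE : ∀ x
    ∈ tubeDom r₁ r₂, E (x.1 + p • axis n, x.2) = E x) {j : ℕ} (η : DForm n M j) (hx : x ∈ tubeDom r₁
    r₂) (k : ℤ) : pullForm E η (x.1 + (k * p) • axis n, x.2) = pullForm E η x := by
  set φ : Coords n → Coords n := fun y => y + ((k * p) • axis n, 0)
  have hφ : ∀ y, HasFDerivAt φ (ContinuousLinearMap.id ℝ _) y := fun y =>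
    (hasFDerivAt_id y).add_const _
  have hφx : φ x = (x.1 + (k * p) • axis n, x.2) := by simp [φ, Prod.ext_iff]
  have h1 : (E ∘ φ) =ᶠ[𝓝 x] E := by
    filter_upwards [(isOpen_tubeDom r₁ r₂).mem_nhds hx] with y hy
    rw [← Integrable.periodic_int hE hy k]
    simp [φ, Prod.add_def]
  have h2 := pullForm_comp (E := E) (η := η) (φ := φ) (z := x) (by
    rw [hφx]
    exact (ha _ (tubeDom_add_axis hx _)).mdiff)
    (hφ x).differentiableAt
  rw [pullForm_congr h1, (hφ x).fderiv, hφx] at h2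
  exact h2.symm

/-- The points `(t, E x)` with `x` close to the point with parameter `t` on the axis. -/
def tubeNbhd (E : Coords n → M) (ρ : ℝ) : Set (ℝ × M) :=
  {q | ∃ x : Coords n, ‖x - (q.1 • axis n, 0)‖ < ρ ∧ E x = q.2}

lemma mem_tubeDom_of_near (hx : ‖x - (t • axis n, 0)‖ < ρ) (h₁ : 2 * ρ ≤ r₁) (h₂ : ρ ≤ r₂) : x ∈
    tubeDom r₁ r₂ := by
  rw [Prod.norm_def, max_lt_iff] at hx
  simp only [Prod.fst_sub, Prod.snd_sub, sub_zero] at hx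
  refine ⟨?_, hx.2.trans_le h₂⟩
  have h3 : offAxis n x.1 = offAxis n (x.1 - t • axis n) := by simp [offAxis_axis]
  rw [h3]
  linarith [norm_offAxis_le (x.1 - t • axis n)]

lemma IsTube.isOpen_tubeNbhd (ht : IsTube Ω F p r₁ r₂ b E) (h : IsIntegrableSystem Ω F) (h₁ : 2 * ρ
    ≤ r₁) (h₂ : ρ ≤ r₂) : IsOpen (tubeNbhd E ρ) := by
  rw [isOpen_iff_mem_nhds]
  rintro ⟨t, m⟩ ⟨x, hx, rfl⟩
  have hxD := mem_tubeDom_of_near hx h₁ h₂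
  obtain ⟨g, hg, hgx, hEg, -⟩ := exists_local_inverse (ht.analytic x hxD) (ht.bijective h hxD)
  have h1 : ContinuousAt (fun q : ℝ × M => ‖g q.2 - (q.1 • axis n, 0)‖) (t, E x) := by
    have h2 : ContinuousAt (fun q : ℝ × M => g q.2) (t, E x) :=
      ContinuousAt.comp (g := g) (f := Prod.snd) (x := (t, E x)) hg.continuousAt continuousAt_snd
    exact (h2.sub (by fun_prop)).norm
  have h3 : ∀ᶠ q in 𝓝 (t, E x), ‖g q.2 - (q.1 • axis n, 0)‖ < ρ :=
    h1.eventually_lt continuousAt_const (by simp only [hgx]; exact hx)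
  filter_upwards [h3, (continuousAt_snd (p := (t, E x))).eventually hEg] with q hq hq'
  exact ⟨g q.2, hq, hq'⟩

lemma IsTube.eq_of_near (ht : IsTube Ω F p r₁ r₂ b E) (h₁ : 2 * ρ ≤ r₁) (h₂ : ρ ≤ r₂) (h₃ : 2 * ρ ≤
    p) {y : Coords n} (hx : ‖x - (t • axis n, 0)‖ < ρ) (hy : ‖y - (t • axis n, 0)‖ < ρ) (hxy : E x =
    E y) : x = y := by
  obtain ⟨h4, k, hk⟩ := ht.injective x (mem_tubeDom_of_near hx h₁ h₂) y
    (mem_tubeDom_of_near hy h₁ h₂) hxy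
  have h5 : ‖x.1 - y.1‖ < 2 * ρ := by
    have h6 : ‖x - y‖ < 2 * ρ := by
      rw [← sub_sub_sub_cancel_right x y (t • axis n, 0)]
      exact (norm_sub_le _ _).trans_lt (by linarith)
    exact (norm_fst_le (x - y)).trans_lt h6
  rw [hk, norm_smul, norm_axis, mul_one, Real.norm_eq_abs, abs_mul, abs_of_pos ht.period_pos] at h5
  have h6 : |(k : ℝ)| < 1 := by
    by_contra hc
    nlinarith [ht.period_pos]
  have h7 : k = 0 := by
    rw [← Int.abs_lt_one_iff]
    exact_mod_cast h6
  rw [h7] at hk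
  simp at hk
  exact Prod.ext (sub_eq_zero.1 hk) h4

lemma IsTube.exists_lift (ht : IsTube Ω F p r₁ r₂ b E) (h : IsIntegrableSystem Ω F) {N : ℕ} (hN : 2
    * π = N * p) (h₁ : 2 * ρ ≤ r₁) (h₂ : ρ ≤ r₂) (h₃ : 2 * ρ ≤ p) (hc : IsFiberLoop F z c) (hW : ∀ t
    ∈ Icc 0 (2 * π), (t, c t) ∈ tubeNbhd E ρ) : ‖z‖ < r₂ ∧ ∃ τ : ℝ → Target n, ContDiff ℝ 1 τ ∧ (∀
    t, ‖offAxis n (τ t)‖ < r₁) ∧ (∀ t, E (τ t, z) = c t) ∧ ∀ t, τ (t + 2 * π) = τ t + (2 * π) • axis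
    n := by
  have hex : ∀ t, ∃ x : Coords n, ‖x - (t • axis n, 0)‖ < ρ ∧ E x = c t := by
    intro t
    obtain ⟨k, hk, -⟩ := existsUnique_add_zsmul_mem_Ico Real.two_pi_pos t 0
    rw [zero_add, zsmul_eq_mul] at hk
    obtain ⟨x, hx, hxc⟩ := hW _ ⟨hk.1, hk.2.le⟩
    simp only at hx hxc
    refine ⟨(x.1 + (((-k * N : ℤ) : ℝ) * p) • axis n, x.2), ?_, ?_⟩
    · convert hx using 2
      refine Prod.ext ?_ rfl
      simp only [Prod.fst_sub]
      rw [hN]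
      push_cast
      module
    · rw [ht.periodic_int (mem_tubeDom_of_near hx h₁ h₂), hxc]
      exact hc.periodic.int_mul k t
  choose x hx hxc using hex
  have hxD : ∀ t, x t ∈ tubeDom r₁ r₂ := fun t => mem_tubeDom_of_near (hx t) h₁ h₂
  have hx2 : ∀ t, (x t).2 = z := fun t => by rw [← ht.momentum _ (hxD t), hxc, hc.mem_fiber]
  refine ⟨by rw [← hx2 0]; exact (hxD 0).2, fun t => (x t).1, ?_, fun t => (hxD t).1, fun t => ?_,
    fun t => ?_⟩
  · rw [contDiff_iff_contDiffAt]
    intro t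
    obtain ⟨g, hg, hgx, hEg, -⟩ := exists_local_inverse (ht.analytic _ (hxD t))
      (ht.bijective h (hxD t))
    rw [hxc] at hg hgx hEg
    have h4 : ContMDiffAt 𝓘(ℝ, ℝ) 𝓘(ℝ, Coords n) 1 (fun t => g (c t)) t :=
      ContMDiffAt.comp (g := g) (f := c) t (hg.of_le le_top) hc.contMDiff.contMDiffAt
    have h5 : ContDiffAt ℝ 1 (fun t => g (c t)) t := contMDiffAt_iff_contDiffAt.1 h4
    have h8 : ContinuousAt (fun s : ℝ => ‖g (c s) - (s • axis n, 0)‖) t :=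
      (h5.continuousAt.sub (by fun_prop)).norm
    have h6 : ∀ᶠ s in 𝓝 t, ‖g (c s) - (s • axis n, 0)‖ < ρ :=
      h8.eventually_lt continuousAt_const (by simp only [hgx]; exact hx t)
    have h7 : x =ᶠ[𝓝 t] fun s => g (c s) := by
      filter_upwards [h6, hc.contMDiff.continuous.continuousAt.eventually hEg] with s hs hs'
      exact ht.eq_of_near h₁ h₂ h₃ (hx s) hs (by rw [hxc, hs'])
    exact contDiffAt_fst.comp t (h5.congr_of_eventuallyEq h7)
  · rw [← hx2 t]; exact hxc t
  · have h4 := ht.periodic_int (hxD t) N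
    have h5 : x (t + 2 * π) = ((x t).1 + (2 * π) • axis n, (x t).2) := by
      refine ht.eq_of_near h₁ h₂ h₃ (hx _) ?_ ?_
      · convert hx t using 2
        refine Prod.ext ?_ rfl
        change (x t).1 + (2 * π) • axis n - (t + 2 * π) • axis n = (x t).1 - t • axis n
        module
      · rw [hxc, hc.periodic, ← hxc t, ← h4, hN]
        push_cast
        rfl
    simp only [h5]

lemma IsTube.isFiberLoop (ht : IsTube Ω F p r₁ r₂ b E) {N : ℕ} (hN : 2 * π = N * p) {τ : ℝ → Target
    n} (hτ : ContDiff ℝ 1 τ) (hτ₁ : ∀ t, ‖offAxis n (τ t)‖ < r₁) (hper : ∀ t, τ (t + 2 * π) = τ t +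
    (2 * π) • axis n) (hz : ‖z‖ < r₂) : IsFiberLoop F z fun t => E (τ t, z) := by
  have hD : ∀ t, (τ t, z) ∈ tubeDom r₁ r₂ := fun t => ⟨hτ₁ t, hz⟩
  refine ⟨fun t => ?_, fun t => ?_, fun t => ht.momentum _ (hD t)⟩
  · have h1 := ht.periodic_int (hD t) N
    rw [hper, hN, ← h1]
    push_cast
    rfl
  · refine ContMDiffAt.comp (g := E) (f := fun t => (τ t, z)) t
      ((ht.analytic _ (hD t)).of_le le_top) (contMDiffAt_iff_contDiffAt.2 ?_)
    exact hτ.contDiffAt.prodMk contDiffAt_const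

lemma IsTube.hasGradientAt_loopIntegral (ht : IsTube Ω F p r₁ r₂ b E) (h : IsIntegrableSystem Ω F)
    {N : ℕ} (hN : 2 * π = N * p) (hα : IsAnalyticPrimitiveOn Ω α G) {z₀ : Target n} (hz₀ : ‖z₀‖ <
    r₂) {τ : ℝ → Target n} (hτ : ContDiff ℝ 1 τ) (hτ₁ : ∀ t, ‖offAxis n (τ t)‖ < r₁) (hper : ∀ t, τ
    (t + 2 * π) = τ t + (2 * π) • axis n) (hG : ∀ t, E (τ t, z₀) ∈ G) : HasGradientAt (fun z =>
    loopIntegral α fun t => E (τ t, z)) ((2 * π) • b z₀) z₀ := by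
  have hD : ∀ t, (τ t, z₀) ∈ tubeDom r₁ r₂ := fun t => ⟨hτ₁ t, hz₀⟩
  have h1 := hasGradientAt_integral_oneForm (η := pullForm E α) (z₀ := z₀) (τ := τ)
    (a := 0) (b := 2 * π) (L := driftMap (b z₀)) hτ
    (fun t _ => (contDiffAt_pullForm hα.2.1 (hG t) (ht.analytic _ (hD t))).analyticAt)
    (fun t _ u w => by
      rw [extDeriv_pullForm hα.2.1 hα.2.2 (hG t) (ht.analytic _ (hD t)), ← inner_fiberMap,
        ht.fiberMap_eq h (hD t)])
    (by
      have h2 := pullForm_periodic ht.analytic ht.periodic α (hD 0) N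
      have h3 := hper 0
      rw [zero_add] at h3
      rw [h3, ← h2, hN]
      push_cast
      rfl)
  have h3 := hper 0
  rw [zero_add] at h3
  rw [h3, add_sub_cancel_left, driftMap_axis] at h1
  rw [hasGradientAt_iff_hasFDerivAt] at h1 ⊢
  refine h1.congr_of_eventuallyEq ?_
  filter_upwards [(isOpen_lt continuous_norm continuous_const).mem_nhds hz₀] with z hz
  rw [loopIntegral_eq]
  refine intervalIntegral.integral_congr fun t _ => ?_
  have hDz : (τ t, z) ∈ tubeDom r₁ r₂ := ⟨hτ₁ t, hz⟩
  have hE := (ht.analytic _ hDz).mdiff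
  have hx : HasDerivAt (fun t => (τ t, z)) (deriv τ t, 0) t :=
    (hτ.differentiable (by decide) t).hasDerivAt.prodMk (hasDerivAt_const t z)
  have h4 := dParam_comp (n := n) (E := E) (φ := fun t => (τ t, z)) (z := t) hE hx.differentiableAt
  simp only [loopIntegrand, h4, oneForm_apply, pullForm_apply_one, ContinuousLinearMap.comp_apply]
  rw [show fderiv ℝ (fun t => (τ t, z)) t 1 = (deriv τ t, 0) from hx.deriv]

lemma eventually_graph_mem [TopologicalSpace Z] {S : Set Z} (hS : IsOpen S) {f : Z → ℝ → M} (hf :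
    ContinuousOn (fun q : Z × ℝ => f q.1 q.2) (S ×ˢ univ)) {z₀ : Z} (hz₀ : z₀ ∈ S) {W : Set (ℝ × M)}
    (hW : IsOpen W) {K : Set ℝ} (hK : IsCompact K) (h : ∀ t ∈ K, (t, f z₀ t) ∈ W) : ∀ᶠ z in 𝓝 z₀, ∀
    t ∈ K, (t, f z t) ∈ W := by
  refine hK.eventually_forall_of_forall_eventually fun t ht => ?_
  have h1 : ContinuousAt (fun q : Z × ℝ => f q.1 q.2) (z₀, t) :=
    hf.continuousAt ((hS.prod isOpen_univ).mem_nhds ⟨hz₀, trivial⟩)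
  exact (continuousAt_snd.prodMk h1).eventually (hW.mem_nhds (h t ht))

lemma IsTube.continuousOn_comp (ht : IsTube Ω F p r₁ r₂ b E) {τ : ℝ → Target n} (hτ : Continuous τ)
    (hτ₁ : ∀ t, ‖offAxis n (τ t)‖ < r₁) : ContinuousOn (fun q : Target n × ℝ => E (τ q.2, q.1)) ({w
    | ‖w‖ < r₂} ×ˢ univ) := by
  have h1 : Continuous fun q : Target n × ℝ => (τ q.2, q.1) :=
    (hτ.comp continuous_snd).prodMk continuous_fst
  have h2 : ContinuousOn E (tubeDom r₁ r₂) :=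
    fun x hx => (ht.analytic x hx).continuousAt.continuousWithinAt
  exact h2.comp h1.continuousOn fun q hq => ⟨hτ₁ _, hq.1⟩

lemma IsClosedCurveFamily.isFiberLoop {Z : Set (Target n)} {c : Target n → ℝ → M} (hc :
    IsClosedCurveFamily F Z c) (hz : z ∈ Z) : IsFiberLoop F z (c z) :=
  ⟨hc.periodic z hz, hc.contMDiff z hz, hc.mem_fiber z hz⟩

theorem IsTube.mineurArnoldFormula (ht : IsTube Ω F p r₁ r₂ b E) (h : IsIntegrableSystem Ω F) {N :
    ℕ} (hN : 2 * π = N * p) (h₁ : 2 * ρ ≤ r₁) (h₂ : ρ ≤ r₂) (h₃ : 2 * ρ ≤ p) {V : Set (Target n)}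
    (hJ : AnalyticOnNhd ℝ J V) (hJb : ∀ z ∈ V, HasGradientAt J (b z) z) {Z : Set (Target n)} (hZo :
    IsOpen Z) (hZc : IsConnected Z) (hZV : Z ⊆ V) {c : Target n → ℝ → M} (hc : IsClosedCurveFamily F
    Z c) (hcW : ∃ z ∈ Z, ∀ t ∈ Icc 0 (2 * π), (t, c z t) ∈ tubeNbhd E ρ) (hα : IsAnalyticPrimitiveOn
    Ω α G) (hG : ∀ z ∈ Z, range (c z) ⊆ G) : MineurArnoldFormula α Z c J := by
  have hG' : ∀ z ∈ Z, ∀ t, c z t ∈ G := fun z hz t => hG z hz ⟨t, rfl⟩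
  have hrep : ∀ z ∈ Z, ∃ (k : Target n → ℝ) (W : Set (ℝ × M)), AnalyticAt ℝ k z ∧ IsOpen W ∧
      (∀ t ∈ Icc 0 (2 * π), (t, c z t) ∈ W) ∧
      (∀ w c, IsFiberLoop F w c → (∀ t ∈ Icc 0 (2 * π), (t, c t) ∈ W) →
        loopIntegral α c = k w) ∧ (fun w => loopIntegral α (c w)) =ᶠ[𝓝 z] k := by
    intro z hz
    obtain ⟨k, W, hk, hW, hzW, hkW⟩ := Integrable.exists_loopIntegral_eq h hα (hc.isFiberLoop hz)
      (hG' z hz) fun t => momentumRank_eq_iff.1 (hc.regular z hz t)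
    refine ⟨k, W, hk, hW, hzW, hkW, ?_⟩
    filter_upwards [eventually_graph_mem hZo hc.continuousOn hz hW isCompact_Icc hzW,
      hZo.mem_nhds hz] with w hw hwZ
    exact hkW w (c w) (hc.isFiberLoop hwZ) hw
  have hA : AnalyticOnNhd ℝ (fun z => loopIntegral α (c z)) Z := by
    intro z hz
    obtain ⟨k, W, hk, -, -, -, he⟩ := hrep z hz
    exact hk.congr he.symm
  have hgrad : ∀ z ∈ Z, (∀ t ∈ Icc 0 (2 * π), (t, c z t) ∈ tubeNbhd E ρ) →
      HasGradientAt (fun w => loopIntegral α (c w)) ((2 * π) • b z) z := by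
    intro z hz hzt
    obtain ⟨k, W, hk, hW, hzW, hkW, he⟩ := hrep z hz
    obtain ⟨hz₂, τ, hτ, hτ₁, hτE, hτp⟩ := ht.exists_lift h hN h₁ h₂ h₃ (hc.isFiberLoop hz) hzt
    have h4 := ht.hasGradientAt_loopIntegral h hN hα hz₂ hτ hτ₁ hτp
      (fun t => by rw [hτE]; exact hG' z hz t)
    have hB : IsOpen {w : Target n | ‖w‖ < r₂} := isOpen_lt continuous_norm continuous_const
    have h5 : (fun w => loopIntegral α fun t => E (τ t, w)) =ᶠ[𝓝 z] k := by
      have h6 : ∀ᶠ w in 𝓝 z, ∀ t ∈ Icc 0 (2 * π), (t, E (τ t, w)) ∈ W :=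
        eventually_graph_mem hB (ht.continuousOn_comp hτ.continuous hτ₁) hz₂ hW isCompact_Icc
          fun t htt => by rw [hτE]; exact hzW t htt
      filter_upwards [h6, hB.mem_nhds hz₂] with w hw hw₂
      exact hkW w _ (ht.isFiberLoop hN hτ hτ₁ hτp hw₂) hw
    rw [hasGradientAt_iff_hasFDerivAt] at h4 ⊢
    exact h4.congr_of_eventuallyEq (he.trans h5.symm)
  obtain ⟨z₁, hz₁, hz₁W⟩ := hcW
  have hD : AnalyticOnNhd ℝ (fun z => J z - 1 / (2 * π) * loopIntegral α (c z)) Z :=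
    fun z hz => (hJ z (hZV hz)).sub (analyticAt_const.mul (hA z hz))
  have hnear := eventually_graph_mem hZo hc.continuousOn hz₁ (ht.isOpen_tubeNbhd h h₁ h₂)
    isCompact_Icc hz₁W
  obtain ⟨δ, hδ, hball⟩ := eventually_nhds_iff_ball.1 (hnear.and (hZo.mem_nhds hz₁))
  have hloc : (fun z => J z - 1 / (2 * π) * loopIntegral α (c z)) =ᶠ[𝓝 z₁]
      fun _ => J z₁ - 1 / (2 * π) * loopIntegral α (c z₁) := by
    filter_upwards [ball_mem_nhds z₁ hδ] with w hw
    have hd : ∀ z ∈ ball z₁ δ, HasFDerivAt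
        (fun z => J z - 1 / (2 * π) * loopIntegral α (c z)) (0 : Target n →L[ℝ] ℝ) z := by
      intro z hz
      obtain ⟨h4, h5⟩ := hball z hz
      have h6 := (hJb z (hZV h5)).hasFDerivAt.sub ((hgrad z h5 h4).hasFDerivAt.const_mul
        (1 / (2 * π)))
      refine h6.congr_fderiv ?_
      rw [map_smul, smul_smul, one_div_mul_cancel Real.two_pi_pos.ne', one_smul, sub_self]
    exact isOpen_ball.is_const_of_fderiv_eq_zero (𝕜 := ℝ) (convex_ball z₁ δ).isPreconnected
      (fun z hz => (hd z hz).differentiableAt.differentiableWithinAt) (fun z hz => (hd z hz).fderiv)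
      hw (mem_ball_self hδ)
  have hconst := hD.eqOn_of_preconnected_of_eventuallyEq (fun _ _ => analyticAt_const)
    hZc.isPreconnected hz₁ hloc
  refine ⟨J z₁ - 1 / (2 * π) * loopIntegral α (c z₁), fun z hz => ?_⟩
  have h4 := hconst hz
  simp only at h4
  linarith

lemma IsTube.isOpen_image (ht : IsTube Ω F p r₁ r₂ b E) (h : IsIntegrableSystem Ω F) {D : Set
    (Coords n)} (hD : IsOpen D) (hDt : D ⊆ tubeDom r₁ r₂) : IsOpen (E '' D) := by
  rw [isOpen_iff_mem_nhds]
  rintro _ ⟨x, hx, rfl⟩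
  obtain ⟨g, hg, hgx, hEg, -⟩ := exists_local_inverse (ht.analytic x (hDt hx))
    (ht.bijective h (hDt hx))
  have h1 : ∀ᶠ m in 𝓝 (E x), g m ∈ D :=
    hg.continuousAt.preimage_mem_nhds (by rw [hgx]; exact hD.mem_nhds hx)
  filter_upwards [h1, hEg] with m hm hm'
  exact ⟨g m, hm, hm'⟩

variable (n) in
def offAxisPair : Coords n →L[ℝ] Coords n :=
  (offAxis n).prodMap (ContinuousLinearMap.id ℝ (Target n))

lemma linRetract_offAxisPair (s : ℝ) (x : Coords n) : linRetract (offAxisPair n) s x = (x.1 0 • axis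
    n + s • offAxis n x.1, s • x.2) := by
  rw [linRetract_apply]
  refine Prod.ext ?_ ?_
  · change x.1 - offAxis n x.1 + s • offAxis n x.1 = _
    congr 1
    rw [offAxis_apply, sub_sub_cancel]
  · change x.2 - x.2 + s • x.2 = _
    rw [sub_self, zero_add]

lemma linRetract_mem_tubeDom (hx : x ∈ tubeDom r₁ r₂) (hs : s ∈ Icc (0 : ℝ) 1) : linRetract
    (offAxisPair n) s x ∈ tubeDom r₁ r₂ := by
  rw [linRetract_offAxisPair]
  refine ⟨?_, ?_⟩
  · simp only [map_add, map_smul, offAxis_axis, smul_zero, zero_add,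
      offAxis_of_zero (offAxis_zero x.1), norm_smul, Real.norm_eq_abs, abs_of_nonneg hs.1]
    exact (mul_le_of_le_one_left (norm_nonneg _) hs.2).trans_lt hx.1
  · simp only [norm_smul, Real.norm_eq_abs, abs_of_nonneg hs.1]
    exact (mul_le_of_le_one_left (norm_nonneg _) hs.2).trans_lt hx.2

/-- The primitive of the symplectic form in the parameter space of a tube. -/
def tubePrimitive (Ω : DForm n M 2) (E : Coords n → M) : Coords n → (Coords n) [⋀^Fin 1]→L[ℝ] ℝ :=
  homotopyPrimitive (offAxisPair n) (pullForm E Ω)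

lemma IsTube.analyticAt_pullForm (ht : IsTube Ω F p r₁ r₂ b E) (h : IsIntegrableSystem Ω F) (hx : x
    ∈ tubeDom r₁ r₂) : AnalyticAt ℝ (pullForm E Ω) x :=
  (contDiffAt_pullForm h.symplectic.analytic (mem_univ _) (ht.analytic x hx)).analyticAt

lemma IsTube.analyticAt_tubePrimitive (ht : IsTube Ω F p r₁ r₂ b E) (h : IsIntegrableSystem Ω F) (hx
    : x ∈ tubeDom r₁ r₂) : AnalyticAt ℝ (tubePrimitive Ω E) x :=
  analyticAt_homotopyPrimitive fun _ hs => ht.analyticAt_pullForm h (linRetract_mem_tubeDom hx hs)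

lemma IsTube.extDeriv_tubePrimitive (ht : IsTube Ω F p r₁ r₂ b E) (h : IsIntegrableSystem Ω F) (hx :
    x ∈ tubeDom r₁ r₂) : extDeriv (tubePrimitive Ω E) x = pullForm E Ω x := by
  refine extDeriv_homotopyPrimitive
    (fun s hs => ht.analyticAt_pullForm h (linRetract_mem_tubeDom hx hs)) (fun s hs => ?_) ?_
  · rw [extDeriv_pullForm h.symplectic.analytic h.symplectic.closed (mem_univ _)
      (ht.analytic _ (linRetract_mem_tubeDom hx hs))]
    rfl
  · intro u v
    rw [toBilin_apply, linRetract_offAxisPair 0 u, linRetract_offAxisPair 0 v]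
    simp only [zero_smul, add_zero]
    exact (ht.isFiberedAt h (linRetract_mem_tubeDom hx ⟨le_rfl, zero_le_one⟩)).isotropic h _ _

lemma IsTube.tubePrimitive_periodic (ht : IsTube Ω F p r₁ r₂ b E) (hx : x ∈ tubeDom r₁ r₂) (k : ℤ) :
    tubePrimitive Ω E (x.1 + (k * p) • axis n, x.2) = tubePrimitive Ω E x := by
  refine intervalIntegral.integral_congr fun s hs => ?_
  rw [uIcc_of_le zero_le_one] at hs
  have h1 : offAxisPair n (x.1 + (k * p) • axis n, x.2) = offAxisPair n x := by
    refine Prod.ext ?_ rfl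
    change offAxis n (x.1 + (k * p) • axis n) = offAxis n x.1
    simp [offAxis_axis]
  have h2 : linRetract (offAxisPair n) s (x.1 + (k * p) • axis n, x.2) =
      ((linRetract (offAxisPair n) s x).1 + (k * p) • axis n,
        (linRetract (offAxisPair n) s x).2) := by
    rw [linRetract_offAxisPair, linRetract_offAxisPair]
    refine Prod.ext ?_ rfl
    simp only [PiLp.add_apply, PiLp.smul_apply, axis_zero, smul_eq_mul, mul_one, map_add, map_smul,
      offAxis_axis, smul_zero, add_zero]
    module
  simp only [h1, h2, pullForm_periodic ht.analytic ht.periodic Ω (linRetract_mem_tubeDom hx hs) k]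

theorem IsTube.exists_primitive (ht : IsTube Ω F p r₁ r₂ b E) (h : IsIntegrableSystem Ω F) : ∃ α :
    DForm n M 1, IsAnalyticPrimitiveOn Ω α (E '' tubeDom r₁ r₂) := by
  classical
  set D : Set (Coords n) := tubeDom r₁ r₂ with hDdef
  set β := tubePrimitive Ω E
  have hloc : ∀ x : D, ∃ g : M → Coords n, ContMDiffAt 𝓘[n] 𝓘(ℝ, Coords n) ω g (E x) ∧ g (E x) = x ∧
      (∀ᶠ m in 𝓝 (E x), E (g m) = m) ∧ ∀ᶠ y in 𝓝 (x : Coords n), g (E y) = y :=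
    fun x => exists_local_inverse (ht.analytic x x.2) (ht.bijective h x.2)
  choose g hg hgx hEg hgE using hloc
  have hpre : ∀ m : M, ∃ x : D, m ∈ E '' D → E x = m := by
    intro m
    by_cases hm : m ∈ E '' D
    · obtain ⟨x, hx, hxm⟩ := hm
      exact ⟨⟨x, hx⟩, fun _ => hxm⟩
    · exact ⟨⟨0, by simp [hDdef, tubeDom, ht.width_pos, ht.base_pos]⟩, fun h => absurd h hm⟩
  choose x hx using hpre
  let α : DForm n M 1 := fun m =>
    ((β (x m)).compContinuousLinearMap (dFun n (g (x m)) m) : Model n [⋀^Fin 1]→L[ℝ] ℝ)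
  have hpull : ∀ y ∈ D, pullForm E α y = β y := by
    intro y hy
    have hxy : E (x (E y)) = E y := hx (E y) ⟨y, hy, rfl⟩
    set x₀ : D := x (E y)
    obtain ⟨h2, k, hk⟩ := ht.injective x₀ x₀.2 y hy hxy
    have hx₀ : (x₀ : Coords n) = (y.1 + (k * p) • axis n, y.2) := Prod.ext (by rw [← hk]; simp) h2
    have hβ : β x₀ = β y := by rw [hx₀]; exact ht.tubePrimitive_periodic hy k
    have hcomp : fderiv ℝ (fun y => g x₀ (E y)) y = ContinuousLinearMap.id ℝ _ := by
      have hφ : HasFDerivAt (fun y : Coords n => y + ((k * p) • axis n, 0))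
          (ContinuousLinearMap.id ℝ _) y := (hasFDerivAt_id y).add_const _
      have hφx : y + (((k * p) • axis n, 0) : Coords n) = (x₀ : Coords n) := by rw [hx₀]; simp [Prod.ext_iff]
      have h3 : Tendsto (fun y : Coords n => y + ((k * p) • axis n, 0)) (𝓝 y)
          (𝓝 (x₀ : Coords n)) := by
        rw [← hφx]; exact hφ.continuousAt
      have h4 : (fun y => g x₀ (E y)) =ᶠ[𝓝 y] fun y => y + ((k * p) • axis n, 0) := by
        filter_upwards [h3.eventually (hgE x₀), (isOpen_tubeDom r₁ r₂).mem_nhds hy] with z hz hzD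
        rw [← hz, ← ht.periodic_int hzD k]
        simp [Prod.add_def]
      rw [h4.fderiv_eq, hφ.fderiv]
    have hgd := hg x₀
    rw [hxy] at hgd
    rw [fderiv_fun_comp_param (n := n) ((ht.analytic y hy).mdiff)
      (hgd.mdiff)] at hcomp
    have h5 : pullForm E α y = (β x₀).compContinuousLinearMap
        ((dFun n (g x₀) (E y)).comp (dParam n E y)) := rfl
    rw [h5, hcomp, hβ]
    rfl
  have hchart : ∀ e ∈ atlas (Model n) M, ∀ u ∈ e.target ∩ e.symm ⁻¹' (E '' D),
      ∃ ψ : Model n → Coords n, ContDiffAt ℝ ω ψ u ∧ ψ u ∈ D ∧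
        ∀ᶠ w in 𝓝 u, formInChart e α w = (β (ψ w)).compContinuousLinearMap (fderiv ℝ ψ w) ∧
          formInChart e Ω w = (pullForm E Ω (ψ w)).compContinuousLinearMap (fderiv ℝ ψ w) := by
    rintro e he u ⟨hu, y, hy, hyu⟩
    have hsymm := contMDiffAt_chart_symm he hu
    set y' : D := ⟨y, hy⟩
    have hg' := hg y'
    have hEg' := hEg y'
    have hgy := hgx y'
    have hyu' : E y' = e.symm u := hyu
    rw [hyu'] at hg' hEg' hgy
    have hψ : ContDiffAt ℝ ω (fun w => g y' (e.symm w)) u :=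
      contMDiffAt_iff_contDiffAt.1 (ContMDiffAt.comp (g := g y') (f := e.symm) u hg' hsymm)
    have h1 : ∀ᶠ w in 𝓝 u, g y' (e.symm w) ∈ D := hψ.continuousAt.preimage_mem_nhds (by
        rw [hgy]; exact (isOpen_tubeDom r₁ r₂).mem_nhds y'.2)
    have h2 : (E ∘ fun w => g y' (e.symm w)) =ᶠ[𝓝 u] e.symm := hsymm.continuousAt.eventually hEg'
    refine ⟨fun w => g y' (e.symm w), hψ, ?_, ?_⟩
    · change g y' (e.symm u) ∈ D
      rw [hgy]; exact y'.2
    filter_upwards [h1, h2.eventually_nhds, hψ.eventually (by decide)] with w hw hw2 hw3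
    have h3 : ∀ {k : ℕ} (η : DForm n M k), formInChart e η w =
        (pullForm E η (g y' (e.symm w))).compContinuousLinearMap
          (fderiv ℝ (fun w => g y' (e.symm w)) w) := by
      intro k η
      have h4 : formInChart e η w = pullForm e.symm η w := rfl
      rw [h4, ← pullForm_congr hw2, pullForm_comp (φ := fun w => g y' (e.symm w)) ((ht.analytic _ hw).mdiff)
        (hw3.diff)]
    exact ⟨by rw [h3, hpull _ hw], h3 Ω⟩
  refine ⟨α, ht.isOpen_image h (isOpen_tubeDom _ _) le_rfl, fun e he u hu => ?_,
    fun e he u hu => ?_⟩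
  · obtain ⟨ψ, hψ, hψD, hev⟩ := hchart e he u hu
    refine AnalyticAt.congr (ContDiffAt.analyticAt ?_) (hev.mono fun w hw => hw.1.symm)
    exact contDiffAt_alternating_pullback (η := β)
      (ht.analyticAt_tubePrimitive h hψD).contDiffAt hψ hψ.analyticAt.fderiv.contDiffAt
  · obtain ⟨ψ, hψ, hψD, hev⟩ := hchart e he u hu
    have h1 : formInChart e α =ᶠ[𝓝 u] fun w => (β (ψ w)).compContinuousLinearMap (fderiv ℝ ψ w) :=
      hev.mono fun w hw => hw.1
    rw [h1.extDeriv_eq, extDeriv_pullback (r := ω)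
      (ht.analyticAt_tubePrimitive h hψD).differentiableAt hψ (by simp),
      ht.extDeriv_tubePrimitive h hψD, hev.self_of_nhds.2]

theorem IsTube.exists_action (ht : IsTube Ω F p r₁ r₂ b E) (h : IsIntegrableSystem Ω F) {N : ℕ} (hN
    : 2 * π = N * p) : ∃ J : Target n → ℝ, AnalyticOnNhd ℝ J (ball 0 r₂) ∧ J 0 = 0 ∧ ∀ z ∈ ball 0
    r₂, HasGradientAt J (b z) z := by
  obtain ⟨α, hα⟩ := ht.exists_primitive h
  set τ : ℝ → Target n := fun t => t • axis n with hτdef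
  have hτ : ContDiff ℝ 1 τ := contDiff_id.smul contDiff_const
  have hτ₁ : ∀ t, ‖offAxis n (τ t)‖ < r₁ := fun t => by simp [hτdef, offAxis_axis, ht.width_pos]
  have hτp : ∀ t, τ (t + 2 * π) = τ t + (2 * π) • axis n := fun t => add_smul _ _ _
  have hD : ∀ z, ‖z‖ < r₂ → ∀ t, (τ t, z) ∈ tubeDom r₁ r₂ := fun z hz t => ⟨hτ₁ t, hz⟩
  set A : Target n → ℝ := fun z => loopIntegral α fun t => E (τ t, z)
  have hA : ∀ z, ‖z‖ < r₂ → AnalyticAt ℝ A z := by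
    intro z hz
    obtain ⟨k, W, hk, hW, hzW, hkW⟩ := exists_loopIntegral_eq h hα
      (ht.isFiberLoop hN hτ hτ₁ hτp hz) (fun t => ⟨_, hD z hz t, rfl⟩)
      (fun t => (ht.isFiberedAt h (hD z hz t)).surjective)
    have hB : IsOpen {w : Target n | ‖w‖ < r₂} := isOpen_lt continuous_norm continuous_const
    refine hk.congr (EventuallyEq.symm ?_)
    filter_upwards [eventually_graph_mem (f := fun w t => E (τ t, w)) hB
      (ht.continuousOn_comp hτ.continuous hτ₁) hz hW isCompact_Icc hzW, hB.mem_nhds hz]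
      with w hw hw₂
    exact hkW w _ (ht.isFiberLoop hN hτ hτ₁ hτp hw₂) hw
  refine ⟨fun z => 1 / (2 * π) * (A z - A 0), fun z hz => ?_, by simp, fun z hz => ?_⟩
  · exact analyticAt_const.mul ((hA z (by simpa using hz)).sub analyticAt_const)
  · have hz' : ‖z‖ < r₂ := by simpa using hz
    have h1 := ht.hasGradientAt_loopIntegral h hN hα hz' hτ hτ₁ hτp (fun t => ⟨_, hD z hz' t, rfl⟩)
    rw [hasGradientAt_iff_hasFDerivAt] at h1 ⊢
    refine ((h1.sub_const (A 0)).const_mul (1 / (2 * π))).congr_fderiv ?_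
    rw [map_smul, smul_smul, one_div_mul_cancel Real.two_pi_pos.ne', one_smul]

lemma flow_periodic_of_closed (hv : ∀ p ∈ N, VFAnalyticAt v p) (hp : 0 < p) (hdom : (p, m) ∈
    flowDomain v N) (hpm : localFlow v N (p, m) = m) : ∀ t, (t, m) ∈ flowDomain v N ∧ localFlow v N
    (t + p, m) = localFlow v N (t, m) := by
  obtain ⟨a, b, h0, hpI, hz, hσ⟩ := exists_isFlowCurve_localFlow hv hdom
  refine flow_periodic hv hp (fun t ht => ?_) hpm
  by_cases h : 0 ≤ t
  · have h1 := hσ.mem_flowDomain h0 (t := t) ⟨h0.1.trans_le h, ht.2.trans_lt hpI.2⟩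
    rwa [hz] at h1
  · have h1 : IsFlowCurve v N (Ioo (a - p) (b - p)) fun t => localFlow v N (t + p, m) :=
      (hσ.shift p).mono fun s hs => ⟨by linarith [hs.1], by linarith [hs.2]⟩
    have h2 := h1.mem_flowDomain (t := t) ⟨by linarith [hpI.1], by linarith [hpI.2]⟩
      ⟨by linarith [h0.1, ht.1], by linarith [hpI.2, not_le.1 h]⟩
    simp only [zero_add, hpm] at h2
    exact h2

lemma mem_of_mem_flowDomain (h : (t, m) ∈ flowDomain v N) : m ∈ N := by
  obtain ⟨a, b, h0, -, σ, hσ0, hσ⟩ := h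
  rw [← show σ 0 = m from hσ0]
  exact (hσ 0 h0).1

lemma eqOn_id_of_eventuallyEq {f : M → M} (hU : IsOpen U) (hUc : IsPreconnected U) (hf : ∀ m ∈ U,
    ContMDiffAt 𝓘[n] 𝓘[n] ω f m) (hq : q ∈ U) (hfq : ∀ᶠ m in 𝓝 q, f m = m) : ∀ m ∈ U, f m = m := by
  have h := hUc.subset_of_closure_inter_subset (u := {m | ∀ᶠ x in 𝓝 m, f x = x})
    (isOpen_iff_mem_nhds.2 fun m hm => eventually_eventually_nhds.2 hm) ⟨q, hq, hfq⟩ ?_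
  · exact fun m hm => (h hm).self_of_nhds
  rintro m ⟨hm, hmU⟩
  have hfm : f m = m := by
    by_contra hne
    obtain ⟨x, hx1, hx2⟩ := mem_closure_iff_nhds.1 hm _
      (((hf m hmU).continuousAt.ne_iff_eventually_ne continuousAt_id).1 hne)
    exact hx1 hx2.self_of_nhds
  set e := chartAt (Model n) m
  have he := chart_mem_atlas (Model n) m
  have hme := mem_chart_source (Model n) m
  have hsymm : ContinuousAt e.symm (e m) := e.continuousAt_symm (e.map_source hme)
  have h2 : ∀ᶠ y in 𝓝 (e m), y ∈ e.target ∧ e.symm y ∈ U ∧ f (e.symm y) ∈ e.source := by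
    have h3 : ∀ᶠ x in 𝓝 m, x ∈ U ∧ f x ∈ e.source :=
      Filter.inter_mem (hU.mem_nhds hmU) ((hf m hmU).continuousAt.preimage_mem_nhds
        (by rw [hfm]; exact e.open_source.mem_nhds hme))
    rw [ContinuousAt, e.left_inv hme] at hsymm
    exact Filter.inter_mem (e.open_target.mem_nhds (e.map_source hme)) (hsymm.eventually h3)
  obtain ⟨r, hr, hball⟩ := eventually_nhds_iff_ball.1 h2
  have hφ : AnalyticOnNhd ℝ (fun y => e (f (e.symm y))) (ball (e m) r) := by
    intro y hy
    obtain ⟨hy1, hy2, hy3⟩ := hball y hy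
    exact (contDiffAt_chart_comp (E := fun y => f (e.symm y)) le_rfl he
      (ContMDiffAt.comp (g := f) (f := e.symm) y (hf _ hy2) (contMDiffAt_chart_symm he hy1))
      hy3).analyticAt
  obtain ⟨x, hxe, hx⟩ := mem_closure_iff_nhds.1 hm (e.source ∩ e ⁻¹' ball (e m) r)
    (e.continuousAt hme |>.preimage_mem_nhds (ball_mem_nhds _ hr) |>
      Filter.inter_mem (e.open_source.mem_nhds hme))
  have h4 : (fun y => e (f (e.symm y))) =ᶠ[𝓝 (e x)] fun y => y := by
    have h5 : Tendsto e.symm (𝓝 (e x)) (𝓝 x) := by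
      have := e.continuousAt_symm (e.map_source hxe.1)
      rwa [ContinuousAt, e.left_inv hxe.1] at this
    filter_upwards [h5.eventually hx, e.open_target.mem_nhds (e.map_source hxe.1)] with y hy hyt
    rw [hy, e.right_inv hyt]
  have h6 := hφ.eqOn_of_preconnected_of_eventuallyEq (fun _ _ => analyticAt_id)
    (convex_ball _ _).isPreconnected hxe.2 h4
  have h7 : ∀ᶠ x in 𝓝 m, x ∈ e.source ∧ e x ∈ ball (e m) r :=
    Filter.inter_mem (e.open_source.mem_nhds hme) (e.continuousAt hme |>.preimage_mem_nhds
      (ball_mem_nhds _ hr))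
  filter_upwards [h7] with y hy
  have h8 := h6 hy.2
  have h9 := (hball _ hy.2).2.2
  simp only [e.left_inv hy.1] at h8 h9
  exact e.injOn h9 hy.1 h8

theorem exists_periodic_domain (hN : IsOpen N) (hv : ∀ p ∈ N, VFAnalyticAt v p) (hL : 0 < L) {S :
    Set M} (hS : IsPreconnected S) (hdom : ∀ m ∈ S, (L, m) ∈ flowDomain v N) (hq : q ∈ S) (hid : ∀ᶠ
    m in 𝓝 q, localFlow v N (L, m) = m) : ∃ U, IsOpen U ∧ S ⊆ U ∧ U ⊆ N ∧ IsPreconnected U ∧ ∀ m ∈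
    U, ∀ t, (t, m) ∈ flowDomain v N ∧ localFlow v N (t, m) ∈ U ∧ localFlow v N (t + L, m) =
    localFlow v N (t, m) := by
  have : LocallyConnectedSpace M := ChartedSpace.locallyConnectedSpace (Model n) M
  set D : Set M := {m | (L, m) ∈ flowDomain v N} with hD
  have hDo : IsOpen D := (isOpen_flowDomain hN hv).preimage (Continuous.prodMk_right L)
  set U := connectedComponentIn D q with hU
  have hUD : U ⊆ D := connectedComponentIn_subset D q
  have hUo : IsOpen U := hDo.connectedComponentIn
  have hSU : S ⊆ U := hS.subset_connectedComponentIn hq hdom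
  have hUid := eqOn_id_of_eventuallyEq hUo isPreconnected_connectedComponentIn
    (f := fun m => localFlow v N (L, m)) (fun m hm => contMDiffAt_localFlow_snd hN hv (hUD hm))
    (hSU hq) hid
  refine ⟨U, hUo, hSU, fun m hm => mem_of_mem_flowDomain (hUD hm),
    isPreconnected_connectedComponentIn, fun m hm t => ?_⟩
  have hper := flow_periodic_of_closed hv hL (hUD hm) (hUid m hm)
  refine ⟨(hper t).1, ?_, (hper t).2⟩
  have hcurve : Continuous fun t => localFlow v N (t, m) := continuous_iff_continuousAt.2 fun t =>
    (hasVelocityAt_localFlow hv (hper t).1).continuousAt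
  have hrange : range (fun t => localFlow v N (t, m)) ⊆ D := by
    rintro _ ⟨s, rfl⟩
    obtain h1 : IsFlowCurve v N (Ioo (-(L + 1)) (L + 1)) fun t => localFlow v N (t + s, m) :=
      fun t _ => ⟨localFlow_mem hv (hper _).1, (hasVelocityAt_localFlow hv (hper _).1).comp_add⟩
    have h2 := h1.mem_flowDomain (t := L) ⟨by linarith, by linarith⟩ ⟨by linarith, by linarith⟩
    simp only [zero_add] at h2
    exact h2
  have h3 : range (fun t => localFlow v N (t, m)) ⊆ U := by
    have h4 := (isPreconnected_range hcurve).subset_connectedComponentIn (x := m)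
      ⟨0, localFlow_zero m hv⟩ hrange
    have h5 := connectedComponentIn_eq hm
    rw [hU, h5]
    exact h4
  exact h3 ⟨t, rfl⟩

section CircleAction
variable {V : Set (Target n)}

lemma hamField_eq_fiberField (h : IsIntegrableSystem Ω F) (hJ : ∀ z ∈ V, HasGradientAt J (b z) z)
    (hm : F m ∈ V) : hamField Ω (fun p => J (F p)) m = fiberField Ω F b m := by
  rw [hamField_comp h (hJ _ hm).differentiableAt, (hJ _ hm).gradient, fiberField]

lemma IsHamiltonianCircleAction.isFlowCurve (h : IsIntegrableSystem Ω F) (hJ : ∀ z ∈ V,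
    HasGradientAt J (b z) z) (hU : U ⊆ F ⁻¹' V) {Φ : AddCircle (2 * π) → M → M} (hΦ :
    IsHamiltonianCircleAction Ω F U (fun p => J (F p)) Φ) (hm : m ∈ U) : IsFlowCurve (fiberField Ω F
    b) (F ⁻¹' V) univ fun t : ℝ => Φ (t : AddCircle (2 * π)) m := by
  intro t _
  have h1 : F (Φ (t : AddCircle (2 * π)) m) ∈ V := hU (hΦ.mapsTo _ hm)
  refine ⟨h1, ?_⟩
  rw [← hamField_eq_fiberField h hJ h1]
  exact hΦ.generated m hm t

lemma IsHamiltonianCircleAction.eqOn (h : IsIntegrableSystem Ω F) (hb : ∀ z ∈ V, AnalyticAt ℝ b z)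
    {J' : Target n → ℝ} (hJ : ∀ z ∈ V, HasGradientAt J (b z) z) (hJ' : ∀ z ∈ V, HasGradientAt J' (b
    z) z) (hU : U ⊆ F ⁻¹' V) {Φ Φ' : AddCircle (2 * π) → M → M} (hΦ : IsHamiltonianCircleAction Ω F
    U (fun p => J (F p)) Φ) (hΦ' : IsHamiltonianCircleAction Ω F U (fun p => J' (F p)) Φ') (θ :
    AddCircle (2 * π)) : EqOn (Φ' θ) (Φ θ) U := by
  intro m hm
  obtain ⟨t, rfl⟩ := QuotientAddGroup.mk_surjective θ
  refine (hΦ'.isFlowCurve h hJ' hU hm).eqOn (fun p hp => vfAnalyticAt_fiberField h (hb _ hp))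
    (hΦ.isFlowCurve h hJ hU hm) isOpen_univ isPreconnected_univ (mem_univ 0) ?_ (mem_univ t)
  simp only [QuotientAddGroup.mk_zero]
  rw [hΦ'.zero_act m hm, hΦ.zero_act m hm]

open Classical in
theorem exists_circleAction (h : IsIntegrableSystem Ω F) (hV : IsOpen V) (hb : ∀ z ∈ V, AnalyticAt ℝ
    b z) (hJ : ∀ z ∈ V, HasGradientAt J (b z) z) (hUV : U ⊆ F ⁻¹' V) (hU : ∀ m ∈ U, ∀ t, (t, m) ∈
    flowDomain (fiberField Ω F b) (F ⁻¹' V) ∧ localFlow (fiberField Ω F b) (F ⁻¹' V) (t, m) ∈ U ∧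
    localFlow (fiberField Ω F b) (F ⁻¹' V) (t + 2 * π, m) = localFlow (fiberField Ω F b) (F ⁻¹' V)
    (t, m)) : ∃ Φ, IsHamiltonianCircleAction Ω F U (fun p => J (F p)) Φ := by
  set v := fiberField Ω F b
  set N : Set M := F ⁻¹' V
  have hN : IsOpen N := hV.preimage h.analytic.continuous
  have hv : ∀ p ∈ N, VFAnalyticAt v p := fun p hp => vfAnalyticAt_fiberField h (hb _ hp)
  set f : M → ℝ → M := fun m t => if m ∈ U then localFlow v N (t, m) else m
  have hf : ∀ m, Periodic (f m) (2 * π) := by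
    intro m t
    by_cases hm : m ∈ U
    · simp only [f, if_pos hm]; exact (hU m hm t).2.2
    · simp only [f, if_neg hm]
  set Φ : AddCircle (2 * π) → M → M := fun θ m => (hf m).lift θ
  have hΦ : ∀ (t : ℝ), ∀ m ∈ U, Φ (t : AddCircle (2 * π)) m = localFlow v N (t, m) := by
    intro t m hm
    change f m t = _
    simp only [f, if_pos hm]
  refine ⟨Φ, ?_, fun m hm => ?_, ?_, ?_, ?_, fun m hm t => ?_⟩
  · intro θ m hm
    obtain ⟨t, rfl⟩ := QuotientAddGroup.mk_surjective θ
    exact (hΦ t m hm).symm ▸ (hU m hm t).2.1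
  · exact (hΦ 0 m hm).trans (localFlow_zero m hv)
  · intro θ θ' m hm
    obtain ⟨t, rfl⟩ := QuotientAddGroup.mk_surjective θ
    obtain ⟨s, rfl⟩ := QuotientAddGroup.mk_surjective θ'
    have h1 := (localFlow_add hv (s := s) (t := t) (m := m) (hU m hm s).1
      (hU _ (hU m hm s).2.1 t).1).2
    refine (hΦ (t + s) m hm).trans (h1.trans ?_)
    have h2 : Φ (s : AddCircle (2 * π)) m = localFlow v N (s, m) := hΦ s m hm
    have h3 := hΦ t _ (hU m hm s).2.1
    rw [← h2] at h3
    rw [← h2]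
    exact h3.symm
  · rintro ⟨t, m⟩ ⟨-, hm⟩
    have h1 := (contMDiffAt_localFlow hN hv (hU m hm t).1).contMDiffWithinAt (s := univ ×ˢ U)
    exact h1.congr (fun q hq => hΦ q.1 q.2 hq.2) (hΦ t m hm)
  · intro θ m hm
    obtain ⟨t, rfl⟩ := QuotientAddGroup.mk_surjective θ
    exact (congrArg F (hΦ t m hm)).trans (momentum_localFlow h (fun p hp => hb _ hp) (t, m))
  · have h1 : (fun t : ℝ => Φ (t : AddCircle (2 * π)) m) = fun t => localFlow v N (t, m) :=
      funext fun t => hΦ t m hm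
    have h2 := hasVelocityAt_localFlow hv (hU m hm t).1
    have h3 : hamField Ω (fun p => J (F p)) (localFlow v N (t, m)) = v (localFlow v N (t, m)) :=
      hamField_eq_fiberField h hJ (hUV (hU m hm t).2.1)
    have h4 : HasVelocityAt (fun t => localFlow v N (t, m)) t
        (hamField Ω (fun p => J (F p)) (localFlow v N (t, m))) := by rw [h3]; exact h2
    have h5 : HasVelocityAt (fun t : ℝ => Φ (t : AddCircle (2 * π)) m) t
        (hamField Ω (fun p => J (F p)) (Φ (t : AddCircle (2 * π)) m)) := by
      rw [h1, hΦ t m hm]; exact h4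
    exact h5
end CircleAction

lemma IsTube.isFlowCurve (ht : IsTube Ω F p r₁ r₂ b E) {b' : Target n → Target n} {V : Set (Target
    n)} {u : Target n} (hζ : ‖ζ‖ < r₂) (hζV : ζ ∈ V) (hI : ∀ s ∈ I, ‖offAxis n (τ + s • u)‖ < r₁)
    (hu : driftMap (b ζ) u = b' ζ) : IsFlowCurve (fiberField Ω F b') (F ⁻¹' V) I fun s => E (τ + s •
    u, ζ) := by
  intro s hs
  have hD : (τ + s • u, ζ) ∈ tubeDom r₁ r₂ := ⟨hI s hs, hζ⟩
  refine ⟨by rw [mem_preimage, ht.momentum _ hD]; exact hζV, ?_⟩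
  have hd : HasDerivAt (fun s : ℝ => ((τ + s • u, ζ) : Coords n)) (u, 0) s := by
    refine HasDerivAt.prodMk ?_ (hasDerivAt_const _ _)
    simpa using ((hasDerivAt_id s).smul_const u).const_add τ
  have h1 := HasVelocityAt.comp_param (n := n) (E := E) ((ht.analytic _ hD).mdiff) hd
  rw [ht.dParam_eq _ hD, ← driftMap_apply] at h1
  simp only [hu] at h1
  rw [fiberField, ht.momentum _ hD]
  exact h1

lemma IsTube.flow_closed (ht : IsTube Ω F p r₁ r₂ b E) (h : IsIntegrableSystem Ω F) {N : ℕ} (hN : 2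
    * π = N * p) {V : Set (Target n)} (hb : ∀ z ∈ V, AnalyticAt ℝ b z) (hx : x ∈ tubeDom r₁ r₂) (hxV
    : x.2 ∈ V) : (2 * π, E x) ∈ flowDomain (fiberField Ω F b) (F ⁻¹' V) ∧ localFlow (fiberField Ω F
    b) (F ⁻¹' V) (2 * π, E x) = E x := by
  have hv : ∀ p ∈ F ⁻¹' V, VFAnalyticAt (fiberField Ω F b) p :=
    fun p hp => vfAnalyticAt_fiberField h (hb _ hp)
  have h1 : IsFlowCurve (fiberField Ω F b) (F ⁻¹' V) (Ioo (-(2 * π)) (2 * π + 1))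
      fun s => E (x.1 + s • axis n, x.2) :=
    ht.isFlowCurve hx.2 hxV (fun s _ => (tubeDom_add_axis hx s).1) (by
      have := driftMap_axis (b x.2) 1
      rwa [one_smul, one_smul] at this)
  have h0 : (0 : ℝ) ∈ Ioo (-(2 * π)) (2 * π + 1) :=
    ⟨by linarith [Real.pi_pos], by linarith [Real.pi_pos]⟩
  have h2 : 2 * π ∈ Ioo (-(2 * π)) (2 * π + 1) :=
    ⟨by linarith [Real.pi_pos], by linarith [Real.pi_pos]⟩
  have hz : E (x.1 + (0 : ℝ) • axis n, x.2) = E x := by simp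
  have h3 := h1.mem_flowDomain h0 h2
  have h4 := h1.localFlow_eq hv h0 h2
  simp only [hz] at h3 h4
  refine ⟨h3, h4.trans ?_⟩
  have h5 := ht.periodic_int hx N
  rw [← h5, hN]
  push_cast
  rfl

lemma IsTube.drift_unique (ht : IsTube Ω F p r₁ r₂ b E) (h : IsIntegrableSystem Ω F) {N : ℕ} (hN0 :
    0 < N) (hN : 2 * π = N * p) {b' : Target n → Target n} {V : Set (Target n)} (hb' : ∀ z ∈ V,
    AnalyticAt ℝ b' z) (hζ : ‖ζ‖ < r₂) (hσ : IsFlowCurve (fiberField Ω F b') (F ⁻¹' V) univ σ) (hσ0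
    : σ 0 = E (0, ζ)) (hσp : σ (2 * π) = σ 0) {κ : ℝ} (hκ : ‖b' ζ - b ζ‖ ≤ κ) (hκN : 2 * κ * N < 1)
    (hκr : 28 * κ < r₁) : b' ζ = b ζ := by
  have hD0 : ((0 : Target n), ζ) ∈ tubeDom r₁ r₂ := ⟨by simpa using ht.width_pos, hζ⟩
  have hζV : ζ ∈ V := by
    have h1 := (hσ 0 trivial).1
    rwa [mem_preimage, hσ0, ht.momentum _ hD0] at h1
  have hb0 := ht.drift_zero_pos hζ
  have hbpos : 0 < b ζ 0 := by linarith
  set q : ℝ := b' ζ 0 / b ζ 0 with hq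
  have hq1 : |q - 1| ≤ 2 * κ := by
    have h1 : q - 1 = (b' ζ - b ζ) 0 / b ζ 0 := by rw [hq, PiLp.sub_apply]; field_simp
    rw [h1, abs_div, abs_of_pos hbpos, div_le_iff₀ hbpos]
    have h2 := (abs_apply_zero_le (b' ζ - b ζ)).trans hκ
    have h3 : 0 ≤ κ := (norm_nonneg _).trans hκ
    nlinarith
  set w : Target n := offAxis n (b' ζ - b ζ) - (q - 1) • offAxis n (b ζ - axis n) with hw
  have hw0 : w 0 = 0 := by simp [hw, offAxis_zero]
  have hwn : ‖w‖ ≤ 4 * κ := by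
    have h1 : ‖offAxis n (b' ζ - b ζ)‖ ≤ 2 * κ := (norm_offAxis_le _).trans (by linarith)
    have h2 : ‖offAxis n (b ζ - axis n)‖ ≤ 1 :=
      (norm_offAxis_le _).trans (by linarith [ht.drift_near ζ hζ])
    refine (norm_sub_le _ _).trans ?_
    rw [norm_smul, Real.norm_eq_abs]
    have h3 := mul_le_mul hq1 h2 (norm_nonneg _) ((abs_nonneg _).trans hq1)
    linarith
  set u : Target n := q • axis n + w with hu
  have hu0 : u 0 = q := by simp [hu, hw0, axis_zero]
  have huo : offAxis n u = w := by simp [hu, offAxis_axis, offAxis_of_zero hw0]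
  have hdu : driftMap (b ζ) u = b' ζ := by
    rw [driftMap_apply, hu0, huo, hw]
    have h1 : b' ζ 0 = q * b ζ 0 := by rw [hq]; field_simp
    simp only [map_sub, offAxis_axis, sub_zero, offAxis_apply, axis_zero]
    rw [h1]
    module
  have h1 : IsFlowCurve (fiberField Ω F b') (F ⁻¹' V) (Ioo (-7) 7)
      fun s => E ((0 : Target n) + s • u, ζ) := by
    refine ht.isFlowCurve hζ hζV (fun s hs => ?_) hdu
    rw [zero_add, map_smul, huo, norm_smul, Real.norm_eq_abs]
    have h2 : |s| ≤ 7 := abs_le.2 ⟨hs.1.le, hs.2.le⟩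
    calc |s| * ‖w‖ ≤ 7 * (4 * κ) := mul_le_mul h2 hwn (norm_nonneg _) (by norm_num)
      _ < r₁ := by linarith
  have hpi : 2 * π ∈ Ioo (-7 : ℝ) 7 := ⟨by linarith [Real.pi_pos], by linarith [Real.pi_lt_d2]⟩
  have h2 := (hσ.mono (subset_univ (Ioo (-7 : ℝ) 7))).eqOn
    (fun p hp => vfAnalyticAt_fiberField h (hb' _ hp)) h1 isOpen_Ioo isPreconnected_Ioo
    (t₀ := 0) (by norm_num) (by simp [hσ0]) hpi
  rw [hσp, hσ0] at h2
  simp only [zero_add] at h2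
  have hD1 : ((2 * π) • u, ζ) ∈ tubeDom r₁ r₂ := by
    refine ⟨?_, hζ⟩
    simp only [map_smul, huo, norm_smul, Real.norm_eq_abs, abs_of_pos Real.two_pi_pos]
    calc 2 * π * ‖w‖ ≤ 7 * (4 * κ) :=
          mul_le_mul (by linarith [hpi.2]) hwn (norm_nonneg _) (by norm_num)
      _ < r₁ := by linarith
  obtain ⟨-, k, hk⟩ := ht.injective _ hD1 _ hD0 h2.symm
  simp only [sub_zero] at hk
  have hk0 := congrArg (fun v : Target n => v 0) hk
  have hko := congrArg (offAxis n) hk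
  simp only [PiLp.smul_apply, hu0, axis_zero, smul_eq_mul, mul_one] at hk0
  simp only [map_smul, huo, offAxis_axis, smul_zero, smul_eq_zero, Real.two_pi_pos.ne',
    false_or] at hko
  have hNk : N * q = k := by
    rw [hN] at hk0
    have := ht.period_pos.ne'
    field_simp at hk0
    linarith
  have hkN : (k : ℤ) - N = 0 := by
    rw [← Int.abs_lt_one_iff]
    have h3 : |((k - N : ℤ) : ℝ)| < 1 := by
      push_cast
      rw [← hNk, show (N : ℝ) * q - N = N * (q - 1) by ring, abs_mul, Nat.abs_cast]
      calc (N : ℝ) * |q - 1| ≤ N * (2 * κ) := mul_le_mul_of_nonneg_left hq1 (Nat.cast_nonneg _)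
        _ < 1 := by linarith
    exact_mod_cast h3
  have hq' : q = 1 := by
    have h3 : (k : ℝ) = N := by exact_mod_cast sub_eq_zero.1 hkN
    rw [h3] at hNk
    have h4 : (N : ℝ) ≠ 0 := by exact_mod_cast hN0.ne'
    field_simp at hNk
    linarith
  rw [← hdu, hu, hko, hq', add_zero, driftMap_axis, one_smul]

section PeriodicTube
variable {N : ℕ}

/-- A tube, contained in a domain on which the flow with the drift of the tube is periodic, and a
function of the momentum map which generates this flow. -/
structure IsPeriodicTube (Ω : DForm n M 2) (F : M → Target n) (p r₁ r₂ : ℝ)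
    (b : Target n → Target n) (E : Coords n → M) (N : ℕ) (J : Target n → ℝ) (U : Set M) : Prop where
  tube : IsTube Ω F p r₁ r₂ b E
  count_pos : 0 < N
  period_eq : 2 * π = N * p
  action_analytic : AnalyticOnNhd ℝ J (ball 0 r₂)
  action_zero : J 0 = 0
  hasGradient : ∀ z ∈ ball 0 r₂, HasGradientAt J (b z) z
  isOpen : IsOpen U
  isPreconnected : IsPreconnected U
  image_eq : F '' U = ball 0 r₂
  tube_subset : E '' tubeDom r₁ r₂ ⊆ U
  flow : ∀ m ∈ U, ∀ t, (t, m) ∈ flowDomain (fiberField Ω F b) (F ⁻¹' ball 0 r₂) ∧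
    localFlow (fiberField Ω F b) (F ⁻¹' ball 0 r₂) (t, m) ∈ U ∧
    localFlow (fiberField Ω F b) (F ⁻¹' ball 0 r₂) (t + 2 * π, m) =
      localFlow (fiberField Ω F b) (F ⁻¹' ball 0 r₂) (t, m)

lemma convex_tubeDom (r₁ r₂ : ℝ) : Convex ℝ (tubeDom (n := n) r₁ r₂) := by
  have h1 : Convex ℝ {x : Coords n | offAxis n x.1 ∈ ball (0 : Target n) r₁} :=
    (convex_ball (0 : Target n) r₁).is_linear_preimage
      ((offAxis n).comp (fst ℝ (Target n) (Target n))).isLinear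
  have h2 : Convex ℝ {x : Coords n | x.2 ∈ ball (0 : Target n) r₂} :=
    (convex_ball (0 : Target n) r₂).is_linear_preimage
      (snd ℝ (Target n) (Target n)).isLinear
  convert h1.inter h2 using 1
  ext x
  simp [tubeDom]

lemma IsTube.mono (ht : IsTube Ω F p r₁ r₂ b E) (hr0 : 0 < r) (hr : r ≤ r₂) : IsTube Ω F p r₁ r b E
    := by
  have hD : ∀ x ∈ tubeDom r₁ r, x ∈ tubeDom (n := n) r₁ r₂ := fun x hx => ⟨hx.1, hx.2.trans_le hr⟩
  exact ⟨ht.period_pos, ht.width_pos, hr0, fun ζ hζ => ht.drift_near ζ (hζ.trans_le hr),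
    fun ζ hζ => ht.drift_analytic ζ (hζ.trans_le hr), fun x hx => ht.analytic x (hD x hx),
    fun x hx => ht.momentum x (hD x hx), fun x hx => ht.dParam_eq x (hD x hx),
    fun x hx => ht.periodic x (hD x hx), fun x hx y hy => ht.injective x (hD x hx) y (hD y hy)⟩

lemma IsTube.isPreconnected_image (ht : IsTube Ω F p r₁ r₂ b E) : IsPreconnected (E '' tubeDom r₁
    r₂) :=
  (convex_tubeDom r₁ r₂).isPreconnected.image E fun x hx =>
    (ht.analytic x hx).continuousAt.continuousWithinAt

lemma IsTube.fiberField_analytic (ht : IsTube Ω F p r₁ r₂ b E) (h : IsIntegrableSystem Ω F) : ∀ p ∈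
    F ⁻¹' ball 0 r₂, VFAnalyticAt (fiberField Ω F b) p :=
  fun _ hp => vfAnalyticAt_fiberField h (ht.drift_analytic _ (mem_ball_zero_iff.1 hp))

lemma isOpen_preimage_ball (h : IsIntegrableSystem Ω F) (r : ℝ) : IsOpen (F ⁻¹' ball 0 r) :=
    isOpen_ball.preimage h.analytic.continuous

/-- The periodic flow in a tube extends to a neighbourhood of every connected set that meets the
tube and on which the flow is defined long enough. -/
theorem IsTube.exists_periodicTube (ht : IsTube Ω F p r₁ r₂ b E) (h : IsIntegrableSystem Ω F) (hN0 :
    0 < N) (hN : 2 * π = N * p) {S : Set M} (hS : IsPreconnected S) (hdom : ∀ m ∈ S, (2 * π, m) ∈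
    flowDomain (fiberField Ω F b) (F ⁻¹' ball 0 r₂)) (hx : x ∈ tubeDom r₁ r₂) (hxS : E x ∈ S) : ∃ J
    U, IsPeriodicTube Ω F p r₁ r₂ b E N J U ∧ S ⊆ U := by
  have hv := ht.fiberField_analytic h
  have hba : ∀ z ∈ ball 0 r₂, AnalyticAt ℝ b z :=
    fun z hz => ht.drift_analytic z (mem_ball_zero_iff.1 hz)
  obtain ⟨J, hJa, hJ0, hJb⟩ := ht.exists_action h hN
  have hclosed := fun (y) (hy : y ∈ tubeDom r₁ r₂) =>
    ht.flow_closed h hN hba hy (mem_ball_zero_iff.2 hy.2)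
  obtain ⟨U, hUo, hSU, hUN, hUc, hU⟩ := exists_periodic_domain (isOpen_preimage_ball h r₂) hv
    Real.two_pi_pos (S := S ∪ E '' tubeDom r₁ r₂)
    (IsPreconnected.union (E x) hxS ⟨x, hx, rfl⟩ hS ht.isPreconnected_image)
    (by rintro m (hm | ⟨y, hy, rfl⟩); exacts [hdom m hm, (hclosed y hy).1])
    (q := E x) (Or.inl hxS) (by
      filter_upwards [(ht.isOpen_image h (isOpen_tubeDom r₁ r₂) Subset.rfl).mem_nhds ⟨x, hx, rfl⟩]
      rintro _ ⟨y, hy, rfl⟩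
      exact (hclosed y hy).2)
  refine ⟨J, U, ⟨ht, hN0, hN, hJa, hJ0, hJb, hUo, hUc, ?_, subset_union_right.trans hSU, hU⟩,
    subset_union_left.trans hSU⟩
  refine Subset.antisymm (image_subset_iff.2 hUN) fun z hz => ?_
  have hD : ((0 : Target n), z) ∈ tubeDom r₁ r₂ :=
    ⟨by simpa using ht.width_pos, mem_ball_zero_iff.1 hz⟩
  exact ⟨E (0, z), hSU (Or.inr ⟨_, hD, rfl⟩), ht.momentum _ hD⟩

lemma IsPeriodicTube.subset_preimage (hP : IsPeriodicTube Ω F p r₁ r₂ b E N J U) : U ⊆ F ⁻¹' ball 0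
    r₂ := image_subset_iff.1 hP.image_eq.subset

theorem IsPeriodicTube.exists_circleAction (hP : IsPeriodicTube Ω F p r₁ r₂ b E N J U) (h :
    IsIntegrableSystem Ω F) : ∃ Φ, IsHamiltonianCircleAction Ω F U (fun p => J (F p)) Φ :=
  Integrable.exists_circleAction h isOpen_ball
    (fun z hz => hP.tube.drift_analytic z (mem_ball_zero_iff.1 hz)) hP.hasGradient hP.subset_preimage
    hP.flow

/-- Actions which are generated by functions close to the given one agree with the given action. -/
theorem IsPeriodicTube.action_unique (hP : IsPeriodicTube Ω F p r₁ r₂ b E N J U) (h :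
    IsIntegrableSystem Ω F) {κ : ℝ} (hκN : 2 * κ * N < 1) (hκr : 28 * κ < r₁) {J' : Target n → ℝ}
    (hJ' : AnalyticOnNhd ℝ J' (ball 0 r₂)) (hκ : ∀ᶠ z in 𝓝 0, ‖gradient J' z - b z‖ ≤ κ) {Φ Φ' :
    AddCircle (2 * π) → M → M} (hΦ : IsHamiltonianCircleAction Ω F U (fun p => J (F p)) Φ) (hΦ' :
    IsHamiltonianCircleAction Ω F U (fun p => J' (F p)) Φ') : (∀ z ∈ ball 0 r₂, J' z = J z + J' 0) ∧
    ∀ θ, EqOn (Φ' θ) (Φ θ) U := by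
  have ht := hP.tube
  have hb' : ∀ z ∈ ball 0 r₂, AnalyticAt ℝ (gradient J') z := fun z hz =>
    ((InnerProductSpace.toDual ℝ (Target n)).symm.toContinuousLinearEquiv.toContinuousLinearMap
      |>.analyticAt _).comp (hJ' z hz).fderiv
  have hJg : ∀ z ∈ ball 0 r₂, HasGradientAt J' (gradient J' z) z := fun z hz =>
    (hJ' z hz).differentiableAt.hasGradientAt
  have hball : ball (0 : Target n) r₂ ∈ 𝓝 0 := ball_mem_nhds _ ht.base_pos
  have heq : ∀ᶠ z in 𝓝 0, gradient J' z = b z := by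
    filter_upwards [hκ, hball] with ζ hζκ hζ
    have hζ' := mem_ball_zero_iff.1 hζ
    have hD : ((0 : Target n), ζ) ∈ tubeDom r₁ r₂ := ⟨by simpa using ht.width_pos, hζ'⟩
    have hm : E (0, ζ) ∈ U := hP.tube_subset ⟨_, hD, rfl⟩
    refine ht.drift_unique h hP.count_pos hP.period_eq hb' hζ'
      (hΦ'.isFlowCurve h hJg hP.subset_preimage hm) ?_ ?_ hζκ hκN hκr
    · exact hΦ'.zero_act _ hm
    · simp only [AddCircle.coe_period]
      rfl
  obtain ⟨r, hr, hball'⟩ := eventually_nhds_iff_ball.1 (heq.and hball)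
  have hd : ∀ z ∈ ball (0 : Target n) r, HasFDerivAt (fun z => J' z - J z)
      (0 : Target n →L[ℝ] ℝ) z := by
    intro z hz
    obtain ⟨h1, h2⟩ := hball' z hz
    have h3 := (hJg z h2).hasFDerivAt.sub (hP.hasGradient z h2).hasFDerivAt
    rw [h1, sub_self] at h3
    exact h3
  have hloc : (fun z => J' z - J z) =ᶠ[𝓝 0] fun _ => J' 0 := by
    filter_upwards [ball_mem_nhds _ hr] with z hz
    have h1 := isOpen_ball.is_const_of_fderiv_eq_zero (𝕜 := ℝ)
      (convex_ball (0 : Target n) r).isPreconnected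
      (fun z hz => (hd z hz).differentiableAt.differentiableWithinAt) (fun z hz => (hd z hz).fderiv)
      hz (mem_ball_self hr)
    rw [h1, hP.action_zero, sub_zero]
  have hconst := AnalyticOnNhd.eqOn_of_preconnected_of_eventuallyEq
    (f := fun z => J' z - J z) (g := fun _ => J' 0)
    (fun z hz => (hJ' z hz).sub (hP.action_analytic z hz)) (fun _ _ => analyticAt_const)
    (convex_ball (0 : Target n) r₂).isPreconnected (mem_ball_self ht.base_pos) hloc
  have hJJ : ∀ z ∈ ball 0 r₂, J' z = J z + J' 0 := fun z hz => by
    have := hconst hz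
    simp only at this
    linarith
  refine ⟨hJJ, ?_⟩
  have hJb : ∀ z ∈ ball 0 r₂, HasGradientAt J' (b z) z := by
    intro z hz
    have h1 := (hP.hasGradient z hz).hasFDerivAt.add_const (J' 0)
    rw [hasGradientAt_iff_hasFDerivAt]
    refine h1.congr_of_eventuallyEq ?_
    filter_upwards [isOpen_ball.mem_nhds hz] with w hw using hJJ w hw
  exact hΦ.eqOn h (fun z hz => ht.drift_analytic z (mem_ball_zero_iff.1 hz)) hP.hasGradient hJb
    hP.subset_preimage hΦ'

theorem IsPeriodicTube.exists_formula (hP : IsPeriodicTube Ω F p r₁ r₂ b E N J U) (h :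
    IsIntegrableSystem Ω F) : ∃ (G : Set M) (α : DForm n M 1), IsAnalyticPrimitiveOn Ω α G ∧
    IsClosedCurveFamily F (ball 0 r₂) (fun z t => E (t • axis n, z)) ∧ (∀ z ∈ ball 0 r₂, range (fun
    t : ℝ => E (t • axis n, z)) ⊆ G) ∧ MineurArnoldFormula α (ball 0 r₂) (fun z t => E (t • axis n,
    z)) J := by
  have ht := hP.tube
  have hD : ∀ z ∈ ball (0 : Target n) r₂, ∀ t : ℝ, (t • axis n, z) ∈ tubeDom r₁ r₂ :=
    fun z hz t => ⟨by simp [offAxis_axis, ht.width_pos], mem_ball_zero_iff.1 hz⟩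
  obtain ⟨α, hα⟩ := ht.exists_primitive h
  have hτ : ContDiff ℝ 1 fun t : ℝ => t • axis n := contDiff_id.smul contDiff_const
  have hloop : ∀ z ∈ ball (0 : Target n) r₂,
      IsFiberLoop F z fun t => E (t • axis n, z) := fun z hz =>
    ht.isFiberLoop hP.period_eq hτ (fun t => (hD z hz t).1)
      (fun t => add_smul _ _ _) (mem_ball_zero_iff.1 hz)
  have hc : IsClosedCurveFamily F (ball 0 r₂) fun z t => E (t • axis n, z) := by
    refine ⟨fun z hz => (hloop z hz).periodic, fun z hz => (hloop z hz).contMDiff, ?_,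
      fun z hz => (hloop z hz).mem_fiber, fun z hz t => ?_⟩
    · rintro ⟨z, t⟩ ⟨hz, -⟩
      have h1 : ContinuousAt (fun q : Target n × ℝ => (q.2 • axis n, q.1)) (z, t) := by fun_prop
      exact (ContinuousAt.comp (g := E) (f := fun q : Target n × ℝ => (q.2 • axis n, q.1))
        (x := (z, t)) (ht.analytic _ (hD z hz t)).continuousAt h1).continuousWithinAt
    · exact momentumRank_eq_iff.2 (ht.isFiberedAt h (hD z hz t)).surjective
  have hG : ∀ z ∈ ball 0 r₂, range (fun t : ℝ => E (t • axis n, z)) ⊆ E '' tubeDom r₁ r₂ := by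
    rintro z hz _ ⟨t, rfl⟩
    exact ⟨_, hD z hz t, rfl⟩
  set ρ := min (r₁ / 2) (min r₂ (p / 2))
  have hρ : 0 < ρ := lt_min (half_pos ht.width_pos) (lt_min ht.base_pos (half_pos ht.period_pos))
  have h1 : ρ ≤ r₁ / 2 := min_le_left _ _
  have h2 : ρ ≤ r₂ := (min_le_right _ _).trans (min_le_left _ _)
  have h3 : ρ ≤ p / 2 := (min_le_right _ _).trans (min_le_right _ _)
  refine ⟨_, α, hα, hc, hG, ht.mineurArnoldFormula h hP.period_eq (ρ := ρ) (by linarith) h2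
    (by linarith) hP.action_analytic hP.hasGradient isOpen_ball
    (isConnected_ball ht.base_pos) Subset.rfl hc
    ⟨0, mem_ball_self ht.base_pos, fun t _ => ⟨(t • axis n, 0), ?_, rfl⟩⟩ hα hG⟩
  simpa using hρ
end PeriodicTube

lemma momentum_eq_of_localOrbit (h : IsIntegrableSystem Ω F) {m' : M} (hm : m' ∈ localOrbit Ω F m) :
    F m' = F m := by
  induction hm with
  | refl => rfl
  | tail _ hs ih =>
    obtain ⟨a, σ, hσ, rfl, rfl⟩ := hs
    rw [← ih]
    have hX : (fun x => ∑ j, a j * F x j) = fun x => inner ℝ (WithLp.toLp 2 a) (F x) := by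
      funext x
      simp [PiLp.inner_apply, mul_comm]
    rw [hX] at hσ
    have hd : ∀ t ∈ Icc (0 : ℝ) 1, HasDerivWithinAt (fun t => F (σ t)) 0 (Icc 0 1) t := by
      intro t ht
      have h1 := (h.mdifferentiableAt (σ t)).hasMFDerivAt.comp_hasMFDerivWithinAt t (hσ t ht)
      have h2 : HasFDerivWithinAt (fun t => F (σ t)) ((dFun n F (σ t)).comp
          ((1 : ℝ →L[ℝ] ℝ).smulRight (hamDir Ω F (WithLp.toLp 2 a) (σ t)))) (Icc 0 1) t :=
        hasMFDerivWithinAt_iff_hasFDerivWithinAt.1 h1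
      refine h2.hasDerivWithinAt.congr_deriv ?_
      simp [dFun_hamDir h]
    exact (constant_of_has_deriv_right_zero (fun t ht => (hd t ht).continuousWithinAt)
      (fun t ht => (hd t (Ico_subset_Icc_self ht)).mono_of_mem_nhdsWithin
        (Icc_mem_nhdsGE_of_mem ht)) 1 (right_mem_Icc.2 zero_le_one))

lemma isFlowCurve_axis (hσ : IsMIntegralCurve (I := 𝓘[n]) σ (hamVF Ω (fun p => F p 0))) :
    IsFlowCurve (fiberField Ω F fun _ => axis n) univ univ σ := by
  intro t _
  refine ⟨trivial, ?_⟩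
  rw [fiberField, axis, hamDir_single]
  exact hσ t

lemma IsFlowCurve.of_axis (h : IsIntegrableSystem Ω F) {V : Set (Target n)} (hσ : IsFlowCurve
    (fiberField Ω F fun _ => axis n) univ univ σ) (hb : b (F (σ 0)) = axis n) (hV : F (σ 0) ∈ V) :
    IsFlowCurve (fiberField Ω F b) (F ⁻¹' V) univ σ := by
  intro t ht
  have h1 := hσ.momentum_eq h isOpen_univ isPreconnected_univ ht (mem_univ 0)
  refine ⟨by rw [mem_preimage, h1]; exact hV, ?_⟩
  rw [fiberField, h1, hb]
  exact (hσ t ht).2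

theorem exists_periodicTube (h : IsIntegrableSystem Ω F) {m₁ : M} (hm₁ : F m₁ = 0) (hreg :
    momentumRank F m₁ = n) {γ : ℝ → ℝ → M} (hγ_cont : ContinuousOn (fun p : ℝ × ℝ => γ p.1 p.2) (Ioc
    0 1 ×ˢ univ)) (hγ_traj : ∀ u ∈ Ioc (0 : ℝ) 1, IsMIntegralCurve (I := 𝓘[n]) (γ u) (hamVF Ω (fun p
    => F p 0))) (hγ_per : ∀ u ∈ Ioc (0 : ℝ) 1, Periodic (γ u) (2 * π)) (hγ_orb : ∀ u ∈ Ioc (0 : ℝ)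
    1, range (γ u) ⊆ localOrbit Ω F m₁) (hγ_m₁ : m₁ ∈ range (γ 1)) (hC : ∀ p ∈ familyClosure γ, ∃ σ
    : ℝ → M, σ 0 = p ∧ IsMIntegralCurve (I := 𝓘[n]) σ (hamVF Ω (fun p => F p 0))) : ∃ p r₁ r₂ b E N
    J U, IsPeriodicTube Ω F p r₁ r₂ b E N J U ∧ b 0 = axis n ∧ (∀ ζ, ‖ζ‖ < r₂ → ‖b ζ - axis n‖ ≤ 1 /
    4) ∧ (∀ t : ℝ, E (t • axis n, 0) = γ 1 t) ∧ familyClosure γ ⊆ U := by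
  have h1m : (1 : ℝ) ∈ Ioc (0 : ℝ) 1 := ⟨one_pos, le_rfl⟩
  have hF : ∀ u ∈ Ioc (0 : ℝ) 1, ∀ t, F (γ u t) = 0 := fun u hu t =>
    (momentum_eq_of_localOrbit h (hγ_orb u hu ⟨t, rfl⟩)).trans hm₁
  have hFC : ∀ q ∈ familyClosure γ, F q = 0 := by
    refine closure_minimal (iUnion₂_subset fun u hu => ?_)
      (isClosed_singleton.preimage h.analytic.continuous : IsClosed (F ⁻¹' {0}))
    rintro _ ⟨t, rfl⟩
    exact hF u hu t
  have hcurve := isFlowCurve_axis (hγ_traj 1 h1m)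
  have hreg0 : Surjective (dFun n F (γ 1 0)) := by
    obtain ⟨s, hs⟩ := hγ_m₁
    have hsh : IsFlowCurve (fiberField Ω F fun _ => axis n) univ univ fun t => γ 1 (t + s) :=
      fun t _ => ⟨trivial, (hcurve (t + s) trivial).2.comp_add⟩
    have hv : ∀ q ∈ (univ : Set M), VFAnalyticAt (fiberField Ω F fun _ => axis n) q :=
      fun q _ => vfAnalyticAt_fiberField h analyticAt_const
    have hI : IsFlowCurve (fiberField Ω F fun _ => axis n) univ (Ioo (-|s| - 1) (|s| + 1))
      fun t => γ 1 (t + s) := hsh.mono (subset_univ _)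
    have h0 : (0 : ℝ) ∈ Ioo (-|s| - 1) (|s| + 1) :=
      ⟨by linarith [abs_nonneg s], by linarith [abs_nonneg s]⟩
    have hs' : -s ∈ Ioo (-|s| - 1) (|s| + 1) :=
      ⟨by linarith [le_abs_self s], by linarith [neg_abs_le s]⟩
    have h1 := hI.mem_flowDomain h0 hs'
    have h2 := hI.localFlow_eq hv h0 hs'
    simp only [zero_add, neg_add_cancel] at h1 h2
    rw [← h2]
    exact surjective_dFun_localFlow h isOpen_univ (fun _ _ => analyticAt_const) h1
      (momentumRank_eq_iff.1 (hs ▸ hreg))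
  obtain ⟨p, r₁, r, b, E, ht, hb0, ⟨N, hN0, hN⟩, hE⟩ := exists_tube h hcurve hreg0
    (hF 1 h1m 0) Real.two_pi_pos (hγ_per 1 h1m)
  have hbc : Tendsto (fun ζ => ‖b ζ - axis n‖) (𝓝 0) (𝓝 0) := by
    have := (ht.drift_analytic 0 (by simpa using ht.base_pos)).continuousAt.sub_const (axis n)
    simpa [ContinuousAt, hb0] using this.norm
  obtain ⟨r', hr', hbr⟩ := eventually_nhds_iff_ball.1
    (hbc.eventually_le_const (show (0 : ℝ) < 1 / 4 by norm_num))
  set r₂ := min r r' with hr₂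
  replace ht := ht.mono (lt_min ht.base_pos hr') (min_le_left r r')
  rw [← hr₂] at ht
  have hS : IsPreconnected (familyClosure γ) := by
    have h2 : (⋃ u ∈ Ioc (0 : ℝ) 1, range (γ u)) =
        (fun p : ℝ × ℝ => γ p.1 p.2) '' (Ioc 0 1 ×ˢ univ) := by
      ext q
      simp only [mem_iUnion, mem_range, mem_image, mem_prod, mem_univ, and_true, Prod.exists]
      exact ⟨fun ⟨u, hu, t, e⟩ => ⟨u, t, hu, e⟩, fun ⟨u, t, hu, e⟩ => ⟨u, hu, t, e⟩⟩
    rw [familyClosure, h2]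
    exact ((isPreconnected_Ioc.prod isPreconnected_univ).image _ hγ_cont).closure
  have h00 : ((0 : ℝ) • axis n, (0 : Target n)) ∈ tubeDom r₁ r₂ :=
    ⟨by simpa using ht.width_pos, by simpa using ht.base_pos⟩
  obtain ⟨J, U, hP, hSU⟩ := ht.exists_periodicTube h hN0 hN hS (fun m hm => by
      obtain ⟨σ, rfl, hσ⟩ := hC m hm
      have h1 := (isFlowCurve_axis hσ).of_axis h (b := b) (V := ball 0 r₂)
        (by rw [hFC _ hm, hb0]) (by rw [hFC _ hm]; exact mem_ball_self ht.base_pos)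
      exact (h1.mono (subset_univ (Ioo (-1) (2 * π + 1)))).mem_flowDomain
        ⟨by norm_num, by linarith [Real.pi_pos]⟩ ⟨by linarith [Real.pi_pos], by linarith⟩)
    h00 (by
      rw [hE]
      exact subset_closure (mem_biUnion h1m ⟨0, rfl⟩))
  exact ⟨p, r₁, r₂, b, E, N, J, U, hP, hb0, fun ζ hζ => hbr ζ (mem_ball_zero_iff.2
    (hζ.trans_le (min_le_right _ _))), hE, hSU⟩

lemma isBigO_sub_apply_zero (hJ : AnalyticAt ℝ J 0) (h0 : J 0 = 0) (hg : HasGradientAt J (axis n) 0)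
    : (fun z => J z - z 0) =O[𝓝 0] (fun z => ‖z‖ ^ 2) := by
  obtain ⟨q, hq⟩ := hJ
  have h1 := hq.isBigO_sub_partialSum_pow 2
  refine h1.congr_left fun z => ?_
  have h2 : q.partialSum 2 z = z 0 := by
    rw [FormalMultilinearSeries.partialSum, Finset.sum_range_succ, Finset.sum_range_one]
    have h3 := hq.hasFDerivAt.unique hg.hasFDerivAt
    have h4 : q 1 (fun _ => z) = inner ℝ (axis n) z := by
      have := congrArg (fun L : Target n →L[ℝ] ℝ => L z) h3
      rw [show (fun _ : Fin 1 => z) = ![z] from funext fun i => by fin_cases i; rfl]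
      simpa using this
    have h5 : q 0 (fun _ => z) = 0 := by
      rw [← h0]
      exact hq.coeff_zero _
    rw [h5, h4, zero_add]
    simp [axis, EuclideanSpace.inner_single_left]
  simp only [zero_add, h2]

lemma gradient_eq_axis (hJ : (fun z => J z - z 0) =O[𝓝 0] (fun z => ‖z‖ ^ 2)) : J 0 = 0 ∧
    HasGradientAt J (axis n) 0 := by
  have h0 : J 0 = 0 := by
    have := hJ.eq_zero_imp.self_of_nhds
    simpa using this
  refine ⟨h0, ?_⟩
  rw [hasGradientAt_iff_isLittleO]
  have h1 : (fun z : Target n => ‖z‖ ^ 2) =o[𝓝 0] fun z => z := by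
    have := Asymptotics.isLittleO_norm_pow_id (E' := Target n) (n := 2) (by norm_num)
    exact this
  refine ((hJ.trans_isLittleO h1).congr (fun z => ?_) fun z => (sub_zero z).symm)
  simp [h0, axis, EuclideanSpace.inner_single_left]

section Jets
variable [CompleteSpace Y] [CompleteSpace Z]

/-- The derivatives of order at most `k` of the analytic function `f` at `x` are bounded by `ε`. -/
def JetLE (k : ℕ) (ε : ℝ) (f : X → Y) (x : X) : Prop :=
  ContDiffAt ℝ ω f x ∧ ∀ j ≤ k, ‖iteratedFDeriv ℝ j f x‖ ≤ ε

variable {k l : ℕ} {ε ε' : ℝ} {f g : X → Y} {x : X}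

lemma JetLE.mono (h : JetLE k ε f x) (hl : l ≤ k) (hε : ε ≤ ε') : JetLE l ε' f x :=
  ⟨h.1, fun j hj => (h.2 j (hj.trans hl)).trans hε⟩

lemma JetLE.congr (h : JetLE k ε f x) (hfg : g =ᶠ[𝓝 x] f) : JetLE k ε g x :=
  ⟨h.1.congr_of_eventuallyEq hfg, fun j hj => by rw [(hfg.iteratedFDeriv ℝ j).self_of_nhds]; exact h.2 j hj⟩

lemma JetLE.norm_le (h : JetLE k ε f x) : ‖f x‖ ≤ ε := by simpa using h.2 0 (Nat.zero_le k)

lemma JetLE.nonneg (h : JetLE k ε f x) : 0 ≤ ε := (norm_nonneg _).trans h.norm_le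

lemma JetLE.fderiv (h : JetLE (k + 1) ε f x) : JetLE k ε (fderiv ℝ f) x :=
  ⟨h.1.analyticAt.fderiv.contDiffAt, fun j hj => by
    rw [norm_iteratedFDeriv_fderiv]; exact h.2 _ (Nat.succ_le_succ hj)⟩

lemma JetLE.of_fderiv (hf : ContDiffAt ℝ ω f x) (h0 : ‖f x‖ ≤ ε) (h : JetLE k ε (_root_.fderiv ℝ f)
    x) : JetLE (k + 1) ε f x := by
  refine ⟨hf, fun j hj => ?_⟩
  cases j with
  | zero => simpa using h0
  | succ j => rw [← norm_iteratedFDeriv_fderiv]; exact h.2 j (Nat.le_of_succ_le_succ hj)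

lemma jetLE_zero (hf : ContDiffAt ℝ ω f x) (h0 : ‖f x‖ ≤ ε) : JetLE 0 ε f x :=
  ⟨hf, fun j hj => by rw [Nat.le_zero.1 hj]; simpa using h0⟩

lemma JetLE.prodMk {g : X → Z} (hf : JetLE k ε f x) (hg : JetLE k ε g x) : JetLE k ε (fun x => (f x,
    g x)) x := by
  refine ⟨hf.1.prodMk hg.1, fun j hj => ?_⟩
  rw [iteratedFDeriv_prodMk (hf.1.of_le le_top) (hg.1.of_le le_top) le_rfl,
    ContinuousMultilinearMap.opNorm_prod]
  exact max_le (hf.2 j hj) (hg.2 j hj)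

lemma JetLE.comp_add {a : X} (h : JetLE k ε f (x + a)) : JetLE k ε (fun x => f (x + a)) x :=
  ⟨ContDiffAt.comp (g := f) x h.1 (contDiffAt_id.add contDiffAt_const), fun j hj => by
    rw [iteratedFDeriv_comp_add_right]; exact h.2 j hj⟩

lemma exists_bound_zero_section {T : X × Y → Z} {Q : Set X} (hQ : IsCompact Q) (hT : ∀ x ∈ Q,
    AnalyticAt ℝ T (x, 0)) : ∃ C ≥ 0, ∃ δ > 0, ∀ x ∈ Q, ∀ y, ‖y‖ ≤ δ → AnalyticAt ℝ T (x, y) ∧ ‖T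
    (x, y)‖ ≤ C := by
  refine hQ.induction_on (p := fun Q => ∃ C ≥ 0, ∃ δ > 0, ∀ x ∈ Q, ∀ y, ‖y‖ ≤ δ →
    AnalyticAt ℝ T (x, y) ∧ ‖T (x, y)‖ ≤ C) ⟨0, le_rfl, 1, one_pos, by simp⟩ ?_ ?_ ?_
  · rintro s t hst ⟨C, hC, δ, hδ, h⟩
    exact ⟨C, hC, δ, hδ, fun x hx => h x (hst hx)⟩
  · rintro s t ⟨C, hC, δ, hδ, h⟩ ⟨C', hC', δ', hδ', h'⟩
    refine ⟨max C C', le_max_of_le_left hC, min δ δ', lt_min hδ hδ', fun x hx y hy => ?_⟩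
    rcases hx with hx | hx
    · exact ⟨(h x hx y (hy.trans (min_le_left _ _))).1,
        (h x hx y (hy.trans (min_le_left _ _))).2.trans (le_max_left _ _)⟩
    · exact ⟨(h' x hx y (hy.trans (min_le_right _ _))).1,
        (h' x hx y (hy.trans (min_le_right _ _))).2.trans (le_max_right _ _)⟩
  · intro x hx
    have h1 : ∀ᶠ q in 𝓝 (x, (0 : Y)), ‖T q‖ < ‖T (x, 0)‖ + 1 :=
      (hT x hx).continuousAt.norm.eventually (gt_mem_nhds (lt_add_one _))
    obtain ⟨δ, hδ, hball⟩ := eventually_nhds_iff_ball.1 ((hT x hx).eventually_analyticAt.and h1)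
    refine ⟨_, mem_nhdsWithin_of_mem_nhds (ball_mem_nhds x (half_pos hδ)), ‖T (x, 0)‖ + 1,
      by positivity, δ / 2, half_pos hδ, fun x' hx' y hy => ?_⟩
    have h2 := hball (x', y) (by
      rw [mem_ball_iff_norm, Prod.mk_sub_mk, sub_zero, Prod.norm_mk]
      exact max_lt ((mem_ball_iff_norm.1 hx').trans (half_lt_self hδ))
        (hy.trans_lt (half_lt_self hδ)))
    exact ⟨h2.1, h2.2.le⟩

lemma exists_bound_of_vanishing {T : X × Y → Z} {Q : Set X} (hQ : IsCompact Q) (hT : ∀ x ∈ Q,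
    AnalyticAt ℝ T (x, 0)) (hT0 : ∀ x ∈ Q, T (x, 0) = 0) : ∃ C ≥ 0, ∃ δ > 0, ∀ x ∈ Q, ∀ y, ‖y‖ ≤ δ →
    AnalyticAt ℝ T (x, y) ∧ ‖T (x, y)‖ ≤ C * ‖y‖ := by
  obtain ⟨C, hC, δ, hδ, h⟩ := exists_bound_zero_section (T := _root_.fderiv ℝ T) hQ
    fun x hx => (hT x hx).fderiv
  obtain ⟨_, _, δ', hδ', h'⟩ := exists_bound_zero_section hQ hT
  refine ⟨C, hC, min δ δ', lt_min hδ hδ', fun x hx y hy => ⟨(h' x hx y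
    (hy.trans (min_le_right _ _))).1, ?_⟩⟩
  have hd : ∀ y ∈ closedBall (0 : Y) (min δ δ'), HasFDerivWithinAt (fun y => T (x, y))
      ((_root_.fderiv ℝ T (x, y)).comp (inr ℝ X Y))
      (closedBall (0 : Y) (min δ δ')) y := fun y hy =>
    (h' x hx y ((mem_closedBall_zero_iff.1 hy).trans
      (min_le_right _ _))).1.differentiableAt.hasFDerivAt_right.hasFDerivWithinAt
  have h1 := (convex_closedBall (0 : Y) (min δ δ')).norm_image_sub_le_of_norm_hasFDerivWithin_le
    (C := C) hd (fun y hy => ?_) (mem_closedBall_self (lt_min hδ hδ').le)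
    (mem_closedBall_zero_iff.2 hy)
  · simpa [hT0 x hx] using h1
  · refine (opNorm_comp_le _ _).trans ?_
    refine (mul_le_of_le_one_right (norm_nonneg _) (norm_inr_le_one ℝ X Y)).trans
      (h x hx y ((mem_closedBall_zero_iff.1 hy).trans (min_le_left _ _))).2
end Jets

lemma hasFDerivAt_comp_graph {T : X × Y → Z} {w : X → Y} {x : X} (hT : DifferentiableAt ℝ T (x, w
    x)) (hw : DifferentiableAt ℝ w x) : HasFDerivAt (fun x => T (x, w x)) ((fderiv ℝ T (x, w
    x)).comp ((ContinuousLinearMap.id ℝ X).prod (fderiv ℝ w x))) x :=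
  HasFDerivAt.comp (𝕜 := ℝ) (E := X) (F := X × Y) (G := Z) (f := fun e => (e, w e)) (g := T) x
    hT.hasFDerivAt ((hasFDerivAt_id x).prodMk hw.hasFDerivAt)

lemma analyticAt_graphDeriv [CompleteSpace Y] [CompleteSpace Z] {T : X × Y → Z} {q : X × (Y × (X
    →L[ℝ] Y))} (hT : AnalyticAt ℝ T (q.1, q.2.1)) : AnalyticAt ℝ (fun q : X × (Y × (X →L[ℝ] Y)) =>
    (fderiv ℝ T (q.1, q.2.1)).comp ((ContinuousLinearMap.id ℝ X).prod q.2.2)) q := by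
  have h1 : ContDiff ℝ ω (fun q : X × (Y × (X →L[ℝ] Y)) => (q.1, q.2.1)) :=
    contDiff_fst.prodMk contDiff_snd.fst
  have h2 : ContDiffAt ℝ ω (fun q : X × (Y × (X →L[ℝ] Y)) => fderiv ℝ T (q.1, q.2.1)) q :=
    ContDiffAt.comp (g := fderiv ℝ T) q hT.fderiv.contDiffAt h1.contDiffAt
  have h3 : ContDiffAt ℝ ω (fun q : X × (Y × (X →L[ℝ] Y)) =>
      (ContinuousLinearMap.id ℝ X).prod q.2.2) q := by
    have : ∀ q : X × (Y × (X →L[ℝ] Y)), (ContinuousLinearMap.id ℝ X).prod q.2.2 =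
        inl ℝ X Y + (inr ℝ X Y).comp q.2.2 := fun q => by
      ext u <;> simp
    simp only [this]
    exact contDiffAt_const.add (contDiffAt_const.clm_comp (contDiff_snd.snd.contDiffAt))
  exact (h2.clm_comp h3).analyticAt

theorem exists_jet_bound_of_vanishing (m : ℕ) : ∀ {X Y Z : Type} [NormedAddCommGroup X] [NormedSpace
    ℝ X] [NormedAddCommGroup Y] [NormedSpace ℝ Y] [CompleteSpace Y] [NormedAddCommGroup Z]
    [NormedSpace ℝ Z] [CompleteSpace Z] {T : X × Y → Z} {Q : Set X}, IsCompact Q → (∀ x ∈ Q,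
    AnalyticAt ℝ T (x, 0)) → (∀ x ∈ Q, ∀ᶠ x' in 𝓝 x, T (x', 0) = 0) → ∃ C ≥ 0, ∃ δ > 0, ∀ x ∈ Q, ∀
    (w : X → Y) (ε : ℝ), ε ≤ δ → JetLE m ε w x → JetLE m (C * ε) (fun x => T (x, w x)) x := by
  induction m with
  | zero =>
    intro X Y Z _ _ _ _ _ _ _ _ T Q hQ hT hT0
    obtain ⟨C, hC, δ, hδ, h⟩ := exists_bound_of_vanishing hQ hT fun x hx => (hT0 x hx).self_of_nhds
    refine ⟨C, hC, δ, hδ, fun x hx w ε hε hw => ?_⟩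
    obtain ⟨h1, h2⟩ := h x hx (w x) (hw.norm_le.trans hε)
    exact jetLE_zero (ContDiffAt.comp (g := T) x h1.contDiffAt (contDiffAt_id.prodMk hw.1))
      (h2.trans (mul_le_mul_of_nonneg_left hw.norm_le hC))
  | succ m ih =>
    intro X Y Z _ _ _ _ _ _ _ _ T Q hQ hT hT0
    obtain ⟨C, hC, δ, hδ, h⟩ := exists_bound_of_vanishing hQ hT fun x hx => (hT0 x hx).self_of_nhds
    obtain ⟨C', hC', δ', hδ', h'⟩ := ih (T := fun q : X × (Y × (X →L[ℝ] Y)) =>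
      (fderiv ℝ T (q.1, q.2.1)).comp ((ContinuousLinearMap.id ℝ X).prod q.2.2)) hQ
      (fun x hx => analyticAt_graphDeriv (hT x hx)) (fun x hx => by
        have h1 : Tendsto (fun x' : X => (x', (0 : Y))) (𝓝 x) (𝓝 (x, 0)) :=
          (Continuous.prodMk_left (0 : Y)).continuousAt
        filter_upwards [(hT0 x hx).eventually_nhds, h1.eventually (hT x hx).eventually_analyticAt]
          with x' h2 h3
        have h4 := (hasFDerivAt_comp_graph (w := fun _ => (0 : Y)) h3.differentiableAt
          (differentiableAt_const _)).fderiv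
        rw [Filter.EventuallyEq.fderiv_eq (f := fun _ => (0 : Z)) h2] at h4
        simp only [fderiv_fun_const, Pi.zero_apply] at h4
        exact h4.symm)
    refine ⟨max C C', le_max_of_le_left hC, min δ δ', lt_min hδ hδ', fun x hx w ε hε hw => ?_⟩
    obtain ⟨h1, h2⟩ := h x hx (w x) (hw.norm_le.trans (hε.trans (min_le_left _ _)))
    have hε0 := hw.nonneg
    refine JetLE.of_fderiv (ContDiffAt.comp (g := T) x h1.contDiffAt (contDiffAt_id.prodMk hw.1))
      (h2.trans (mul_le_mul (le_max_left _ _) hw.norm_le (norm_nonneg _) (le_max_of_le_left hC))) ?_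
    refine ((h' x hx (fun x => (w x, fderiv ℝ w x)) ε (hε.trans (min_le_right _ _))
      ((hw.mono (Nat.le_succ m) le_rfl).prodMk hw.fderiv)).mono le_rfl
      (mul_le_mul_of_nonneg_right (le_max_right _ _) hε0)).congr ?_
    have h3 : Tendsto (fun x => (x, w x)) (𝓝 x) (𝓝 (x, w x)) :=
      continuousAt_id.prodMk hw.1.continuousAt
    filter_upwards [h3.eventually h1.eventually_analyticAt,
      hw.1.analyticAt.eventually_analyticAt] with x' h4 h5
    exact (hasFDerivAt_comp_graph h4.differentiableAt h5.differentiableAt).fderiv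

section
variable {A B D : Type*} [NormedAddCommGroup A] [NormedSpace ℝ A] [NormedAddCommGroup B]
  [NormedSpace ℝ B] [NormedAddCommGroup D] [NormedSpace ℝ D] {d : D}

lemma _root_.ContDiffAt.clm_flip {L : D → X →L[ℝ] A →L[ℝ] B} (h : ContDiffAt ℝ ω L d) : ContDiffAt ℝ
    ω (fun d => (L d).flip) d := by
  have h1 : ContDiff ℝ ω (ContinuousLinearMap.flipₗᵢ ℝ X A B) := LinearIsometryEquiv.contDiff _
  exact h1.contDiffAt.comp d h

lemma _root_.ContDiffAt.clm_compL {L : D → A →L[ℝ] B} (h : ContDiffAt ℝ ω L d) : ContDiffAt ℝ ω (fun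
    d => compL ℝ X A B (L d)) d := by
  have h1 : ContDiff ℝ ω (compL ℝ X A B) := ContinuousLinearMap.contDiff _
  exact h1.contDiffAt.comp d h

lemma _root_.ContDiffAt.clm_compL_flip {L : D → X →L[ℝ] A} (h : ContDiffAt ℝ ω L d) : ContDiffAt ℝ ω
    (fun d => (compL ℝ X A B).flip (L d)) d := by
  have h1 : ContDiff ℝ ω ((compL ℝ X A B).flip) := ContinuousLinearMap.contDiff _
  exact h1.contDiffAt.comp d h
end

theorem exists_jet_bound (m : ℕ) : ∀ {X Y X' A B : Type} [NormedAddCommGroup X] [NormedSpace ℝ X]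
    [NormedAddCommGroup Y] [NormedSpace ℝ Y] [CompleteSpace Y] [NormedAddCommGroup X'] [NormedSpace
    ℝ X'] [CompleteSpace X'] [NormedAddCommGroup A] [NormedSpace ℝ A] [CompleteSpace A]
    [NormedAddCommGroup B] [NormedSpace ℝ B] [CompleteSpace B] {T : X × Y → A →L[ℝ] B} {G : X × Y →
    X'} {Q : Set X}, IsCompact Q → (∀ x ∈ Q, AnalyticAt ℝ T (x, 0)) → (∀ x ∈ Q, AnalyticAt ℝ G (x,
    0)) → ∃ C ≥ 0, ∃ δ > 0, ∀ x ∈ Q, ∀ (w : X → Y) (f : X' → A) (ε : ℝ), JetLE m δ w x → JetLE m ε f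
    (G (x, w x)) → JetLE m (C * ε) (fun x => T (x, w x) (f (G (x, w x)))) x := by
  have hzero : ∀ {X Y X' A B : Type} [NormedAddCommGroup X]
    [NormedSpace ℝ X] [NormedAddCommGroup Y] [NormedSpace ℝ Y] [CompleteSpace Y]
    [NormedAddCommGroup X'] [NormedSpace ℝ X'] [CompleteSpace X'] [NormedAddCommGroup A]
    [NormedSpace ℝ A] [CompleteSpace A] [NormedAddCommGroup B] [NormedSpace ℝ B] [CompleteSpace B]
    {T : X × Y → A →L[ℝ] B} {G : X × Y → X'} {Q : Set X},
    IsCompact Q → (∀ x ∈ Q, AnalyticAt ℝ T (x, 0)) → (∀ x ∈ Q, AnalyticAt ℝ G (x, 0)) →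
    ∃ C ≥ 0, ∃ δ > 0, ∀ x ∈ Q, ∀ (w : X → Y) (f : X' → A) (ε : ℝ), JetLE 0 δ w x →
      JetLE 0 ε f (G (x, w x)) → AnalyticAt ℝ T (x, w x) ∧ AnalyticAt ℝ G (x, w x) ∧
        ContDiffAt ℝ ω (fun x => T (x, w x) (f (G (x, w x)))) x ∧
        ‖T (x, w x) (f (G (x, w x)))‖ ≤ C * ε := by
    intro X Y X' A B _ _ _ _ _ _ _ _ _ _ _ _ _ _ T G Q hQ hT hG
    obtain ⟨C, hC, δ, hδ, h⟩ := exists_bound_zero_section hQ hT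
    obtain ⟨_, _, δ', hδ', h'⟩ := exists_bound_zero_section hQ hG
    refine ⟨C, hC, min δ δ', lt_min hδ hδ', fun x hx w f ε hw hf => ?_⟩
    obtain ⟨h1, h2⟩ := h x hx (w x) (hw.norm_le.trans (min_le_left _ _))
    obtain ⟨h3, -⟩ := h' x hx (w x) (hw.norm_le.trans (min_le_right _ _))
    have h4 : ContDiffAt ℝ ω (fun x => (x, w x)) x := contDiffAt_id.prodMk hw.1
    refine ⟨h1, h3, (ContDiffAt.comp (g := T) x h1.contDiffAt h4).clm_apply
      (ContDiffAt.comp (g := f) x hf.1 (ContDiffAt.comp (g := G) x h3.contDiffAt h4)), ?_⟩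
    exact ((T (x, w x)).le_opNorm _).trans (mul_le_mul h2 hf.norm_le (norm_nonneg _) hC)
  induction m with
  | zero =>
    intro X Y X' A B _ _ _ _ _ _ _ _ _ _ _ _ _ _ T G Q hQ hT hG
    obtain ⟨C, hC, δ, hδ, h⟩ := hzero hQ hT hG
    refine ⟨C, hC, δ, hδ, fun x hx w f ε hw hf => ?_⟩
    obtain ⟨-, -, h1, h2⟩ := h x hx w f ε hw hf
    exact jetLE_zero h1 h2
  | succ m ih =>
    intro X Y X' A B _ _ _ _ _ _ _ _ _ _ _ _ _ _ T G Q hQ hT hG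
    obtain ⟨C, hC, δ, hδ, h⟩ := hzero hQ hT hG
    let P : (X × Y → A →L[ℝ] B) → X × (Y × (X →L[ℝ] Y)) → X →L[ℝ] (A →L[ℝ] B) := fun T q =>
      (fderiv ℝ T (q.1, q.2.1)).comp ((ContinuousLinearMap.id ℝ X).prod q.2.2)
    let R : X × (Y × (X →L[ℝ] Y)) → X →L[ℝ] X' := fun q =>
      (fderiv ℝ G (q.1, q.2.1)).comp ((ContinuousLinearMap.id ℝ X).prod q.2.2)
    let T' : X × (Y × (X →L[ℝ] Y)) → (A × (X' →L[ℝ] A)) →L[ℝ] (X →L[ℝ] B) := fun q =>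
      (P T q).flip.comp (fst ℝ A (X' →L[ℝ] A)) +
      (((compL ℝ X A B) (T (q.1, q.2.1))).comp
        ((compL ℝ X X' A).flip (R q))).comp
          (snd ℝ A (X' →L[ℝ] A))
    have hfst : ContDiff ℝ ω (fun q : X × (Y × (X →L[ℝ] Y)) => (q.1, q.2.1)) :=
      contDiff_fst.prodMk contDiff_snd.fst
    obtain ⟨C', hC', δ', hδ', h'⟩ := ih (T := T') (G := fun q => G (q.1, q.2.1)) hQ (fun x hx => by
        have h1 : ContDiffAt ℝ ω (fun q => (P T q).flip) (x, ((0 : Y), (0 : X →L[ℝ] Y))) :=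
          (analyticAt_graphDeriv (q := (x, 0, 0)) (hT x hx)).contDiffAt.clm_flip
        have h2 : ContDiffAt ℝ ω (fun q : X × (Y × (X →L[ℝ] Y)) =>
            (compL ℝ X A B) (T (q.1, q.2.1))) (x, (0, 0)) :=
          ContDiffAt.clm_compL
            (ContDiffAt.comp (g := T) (x, ((0 : Y), (0 : X →L[ℝ] Y))) (hT x hx).contDiffAt
              hfst.contDiffAt)
        have h3 : ContDiffAt ℝ ω (fun q => (compL ℝ X X' A).flip (R q))
            (x, ((0 : Y), (0 : X →L[ℝ] Y))) :=
          ContDiffAt.clm_compL_flip (analyticAt_graphDeriv (q := (x, 0, 0)) (hG x hx)).contDiffAt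
        exact ((h1.clm_comp contDiffAt_const).add
          ((h2.clm_comp h3).clm_comp contDiffAt_const)).analyticAt)
      (fun x hx => (ContDiffAt.comp (g := G) (x, ((0 : Y), (0 : X →L[ℝ] Y)))
        (hG x hx).contDiffAt hfst.contDiffAt).analyticAt)
    refine ⟨max C C', le_max_of_le_left hC, min δ δ', lt_min hδ hδ', fun x hx w f ε hw hf => ?_⟩
    have hε0 := hf.nonneg
    obtain ⟨h1, h2, h3, h4⟩ := h x hx w f ε (hw.mono (Nat.zero_le _) (min_le_left _ _))
      (hf.mono (Nat.zero_le _) le_rfl)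
    refine JetLE.of_fderiv h3 (h4.trans (mul_le_mul_of_nonneg_right (le_max_left _ _) hε0)) ?_
    have hw' := hw.mono le_rfl (min_le_right δ δ')
    refine ((h' x hx (fun x => (w x, fderiv ℝ w x)) (fun y => (f y, fderiv ℝ f y)) ε
      ((hw'.mono (Nat.le_succ m) le_rfl).prodMk hw'.fderiv)
      ((hf.mono (Nat.le_succ m) le_rfl).prodMk hf.fderiv)).mono le_rfl
      (mul_le_mul_of_nonneg_right (le_max_right _ _) hε0)).congr ?_
    have h5 : Tendsto (fun x => (x, w x)) (𝓝 x) (𝓝 (x, w x)) :=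
      continuousAt_id.prodMk hw.1.continuousAt
    have h6 : Tendsto (fun x => G (x, w x)) (𝓝 x) (𝓝 (G (x, w x))) :=
      ContinuousAt.comp (g := G) h2.continuousAt h5
    filter_upwards [h5.eventually h1.eventually_analyticAt, h5.eventually h2.eventually_analyticAt,
      hw.1.analyticAt.eventually_analyticAt, h6.eventually hf.1.analyticAt.eventually_analyticAt]
      with x' h7 h8 h9 h10
    have h11 := hasFDerivAt_comp_graph h7.differentiableAt h9.differentiableAt
    have h12 := hasFDerivAt_comp_graph h8.differentiableAt h9.differentiableAt
    have h13 : HasFDerivAt (fun x => f (G (x, w x))) _ x' :=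
      HasFDerivAt.comp (g := f) x' h10.differentiableAt.hasFDerivAt h12
    rw [(h11.clm_apply h13).fderiv]
    ext u
    simp only [T', P, R, add_apply, ContinuousLinearMap.comp_apply, ContinuousLinearMap.flip_apply,
      ContinuousLinearMap.compL_apply, ContinuousLinearMap.coe_fst', ContinuousLinearMap.coe_snd']
    abel

lemma jetLE_intervalIntegral (m : ℕ) : ∀ {X Y : Type} [NormedAddCommGroup X] [NormedSpace ℝ X]
    [NormedAddCommGroup Y] [NormedSpace ℝ Y] [CompleteSpace Y] {f : ℝ × X → Y} {a b ε : ℝ} {x : X},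
    (∀ s ∈ uIcc a b, AnalyticAt ℝ f (s, x)) → (∀ s ∈ uIcc a b, JetLE m ε (fun x => f (s, x)) x) →
    JetLE m (ε * |b - a|) (fun x => ∫ s in a..b, f (s, x)) x := by
  have hzero : ∀ {X Y : Type} [NormedAddCommGroup X] [NormedSpace ℝ X]
    [NormedAddCommGroup Y] [NormedSpace ℝ Y] [CompleteSpace Y] {f : ℝ × X → Y} {a b ε : ℝ} {x : X},
    (∀ s ∈ uIcc a b, JetLE 0 ε (fun x => f (s, x)) x) →
    ‖∫ s in a..b, f (s, x)‖ ≤ ε * |b - a| := fun h =>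
    intervalIntegral.norm_integral_le_of_norm_le_const fun s hs =>
      (h s (uIoc_subset_uIcc hs)).norm_le
  induction m with
  | zero =>
    intro X Y _ _ _ _ _ f a b ε x hf h
    exact jetLE_zero (analyticAt_intervalIntegral hf).contDiffAt (hzero h)
  | succ m ih =>
    intro X Y _ _ _ _ _ f a b ε x hf h
    refine JetLE.of_fderiv (analyticAt_intervalIntegral hf).contDiffAt
      (hzero fun s hs => (h s hs).mono (Nat.zero_le _) le_rfl) ?_
    refine (ih (f := fun q : ℝ × X => (fderiv ℝ f q).comp (inr ℝ ℝ X))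
      (fun s hs => ?_) fun s hs => ?_).congr ?_
    · exact (((hf s hs).fderiv.contDiffAt (n := ω)).clm_comp contDiffAt_const).analyticAt
    · refine (h s hs).fderiv.congr ?_
      have h1 : Tendsto (fun y : X => (s, y)) (𝓝 x) (𝓝 (s, x)) :=
        (Continuous.prodMk_right s).continuousAt
      filter_upwards [h1.eventually (hf s hs).eventually_analyticAt] with y hy
      exact hy.differentiableAt.hasFDerivAt_right.fderiv.symm
    · have h1 : ∀ᶠ y in 𝓝 x, ∀ s ∈ uIcc a b, AnalyticAt ℝ f (s, y) := by
        refine isCompact_uIcc.eventually_forall_of_forall_eventually fun s hs => ?_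
        exact (continuous_swap.tendsto (x, s)).eventually (hf s hs).eventually_analyticAt
      filter_upwards [h1] with y hy
      exact (hasFDerivAt_intervalIntegral_of_analytic hy).fderiv

section Transfer
variable {X : Type} [NormedAddCommGroup X] [NormedSpace ℝ X] [FiniteDimensional ℝ X]

lemma jetLE_const_zero {X : Type*} [NormedAddCommGroup X] [NormedSpace ℝ X] [CompleteSpace Y] (k :
    ℕ) {ε : ℝ} (hε : 0 ≤ ε) (x : X) : JetLE k ε (fun _ : X => (0 : Y)) x :=
  ⟨contDiffAt_const, fun j _ => by rw [iteratedFDeriv_fun_zero]; simpa using hε⟩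

lemma contDiff_compContinuousLinearMapCLM {W : Type*} [NormedAddCommGroup W] [NormedSpace ℝ W]
    [FiniteDimensional ℝ W] (k : ℕ) : ContDiff ℝ ω fun A : X →L[ℝ] W =>
    (ContinuousAlternatingMap.compContinuousLinearMapCLM A : W [⋀^Fin k]→L[ℝ] ℝ →L[ℝ] X [⋀^Fin
    k]→L[ℝ] ℝ) := by
  rw [contDiff_clm_apply_iff]
  refine fun η => contDiff_iff_contDiffAt.2 fun A => contDiffAt_alternating fun v => ?_
  refine contDiffAt_alternating_apply (η := fun _ => η) (w := fun (A : X →L[ℝ] W) i => A (v i))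
    contDiffAt_const ?_
  rw [contDiffAt_pi]
  exact fun i => contDiffAt_id.clm_apply contDiffAt_const

/-- Closeness of two systems, seen through a map from a normed space. -/
theorem exists_transfer {E : X → M} {Q : Set X} (hQ : IsCompact Q) (hE : ∀ x ∈ Q, ContMDiffAt 𝓘(ℝ,
    X) 𝓘[n] ω E x) (P : CompactPieces n M) (hEQ : E '' Q ⊆ ⋃ i, P.piece i) (k : ℕ) : ∃ C ≥ 0, ∀ (ε :
    ℝ) (Ω Ω' : DForm n M 2) (F F' : M → Target n), IsIntegrableSystem Ω F → IsIntegrableSystem Ω' F'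
    → SystemCkClose P k ε Ω Ω' F F' → ∀ x ∈ Q, JetLE k (C * ε) (fun x => F' (E x) - F (E x)) x ∧
    JetLE k (C * ε) (fun x => pullForm E Ω' x - pullForm E Ω x) x := by
  have hcont : ContinuousOn E Q := fun x hx => (hE x hx).continuousAt.continuousWithinAt
  have hpiece : ∀ i, ∃ C ≥ 0, ∀ (ε : ℝ) (Ω Ω' : DForm n M 2) (F F' : M → Target n),
      IsIntegrableSystem Ω F → IsIntegrableSystem Ω' F' → SystemCkClose P k ε Ω Ω' F F' →
      ∀ x ∈ Q ∩ E ⁻¹' P.piece i, JetLE k (C * ε) (fun x => F' (E x) - F (E x)) x ∧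
        JetLE k (C * ε) (fun x => pullForm E Ω' x - pullForm E Ω x) x := by
    intro i
    set e := P.chart i
    have he := P.chart_mem i
    have hQi : IsCompact (Q ∩ E ⁻¹' P.piece i) := hQ.of_isClosed_subset
      (hcont.preimage_isClosed_of_isClosed hQ.isClosed (P.isCompact i).isClosed) inter_subset_left
    have hes : ∀ x ∈ Q ∩ E ⁻¹' P.piece i, E x ∈ e.source := fun x hx => P.subset i hx.2
    have hφ : ∀ x ∈ Q ∩ E ⁻¹' P.piece i, ContDiffAt ℝ ω (fun x => e (E x)) x := fun x hx =>
      contDiffAt_chart_comp le_rfl he (hE x hx.1) (hes x hx)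
    have hG : ∀ x ∈ Q ∩ E ⁻¹' P.piece i,
        AnalyticAt ℝ (fun q : X × ℝ => e (E q.1)) (x, 0) := fun x hx =>
      (ContDiffAt.comp (g := fun x => e (E x)) (x, (0 : ℝ)) (hφ x hx) contDiffAt_fst).analyticAt
    obtain ⟨C₁, hC₁, δ₁, hδ₁, h₁⟩ := exists_jet_bound k (X := X) (Y := ℝ) (A := Target n)
      (T := fun _ => ContinuousLinearMap.id ℝ (Target n)) hQi (fun _ _ => analyticAt_const) hG
    obtain ⟨C₂, hC₂, δ₂, hδ₂, h₂⟩ := exists_jet_bound k (X := X) (Y := ℝ)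
      (A := Model n [⋀^Fin 2]→L[ℝ] ℝ) (B := X [⋀^Fin 2]→L[ℝ] ℝ)
      (T := fun q => ContinuousAlternatingMap.compContinuousLinearMapCLM
        (fderiv ℝ (fun x => e (E x)) q.1)) hQi (fun x hx =>
        ((contDiff_compContinuousLinearMapCLM 2).contDiffAt.comp (x, (0 : ℝ))
          (ContDiffAt.comp (g := fderiv ℝ (fun x => e (E x))) (x, (0 : ℝ))
            (hφ x hx).analyticAt.fderiv.contDiffAt contDiffAt_fst)).analyticAt) hG
    refine ⟨max C₁ C₂, le_max_of_le_left hC₁, fun ε Ω Ω' F F' h h' hc x hx => ?_⟩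
    have het := e.map_source (hes x hx)
    have hmem : e (E x) ∈ e.target ∩ e.symm ⁻¹' univ := ⟨het, trivial⟩
    have hε : 0 ≤ ε := (norm_nonneg _).trans (hc i (E x) hx.2 0 (Nat.zero_le _)).1
    have hmF : ∀ {F : M → Target n} {Ω : DForm n M 2}, IsIntegrableSystem Ω F →
        ContDiffAt ℝ ω (fun y => F (e.symm y)) (e (E x)) := fun h =>
      contMDiffAt_iff_contDiffAt.1 (h.analytic.contMDiffAt.comp _ (contMDiffAt_chart_symm he het))
    have hmΩ : ∀ {F : M → Target n} {Ω : DForm n M 2}, IsIntegrableSystem Ω F →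
        ContDiffAt ℝ ω (formInChart e Ω) (e (E x)) := fun h =>
      (h.symplectic.analytic e he _ hmem).contDiffAt
    have hev := eventually_eq_chart_symm_comp (hE x hx.1).continuousAt (hes x hx)
    constructor
    · refine ((h₁ x hx (fun _ => 0) (fun y => F' (e.symm y) - F (e.symm y)) ε
        (jetLE_const_zero k hδ₁.le x)
        ⟨(hmF h').sub (hmF h), fun j hj => (hc i (E x) hx.2 j hj).2⟩).mono le_rfl
        (mul_le_mul_of_nonneg_right (le_max_left _ _) hε)).congr ?_
      filter_upwards [hev] with y hy
      simp only [Function.comp_apply] at hy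
      change F' (E y) - F (E y) = F' (e.symm (e (E y))) - F (e.symm (e (E y)))
      rw [← hy]
    · refine ((h₂ x hx (fun _ => 0) (fun y => formInChart e Ω' y - formInChart e Ω y) ε
        (jetLE_const_zero k hδ₂.le x)
        ⟨(hmΩ h').sub (hmΩ h), fun j hj => (hc i (E x) hx.2 j hj).1⟩).mono le_rfl
        (mul_le_mul_of_nonneg_right (le_max_right _ _) hε)).congr ?_
      filter_upwards [pullForm_eventuallyEq_chart (η := Ω) he (hE x hx.1) (hes x hx),
        pullForm_eventuallyEq_chart (η := Ω') he (hE x hx.1) (hes x hx)] with y hy hy'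
      rw [hy, hy', map_sub]
      rfl
  choose C hC h using hpiece
  refine ⟨∑ i, C i, Finset.sum_nonneg fun i _ => hC i, fun ε Ω Ω' F F' h1 h2 hc x hx => ?_⟩
  obtain ⟨i, hi⟩ := mem_iUnion.1 (hEQ ⟨x, hx, rfl⟩)
  obtain ⟨h3, h4⟩ := h i ε Ω Ω' F F' h1 h2 hc x ⟨hx, hi⟩
  have hε : 0 ≤ ε := (norm_nonneg _).trans (hc i (E x) hi 0 (Nat.zero_le _)).1
  have h5 : C i * ε ≤ (∑ i, C i) * ε := mul_le_mul_of_nonneg_right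
    (Finset.single_le_sum (f := C) (fun i _ => hC i) (Finset.mem_univ i)) hε
  exact ⟨h3.mono le_rfl h5, h4.mono le_rfl h5⟩
end Transfer

section NearIdentity

theorem exists_jet_bound_inverse (m : ℕ) {X : Type} [NormedAddCommGroup X] [NormedSpace ℝ X]
    [FiniteDimensional ℝ X] {Q : Set X} (hQ : IsCompact Q) : ∃ C ≥ 0, ∃ δ > 0, ∀ x ∈ Q, ∀ (a w : X →
    X) (ε : ℝ), ε ≤ δ → JetLE m ε a (x + w x) → ContDiffAt ℝ ω w x → (∀ᶠ x in 𝓝 x, w x = -a (x + w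
    x)) → JetLE m (C * ε) w x := by
  induction m with
  | zero =>
    refine ⟨1, zero_le_one, 1, one_pos, fun x hx a w ε hε ha hw h => jetLE_zero hw ?_⟩
    rw [h.self_of_nhds, norm_neg, one_mul]
    exact ha.norm_le
  | succ m ih =>
    obtain ⟨C₁, hC₁, δ₁, hδ₁, h₁⟩ := ih
    obtain ⟨C₂, hC₂, δ₂, hδ₂, h₂⟩ := exists_jet_bound m (X := X) (Y := X) (A := X →L[ℝ] X)
      (T := fun _ => ContinuousLinearMap.id ℝ (X →L[ℝ] X)) (G := fun q : X × X => q.1 + q.2) hQ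
      (fun _ _ => analyticAt_const)
      (fun x _ => (contDiff_fst.add contDiff_snd : ContDiff ℝ ω _).contDiffAt.analyticAt)
    obtain ⟨C₃, hC₃, δ₃, hδ₃, h₃⟩ := exists_jet_bound_of_vanishing m (X := X) (Y := X →L[ℝ] X)
      (T := fun q : X × (X →L[ℝ] X) => Ring.inverse (1 + q.2) - 1) hQ (fun x _ => by
        have h0 : ContDiffAt ℝ ω (Ring.inverse : (X →L[ℝ] X) → X →L[ℝ] X) (1 + 0) := by
          rw [add_zero]
          exact contDiffAt_ringInverse ℝ 1
        exact ((ContDiffAt.comp (g := (Ring.inverse : (X →L[ℝ] X) → X →L[ℝ] X))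
          (f := fun q : X × (X →L[ℝ] X) => 1 + q.2) (x, 0) h0
          (contDiffAt_const.add contDiffAt_snd)).sub contDiffAt_const).analyticAt)
      (fun x _ => Filter.Eventually.of_forall fun x' => by simp)
    have hpos : 0 < min (min δ₁ (1 / 2)) (min (δ₂ / (C₁ + 1)) (δ₃ / (C₂ + 1))) := by positivity
    refine ⟨max 1 (C₃ * C₂), le_max_of_le_left zero_le_one, _, hpos,
      fun x hx a w ε hε ha hw h => ?_⟩
    obtain ⟨⟨hε₁, hε'⟩, hε₂, hε₃⟩ : (ε ≤ δ₁ ∧ ε ≤ 1 / 2) ∧ ε ≤ δ₂ / (C₁ + 1) ∧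
      ε ≤ δ₃ / (C₂ + 1) := by simpa only [le_min_iff] using hε
    have hε0 := ha.nonneg
    rw [le_div_iff₀ (by linarith)] at hε₂ hε₃
    have hwm := (h₁ x hx a w ε hε₁ (ha.mono (Nat.le_succ m) le_rfl) hw h).mono le_rfl
      (show C₁ * ε ≤ δ₂ by linarith)
    have hDa := h₂ x hx w (fderiv ℝ a) ε hwm ha.fderiv
    have hDw := h₃ x hx _ (C₂ * ε) (by linarith) hDa
    refine JetLE.of_fderiv hw ?_ ((hDw.mono le_rfl ?_).congr ?_)
    · rw [h.self_of_nhds, norm_neg]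
      exact ha.norm_le.trans (le_mul_of_one_le_left hε0 (le_max_left _ _))
    · rw [← mul_assoc]
      exact mul_le_mul_of_nonneg_right (le_max_right _ _) hε0
    have hg : Tendsto (fun x => x + w x) (𝓝 x) (𝓝 (x + w x)) := continuousAt_id.add hw.continuousAt
    have hsmall : ∀ᶠ x in 𝓝 x, ‖fderiv ℝ a (x + w x)‖ < 1 :=
      (ContinuousAt.comp (g := fderiv ℝ a) (f := fun x => x + w x) ha.fderiv.1.continuousAt
        hg).norm.eventually (gt_mem_nhds (ha.fderiv.norm_le.trans_lt (by linarith)))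
    filter_upwards [h.eventually_nhds, hsmall, hw.analyticAt.eventually_analyticAt,
      hg.eventually ha.1.analyticAt.eventually_analyticAt] with y hy hy1 hy2 hy3
    have h4 : HasFDerivAt (fun x => -a (x + w x)) (-((fderiv ℝ a (y + w y)).comp
        (ContinuousLinearMap.id ℝ X + fderiv ℝ w y))) y :=
      (HasFDerivAt.comp (g := a) y hy3.differentiableAt.hasFDerivAt
        ((hasFDerivAt_id y).add hy2.differentiableAt.hasFDerivAt)).neg
    have h5 : fderiv ℝ w y = -(fderiv ℝ a (y + w y) * (1 + fderiv ℝ w y)) := by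
      conv_lhs => rw [Filter.EventuallyEq.fderiv_eq hy, h4.fderiv]
      rfl
    have h6 : IsUnit (1 + fderiv ℝ a (y + w y)) := by
      have := isUnit_one_sub_of_norm_lt_one (x := -fderiv ℝ a (y + w y)) (by rwa [norm_neg])
      rwa [sub_neg_eq_add] at this
    have h7 : (1 + fderiv ℝ a (y + w y)) * (1 + fderiv ℝ w y) = 1 := by
      rw [add_mul, one_mul, add_assoc]
      conv_lhs => rw [h5]
      nth_rewrite 2 [← h5]
      abel
    have h8 := Ring.inverse_mul_cancel_left _ (1 + fderiv ℝ w y) h6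
    rw [h7, mul_one] at h8
    change fderiv ℝ w y = Ring.inverse (1 + fderiv ℝ a (y + w y)) - 1
    rw [h8, add_sub_cancel_left]

variable {T Λ : Type*} [NormedAddCommGroup T] [NormedSpace ℝ T] [FiniteDimensional ℝ T]
  [NormedAddCommGroup Λ] [NormedSpace ℝ Λ] [FiniteDimensional ℝ Λ]

theorem exists_fiber_inverse {h : T × Λ → T} {O O' : Set T} {B : Set Λ} {d : ℝ} (hd0 : 0 ≤ d) (hO :
    IsOpen O) (hOc : Convex ℝ O) (hB : IsOpen B) (ha : ∀ τ ∈ O, ∀ l ∈ B, AnalyticAt ℝ h (τ, l)) (hD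
    : ∀ τ ∈ O, ∀ l ∈ B, ∀ u, ‖fderiv ℝ h (τ, l) (u, 0) - u‖ ≤ 1 / 2 * ‖u‖) (hd : ∀ τ ∈ O, ∀ l ∈ B,
    ‖h (τ, l) - τ‖ ≤ d) (hO'o : IsOpen O') (hO' : ∀ y ∈ O', closedBall y (2 * d) ⊆ O) : ∃ g : T × Λ
    → T, (∀ y ∈ O', ∀ l ∈ B, g (y, l) ∈ O ∧ ‖g (y, l) - y‖ ≤ 2 * d ∧ h (g (y, l), l) = y ∧
    AnalyticAt ℝ g (y, l)) ∧ ∀ y ∈ O', ∀ l ∈ B, ∀ τ ∈ O, h (τ, l) = y → τ = g (y, l) := by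
  have hlin : ∀ l ∈ B, ApproximatesLinearOn (fun τ => h (τ, l)) (ContinuousLinearMap.id ℝ T) O
      (1 / 2) := by
    intro l hl x hx y hy
    have h1 : ∀ τ ∈ O, HasFDerivWithinAt (fun τ => h (τ, l) - τ)
        ((fderiv ℝ h (τ, l)).comp (inl ℝ T Λ) - ContinuousLinearMap.id ℝ T)
        O τ := fun τ hτ =>
      ((ha τ hτ l hl).differentiableAt.hasFDerivAt_left.sub
        (hasFDerivAt_id τ)).hasFDerivWithinAt
    have h2 := hOc.norm_image_sub_le_of_norm_hasFDerivWithin_le (C := 1 / 2) h1 (fun τ hτ =>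
      opNorm_le_bound _ (by norm_num) fun u => by
        simpa using hD τ hτ l hl u) hy hx
    have h3 : h (x, l) - h (y, l) - (ContinuousLinearMap.id ℝ T) (x - y) =
        h (x, l) - x - (h (y, l) - y) := by simp only [ContinuousLinearMap.id_apply]; abel
    simp only [h3]
    simpa using h2
  have hinj : ∀ l ∈ B, ∀ x ∈ O, ∀ y ∈ O, h (x, l) = h (y, l) → x = y := by
    intro l hl x hx y hy hxy
    have h1 := hlin l hl x hx y hy
    simp only [hxy, sub_self, zero_sub, ContinuousLinearMap.id_apply, norm_neg] at h1
    norm_num at h1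
    rw [← sub_eq_zero, ← norm_le_zero_iff]
    linarith
  have hex : ∀ q : T × Λ, ∃ τ, q.1 ∈ O' → q.2 ∈ B →
      τ ∈ O ∧ ‖τ - q.1‖ ≤ 2 * d ∧ h (τ, q.2) = q.1 := by
    rintro ⟨y, l⟩
    by_cases hy : y ∈ O' ∧ l ∈ B
    · have h1 := (hlin l hy.2).surjOn_closedBall_of_nonlinearRightInverse
        (f' := ContinuousLinearMap.id ℝ T) ⟨id, 1, fun y => by simp, fun y => rfl⟩ (ε := 2 * d)
        (b := y) (by linarith) (hO' y hy.1)
      have hyO : y ∈ O := hO' y hy.1 (mem_closedBall_self (by linarith))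
      obtain ⟨τ, hτ, hτy⟩ := h1 (show y ∈ closedBall (h (y, l)) _ by
        rw [mem_closedBall_iff_norm, norm_sub_rev]
        refine (hd y hyO l hy.2).trans_eq ?_
        norm_num
        ring)
      exact ⟨τ, fun _ _ => ⟨hO' y hy.1 hτ, mem_closedBall_iff_norm.1 hτ, hτy⟩⟩
    · exact ⟨0, fun h1 h2 => absurd ⟨h1, h2⟩ hy⟩
  choose g hg using hex
  have huniq : ∀ y ∈ O', ∀ l ∈ B, ∀ τ ∈ O, h (τ, l) = y → τ = g (y, l) := by
    intro y hy l hl τ hτ hτy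
    obtain ⟨h1, -, h2⟩ := hg (y, l) hy hl
    exact hinj l hl τ hτ _ h1 (hτy.trans h2.symm)
  refine ⟨g, fun y hy l hl => ?_, huniq⟩
  obtain ⟨h1, h2, h3⟩ := hg (y, l) hy hl
  refine ⟨h1, h2, h3, ?_⟩
  simp only at h1 h3
  set τ := g (y, l) with hτ
  have hH : HasFDerivAt (fun q : T × Λ => (h q, q.2))
      ((fderiv ℝ h (τ, l)).prod (snd ℝ T Λ)) (τ, l) :=
    (ha τ h1 l hl).differentiableAt.hasFDerivAt.prodMk hasFDerivAt_snd
  have hHinj : Injective ((fderiv ℝ h (τ, l)).prod (snd ℝ T Λ)) := by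
    refine (injective_iff_map_eq_zero _).2 fun ⟨u, v⟩ huv => ?_
    have h4 : fderiv ℝ h (τ, l) (u, v) = 0 := congrArg Prod.fst huv
    have h5 : v = 0 := congrArg Prod.snd huv
    subst h5
    have h6 := hD τ h1 l hl u
    rw [h4, zero_sub, norm_neg] at h6
    have h7 : u = 0 := norm_le_zero_iff.1 (by linarith)
    rw [h7]; rfl
  obtain ⟨G, hG, hG0, hHG, -⟩ := exists_analytic_inverse (f := fun q : T × Λ => (h q, q.2))
    (x₀ := (τ, l)) ((ha τ h1 l hl).contDiffAt.prodMk contDiffAt_snd) (by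
      rw [hH.fderiv]
      exact ⟨hHinj, (LinearMap.injective_iff_surjective (f := ((fderiv ℝ h (τ, l)).prod
        (snd ℝ T Λ)).toLinearMap)).1 hHinj⟩)
  simp only [h3] at hG hG0 hHG
  have hG1 : ContDiffAt ℝ ω (fun q => (G q).1) (y, l) := hG.fst
  refine (hG1.congr_of_eventuallyEq ?_).analyticAt
  have h4 : ∀ᶠ q in 𝓝 (y, l), (G q).1 ∈ O := hG1.continuousAt.preimage_mem_nhds
    (by simp only [hG0]; exact hO.mem_nhds h1)
  filter_upwards [hHG, h4, (hO'o.prod hB).mem_nhds (⟨hy, hl⟩ : (y, l) ∈ O' ×ˢ B)] with q h5 h6 h7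
  have h8 := congrArg Prod.snd h5
  have h9 := congrArg Prod.fst h5
  simp only at h8 h9
  refine (huniq q.1 h7.1 q.2 h7.2 _ h6 ?_).symm
  rw [← h9, ← h8]
end NearIdentity

section FiberedTube
variable {r₁' c : ℝ}

lemma convex_offAxis (r : ℝ) : Convex ℝ {τ : Target n | ‖offAxis n τ‖ < r} := by
  have h : {τ : Target n | ‖offAxis n τ‖ < r} = offAxis n ⁻¹' ball 0 r := by ext τ; simp
  rw [h]
  exact (convex_ball (0 : Target n) r).linear_preimage (offAxis n).toLinearMap

lemma isOpen_offAxis (r : ℝ) : IsOpen {τ : Target n | ‖offAxis n τ‖ < r} :=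
  isOpen_lt (by fun_prop) continuous_const

def driftInv (β : Target n) : Target n →L[ℝ] Target n :=
  offAxis n + (EuclideanSpace.proj (0 : Fin n)).smulRight ((β 0)⁻¹ • (axis n - offAxis n β))

lemma driftInv_apply (β v : Target n) : driftInv β v = offAxis n v + v 0 • (β 0)⁻¹ • (axis n -
    offAxis n β) := rfl

lemma driftMap_driftInv {β : Target n} (hβ : β 0 ≠ 0) (v : Target n) : driftMap β (driftInv β v) = v
    := by
  have h0 : driftInv β v 0 = v 0 * (β 0)⁻¹ := by simp [driftInv_apply, offAxis_zero, axis_zero]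
  rw [driftMap_apply, h0, driftInv_apply, map_add, map_smul, map_smul, map_sub, offAxis_axis,
    offAxis_of_zero (offAxis_zero v), offAxis_of_zero (offAxis_zero β), offAxis_apply,
    offAxis_apply β]
  have h1 : v 0 = v 0 * (β 0)⁻¹ * β 0 := by field_simp
  nth_rewrite 2 [h1]
  module

lemma driftInv_driftMap {β : Target n} (hβ : β 0 ≠ 0) (u : Target n) : driftInv β (driftMap β u) = u
    := by
  have h0 : driftMap β u 0 = u 0 * β 0 := by simp [driftMap_apply, offAxis_zero]
  rw [driftInv_apply, h0, driftMap_apply, map_add, map_smul, offAxis_of_zero (offAxis_zero u),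
    smul_smul, mul_inv_cancel_right₀ hβ, smul_sub, offAxis_apply u]
  module

lemma norm_driftInv_le {β : Target n} (hβ : ‖β - axis n‖ ≤ 1 / 2) (v : Target n) : ‖driftInv β v‖ ≤
    6 * ‖v‖ := by
  have h0 := abs_le.1 ((abs_apply_zero_le (β - axis n)).trans hβ)
  simp only [PiLp.sub_apply, axis_zero] at h0
  have h1 : ‖axis n - offAxis n β‖ ≤ 2 := by
    have h2 := (norm_offAxis_le (β - axis n)).trans (mul_le_mul_of_nonneg_left hβ zero_le_two)
    rw [map_sub, offAxis_axis, sub_zero] at h2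
    refine (norm_sub_le _ _).trans ?_
    rw [norm_axis]; linarith
  have h3 : |(β 0)⁻¹| ≤ 2 := by
    rw [abs_of_nonneg (inv_nonneg.2 (by linarith))]
    exact inv_le_of_inv_le₀ two_pos (by linarith)
  rw [driftInv_apply]
  refine (norm_add_le _ _).trans ?_
  rw [norm_smul, norm_smul, Real.norm_eq_abs, Real.norm_eq_abs]
  have h4 : |(β 0)⁻¹| * ‖axis n - offAxis n β‖ ≤ 2 * 2 :=
    mul_le_mul h3 h1 (norm_nonneg _) zero_le_two
  have h5 := mul_le_mul (abs_apply_zero_le v) h4 (by positivity) (norm_nonneg _)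
  linarith [norm_offAxis_le v]

/-- A parametrisation of a tube in which the momentum map is the second coordinate. -/
structure IsFiberedTube (F : M → Target n) (p r₁ r₂ : ℝ) (E : Coords n → M) : Prop where
  analytic : ∀ x ∈ tubeDom r₁ r₂, ContMDiffAt 𝓘(ℝ, Coords n) 𝓘[n] ω E x
  momentum : ∀ x ∈ tubeDom r₁ r₂, F (E x) = x.2
  bijective : ∀ x ∈ tubeDom r₁ r₂, Bijective (dParam n E x)
  periodic : ∀ x ∈ tubeDom r₁ r₂, E (x.1 + p • axis n, x.2) = E x
  injective : ∀ x ∈ tubeDom r₁ r₂, ∀ y ∈ tubeDom r₁ r₂, E x = E y →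
    ∃ k : ℤ, x.1 - y.1 = (k * p) • axis n

lemma IsFiberedTube.isFiberedAt (ht : IsFiberedTube F p r₁ r₂ E) (h : IsIntegrableSystem Ω F)
    (hx : x ∈ tubeDom r₁ r₂) : IsFiberedAt F E x :=
  isFiberedAt_of_mem_tubeDom h hx (ht.analytic x hx) ht.momentum

/-- The Hamiltonian directions of the first coordinates of a fibered tube. -/
def fiberFrame (Ω : DForm n M 2) (E : Coords n → M) (x : Coords n) :
    Target n →L[ℝ] Target n := fiberMap (pullForm E Ω x)

/-- The average of the Hamiltonian direction of the axis. -/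
def meanDrift (Ω : DForm n M 2) (p : ℝ) (E : Coords n → M) (ζ : Target n) : Target n :=
  ∫ s in (0 : ℝ)..1, fiberFrame Ω E ((s * p) • axis n, ζ) (axis n)

variable (h : IsIntegrableSystem Ω F) (ht : IsFiberedTube F p r₁ r₂ E)
include h ht

lemma IsFiberedTube.analyticAt_pullForm (hx : x ∈ tubeDom r₁ r₂) : AnalyticAt ℝ (pullForm E Ω) x :=
  (contDiffAt_pullForm h.symplectic.analytic (mem_univ _) (ht.analytic x hx)).analyticAt

lemma IsFiberedTube.hasFDerivAt_fiberPeriod (hx : x ∈ tubeDom r₁ r₂) : HasFDerivAt (fun τ =>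
    fiberPeriod (pullForm E Ω) (τ, x.2)) (fiberFrame Ω E x) x.1 := by
  have hS : ∀ τ ∈ {τ : Target n | ‖offAxis n τ‖ < r₁}, (τ, x.2) ∈ tubeDom r₁ r₂ :=
    fun τ hτ => ⟨hτ, hx.2⟩
  refine Integrable.hasFDerivAt_fiberPeriod (convex_offAxis r₁) (isOpen_offAxis r₁) ?_
    (fun τ hτ => (ht.analyticAt_pullForm h (hS τ hτ)).differentiableAt) (fun τ hτ => ?_)
    (fun τ hτ => ?_) hx.1
  · simpa using (norm_nonneg _).trans_lt hx.1
  · rw [extDeriv_pullForm h.symplectic.analytic h.symplectic.closed (mem_univ _)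
      (ht.analytic _ (hS τ hτ))]
    rfl
  · filter_upwards [(isOpen_tubeDom r₁ r₂).mem_nhds (hS τ hτ)] with y hy
    exact (ht.isFiberedAt h hy).isotropic h

lemma IsFiberedTube.analyticAt_meanDrift (h₁ : 0 < r₁) (hζ : ‖ζ‖ < r₂) : AnalyticAt ℝ (meanDrift Ω p
    E) ζ := by
  refine analyticAt_intervalIntegral
    (f := fun q : ℝ × Target n => fiberFrame Ω E ((q.1 * p) • axis n, q.2) (axis n))
    fun s _ => ContDiffAt.analyticAt ?_
  refine (contDiffAt_fiberMap ?_).clm_apply contDiffAt_const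
  refine ContDiffAt.comp (g := pullForm E Ω) (f := fun q : ℝ × Target n => ((q.1 * p) • axis n, q.2))
    (s, ζ) (ht.analyticAt_pullForm h (mem_tubeDom_axis h₁ _ hζ)).contDiffAt ?_
  exact ((contDiffAt_fst.mul contDiffAt_const).smul contDiffAt_const).prodMk contDiffAt_snd

lemma IsFiberedTube.meanDrift_sub (h₁ : 0 < r₁) (hζ : ‖ζ‖ < r₂) (β : Target n) : meanDrift Ω p E ζ -
    β = ∫ s in (0 : ℝ)..1, (fiberFrame Ω E ((s * p) • axis n, ζ) - driftMap β) (axis n) := by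
  have hint : IntervalIntegrable (fun s : ℝ => fiberFrame Ω E ((s * p) • axis n, ζ) (axis n))
      volume 0 1 := ContinuousOn.intervalIntegrable fun s _ => by
    have h1 : ContinuousAt (fun s : ℝ => ((s * p) • axis n, ζ)) s := by fun_prop
    have h2 := (contDiffAt_fiberMap (ht.analyticAt_pullForm h
      (mem_tubeDom_axis h₁ (s * p) hζ)).contDiffAt (r := 0)).continuousAt
    exact ((ContinuousAt.comp (g := fun x => fiberMap (pullForm E Ω x))
      (f := fun s : ℝ => ((s * p) • axis n, ζ)) (x := s) h2 h1).clm_apply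
      continuousAt_const).continuousWithinAt
  have h4 := driftMap_axis β 1
  rw [one_smul, one_smul] at h4
  simp only [sub_apply, h4]
  rw [intervalIntegral.integral_sub hint intervalIntegrable_const]
  simp [meanDrift]

lemma IsFiberedTube.norm_meanDrift_sub_le (h₁ : 0 < r₁) (hc : ∀ x ∈ tubeDom r₁ r₂, ‖fiberFrame Ω E x
    - driftMap (b x.2)‖ ≤ c) (hζ : ‖ζ‖ < r₂) : ‖meanDrift Ω p E ζ - b ζ‖ ≤ c := by
  rw [ht.meanDrift_sub h h₁ hζ]
  have h2 := intervalIntegral.norm_integral_le_of_norm_le_const (a := (0 : ℝ)) (b := 1) (C := c)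
    (f := fun s => (fiberFrame Ω E ((s * p) • axis n, ζ) - driftMap (b ζ)) (axis n)) fun s _ => by
    have h3 := ((fiberFrame Ω E ((s * p) • axis n, ζ) - driftMap (b ζ)).le_opNorm (axis n)).trans
      (mul_le_mul_of_nonneg_right (hc _ (mem_tubeDom_axis h₁ (s * p) hζ)) (norm_nonneg _))
    rwa [norm_axis, mul_one] at h3
  simpa using h2

lemma IsFiberedTube.fiberPeriod_add (h₁ : 0 < r₁) (hx : x ∈ tubeDom r₁ r₂) : fiberPeriod (pullForm E
    Ω) (x.1 + p • axis n, x.2) = fiberPeriod (pullForm E Ω) x + p • meanDrift Ω p E x.2 := by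
  have h0 : fiberPeriod (pullForm E Ω) (0, x.2) = 0 := by simp [fiberPeriod]
  have h1 : fiberPeriod (pullForm E Ω) (p • axis n, x.2) = p • meanDrift Ω p E x.2 := by
    rw [fiberPeriod, meanDrift, ← intervalIntegral.integral_smul]
    simp only [map_smul, smul_smul, fiberFrame]
  have hd : ∀ τ ∈ {τ : Target n | ‖offAxis n τ‖ < r₁}, HasFDerivAt
      (fun τ => fiberPeriod (pullForm E Ω) (τ + p • axis n, x.2) -
        fiberPeriod (pullForm E Ω) (τ, x.2)) (0 : Target n →L[ℝ] Target n) τ := by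
    intro τ hτ
    have hτx : (τ, x.2) ∈ tubeDom r₁ r₂ := ⟨hτ, hx.2⟩
    have h2 := ht.hasFDerivAt_fiberPeriod h (tubeDom_add_axis hτx p)
    have h3 := HasFDerivAt.comp (𝕜 := ℝ) (g := fun τ => fiberPeriod (pullForm E Ω) (τ, x.2)) τ h2
      ((hasFDerivAt_id τ).add_const (p • axis n))
    refine (h3.sub (ht.hasFDerivAt_fiberPeriod h hτx)).congr_fderiv ?_
    have h4 := pullForm_periodic ht.analytic ht.periodic Ω hτx 1
    simp only [Int.cast_one, one_mul] at h4
    simp only [fiberFrame, h4]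
    ext u; simp
  have h2 := (isOpen_offAxis r₁).is_const_of_fderiv_eq_zero (𝕜 := ℝ) (convex_offAxis r₁).isPreconnected
    (fun τ hτ => (hd τ hτ).differentiableAt.differentiableWithinAt) (fun τ hτ => (hd τ hτ).fderiv)
    hx.1 (show ‖offAxis n 0‖ < r₁ by simpa using h₁)
  simp only [zero_add, h0, h1, sub_zero] at h2
  rw [← h2]
  abel

/-- A fibered tube whose frame is nearly standard can be reparametrised as a tube. -/
theorem IsFiberedTube.exists_isTube (hp : 0 < p) (h₁0 : 0 < r₁) (h₁' : 0 < r₁') (h₂ : 0 < r₂) (hb :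
    ∀ ζ, ‖ζ‖ < r₂ → ‖b ζ - axis n‖ ≤ 1 / 4) (hc : ∀ x ∈ tubeDom r₁ r₂, ‖fiberFrame Ω E x - driftMap
    (b x.2)‖ ≤ c) (hc0 : 0 ≤ c) (hc' : 24 * c ≤ 1) (hr : r₁' + 48 * c * (p + r₁) ≤ r₁) : ∃ E',
    IsTube Ω F p r₁' r₂ (meanDrift Ω p E) E' ∧ (∀ x ∈ tubeDom r₁' r₂, ∃ τ, (τ, x.2) ∈ tubeDom r₁ r₂
    ∧ ‖τ - x.1‖ ≤ 24 * c * (p + r₁) ∧ E' x = E (τ, x.2)) ∧ ∀ x ∈ tubeDom r₁ r₂, ‖offAxis n x.1‖ + 48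
    * c * (p + r₁) < r₁' → ∃ τ, ‖τ - x.1‖ ≤ 24 * c * (p + r₁) ∧ E' (τ, x.2) = E x := by
  set d : ℝ := 12 * c * (p + r₁) with hd
  have hd0 : 0 ≤ d := by positivity
  set β := meanDrift Ω p E with hβdef
  set f : Coords n → Target n := fun x => driftInv (β x.2) (fiberPeriod (pullForm E Ω) x) with hf
  have hββ : ∀ ζ, ‖ζ‖ < r₂ → ‖β ζ - b ζ‖ ≤ c := fun ζ hζ => ht.norm_meanDrift_sub_le h h₁0 hc hζ
  have hβ : ∀ ζ, ‖ζ‖ < r₂ → ‖β ζ - axis n‖ ≤ 1 / 2 := fun ζ hζ => by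
    have := norm_add_le (β ζ - b ζ) (b ζ - axis n)
    rw [sub_add_sub_cancel] at this
    linarith [hββ ζ hζ, hb ζ hζ]
  have hβ0 : ∀ ζ, ‖ζ‖ < r₂ → β ζ 0 ≠ 0 := fun ζ hζ h0 => by
    have := (abs_apply_zero_le (β ζ - axis n)).trans (hβ ζ hζ)
    simp only [PiLp.sub_apply, axis_zero, h0] at this
    norm_num at this
  have hfa : ∀ x ∈ tubeDom r₁ r₂, AnalyticAt ℝ f x := by
    intro x hx
    have hP : ContDiffAt ℝ ω (fiberPeriod (pullForm E Ω)) x :=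
      (analyticAt_fiberPeriod fun s hs => ht.analyticAt_pullForm h ⟨by
        rw [map_smul, norm_smul, Real.norm_of_nonneg hs.1]
        exact (mul_le_of_le_one_left (norm_nonneg _) hs.2).trans_lt hx.1, hx.2⟩).contDiffAt
    have hβa : ContDiffAt ℝ ω (fun x : Coords n => β x.2) x :=
      ContDiffAt.comp (g := β) x (ht.analyticAt_meanDrift h h₁0 hx.2).contDiffAt contDiffAt_snd
    have hco : ∀ {g : Coords n → Target n}, ContDiffAt ℝ ω g x →
        ContDiffAt ℝ ω (fun x => g x 0) x := fun hg =>
      (EuclideanSpace.proj (𝕜 := ℝ) (0 : Fin n)).contDiff.contDiffAt.comp x hg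
    have ho : ∀ {g : Coords n → Target n}, ContDiffAt ℝ ω g x →
        ContDiffAt ℝ ω (fun x => offAxis n (g x)) x := fun hg =>
      (offAxis n).contDiff.contDiffAt.comp x hg
    exact ((ho hP).add ((hco hP).smul (((hco hβa).inv (hβ0 _ hx.2)).smul
      (contDiffAt_const.sub (ho hβa))))).analyticAt
  have hfd : ∀ x ∈ tubeDom r₁ r₂, HasFDerivAt (fun τ => f (τ, x.2))
      ((driftInv (β x.2)).comp (fiberFrame Ω E x)) x.1 := fun x hx =>
    (driftInv (β x.2)).hasFDerivAt.comp x.1 (ht.hasFDerivAt_fiberPeriod h hx)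
  have hfd' : ∀ x ∈ tubeDom r₁ r₂, ∀ u,
      fderiv ℝ f x (u, 0) = driftInv (β x.2) (fiberFrame Ω E x u) := by
    intro x hx u
    have h1 := (hfa x hx).differentiableAt.hasFDerivAt_left
    exact congrArg (fun L : Target n →L[ℝ] Target n => L u) (h1.unique (hfd x hx))
  have hclose : ∀ x ∈ tubeDom r₁ r₂, ∀ u,
      ‖driftInv (β x.2) (fiberFrame Ω E x u) - u‖ ≤ 12 * c * ‖u‖ := by
    intro x hx u
    have h1 : driftInv (β x.2) (fiberFrame Ω E x u) - u =
        driftInv (β x.2) ((fiberFrame Ω E x - driftMap (b x.2)) u - u 0 • (β x.2 - b x.2)) := by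
      conv_lhs => rw [← driftInv_driftMap (hβ0 _ hx.2) u, ← map_sub]
      congr 1
      rw [driftInv_driftMap (hβ0 _ hx.2), sub_apply, driftMap_apply, driftMap_apply]
      module
    rw [h1]
    refine (norm_driftInv_le (hβ _ hx.2) _).trans ?_
    have h2 := ((fiberFrame Ω E x - driftMap (b x.2)).le_opNorm u).trans
      (mul_le_mul_of_nonneg_right (hc x hx) (norm_nonneg u))
    have h3 : ‖u 0 • (β x.2 - b x.2)‖ ≤ ‖u‖ * c := by
      rw [norm_smul]
      exact mul_le_mul (abs_apply_zero_le u) (hββ _ hx.2) (norm_nonneg _) (norm_nonneg _)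
    linarith [norm_sub_le ((fiberFrame Ω E x - driftMap (b x.2)) u) (u 0 • (β x.2 - b x.2))]
  have hfper : ∀ x ∈ tubeDom r₁ r₂, f (x.1 + p • axis n, x.2) = f x + p • axis n := by
    intro x hx
    have h1 := driftInv_driftMap (hβ0 _ hx.2) (axis n)
    have h2 := driftMap_axis (β x.2) 1
    rw [one_smul, one_smul] at h2
    rw [h2] at h1
    simp only [hf]
    rw [ht.fiberPeriod_add h h₁0 hx, map_add, map_smul, h1]
  have hfint : ∀ x ∈ tubeDom r₁ r₂, ∀ k : ℤ,
      f (x.1 + (k * p) • axis n, x.2) = f x + (k * p) • axis n := by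
    intro x hx k
    have h1 := periodic_int (p := p) (E := fun x => f x - x.1) (fun y hy => by
      simp only [hfper y hy]; abel) hx k
    simp only at h1
    rw [sub_eq_iff_eq_add] at h1
    rw [h1]; abel
  have hdist : ∀ x ∈ tubeDom r₁ r₂, ‖f x - x.1‖ ≤ d := by
    intro x hx
    obtain ⟨k, hk, -⟩ := existsUnique_add_zsmul_mem_Ico hp (x.1 0) 0
    set y := x.1 + (k * p) • axis n with hy
    have hyx : (y, x.2) ∈ tubeDom r₁ r₂ := tubeDom_add_axis hx _
    have h1 : f x - x.1 = f (y, x.2) - y := by rw [hy, hfint x hx k]; abel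
    have hyn : ‖y‖ ≤ p + r₁ := by
      rw [← offAxis_add_axis y]
      refine (norm_add_le _ _).trans ?_
      rw [norm_smul, norm_axis, mul_one, add_comm]
      refine add_le_add ?_ hyx.1.le
      have h2 : y 0 = x.1 0 + k • p := by simp [hy, axis_zero]
      rw [h2, Real.norm_of_nonneg hk.1]
      simpa using hk.2.le
    have h2 := (convex_offAxis (n := n) r₁).norm_image_sub_le_of_norm_hasFDerivWithin_le
      (f := fun τ => f (τ, x.2) - τ) (C := 12 * c) (x := 0) (y := y)
      (f' := fun τ => (driftInv (β x.2)).comp (fiberFrame Ω E (τ, x.2)) -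
        ContinuousLinearMap.id ℝ (Target n))
      (fun τ hτ => ((hfd (τ, x.2) ⟨hτ, hx.2⟩).sub (hasFDerivAt_id τ)).hasFDerivWithinAt)
      (fun τ hτ => opNorm_le_bound _ (by positivity) fun u =>
        hclose (τ, x.2) ⟨hτ, hx.2⟩ u) (show ‖offAxis n 0‖ < r₁ by simpa using h₁0) hyx.1
    have h0 : f (0, x.2) = 0 := by simp [hf, fiberPeriod]
    simp only [h0, sub_zero] at h2
    rw [h1]
    exact h2.trans (mul_le_mul_of_nonneg_left hyn (by positivity))
  have hO' : ∀ y ∈ {τ : Target n | ‖offAxis n τ‖ < r₁'},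
      closedBall y (2 * d) ⊆ {τ | ‖offAxis n τ‖ < r₁} := by
    intro y (hy : ‖offAxis n y‖ < r₁') z hz
    have h1 := norm_offAxis_le (z - y)
    have h2 := norm_add_le (offAxis n y) (offAxis n (z - y))
    rw [← map_add, add_sub_cancel] at h2
    have h3 := mem_closedBall_iff_norm.1 hz
    have : ‖offAxis n z‖ < r₁ := by linarith
    exact this
  obtain ⟨g, hg, hgu⟩ := exists_fiber_inverse (h := f) (O := {τ | ‖offAxis n τ‖ < r₁})
    (O' := {τ | ‖offAxis n τ‖ < r₁'}) (B := ball 0 r₂) hd0 (isOpen_offAxis r₁)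
    (convex_offAxis r₁) isOpen_ball (fun τ hτ l hl => hfa (τ, l) ⟨hτ, mem_ball_zero_iff.1 hl⟩)
    (fun τ hτ l hl u => by
      rw [hfd' (τ, l) ⟨hτ, mem_ball_zero_iff.1 hl⟩]
      exact (hclose (τ, l) ⟨hτ, mem_ball_zero_iff.1 hl⟩ u).trans
        (mul_le_mul_of_nonneg_right (by linarith) (norm_nonneg u)))
    (fun τ hτ l hl => hdist (τ, l) ⟨hτ, mem_ball_zero_iff.1 hl⟩) (isOpen_offAxis r₁') hO'
  have hg' : ∀ x ∈ tubeDom r₁' r₂, (g x, x.2) ∈ tubeDom r₁ r₂ ∧ ‖g x - x.1‖ ≤ 2 * d ∧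
      f (g x, x.2) = x.1 ∧ AnalyticAt ℝ g x := fun x hx => by
    obtain ⟨h1, h2⟩ := hg x.1 hx.1 x.2 (mem_ball_zero_iff.2 hx.2)
    exact ⟨⟨h1, hx.2⟩, h2⟩
  have hgu' : ∀ x ∈ tubeDom r₁' r₂, ∀ τ, (τ, x.2) ∈ tubeDom r₁ r₂ → f (τ, x.2) = x.1 → τ = g x :=
    fun x hx τ hτ => hgu x.1 hx.1 x.2 (mem_ball_zero_iff.2 hx.2) τ hτ.1
  refine ⟨fun x => E (g x, x.2), ⟨hp, h₁', h₂, hβ, fun ζ hζ => ht.analyticAt_meanDrift h h₁0 hζ,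
    fun x hx => ?_, fun x hx => ht.momentum _ (hg' x hx).1, fun x hx u => ?_, fun x hx => ?_,
    fun x hx y hy hxy => ?_⟩, fun x hx => ⟨g x, (hg' x hx).1, ?_, rfl⟩, fun x hx hxr => ?_⟩
  · obtain ⟨h1, -, -, h2⟩ := hg' x hx
    exact ContMDiffAt.comp (g := E) (f := fun x => (g x, x.2)) x (ht.analytic _ h1)
      (h2.contDiffAt.prodMk contDiffAt_snd).contMDiffAt
  · obtain ⟨h1, -, -, h2⟩ := hg' x hx
    have h3 : HasFDerivAt (fun x : Coords n => (g x, x.2))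
        ((fderiv ℝ g x).prod (snd ℝ _ _)) x :=
      h2.differentiableAt.hasFDerivAt.prodMk hasFDerivAt_snd
    have h4 := dParam_comp (n := n) (E := E) (φ := fun x : Coords n => (g x, x.2))
      ((ht.analytic _ h1).mdiff) h3.differentiableAt
    have h5 : fderiv ℝ f (g x, x.2) (fderiv ℝ g x (u, 0), 0) = u := by
      have h6 := HasFDerivAt.comp (𝕜 := ℝ) (g := f) x (hfa _ h1).differentiableAt.hasFDerivAt h3
      have h7 : HasFDerivAt (fun x : Coords n => f (g x, x.2))
          (fst ℝ (Target n) (Target n)) x := by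
        refine hasFDerivAt_fst.congr_of_eventuallyEq ?_
        filter_upwards [(isOpen_tubeDom r₁' r₂).mem_nhds hx] with y hy using (hg' y hy).2.2.1
      exact congrArg (fun L : (Coords n) →L[ℝ] Target n => L (u, 0)) (h6.unique h7)
    rw [hfd' _ h1] at h5
    have h6 := congrArg (driftMap (β x.2)) h5
    simp only at h6
    rw [driftMap_driftInv (hβ0 _ hx.2)] at h6
    rw [h4, h3.fderiv, ← driftMap_apply, ← h6]
    exact (ht.isFiberedAt h h1).dParam_eq_hamDir h (ht.bijective _ h1) _
  · obtain ⟨h1, -, h2, -⟩ := hg' x hx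
    have h3 : g x + p • axis n = g (x.1 + p • axis n, x.2) :=
      hgu' _ (tubeDom_add_axis hx p) _ (tubeDom_add_axis h1 p) ((hfper _ h1).trans (by rw [h2]))
    simp only [← h3]
    exact ht.periodic _ h1
  · obtain ⟨h1, -, h2, -⟩ := hg' x hx
    obtain ⟨h1', -, h2', -⟩ := hg' y hy
    have h3 := congrArg F hxy
    simp only [ht.momentum _ h1, ht.momentum _ h1'] at h3
    obtain ⟨k, hk⟩ := ht.injective _ h1 _ h1' hxy
    refine ⟨h3, k, ?_⟩
    have h4 := hfint _ h1' k
    simp only at hk h4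
    rw [← hk, add_sub_cancel, ← h3, h2, h3, h2'] at h4
    rw [h4, add_sub_cancel_left, hk]
  · exact (hg' x hx).2.1.trans_eq (by rw [hd]; ring)
  · have h1 := hdist x hx
    have h2 := norm_add_le (offAxis n x.1) (offAxis n (f x - x.1))
    rw [← map_add, add_sub_cancel] at h2
    have h3 : (f x, x.2) ∈ tubeDom r₁' r₂ := ⟨by linarith [norm_offAxis_le (f x - x.1)], hx.2⟩
    refine ⟨f x, h1.trans (by linarith), ?_⟩
    have h4 : x.1 = g (f x, x.2) := hgu' _ h3 x.1 hx rfl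
    simp only [← h4]
end FiberedTube

section Perturbation
variable {r' ε : ℝ}

lemma JetLE.add {ε ε' : ℝ} {f g : X → Y} {x : X} (hf : JetLE k ε f x) (hg : JetLE k ε' g x) : JetLE
    k (ε + ε') (fun x => f x + g x) x := by
  refine ⟨hf.1.add hg.1, fun j hj => ?_⟩
  rw [fun_iteratedFDeriv_add_apply (hf.1.of_le le_top) (hg.1.of_le le_top)]
  exact (norm_add_le _ _).trans (add_le_add (hf.2 j hj) (hg.2 j hj))

lemma JetLE.clm {ε : ℝ} {f : X → Y} {x : X} (hf : JetLE k ε f x) (L : Y →L[ℝ] Z) : JetLE k (‖L‖ * ε)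
    (fun x => L (f x)) x := by
  refine ⟨L.contDiff.contDiffAt.comp x hf.1, fun j hj => ?_⟩
  exact (L.norm_iteratedFDeriv_comp_left hf.1 le_top).trans
    (mul_le_mul_of_nonneg_left (hf.2 j hj) (norm_nonneg _))

/-- A compact part of a tube, which contains a period. -/
def tubePeriod (p r₁ r₂ : ℝ) : Set (Coords n) :=
  {x | x.1 0 ∈ Icc 0 p ∧ ‖offAxis n x.1‖ ≤ r₁ ∧ ‖x.2‖ ≤ r₂}

lemma isCompact_tubePeriod (p r₁ r₂ : ℝ) : IsCompact (tubePeriod (n := n) p r₁ r₂) := by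
  have h0 : Continuous fun x : Coords n => x.1 0 :=
    (EuclideanSpace.proj (𝕜 := ℝ) (0 : Fin n)).continuous.comp continuous_fst
  refine isCompact_of_isClosed_isBounded ?_ ?_
  · exact (isClosed_Icc.preimage h0).inter ((isClosed_le (f := fun x : Coords n =>
      ‖offAxis n x.1‖) (by fun_prop) continuous_const).inter (isClosed_le
      (f := fun x : Coords n => ‖x.2‖) (by fun_prop) continuous_const))
  · refine isBounded_closedBall (x := (0 : Coords n)) (r := max (r₁ + p) r₂)
      |>.subset fun x hx => ?_
    rw [mem_closedBall_zero_iff, Prod.norm_def]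
    refine max_le_max ?_ hx.2.2
    rw [← offAxis_add_axis x.1]
    refine (norm_add_le _ _).trans (add_le_add hx.2.1 ?_)
    rw [norm_smul, norm_axis, mul_one, Real.norm_of_nonneg hx.1.1]
    exact hx.1.2

lemma JetLE.of_periodic [CompleteSpace Y] {f : Coords n → Y} (hp : 0 < p) (hf : ∀ x ∈ tubeDom r₁ r₂,
    f (x.1 + p • axis n, x.2) = f x) (hQ : ∀ x ∈ tubeDom r₁ r₂, x.1 0 ∈ Icc 0 p → JetLE k ε f x) (hx
    : x ∈ tubeDom r₁ r₂) : JetLE k ε f x := by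
  obtain ⟨j, hj, -⟩ := existsUnique_add_zsmul_mem_Ico hp (x.1 0) 0
  have h1 : ∀ y : Coords n, y + ((j * p) • axis n, 0) = (y.1 + (j * p) • axis n, y.2) :=
    fun y => Prod.ext rfl (add_zero _)
  refine (JetLE.comp_add (f := f) (a := ((j * p) • axis n, 0)) ?_).congr ?_
  · rw [h1]
    refine hQ _ (tubeDom_add_axis hx _) (Ico_subset_Icc_self ?_)
    simpa [axis_zero] using hj
  · filter_upwards [(isOpen_tubeDom r₁ r₂).mem_nhds hx] with y hy
    rw [h1, periodic_int hf hy j]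

lemma eventually_mul_lt (K : ℝ) {δ : ℝ} (hδ : 0 < δ) : ∀ᶠ ε : ℝ in 𝓝[>] 0, K * ε < δ := by
  have h : ContinuousAt (fun ε : ℝ => K * ε) 0 := by fun_prop
  exact eventually_nhdsWithin_of_eventually_nhds
    (h.eventually_lt continuousAt_const (by simpa using hδ))

lemma IsTube.exists_transfer (ht : IsTube Ω F p r₁ r₂ b E) (h : IsIntegrableSystem Ω F) {s₁ s₂ : ℝ}
    (h₁ : s₁ < r₁) (h₂ : s₂ < r₂) (P : CompactPieces n M) (hK : E '' tubePeriod p s₁ s₂ ⊆ ⋃ i,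
    P.piece i) (k : ℕ) : ∃ C ≥ 0, ∀ (ε : ℝ) (Ω' : DForm n M 2) (F' : M → Target n),
    IsIntegrableSystem Ω' F' → SystemCkClose P k ε Ω Ω' F F' → ∀ x ∈ tubeDom s₁ s₂, JetLE k (C * ε)
    (fun x => F' (E x) - x.2) x ∧ JetLE k (C * ε) (fun x => pullForm E Ω' x - pullForm E Ω x) x :=
    by
  have hsub : tubeDom s₁ s₂ ⊆ tubeDom (n := n) r₁ r₂ := fun x hx => ⟨hx.1.trans h₁, hx.2.trans h₂⟩
  obtain ⟨C, hC, hT⟩ := Integrable.exists_transfer (isCompact_tubePeriod p s₁ s₂)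
    (fun x hx => ht.analytic x ⟨hx.2.1.trans_lt h₁, hx.2.2.trans_lt h₂⟩) P hK k
  refine ⟨C, hC, fun ε Ω' F' h' hc x hx => ⟨?_, ?_⟩⟩
  · refine JetLE.of_periodic ht.period_pos (fun y hy => ?_) (fun y hy hy0 => ?_) hx
    · simp only [ht.periodic y (hsub hy)]
    · refine (hT ε Ω Ω' F F' h h' hc y ⟨hy0, hy.1.le, hy.2.le⟩).1.congr ?_
      filter_upwards [(isOpen_tubeDom r₁ r₂).mem_nhds (hsub hy)] with z hz
      rw [ht.momentum z hz]
  · refine JetLE.of_periodic ht.period_pos (fun y hy => ?_)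
      (fun y hy hy0 => (hT ε Ω Ω' F F' h h' hc y ⟨hy0, hy.1.le, hy.2.le⟩).2) hx
    have h3 := fun η : DForm n M 2 => pullForm_periodic ht.analytic ht.periodic (η := η) (hsub hy) 1
    simp only [Int.cast_one, one_mul] at h3
    rw [h3, h3]

set_option maxHeartbeats 1000000 in
theorem IsTube.exists_isFiberedTube (ht : IsTube Ω F p r₁ r₂ b E) (h : IsIntegrableSystem Ω F) (hr'0
    : 0 < r') (hr' : r' < r₂) : ∃ K, IsCompact K ∧ K ⊆ E '' tubeDom r₁ r₂ ∧ ∀ P : CompactPieces n M,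
    K ⊆ ⋃ i, P.piece i → ∀ m : ℕ, ∃ C ≥ 0, ∀ᶠ ε : ℝ in 𝓝[>] 0, ∀ (Ω' : DForm n M 2) (F' : M → Target
    n), IsIntegrableSystem Ω' F' → SystemCkClose P (m + 1) ε Ω Ω' F F' → ∃ E', IsFiberedTube F' p
    (r₁ / 2) r' E' ∧ (∀ x ∈ tubeDom (r₁ / 2) r', JetLE m (C * ε) (fun x => fiberFrame Ω' E' x -
    driftMap (b x.2)) x) ∧ (∀ x ∈ tubeDom (r₁ / 2) r', ∃ ζ, ‖ζ - x.2‖ ≤ C * ε ∧ (x.1, ζ) ∈ tubeDom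
    r₁ r₂ ∧ E' x = E (x.1, ζ)) ∧ ∀ x ∈ tubeDom (r₁ / 2) (r' / 2), ∃ ζ, ‖ζ‖ < r' ∧ ‖ζ - x.2‖ ≤ C * ε
    ∧ E' (x.1, ζ) = E x := by
  have hr₁ := ht.width_pos
  set s₁ : ℝ := 3 / 4 * r₁ with hs₁
  set s₂ : ℝ := (r' + r₂) / 2 with hs₂
  have hs₁r : s₁ < r₁ := by linarith
  have hs₂r : s₂ < r₂ := by linarith
  have hQsub : tubePeriod p s₁ s₂ ⊆ tubeDom (n := n) r₁ r₂ := fun x hx =>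
    ⟨hx.2.1.trans_lt hs₁r, hx.2.2.trans_lt hs₂r⟩
  refine ⟨E '' tubePeriod p s₁ s₂, (isCompact_tubePeriod p s₁ s₂).image_of_continuousOn
    fun x hx => (ht.analytic x (hQsub hx)).continuousAt.continuousWithinAt, image_mono hQsub,
    fun P hK m => ?_⟩
  obtain ⟨C₁, hC₁, hT⟩ := ht.exists_transfer h hs₁r hs₂r P hK (m + 1)
  set Q : Set (Coords n) := tubePeriod p (r₁ / 2) r'
  have hQ : IsCompact Q := isCompact_tubePeriod p _ _
  have hQD : ∀ x ∈ Q, x ∈ tubeDom r₁ r₂ := fun x hx =>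
    ⟨hx.2.1.trans_lt (by linarith), hx.2.2.trans_lt hr'⟩
  have hθ : ∀ x ∈ Q, ContDiffAt ℝ ω (pullForm E Ω) x := fun x hx =>
    contDiffAt_pullForm h.symplectic.analytic (mem_univ _) (ht.analytic x (hQD x hx))
  obtain ⟨C₂, hC₂, δ₂, hδ₂, hI⟩ := exists_jet_bound_inverse (m + 1) hQ
  let X := Coords n
  let S : X × (X × (X →L[ℝ] X)) → X [⋀^Fin 2]→L[ℝ] ℝ →L[ℝ] X [⋀^Fin 2]→L[ℝ] ℝ := fun q =>
    ContinuousAlternatingMap.compContinuousLinearMapCLM (ContinuousLinearMap.id ℝ X + q.2.2)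
  have hS : ContDiff ℝ ω S := (contDiff_compContinuousLinearMapCLM 2).comp
    (contDiff_const.add contDiff_snd.snd)
  have hG : ContDiff ℝ ω fun q : X × (X × (X →L[ℝ] X)) => q.1 + q.2.1 :=
    contDiff_fst.add contDiff_snd.fst
  obtain ⟨C₃, hC₃, δ₃, hδ₃, hB⟩ := exists_jet_bound m (T := S) (G := fun q => q.1 + q.2.1) hQ
    (fun x _ => hS.contDiffAt.analyticAt) (fun x _ => hG.contDiffAt.analyticAt)
  obtain ⟨C₄, hC₄, δ₄, hδ₄, hV⟩ := exists_jet_bound_of_vanishing m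
    (T := fun q => S q (pullForm E Ω (q.1 + q.2.1)) - pullForm E Ω q.1) hQ
    (fun x hx => ((hS.contDiffAt.clm_apply (ContDiffAt.comp (g := pullForm E Ω)
      (x, ((0 : X), (0 : X →L[ℝ] X))) (by simpa using hθ x hx) hG.contDiffAt)).sub
      (ContDiffAt.comp (g := pullForm E Ω) (x, ((0 : X), (0 : X →L[ℝ] X))) (hθ x hx)
        contDiffAt_fst)).analyticAt)
    (fun x _ => Filter.Eventually.of_forall fun x' => by
      simp only [S, Prod.snd_zero, Prod.fst_zero, add_zero]
      exact sub_eq_zero.2 (ContinuousAlternatingMap.ext fun v => rfl))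
  set L : (X [⋀^Fin 2]→L[ℝ] ℝ) →L[ℝ] (Target n →L[ℝ] Target n) :=
    isBoundedLinearMap_fiberMap.toContinuousLinearMap
  set C := max (2 * C₁) (‖L‖ * (C₃ * C₁ + C₄ * (C₂ * C₁)))
  refine ⟨C, le_max_of_le_left (by positivity), ?_⟩
  filter_upwards [eventually_mul_lt C₁ (half_pos one_pos), eventually_mul_lt C₁ hδ₂,
    eventually_mul_lt (2 * C₁) (show 0 < (r₂ - r') / 4 by linarith),
    eventually_mul_lt (C₂ * C₁) hδ₃, eventually_mul_lt (C₂ * C₁) hδ₄,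
    eventually_mul_lt C₁ (half_pos hr'0), self_mem_nhdsWithin] with ε hε₁ hε₂ hε₃ hε₄ hε₅ hε₆ hε₀ Ω' F' h' hc
  replace hT := hT ε Ω' F' h' hc
  have he0 : 0 ≤ C₁ * ε := mul_nonneg hC₁ (mem_Ioi.1 hε₀).le
  have hε0 : ‖L‖ * (C₃ * C₁ + C₄ * (C₂ * C₁)) * ε ≤ C * ε ∧ 2 * (C₁ * ε) ≤ C * ε := by
    exact ⟨mul_le_mul_of_nonneg_right (le_max_right _ _) (mem_Ioi.1 hε₀).le, by
      rw [← mul_assoc]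
      exact mul_le_mul_of_nonneg_right (le_max_left _ _) (mem_Ioi.1 hε₀).le⟩
  set e := C₁ * ε with he
  have ha : ∀ x ∈ tubeDom s₁ s₂, ContDiffAt ℝ ω (fun x => F' (E x)) x := fun x hx =>
    ((hT x hx).1.1.add contDiffAt_snd).congr_of_eventuallyEq (.of_forall fun y => by
      simp only [sub_add_cancel])
  have hs₂' : 0 < s₂ := by linarith
  have hD : ∀ ζ ∈ ball (0 : Target n) s₂, ∀ τ ∈ {τ : Target n | ‖offAxis n τ‖ < s₁}, ∀ u,
      ‖fderiv ℝ (fun q : X => F' (E (q.2, q.1))) (ζ, τ) (u, 0) - u‖ ≤ 1 / 2 * ‖u‖ := by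
    intro ζ hζ τ hτ u
    have hx : (τ, ζ) ∈ tubeDom s₁ s₂ := ⟨hτ, mem_ball_zero_iff.1 hζ⟩
    have h1 := ((ha _ hx).diff).hasFDerivAt
    have h2 := (h1.sub hasFDerivAt_snd).fderiv
    have h3 := (hT _ hx).1.fderiv.norm_le
    have h4 := HasFDerivAt.comp (g := fun x => F' (E x)) (f := fun q : X => (q.2, q.1)) (ζ, τ) h1
      (hasFDerivAt_snd.prodMk hasFDerivAt_fst)
    rw [show (fun q : X => F' (E (q.2, q.1))) = (fun x => F' (E x)) ∘ fun q : X => (q.2, q.1) from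
      rfl, h4.fderiv]
    rw [show (fun x : X => F' (E x) - x.2) = (fun x => F' (E x)) - Prod.snd from rfl, h2] at h3
    have h5 := (ContinuousLinearMap.le_opNorm _ ((0, u) : X)).trans
      (mul_le_mul_of_nonneg_right h3 (norm_nonneg _))
    rw [show ‖((0, u) : X)‖ = ‖u‖ by simp [Prod.norm_def]] at h5
    refine le_trans (le_of_eq ?_) (h5.trans (mul_le_mul_of_nonneg_right hε₁.le (norm_nonneg _)))
    rfl
  have hO : ∀ ζ ∈ ball (0 : Target n) ((r' + s₂) / 2), closedBall ζ (2 * e) ⊆ ball 0 s₂ := by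
    intro ζ hζ ζ' hζ'
    rw [mem_ball_zero_iff] at hζ ⊢
    rw [mem_closedBall, dist_eq_norm] at hζ'
    have h1 := norm_add_le (ζ' - ζ) ζ
    rw [sub_add_cancel] at h1
    linarith
  obtain ⟨χ, hχ, hχu⟩ := exists_fiber_inverse (h := fun q : Coords n => F' (E (q.2, q.1)))
    (O := ball 0 s₂) (B := {τ | ‖offAxis n τ‖ < s₁}) (O' := ball 0 ((r' + s₂) / 2))
    (d := e) he0 isOpen_ball (convex_ball _ _) (isOpen_offAxis s₁)
    (fun ζ hζ τ hτ => (ContDiffAt.comp (g := fun x => F' (E x)) (f := fun q : X => (q.2, q.1)) (ζ, τ)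
      (ha (τ, ζ) ⟨hτ, mem_ball_zero_iff.1 hζ⟩) (contDiffAt_snd.prodMk contDiffAt_fst)).analyticAt)
    hD (fun ζ hζ τ hτ => (hT (τ, ζ) ⟨hτ, mem_ball_zero_iff.1 hζ⟩).1.norm_le) isOpen_ball
    hO

  set D' : Set X := tubeDom s₁ ((r' + s₂) / 2)
  have hD' : ∀ x ∈ tubeDom (r₁ / 2) r', x ∈ D' := fun x hx => ⟨hx.1.trans (by linarith),
    hx.2.trans (by linarith)⟩
  replace hχ := fun (x : X) (hx : x ∈ D') => hχ x.2 (mem_ball_zero_iff.2 hx.2) x.1 hx.1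
  replace hχu := fun (x : X) (hx : x ∈ D') ζ hζ => hχu x.2 (mem_ball_zero_iff.2 hx.2) x.1 hx.1 ζ hζ
  have hmem : ∀ x ∈ D', (x.1, χ (x.2, x.1)) ∈ tubeDom s₁ s₂ := fun x hx =>
    ⟨hx.1, mem_ball_zero_iff.1 (hχ x hx).1⟩
  have hDE : tubeDom s₁ s₂ ⊆ tubeDom (n := n) r₁ r₂ := fun x hx =>
    ⟨hx.1.trans hs₁r, hx.2.trans hs₂r⟩
  set g : X → X := fun x => (x.1, χ (x.2, x.1)) with hg
  set w : X → X := fun x => (0, χ (x.2, x.1) - x.2) with hw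
  have hgw : ∀ x, x + w x = g x := fun x => Prod.ext (add_zero _) (add_sub_cancel _ _)
  have hχa : ∀ x ∈ D', ContDiffAt ℝ ω (fun x : X => χ (x.2, x.1)) x := fun x hx =>
    ContDiffAt.comp (g := χ) (f := fun x : X => (x.2, x.1)) x (hχ x hx).2.2.2.contDiffAt
      (contDiffAt_snd.prodMk contDiffAt_fst)
  have hga : ∀ x ∈ D', ContDiffAt ℝ ω g x := fun x hx => contDiffAt_fst.prodMk (hχa x hx)
  have hwa : ∀ x ∈ D', ContDiffAt ℝ ω w x := fun x hx =>
    contDiffAt_const.prodMk ((hχa x hx).sub contDiffAt_snd)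
  have hEa : ∀ x ∈ D', MDifferentiableAt 𝓘(ℝ, X) 𝓘[n] E (g x) := fun x hx =>
    (ht.analytic _ (hDE (hmem x hx))).mdiff
  have hD'o : ∀ x ∈ D', D' ∈ 𝓝 x := fun x hx => (isOpen_tubeDom _ _).mem_nhds hx
  have hE'a : ∀ x ∈ D', ContMDiffAt 𝓘(ℝ, X) 𝓘[n] ω (fun x => E (g x)) x := fun x hx =>
    ContMDiffAt.comp (g := E) (f := g) x (ht.analytic _ (hDE (hmem x hx))) (hga x hx).contMDiffAt
  have hper : ∀ x ∈ D', E (g (x.1 + p • axis n, x.2)) = E (g x) := fun x hx => by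
    have h1 : χ (x.2, x.1) = χ (x.2, x.1 + p • axis n) := by
      refine hχu _ (tubeDom_add_axis hx p) _ (hχ x hx).1 ?_
      exact (congrArg F' (ht.periodic _ (hDE (hmem x hx)))).trans (hχ x hx).2.2.1
    rw [hg]
    simp only [← h1]
    exact ht.periodic _ (hDE (hmem x hx))
  refine ⟨fun x => E (g x), ⟨fun x hx => hE'a x (hD' x hx), fun x hx => (hχ x (hD' x hx)).2.2.1,
    fun x hx => ?_, fun x hx => hper x (hD' x hx), fun x hx y hy hxy => ?_⟩, fun x hx => ?_,
    fun x hx => ⟨χ (x.2, x.1), ((hχ x (hD' x hx)).2.1).trans hε0.2, hDE (hmem x (hD' x hx)), rfl⟩,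
    fun x hx => ?_⟩
  · have hx' := hD' x hx
    refine IsFiberedAt.bijective (isFiberedAt_of_eventually
      (h'.analytic _ |>.mdiff) ((hE'a x hx').mdiff)
      (c := 0) ?_) fun u hu => ?_
    · filter_upwards [hD'o x hx'] with y hy
      rw [zero_add, (hχ y hy).2.2.1]
    · rw [dParam_comp (hEa x hx') ((hga x hx').diff)] at hu
      have h1 := (injective_iff_map_eq_zero _).1 (ht.bijective h (hDE (hmem x hx'))).1 _ hu
      rw [(hasFDerivAt_fst.prodMk ((hχa x hx').diff).hasFDerivAt).fderiv]
        at h1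
      exact congrArg Prod.fst h1
  · exact (ht.injective _ (hDE (hmem x (hD' x hx))) _ (hDE (hmem y (hD' y hy))) hxy).2
  · refine JetLE.of_periodic ht.period_pos (fun y hy => ?_) (fun y hy hy0 => ?_) hx
    · have h1 := pullForm_periodic (E := fun x => E (g x)) (r₁ := r₁ / 2) (r₂ := r') (η := Ω')
        (fun x hx => hE'a x (hD' x hx)) (p := p) (fun x hx => hper x (hD' x hx)) hy 1
      simp only [Int.cast_one, one_mul] at h1
      simp only [fiberFrame, h1]
    · have hyQ : y ∈ Q := ⟨hy0, hy.1.le, hy.2.le⟩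
      have hyD := hD' y hy
      have hTy := hT _ (hmem y hyD)
      have hw1 : JetLE (m + 1) (C₂ * e) w y := by
        refine hI y hyQ (fun x => (0, F' (E x) - x.2)) w e hε₂.le ?_ (hwa y hyD) ?_
        · rw [hgw]
          exact (jetLE_const_zero _ he0 _).prodMk hTy.1
        · filter_upwards [hD'o y hyD] with z hz
          rw [hgw]
          have h1 := (hχ z hz).2.2.1
          simp only at h1
          simp only [hg, hw, h1, Prod.neg_mk, neg_zero, neg_sub]
      have hw2 : JetLE m (C₂ * e) (fun x => (w x, fderiv ℝ w x)) y :=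
        (hw1.mono (by lia) le_rfl).prodMk hw1.fderiv
      rw [mul_assoc, ← he] at hε₄ hε₅
      have h1 := hB y hyQ _ (fun x => pullForm E Ω' x - pullForm E Ω x) e
        (hw2.mono le_rfl hε₄.le) (by simpa only [hgw] using hTy.2.mono (by lia) le_rfl)
      have h2 := ((h1.add (hV y hyQ _ _ hε₅.le hw2)).clm L).mono le_rfl
        (le_trans (le_of_eq (by rw [he]; ring)) hε0.1)
      refine h2.congr ?_
      filter_upwards [hD'o y hyD, (isOpen_tubeDom _ _).mem_nhds hy] with z hz hz'
      have h5 : HasFDerivAt (fun x => x + w x) (ContinuousLinearMap.id ℝ X + fderiv ℝ w z) z :=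
        (hasFDerivAt_id z).add ((hwa z hz).diff).hasFDerivAt
      have h3 : pullForm (fun x => E (g x)) Ω' z =
          S (z, (w z, fderiv ℝ w z)) (pullForm E Ω' (z + w z)) := by
        rw [show (fun x => E (g x)) = E ∘ g from rfl,
          pullForm_comp (hEa z hz) ((hga z hz).diff), hgw,
          show g = fun x => x + w x from funext fun x => (hgw x).symm, h5.fderiv]
        rfl
      have h4 : driftMap (b z.2) = L (pullForm E Ω z) :=
        (ht.fiberMap_eq h ⟨hz'.1.trans (by linarith), hz'.2.trans hr'⟩).symm
      rw [h4, fiberFrame, h3, map_sub (S _), sub_add_sub_cancel, map_sub L]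
      rfl
  · have hx1 : x ∈ tubeDom s₁ s₂ := ⟨hx.1.trans (by linarith), hx.2.trans (by linarith)⟩
    have h1 : ‖F' (E x) - x.2‖ ≤ e := (hT x hx1).1.norm_le
    have h2 := norm_add_le (F' (E x) - x.2) x.2
    rw [sub_add_cancel] at h2
    have h3 := hx.2
    have h4 : ((x.1, F' (E x)) : X) ∈ D' := ⟨hx1.1, by
      show ‖F' (E x)‖ < _
      linarith⟩
    refine ⟨F' (E x), by linarith, h1.trans (by linarith [hε0.2]), ?_⟩
    have h5 := hχu _ h4 x.2 (mem_ball_zero_iff.2 hx1.2) rfl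
    simp only [hg]
    rw [← h5]
end Perturbation

section PerturbedTube
variable {r' η : ℝ}

theorem IsTube.exists_perturbation (ht : IsTube Ω F p r₁ r₂ b E) (h : IsIntegrableSystem Ω F) (hb :
    ∀ ζ, ‖ζ‖ < r₂ → ‖b ζ - axis n‖ ≤ 1 / 4) (hr'0 : 0 < r') (hr' : r' < r₂) (hη : 0 < η) : ∃ K,
    IsCompact K ∧ K ⊆ E '' tubeDom r₁ r₂ ∧ ∀ P : CompactPieces n M, K ⊆ ⋃ i, P.piece i → ∀ m : ℕ, ∃
    C ≥ 0, ∀ᶠ ε : ℝ in 𝓝[>] 0, ∀ (Ω' : DForm n M 2) (F' : M → Target n), IsIntegrableSystem Ω' F' →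
    SystemCkClose P (m + 1) ε Ω Ω' F F' → ∃ b' E', IsTube Ω' F' p (r₁ / 4) r' b' E' ∧ (∀ ζ, ‖ζ‖ < r'
    → JetLE m (C * ε) (fun ζ => b' ζ - b ζ) ζ) ∧ (∀ x ∈ tubeDom (r₁ / 4) r', ∃ y ∈ tubeDom r₁ r₂, ‖y
    - x‖ ≤ η ∧ E' x = E y) ∧ ∀ x ∈ tubeDom (r₁ / 8) (r' / 2), ∃ y, ‖y - x‖ ≤ η ∧ E' y = E x := by
  obtain ⟨K, hK, hKE, hP⟩ := ht.exists_isFiberedTube h hr'0 hr'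
  refine ⟨K, hK, hKE, fun P hKP m => ?_⟩
  obtain ⟨C, hC, hT⟩ := hP P hKP m
  have hr₁ := ht.width_pos
  have hp := ht.period_pos
  let A := Target n →L[ℝ] Target n
  let L : A →L[ℝ] Target n := ContinuousLinearMap.apply ℝ _ (axis n)
  have hG : ContDiff ℝ ω fun q : Coords n => ((0 : Target n), q.1) :=
    contDiff_const.prodMk contDiff_fst
  obtain ⟨C', hC', δ, hδ, hJ⟩ := exists_jet_bound m (X := Target n) (Y := Target n) (T := fun _ => L)
    (G := fun q => (0, q.1)) (isCompact_closedBall (0 : Target n) r')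
    (fun x _ => analyticAt_const) (fun x _ => hG.contDiffAt.analyticAt)
  refine ⟨C' * C, by positivity, ?_⟩
  have hpr : 0 < p + r₁ / 2 := by positivity
  filter_upwards [hT, eventually_mul_lt (24 * C) one_pos,
    eventually_mul_lt (48 * C * (p + r₁ / 2)) (show 0 < r₁ / 8 by positivity),
    eventually_mul_lt (24 * C * (p + r₁ / 2)) hη, eventually_mul_lt C hη, self_mem_nhdsWithin]
    with ε hT hε₁ hε₂ hε₃ hε₄ hε₀ Ω' F' h' hc
  obtain ⟨E₁, ht₁, hJ₁, hE₁, hE₁'⟩ := hT Ω' F' h' hc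
  have hc0 : 0 ≤ C * ε := mul_nonneg hC (mem_Ioi.1 hε₀).le
  obtain ⟨E', ht', hE', hE''⟩ := ht₁.exists_isTube h' hp (by positivity : 0 < r₁ / 2)
    (r₁' := r₁ / 4) (b := b) (by positivity) hr'0 (fun ζ hζ => hb ζ (hζ.trans hr'))
    (fun x hx => (hJ₁ x hx).norm_le) hc0 (by linarith) (by linarith)
  refine ⟨_, E', ht', fun ζ hζ => ?_, fun x hx => ?_, fun x hx => ?_⟩
  · set Δ := fun x : Coords n => fiberFrame Ω' E₁ x - driftMap (b x.2) with hΔ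
    have hx : ∀ s : ℝ, (((s * p) • axis n, ζ) : Coords n) ∈ tubeDom (r₁ / 2) r' :=
      fun s => ⟨by simpa [offAxis_axis] using hr₁, hζ⟩
    have h1 : JetLE m (C' * (C * ε) * |1 - 0|)
        (fun ζ => ∫ s in (0 : ℝ)..1, Δ ((s * p) • axis n, ζ) (axis n)) ζ := by
      refine jetLE_intervalIntegral m (f := fun q : ℝ × Target n => Δ ((q.1 * p) • axis n, q.2)
        (axis n)) (fun s _ => ?_) (fun s _ => ?_)
      · have h2 : ContDiff ℝ ω fun q : ℝ × Target n => ((q.1 * p) • axis n, q.2) :=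
          ((contDiff_fst.mul contDiff_const).smul contDiff_const).prodMk contDiff_snd
        exact ((ContDiffAt.comp (g := Δ) (s, ζ) (hJ₁ _ (hx s)).1 h2.contDiffAt).clm_apply
          contDiffAt_const).analyticAt
      · have h2 := hJ ζ (mem_closedBall_zero_iff.2 hζ.le) (fun _ => 0)
          (fun x => Δ (x + ((s * p) • axis n, 0))) (C * ε) (jetLE_const_zero m hδ.le ζ)
          (JetLE.comp_add (f := Δ) (a := ((s * p) • axis n, 0))
            (by simpa only [Prod.mk_add_mk, zero_add, add_zero] using hJ₁ _ (hx s)))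
        simp only [Prod.mk_add_mk, zero_add, add_zero] at h2
        exact h2
    rw [sub_zero, abs_one, mul_one, ← mul_assoc] at h1
    refine h1.congr ?_
    filter_upwards [(isOpen_lt continuous_norm continuous_const).mem_nhds hζ] with ξ hξ
    exact ht₁.meanDrift_sub h' (half_pos hr₁) hξ (b ξ)
  · obtain ⟨τ, hτ, hτx, h1⟩ := hE' x hx
    obtain ⟨ζ, hζ, hζx, h2⟩ := hE₁ _ hτ
    refine ⟨(τ, ζ), hζx, ?_, h1.trans h2⟩
    rw [Prod.norm_def]
    exact max_le (hτx.trans (by linarith)) (hζ.trans hε₄.le)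
  · obtain ⟨ζ, hζ', hζ, h1⟩ := hE₁' x ⟨hx.1.trans (by linarith), hx.2⟩
    obtain ⟨τ, hτ, h2⟩ := hE'' (x.1, ζ) ⟨hx.1.trans (by linarith), hζ'⟩ (by
      have := hx.1
      simp only
      linarith)
    refine ⟨(τ, ζ), ?_, h2.trans h1⟩
    rw [Prod.norm_def]
    exact max_le (hτ.trans (by linarith)) (hζ.trans hε₄.le)

end PerturbedTube

section SmallCurve
variable {V : Type*} [NormedAddCommGroup V] [NormedSpace ℝ V] [FiniteDimensional ℝ V]

lemma exists_curve_of_small {W : ℝ × V → V} {a c R : ℝ} {y₀ : V} (hac : (0 : ℝ) ∈ Icc a c) (hR : 0 ≤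
    R) (hL0 : 0 ≤ L) (hW : ∀ x ∈ Icc a c ×ˢ closedBall y₀ R, ContDiffAt ℝ 1 W x) (hL : ∀ x ∈ Icc a c
    ×ˢ closedBall y₀ R, ‖W x‖ ≤ L) (hLR : L * (c - a) ≤ R / 2) {y : V} (hy : y ∈ closedBall y₀ (R /
    2)) : ∃ α : ℝ → V, α 0 = y ∧ ∀ t ∈ Ioo a c, α t ∈ closedBall y₀ R ∧ HasDerivAt α (W (t, α t)) t
    := by
  lift R to NNReal using hR
  lift L to NNReal using hL0
  have hQ : IsCompact (Icc a c ×ˢ closedBall y₀ R) := isCompact_Icc.prod (isCompact_closedBall y₀ R)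
  obtain ⟨K, hK⟩ := hQ.exists_bound_of_continuousOn (f := fderiv ℝ W) fun x hx =>
    ((hW x hx).fderiv_right (m := 0) (by simp)).continuousAt.continuousWithinAt
  have hPL : IsPicardLindelof (fun t y => W (t, y)) (⟨0, hac⟩ : Icc a c) y₀ R
      (R / 2) L (Real.toNNReal K) := by
    refine ⟨fun t ht => ?_, fun y hy t ht => ?_, fun t ht y hy => hL _ ⟨ht, hy⟩, ?_⟩
    · refine (convex_closedBall y₀ R).lipschitzOnWith_of_nnnorm_hasFDerivWithin_le
        (f' := fun y => (fderiv ℝ W (t, y)).comp (inr ℝ ℝ V))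
        (fun y hy => ?_) fun y hy => ?_
      · exact ((hW (t, y) ⟨ht, hy⟩).differentiableAt
          one_ne_zero).hasFDerivAt_right.hasFDerivWithinAt
      · rw [← NNReal.coe_le_coe, coe_nnnorm]
        refine (opNorm_comp_le _ _).trans ?_
        exact (mul_le_of_le_one_right (norm_nonneg _) (norm_inr_le_one ..)).trans
          ((hK (t, y) ⟨ht, hy⟩).trans (Real.le_coe_toNNReal K))
    · exact (ContinuousAt.comp (g := W) (f := fun t => (t, y)) (hW (t, y) ⟨ht, hy⟩).continuousAt
        (by fun_prop)).continuousWithinAt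
    · rw [NNReal.coe_div]
      change L * max (c - 0) (0 - a) ≤ R - R / 2
      have : max (c - 0) (0 - a) ≤ c - a := max_le (by linarith [hac.1]) (by linarith [hac.2])
      nlinarith [L.2]
  obtain ⟨α, hα⟩ := ODE.FunSpace.exists_isFixedPt_next hPL (x := y) (by simpa using hy)
  have hmem : ∀ t, α.compProj t ∈ closedBall y₀ R := fun t =>
    α.compProj_mem_closedBall hPL.mul_max_le
  refine ⟨α.compProj, ?_, fun t ht => ⟨hmem t, ?_⟩⟩
  · exact (α.compProj_val (t := ⟨0, hac⟩)).trans
      ((congrArg (fun β => β.toFun ⟨0, hac⟩) hα.symm).trans (ODE.FunSpace.next_apply₀ hPL _ α))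
  · have h1 := ODE.hasDerivWithinAt_picard_Icc (t₀ := 0) hac hPL.continuousOn_uncurry
      α.continuous_compProj.continuousOn (fun t _ => hmem t) y (Ioo_subset_Icc_self ht)
    refine (h1.congr_of_mem (fun t' ht' => ?_) (Ioo_subset_Icc_self ht)).hasDerivAt
      (Icc_mem_nhds ht.1 ht.2)
    exact (α.compProj_of_mem ht').trans (congrArg (fun β => β.toFun ⟨t', ht'⟩) hα.symm)

end SmallCurve

section MovingFrame
variable {E : ℝ × Model n → M}

def movingDrift (q : (ℝ × Model n) [⋀^Fin 2]→L[ℝ] ℝ × ((ℝ × Model n →L[ℝ] Target n) × Target n)) :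
    Model n :=
  (toBilin (Model n) (q.1.compContinuousLinearMap
    (inr ℝ ℝ (Model n)))).flip.inverse
    ((innerSL ℝ q.2.2).comp (q.2.1.comp (inr ℝ ℝ (Model n))) -
      ((toBilin (ℝ × Model n) q.1).flip (1, 0)).comp (inr ℝ ℝ (Model n)))

lemma movingDrift_spec {q : (ℝ × Model n) [⋀^Fin 2]→L[ℝ] ℝ × ((ℝ × Model n →L[ℝ] Target n) × Target
    n)} (hq : ∀ v : Model n, (∀ u : Model n, q.1 ![(0, u), (0, v)] = 0) → v = 0) : ContDiffAt ℝ ω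
    movingDrift q ∧ ∀ u, q.1 ![(0, u), (1, movingDrift q)] = inner ℝ q.2.2 (q.2.1 (0, u)) := by
  have hcomp : ∀ (η : (ℝ × Model n) [⋀^Fin 2]→L[ℝ] ℝ) (u v : Model n),
      toBilin (Model n) (η.compContinuousLinearMap (inr ℝ ℝ (Model n))) u v =
        η ![(0, u), (0, v)] := fun η u v => by
    rw [toBilin_apply, ContinuousAlternatingMap.compContinuousLinearMap_apply]
    exact congrArg η (funext fun i => by fin_cases i <;> rfl)
  let Y := (ℝ × Model n) [⋀^Fin 2]→L[ℝ] ℝ × ((ℝ × Model n →L[ℝ] Target n) × Target n)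
  have h1 : ContDiff ℝ ω fun q : Y => q.1 := contDiff_fst
  have h2 : ContDiff ℝ ω fun q : Y => q.2.1 := contDiff_fst.comp contDiff_snd
  have h3 : ContDiff ℝ ω fun q : Y => q.2.2 := contDiff_snd.comp contDiff_snd
  have h0 : ContDiff ℝ ω fun η : (ℝ × Model n) [⋀^Fin 2]→L[ℝ] ℝ =>
      η.compContinuousLinearMap (inr ℝ ℝ (Model n)) := by
    have := ContinuousLinearMap.contDiff (n := ω) (ContinuousAlternatingMap.compContinuousLinearMapCLM
      (inr ℝ ℝ (Model n)) : (ℝ × Model n) [⋀^Fin 2]→L[ℝ] ℝ →L[ℝ] _)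
    exact this
  have hB : ContDiffAt ℝ ω (fun q : Y => toBilin (Model n) (q.1.compContinuousLinearMap
      (inr ℝ ℝ (Model n)))) q :=
    contDiffAt_toBilin (h0.comp h1).contDiffAt
  have h4 : ContDiffAt ℝ ω (fun q : Y => (toBilin (ℝ × Model n) q.1).flip (1, 0)) q :=
    (contDiffAt_toBilin h1.contDiffAt).clm_flip.clm_apply contDiffAt_const
  have h5 : ContDiffAt ℝ ω (fun q : Y => innerSL ℝ q.2.2) q :=
    ((innerSL ℝ).contDiff.comp h3).contDiffAt
  have hl := (h5.clm_comp (h2.contDiffAt.clm_comp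
    (contDiffAt_const (c := inr ℝ ℝ (Model n))))).sub
    (h4.clm_comp (contDiffAt_const (c := inr ℝ ℝ (Model n))))
  obtain ⟨h6, h7⟩ := exists_contDiffAt_bilin_solve hB hl (by simpa only [hcomp] using hq)
  refine ⟨h6, fun u => ?_⟩
  have h8 := h7.self_of_nhds u
  rw [hcomp] at h8
  have h9 : ((1, movingDrift q) : ℝ × Model n) = (1, 0) + (0, movingDrift q) := by simp
  rw [h9, ← toBilin_apply, map_add, toBilin_apply, toBilin_apply]
  exact (congrArg _ h8).trans (add_sub_cancel _ _)

lemma movingDrift_nondegenerate (h : IsIntegrableSystem Ω F) {x : ℝ × Model n} (hE : Injective fun u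
    : Model n => dParam n E x (0, u)) (v : Model n) (hv : ∀ u : Model n, pullForm E Ω x ![(0, u),
    (0, v)] = 0) : v = 0 := by
  have hs := (LinearMap.injective_iff_surjective (f := ((dParam n E x).comp
    (inr ℝ ℝ (Model n))).toLinearMap)).1 hE
  refine hE ((formAt_nondegenerate h.symplectic (m := E x) fun w => ?_).trans
    (map_zero (dParam n E x)).symm)
  obtain ⟨u, rfl⟩ := hs w
  have := hv u
  rwa [pullForm_apply_two] at this

lemma dParam_movingDrift (h : IsIntegrableSystem Ω F) {x : ℝ × Model n} (hEd : MDifferentiableAt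
    𝓘(ℝ, ℝ × Model n) 𝓘[n] E x) (hE : Injective fun u : Model n => dParam n E x (0, u)) : dParam n E
    x (1, movingDrift (pullForm E Ω x, (fderiv ℝ (fun x => F (E x)) x, b (F (E x))))) = fiberField Ω
    F b (E x) := by
  have hs := (LinearMap.injective_iff_surjective (f := ((dParam n E x).comp
    (inr ℝ ℝ (Model n))).toLinearMap)).1 hE
  refine (hamDir_unique h fun w => ?_).symm
  obtain ⟨u, rfl⟩ := hs w
  have h1 := (movingDrift_spec (q := (pullForm E Ω x, (fderiv ℝ (fun x => F (E x)) x, b (F (E x)))))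
    (movingDrift_nondegenerate h hE)).2 u
  rw [pullForm_apply_two] at h1
  refine h1.trans ?_
  rw [fderiv_fun_comp_param hEd (h.mdifferentiableAt _)]
  rfl

lemma movingDrift_eq_zero (h : IsIntegrableSystem Ω F) {x : ℝ × Model n} (hEd : MDifferentiableAt
    𝓘(ℝ, ℝ × Model n) 𝓘[n] E x) (hE : Injective fun u : Model n => dParam n E x (0, u)) (hv : dParam
    n E x (1, 0) = fiberField Ω F b (E x)) : movingDrift (pullForm E Ω x, (fderiv ℝ (fun x => F (E
    x)) x, b (F (E x)))) = 0 := by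
  have h1 := dParam_movingDrift (b := b) h hEd hE
  rw [← hv, ← sub_eq_zero, ← map_sub, Prod.mk_sub_mk, sub_self, sub_zero] at h1
  exact hE (h1.trans (map_zero (dParam n E x)).symm)

end MovingFrame

section PerturbedFlow
variable {E : ℝ × Model n → M} {c r' R T : ℝ} {y₀ : Model n}

lemma eventually_mem_flowDomain_perturbation (h : IsIntegrableSystem Ω F) (hcr : c < r') (hb : ∀ ζ,
    ‖ζ‖ < r' → AnalyticAt ℝ b ζ) (hT : 0 < T) (hR : 0 < R) (hE : ∀ x ∈ Icc (-1) (T + 1) ×ˢ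
    closedBall y₀ R, ContMDiffAt 𝓘(ℝ, ℝ × Model n) 𝓘[n] ω E x ∧ (Injective fun u : Model n => dParam
    n E x (0, u)) ∧ dParam n E x (1, 0) = fiberField Ω F b (E x) ∧ ‖F (E x)‖ ≤ c) (P : CompactPieces
    n M) (hP : E '' (Icc (-1) (T + 1) ×ˢ closedBall y₀ R) ⊆ ⋃ i, P.piece i) (m : ℕ) (C : ℝ) : ∀ᶠ ε :
    ℝ in 𝓝[>] 0, ∀ (Ω' : DForm n M 2) (F' : M → Target n) (b' : Target n → Target n),
    IsIntegrableSystem Ω' F' → SystemCkClose P (m + 1) ε Ω Ω' F F' → (∀ ζ, ‖ζ‖ < r' → JetLE 0 (C *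
    ε) (fun ζ => b' ζ - b ζ) ζ) → ∀ y ∈ closedBall y₀ (R / 2), (T, E (0, y)) ∈ flowDomain
    (fiberField Ω' F' b') (F' ⁻¹' ball 0 r') := by
  let X := ℝ × Model n
  set Q : Set X := Icc (-1) (T + 1) ×ˢ closedBall y₀ R
  have hQ : IsCompact Q := isCompact_Icc.prod (isCompact_closedBall y₀ R)
  obtain ⟨C₁, hC₁, htr⟩ := exists_transfer hQ (fun x hx => (hE x hx).1) P hP (m + 1)
  set f : X → Target n := fun x => F (E x)
  have hf : ∀ x ∈ Q, ContDiffAt ℝ ω f x := fun x hx =>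
    (ContMDiffAt.comp (g := F) x h.analytic.contMDiffAt (hE x hx).1).contDiffAt
  have hEd : ∀ x ∈ Q, MDifferentiableAt 𝓘(ℝ, X) 𝓘[n] E x := fun x hx =>
    (hE x hx).1.mdiff
  let Y := X [⋀^Fin 2]→L[ℝ] ℝ × ((X →L[ℝ] Target n) × (Coords n))
  obtain ⟨C₂, hC₂, δ, hδ, hW⟩ := exists_bound_of_vanishing (X := X) (Y := Y)
    (T := fun q => movingDrift (pullForm E Ω q.1 + q.2.1, (fderiv ℝ f q.1 + q.2.2.1,
      b (f q.1 + q.2.2.2.1) + q.2.2.2.2))) hQ (fun x hx => by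
        have h8 : ContDiffAt ℝ ω b (f x + (0 : Y).2.2.1) := by
          simpa using (hb _ ((hE x hx).2.2.2.trans_lt hcr)).contDiffAt
        refine (ContDiffAt.comp (g := movingDrift) (x, (0 : Y)) (movingDrift_spec ?_).1
          (((contDiffAt_pullForm h.symplectic.analytic (mem_univ _) (hE x hx).1).fst'.add
            contDiffAt_snd.fst).prodMk (((hf x hx).analyticAt.fderiv.contDiffAt.fst'.add
            contDiffAt_snd.snd.fst).prodMk ((ContDiffAt.comp (g := b) (x, (0 : Y)) h8
            ((hf x hx).fst'.add contDiffAt_snd.snd.snd.fst)).add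
            contDiffAt_snd.snd.snd.snd)))).analyticAt
        simpa using movingDrift_nondegenerate h (hE x hx).2.1)
    (fun x hx => by simpa using movingDrift_eq_zero h (hEd x hx) (hE x hx).2.1 (hE x hx).2.2.1)
  filter_upwards [eventually_mul_lt (max C₁ C) hδ,
    eventually_mul_lt (C₂ * max C₁ C * (T + 2)) (half_pos hR),
    eventually_mul_lt C₁ (sub_pos.2 hcr), self_mem_nhdsWithin]
    with ε hε₁ hε₂ hε₃ hε₀ Ω' F' b' h' hc hb' y hy
  have hε : 0 ≤ ε := (mem_Ioi.1 hε₀).le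
  set f' : X → Target n := fun x => F' (E x)
  have hf' : ∀ x ∈ Q, ContDiffAt ℝ ω f' x := fun x hx =>
    (ContMDiffAt.comp (g := F') x h'.analytic.contMDiffAt (hE x hx).1).contDiffAt
  have hnorm : ∀ x ∈ Q, ‖f' x‖ < r' := fun x hx => by
    have h1 := (htr ε Ω Ω' F F' h h' hc x hx).1.norm_le
    have h2 := norm_add_le (f' x - f x) (f x)
    rw [sub_add_cancel] at h2
    linarith [(hE x hx).2.2.2]
  set W : X → Model n := fun x => movingDrift (pullForm E Ω' x, (fderiv ℝ f' x, b' (f' x)))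
  have hWc : ∀ x ∈ Q, ContDiffAt ℝ 1 W x := fun x hx => by
    have h1 : ContDiffAt ℝ ω b' (f' x) :=
      ((hb' _ (hnorm x hx)).1.add (hb _ (hnorm x hx)).contDiffAt).congr_of_eventuallyEq
        (.of_forall fun ζ => (sub_add_cancel _ _).symm)
    exact (ContDiffAt.comp (g := movingDrift) x
      (movingDrift_spec (movingDrift_nondegenerate h' (hE x hx).2.1)).1
      ((contDiffAt_pullForm h'.symplectic.analytic (mem_univ _) (hE x hx).1).prodMk
        ((hf' x hx).analyticAt.fderiv.contDiffAt.prodMk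
          (ContDiffAt.comp (g := b') x h1 (hf' x hx))))).of_le le_top
  have hWn : ∀ x ∈ Q, ‖W x‖ ≤ C₂ * (max C₁ C * ε) := fun x hx => by
    obtain ⟨h1, h2⟩ := htr ε Ω Ω' F F' h h' hc x hx
    have h3 := (h1.mono (Nat.le_add_left 1 m) le_rfl).fderiv.norm_le
    have h4 := (hb' _ (hnorm x hx)).norm_le
    have h5 : ‖((pullForm E Ω' x - pullForm E Ω x, (fderiv ℝ (fun x => f' x - f x) x,
        (f' x - f x, b' (f' x) - b (f' x)))) : Y)‖ ≤ max C₁ C * ε := by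
      have h6 := mul_le_mul_of_nonneg_right (le_max_left C₁ C) hε
      have h7 := mul_le_mul_of_nonneg_right (le_max_right C₁ C) hε
      exact max_le (h2.norm_le.trans h6) (max_le (h3.trans h6) (max_le (h1.norm_le.trans h6)
        (h4.trans h7)))
    have h6 := (hW x hx _ (h5.trans hε₁.le)).2.trans (mul_le_mul_of_nonneg_left h5 hC₂)
    have h7 : fderiv ℝ (fun x => f' x - f x) x = fderiv ℝ f' x - fderiv ℝ f x :=
      fderiv_fun_sub ((hf' x hx).diff)
        ((hf x hx).diff)
    simpa only [h7, add_sub_cancel] using h6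
  have h0 : (0 : ℝ) ∈ Ioo (-1) (T + 1) := ⟨by norm_num, by linarith⟩
  have hL0 : 0 ≤ C₂ * (max C₁ C * ε) := mul_nonneg hC₂ (mul_nonneg (le_max_of_le_left hC₁) hε)
  obtain ⟨α, hα0, hα⟩ := exists_curve_of_small (Ioo_subset_Icc_self h0) hR.le hL0 hWc hWn
    (by linarith) hy
  have hσ : IsFlowCurve (fiberField Ω' F' b') (F' ⁻¹' ball 0 r') (Ioo (-1) (T + 1))
      fun t => E (t, α t) := fun t ht => by
    have hx : (t, α t) ∈ Q := ⟨Ioo_subset_Icc_self ht, (hα t ht).1⟩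
    refine ⟨mem_ball_zero_iff.2 (hnorm _ hx), ?_⟩
    rw [← dParam_movingDrift h' (hEd _ hx) (hE _ hx).2.1]
    exact HasVelocityAt.comp_param (x := fun t => (t, α t)) (hEd _ hx)
      ((hasDerivAt_id t).prodMk (hα t ht).2)
  have h1 := hσ.mem_flowDomain h0 (t := T) ⟨by linarith, by linarith⟩
  simp only [hα0] at h1
  exact h1

lemma exists_nhds_mem_flowDomain_perturbation (h : IsIntegrableSystem Ω F) (hr' : r' ≤ r₂) (hb : ∀
    ζ, ‖ζ‖ < r₂ → AnalyticAt ℝ b ζ) (hT : 0 < T) (hU : IsOpen U) (hflow : ∀ m ∈ U, ∀ t, (t, m) ∈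
    flowDomain (fiberField Ω F b) (F ⁻¹' ball 0 r₂) ∧ localFlow (fiberField Ω F b) (F ⁻¹' ball 0 r₂)
    (t, m) ∈ U) {m₀ : M} (hm₀ : m₀ ∈ U) (hF : ‖F m₀‖ < r') : ∃ O ∈ 𝓝 m₀, ∃ K, IsCompact K ∧ K ⊆ U ∧
    ∀ P : CompactPieces n M, K ⊆ ⋃ i, P.piece i → ∀ (m : ℕ) (C : ℝ), ∀ᶠ ε : ℝ in 𝓝[>] 0, ∀ (Ω' :
    DForm n M 2) (F' : M → Target n) (b' : Target n → Target n), IsIntegrableSystem Ω' F' →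
    SystemCkClose P (m + 1) ε Ω Ω' F F' → (∀ ζ, ‖ζ‖ < r' → JetLE 0 (C * ε) (fun ζ => b' ζ - b ζ) ζ)
    → ∀ q ∈ O, (T, q) ∈ flowDomain (fiberField Ω' F' b') (F' ⁻¹' ball 0 r') := by
  have hv : ∀ p ∈ F ⁻¹' ball 0 r₂, VFAnalyticAt (fiberField Ω F b) p :=
    fun _ hp => vfAnalyticAt_fiberField h (hb _ (mem_ball_zero_iff.1 hp))
  have hN : IsOpen (F ⁻¹' ball 0 r₂) := isOpen_ball.preimage h.analytic.continuous
  set fl := localFlow (fiberField Ω F b) (F ⁻¹' ball 0 r₂) with hfl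
  have he := chart_mem_atlas (Model n) m₀
  have hm := mem_chart_source (Model n) m₀
  set e := chartAt (Model n) m₀
  obtain ⟨c, hc, hcr⟩ := exists_between hF
  have hpo : IsOpen (e.target ∩ e.symm ⁻¹' (U ∩ {q | ‖F q‖ < c})) :=
    e.isOpen_inter_preimage_symm (hU.inter (isOpen_lt h.analytic.continuous.norm continuous_const))
  have hpre : e.target ∩ e.symm ⁻¹' (U ∩ {q | ‖F q‖ < c}) ∈ 𝓝 (e m₀) := by
    refine hpo.mem_nhds ⟨e.map_source hm, ?_⟩
    rw [mem_preimage, e.left_inv hm]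
    exact ⟨hm₀, hc⟩
  obtain ⟨R, hR, hball⟩ := nhds_basis_closedBall.mem_iff.1 hpre
  set E : ℝ × Model n → M := fun x => fl (x.1, e.symm x.2)
  have hE : ∀ x ∈ Icc (-1) (T + 1) ×ˢ closedBall (e m₀) R,
      ContMDiffAt 𝓘(ℝ, ℝ × Model n) 𝓘[n] ω E x ∧
      (Injective fun u : Model n => dParam n E x (0, u)) ∧
      dParam n E x (1, 0) = fiberField Ω F b (E x) ∧ ‖F (E x)‖ ≤ c := by
    rintro ⟨t, y⟩ ⟨-, hy⟩
    obtain ⟨hyt, hyU, hyc⟩ := hball hy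
    have hd := fun s => (hflow _ hyU s).1
    have hs := contMDiffAt_chart_symm he hyt
    have hEa : ContMDiffAt 𝓘(ℝ, ℝ × Model n) 𝓘[n] ω E (t, y) :=
      ContMDiffAt.comp (g := fl) (f := fun x : ℝ × Model n => (x.1, e.symm x.2)) (t, y)
        (contMDiffAt_localFlow hN hv (hd t)) (contDiffAt_fst.contMDiffAt.prodMk
          (ContMDiffAt.comp (g := e.symm) (t, y) hs contDiffAt_snd.contMDiffAt))
    have hEd := hEa.mdifferentiableAt (n := ω) (by decide)
    refine ⟨hEa, fun u u' hu => ?_, ?_, ?_⟩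
    · have hφ := hasFDerivAt_prodMk_right (𝕜 := ℝ) t y
      have h1 := dParam_comp (n := n) (φ := fun y => (t, y)) hEd hφ.differentiableAt
      have h2 : (fun q => fl (-t, q)) ∘ (fun y => E (t, y)) =ᶠ[𝓝 y] e.symm := by
        filter_upwards [hpo.mem_nhds (hball hy)] with y' hy'
        have hy' := hy'.2.1
        have h3 := (localFlow_add hv (hflow _ hy' t).1 (hflow _ (hflow _ hy' t).2 (-t)).1).2
        rw [neg_add_cancel, localFlow_zero _ hv] at h3
        exact h3.symm
      have h3 := (mfderiv_comp y (g := fun q => fl (-t, q)) (mdifferentiableAt_localFlow_snd hN hv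
        (hflow _ (hflow _ hyU t).2 _).1) (MDifferentiableAt.comp (g := E) y hEd
          hφ.differentiableAt.mdifferentiableAt)).symm.trans h2.mfderiv_eq
      refine (bijective_mfderiv_chart_symm he hyt).1 ?_
      rw [← h3]
      refine congrArg (dMap n (fun q => fl (-t, q)) (E (t, y))) ?_
      change dParam n (fun y => E (t, y)) y u = dParam n (fun y => E (t, y)) y u'
      rw [h1, hφ.fderiv]
      exact hu
    · have h1 := HasVelocityAt.comp_param (x := fun s => (s, y)) hEd
        ((hasDerivAt_id t).prodMk (hasDerivAt_const t y))
      exact h1.mfderiv_one.symm.trans (hasVelocityAt_localFlow hv (hd t)).mfderiv_one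
    · have h1 := momentum_localFlow (N := F ⁻¹' ball 0 r₂) h
        (fun p hp => hb _ (mem_ball_zero_iff.1 hp)) (t, e.symm y)
      exact (congrArg norm h1).trans_le (le_of_lt hyc)
  refine ⟨e.source ∩ e ⁻¹' ball (e m₀) (R / 2), (e.isOpen_inter_preimage
    isOpen_ball).mem_nhds ⟨hm, mem_ball_self (half_pos hR)⟩,
    E '' (Icc (-1) (T + 1) ×ˢ closedBall (e m₀) R), (isCompact_Icc.prod
      (isCompact_closedBall _ _)).image_of_continuousOn fun x hx =>
        (hE x hx).1.continuousAt.continuousWithinAt, ?_, fun P hP m C => ?_⟩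
  · rintro _ ⟨x, hx, rfl⟩
    exact (hflow _ (hball hx.2).2.1 _).2
  · filter_upwards [eventually_mem_flowDomain_perturbation h hcr
      (fun ζ hζ => hb ζ (hζ.trans_le hr')) hT hR hE P hP m C] with ε hε Ω' F' b' h' hc hb' q hq
    have h1 := hε Ω' F' b' h' hc hb' (e q) (ball_subset_closedBall hq.2)
    simpa only [E, hfl, localFlow_zero _ hv, e.left_inv hq.1] using h1

/-- On compact sets, the trajectories of a perturbed fibre field are as long as those of the
unperturbed one. -/
theorem exists_mem_flowDomain_perturbation (h : IsIntegrableSystem Ω F) (hr' : r' ≤ r₂) (hb : ∀ ζ,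
    ‖ζ‖ < r₂ → AnalyticAt ℝ b ζ) (hT : 0 < T) (hU : IsOpen U) (hflow : ∀ m ∈ U, ∀ t, (t, m) ∈
    flowDomain (fiberField Ω F b) (F ⁻¹' ball 0 r₂) ∧ localFlow (fiberField Ω F b) (F ⁻¹' ball 0 r₂)
    (t, m) ∈ U) {S : Set M} (hS : IsCompact S) (hSU : S ⊆ U) (hF : ∀ q ∈ S, ‖F q‖ < r') : ∃ K,
    IsCompact K ∧ K ⊆ U ∧ ∀ P : CompactPieces n M, K ⊆ ⋃ i, P.piece i → ∀ (m : ℕ) (C : ℝ), ∀ᶠ ε : ℝ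
    in 𝓝[>] 0, ∀ (Ω' : DForm n M 2) (F' : M → Target n) (b' : Target n → Target n),
    IsIntegrableSystem Ω' F' → SystemCkClose P (m + 1) ε Ω Ω' F F' → (∀ ζ, ‖ζ‖ < r' → JetLE 0 (C *
    ε) (fun ζ => b' ζ - b ζ) ζ) → ∀ q ∈ S, (T, q) ∈ flowDomain (fiberField Ω' F' b') (F' ⁻¹' ball 0
    r') := by
  choose! O hO K hK hKU hP using fun q (hq : q ∈ S) => exists_nhds_mem_flowDomain_perturbation h hr'
    hb hT hU hflow (hSU hq) (hF q hq)
  obtain ⟨t, ht, hcov⟩ := hS.elim_nhds_subcover O hO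
  refine ⟨⋃ q ∈ t, K q, t.isCompact_biUnion fun q hq => hK q (ht q hq),
    iUnion₂_subset fun q hq => hKU q (ht q hq), fun P hKP m C => ?_⟩
  have h1 := (Filter.eventually_all_finset t).2 fun q hq =>
    hP q (ht q hq) P ((subset_biUnion_of_mem (u := K) hq).trans hKP) m C
  filter_upwards [h1] with ε hε Ω' F' b' h' hc hb' q hq
  obtain ⟨q', hq', hqO⟩ := mem_iUnion₂.1 (hcov hq)
  exact hε q' hq' Ω' F' b' h' hc hb' q hqO

end PerturbedFlow

section Persistence
variable {N : ℕ}

lemma exists_isCompact_isPreconnected (n : ℕ) [ChartedSpace (Model n) M] {K : Set M} (hU : IsOpen U)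
    (hUc : IsPreconnected U) (hK : IsCompact K) (hKU : K ⊆ U) (hK0 : K.Nonempty) : ∃ S, IsCompact S
    ∧ IsPreconnected S ∧ K ⊆ S ∧ S ⊆ U := by
  obtain ⟨q, hq⟩ := hK0
  have : LocallyPathConnectedSpace M := ChartedSpace.locallyPathConnectedSpace (Model n) M
  have hpath := (hU.isConnected_iff_isPathConnected.1 ⟨⟨q, hKU hq⟩, hUc⟩).joinedIn q (hKU hq)
  have hloc : ∀ x ∈ K, ∃ O ∈ 𝓝 x, ∃ S, IsCompact S ∧ IsPreconnected S ∧ q ∈ S ∧ O ⊆ S ∧ S ⊆ U := by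
    intro x hx
    set e := chartAt (Model n) x
    have hxs := mem_chart_source (Model n) x
    have hpre : e.target ∩ e.symm ⁻¹' U ∈ 𝓝 (e x) := (e.isOpen_inter_preimage_symm hU).mem_nhds
      ⟨e.map_source hxs, by rw [mem_preimage, e.left_inv hxs]; exact hKU hx⟩
    obtain ⟨R, hR, hball⟩ := nhds_basis_closedBall.mem_iff.1 hpre
    obtain ⟨γ, hγ⟩ := hpath x (hKU hx)
    have hc : ContinuousOn e.symm (closedBall (e x) R) :=
      e.continuousOn_symm.mono (hball.trans inter_subset_left)
    refine ⟨e.source ∩ e ⁻¹' ball (e x) R, (e.isOpen_inter_preimage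
      isOpen_ball).mem_nhds ⟨hxs, mem_ball_self hR⟩,
      range γ ∪ e.symm '' closedBall (e x) R, (isCompact_range γ.continuous).union
      ((isCompact_closedBall _ _).image_of_continuousOn hc), IsPreconnected.union x
      ⟨1, γ.target⟩ ⟨e x, mem_closedBall_self hR.le, e.left_inv hxs⟩
      (isPreconnected_range γ.continuous)
      ((convex_closedBall _ _).isPreconnected.image _ hc), Or.inl ⟨0, γ.source⟩, ?_, ?_⟩
    · exact fun y hy => Or.inr ⟨e y, ball_subset_closedBall hy.2, e.left_inv hy.1⟩
    · refine union_subset (range_subset_iff.2 hγ) ?_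
      rintro _ ⟨y, hy, rfl⟩
      exact (hball hy).2
  choose! O hO S hS hSc hSq hOS hSU using hloc
  obtain ⟨t, ht, hcov⟩ := hK.elim_nhds_subcover O hO
  refine ⟨⋃ x ∈ t, S x, t.isCompact_biUnion fun x hx => hS x (ht x hx), ?_,
    hcov.trans (iUnion₂_mono fun x hx => hOS x (ht x hx)),
    iUnion₂_subset fun x hx => hSU x (ht x hx)⟩
  refine isPreconnected_of_forall q fun y hy => ?_
  obtain ⟨x, hx, hy⟩ := mem_iUnion₂.1 hy
  exact ⟨S x, subset_biUnion_of_mem (u := S) hx, hSq x (ht x hx), hy, hSc x (ht x hx)⟩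

lemma IsPeriodicTube.funCkClose (hP : IsPeriodicTube Ω F p r₁ r₂ b E N J U) {Ω' : DForm n M 2} {F' :
    M → Target n} {r₁' r' : ℝ} {b' : Target n → Target n} {E' : Coords n → M} {J' : Target n → ℝ}
    {U' : Set M} (hP' : IsPeriodicTube Ω' F' p r₁' r' b' E' N J' U') (hr' : r' ≤ r₂) {m : ℕ} {ε : ℝ}
    (hb : ∀ ζ, ‖ζ‖ < r' → JetLE m ε (fun ζ => b' ζ - b ζ) ζ) : FunCkClose (ball 0 r') (m + 1) ((r' +
    1) * (‖(innerSL ℝ : Target n →L[ℝ] Target n →L[ℝ] ℝ)‖ * ε)) J J' := by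
  set L : Target n →L[ℝ] Target n →L[ℝ] ℝ := innerSL ℝ
  have hr0 := hP'.tube.base_pos
  have hd : ∀ z ∈ ball (0 : Target n) r', HasFDerivAt (fun w => J' w - J w)
      (L (b' z - b z)) z := fun z hz => by
    have h1 := (hP'.hasGradient z hz).hasFDerivAt.sub
      (hP.hasGradient z (ball_subset_ball hr' hz)).hasFDerivAt
    rw [← map_sub] at h1
    exact h1
  have hj : ∀ z ∈ ball (0 : Target n) r',
      JetLE m (‖L‖ * ε) (fderiv ℝ fun w => J' w - J w) z := fun z hz => by
    refine ((hb z (mem_ball_zero_iff.1 hz)).clm L).congr ?_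
    filter_upwards [isOpen_ball.mem_nhds hz] with w hw
    exact (hd w hw).fderiv
  have hε : 0 ≤ ‖L‖ * ε := (hj 0 (mem_ball_self hr0)).nonneg
  have hval : ∀ z ∈ ball (0 : Target n) r', ‖J' z - J z‖ ≤ (r' + 1) * (‖L‖ * ε) := by
    intro z hz
    have h1 := (convex_ball (0 : Target n) r').norm_image_sub_le_of_norm_fderiv_le (𝕜 := ℝ)
      (fun w hw => (hd w hw).differentiableAt) (fun w hw => (hj w hw).norm_le)
      (mem_ball_self hr0) hz
    rw [hP.action_zero, hP'.action_zero, sub_self, sub_zero, sub_zero] at h1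
    nlinarith [mem_ball_zero_iff.1 hz]
  have hle : ‖L‖ * ε ≤ (r' + 1) * (‖L‖ * ε) := le_mul_of_one_le_left hε (by linarith)
  intro z hz j hj'
  refine (JetLE.of_fderiv (f := fun w => J' w - J w) ?_ (hval z hz) ((hj z hz).mono le_rfl hle)).2 j hj'
  exact ((hP'.action_analytic z hz).sub (hP.action_analytic z (ball_subset_ball hr' hz))).contDiffAt

end Persistence

section Persistence
variable {N : ℕ}

lemma norm_gradient_sub_le {J' : Target n → ℝ} {β : Target n} {δ : ℝ} (hJ : HasGradientAt J β z)
    (hJ' : DifferentiableAt ℝ J' z) (h : ‖iteratedFDeriv ℝ 1 (fun w => J' w - J w) z‖ ≤ δ) :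
    ‖gradient J' z - β‖ ≤ δ := by
  rw [← norm_iteratedFDeriv_fderiv, norm_iteratedFDeriv_zero,
    (hJ'.hasGradientAt.hasFDerivAt.fun_sub hJ.hasFDerivAt).fderiv, ← map_sub,
    LinearIsometryEquiv.norm_map] at h
  exact h

lemma IsTube.eventually_graph_mem (ht : IsTube Ω F p r₁ r₂ b E) {W : Set (ℝ × M)} (hW : IsOpen W)
    (hEW : ∀ t ∈ Icc 0 (2 * π), (t, E (t • axis n, 0)) ∈ W) : ∀ᶠ y in 𝓝 (0 : Coords n), ∀ t ∈ Icc 0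
    (2 * π), (t, E ((t • axis n, 0) + y)) ∈ W := by
  refine isCompact_Icc.eventually_forall_of_forall_eventually fun t ht' => ?_
  have h1 : ContinuousAt (fun q : (Coords n) × ℝ => (q.2, E ((q.2 • axis n, 0) + q.1))) (0, t) := by
    refine continuousAt_snd.prodMk (ContinuousAt.comp (g := E)
      (f := fun q : (Coords n) × ℝ => (q.2 • axis n, 0) + q.1) (x := (0, t)) ?_ (by fun_prop))
    exact (ht.analytic _ (by
      simpa using mem_tubeDom_axis ht.width_pos t (by simpa using ht.base_pos))).continuousAt
  exact h1.preimage_mem_nhds (hW.mem_nhds (by simpa using hEW t ht'))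

theorem IsPeriodicTube.persistence (hP : IsPeriodicTube Ω F p r₁ r₂ b E N J U) (h :
    IsIntegrableSystem Ω F) (hb : ∀ ζ, ‖ζ‖ < r₂ → ‖b ζ - axis n‖ ≤ 1 / 4) {m : ℕ} {U' : Set M} {V' :
    Set (Target n)} {W : Set (ℝ × M)} (hU' : IsCompact (closure U')) (hU'U : closure U' ⊆ U) (hV' :
    IsCompact (closure V')) (hV'V : closure V' ⊆ ball 0 r₂) (hW : IsOpen W) (hEW : ∀ t ∈ Icc 0 (2 *
    π), (t, E (t • axis n, 0)) ∈ W) : ∃ (K : Set M) (W' : Set (ℝ × M)), IsCompact K ∧ K ⊆ U ∧ IsOpen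
    W' ∧ W' ⊆ W ∧ (∀ t ∈ Icc 0 (2 * π), (t, E (t • axis n, 0)) ∈ W') ∧ ∀ P : CompactPieces n M, K ⊆
    ⋃ i, P.piece i → ∃ ε₀ > 0, ∃ B > 0, ∃ δ > 0, B * ε₀ ≤ δ ∧ ∀ (ε : ℝ) (Ωt : DForm n M 2) (Ft : M →
    Target n), 0 < ε → ε ≤ ε₀ → IsIntegrableSystem Ωt Ft → SystemCkClose P (m + 1) ε Ω Ωt F Ft → ∃
    (Ut : Set M) (Vt : Set (Target n)) (Jt : Target n → ℝ) (Φt : AddCircle (2 * π) → M → M), (IsOpen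
    Ut ∧ U' ⊆ Ut ∧ Vt = Ft '' Ut ∧ IsOpen Vt ∧ V' ⊆ Vt ∧ Vt ⊆ ball 0 r₂ ∧ AnalyticOnNhd ℝ Jt Vt ∧
    FunCkClose Vt (m + 1) (B * ε) J Jt ∧ IsHamiltonianCircleAction Ωt Ft Ut (fun p => Jt (Ft p)) Φt)
    ∧ (∀ (J' : Target n → ℝ) (Φ' : AddCircle (2 * π) → M → M), AnalyticOnNhd ℝ J' Vt → FunCkClose Vt
    (m + 1) δ J J' → IsHamiltonianCircleAction Ωt Ft Ut (fun p => J' (Ft p)) Φ' → (∃ const : ℝ, ∀ z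
    ∈ Vt, J' z = Jt z + const) ∧ ∀ θ, EqOn (Φ' θ) (Φt θ) Ut) ∧ (∃ (c : Target n → ℝ → M) (G : Set M)
    (α : DForm n M 1), IsClosedCurveFamily Ft Vt c ∧ (∀ t ∈ Icc 0 (2 * π), (t, c 0 t) ∈ W') ∧
    IsAnalyticPrimitiveOn Ωt α G ∧ (∀ z ∈ Vt, range (c z) ⊆ G) ∧ MineurArnoldFormula α Vt c Jt) ∧ (∀
    (Z : Set (Target n)) (c : Target n → ℝ → M) (G : Set M) (α : DForm n M 1), IsOpen Z →
    IsConnected Z → Z ⊆ Vt → IsClosedCurveFamily Ft Z c → (∃ z ∈ Z, ∀ t ∈ Icc 0 (2 * π), (t, c z t)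
    ∈ W') → IsAnalyticPrimitiveOn Ωt α G → (∀ z ∈ Z, range (c z) ⊆ G) → MineurArnoldFormula α Z c
    Jt) := by
  have ht := hP.tube
  have hr₁ := ht.width_pos
  have hr₂ := ht.base_pos
  have hp := ht.period_pos
  have hN : (0 : ℝ) < N := Nat.cast_pos.2 hP.count_pos
  have hcl : ∀ {η : ℝ}, 2 * η < r₁ → η < r₂ →
      closedBall (0 : Coords n) η ⊆ tubeDom r₁ r₂ := fun h₁ h₂ x hx => by
    have h3 := mem_closedBall_zero_iff.1 hx
    exact ⟨(norm_offAxis_le _).trans_lt (by linarith [norm_fst_le x]),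
      (norm_snd_le x).trans_lt (by linarith)⟩
  obtain ⟨η₀, hη₀, hη₀'⟩ := exists_between (lt_min (half_pos hr₁) hr₂)
  have hD := hcl (η := η₀) (by linarith [min_le_left (r₁ / 2) r₂]) (by
    linarith [min_le_right (r₁ / 2) r₂])
  have h0 : (0 : Coords n) ∈ closedBall 0 η₀ := mem_closedBall_self hη₀.le
  obtain ⟨S, hS, hSc, hKS, hSU⟩ := exists_isCompact_isPreconnected n hP.isOpen hP.isPreconnected
    (K := closure U' ∪ E '' closedBall 0 η₀) (hU'.union ((isCompact_closedBall _
      _).image_of_continuousOn fun x hx => (ht.analytic x (hD hx)).continuousAt.continuousWithinAt))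
    (union_subset hU'U ((image_mono hD).trans hP.tube_subset)) ⟨E 0, Or.inr ⟨0, h0, rfl⟩⟩
  obtain ⟨r', hr'r, hr'⟩ := exists_lt_subset_ball (((hS.image h.analytic.continuous).union
    hV').isClosed) (union_subset (image_subset_iff.2 (hSU.trans hP.subset_preimage)) hV'V)
  have hFS : ∀ q ∈ S, ‖F q‖ < r' := fun q hq => mem_ball_zero_iff.1 (hr' (Or.inl ⟨q, hq, rfl⟩))
  have hr'0 : 0 < r' := (norm_nonneg _).trans_lt (hFS _ (hKS (Or.inr ⟨0, h0, rfl⟩)))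
  obtain ⟨ρ, hρ, hρ'⟩ := exists_between
    (lt_min (show 0 < r₁ / 16 by positivity) (lt_min (half_pos hr'0) (show 0 < p / 4 by positivity)))
  obtain ⟨hρ₁, hρ₂, hρ₃⟩ : ρ < r₁ / 16 ∧ ρ < r' / 2 ∧ ρ < p / 4 := by simpa using hρ'
  have hWo := hW.inter (ht.isOpen_tubeNbhd h (ρ := ρ) (by linarith) (by linarith))
  have hEW' : ∀ t ∈ Icc 0 (2 * π), (t, E (t • axis n, 0)) ∈ W ∩ tubeNbhd E ρ := fun t ht' =>
    ⟨hEW t ht', (t • axis n, 0), by simpa using hρ, rfl⟩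
  obtain ⟨η₁, hη₁, hη₁W⟩ := eventually_nhds_iff_ball.1 (ht.eventually_graph_mem hWo hEW')
  obtain ⟨η, hη, hη'⟩ := exists_between (lt_min hη₀ (lt_min hη₁ hρ))
  obtain ⟨hηa, hηb, hηc⟩ : η < η₀ ∧ η < η₁ ∧ η < ρ := by simpa using hη'
  obtain ⟨K₁, hK₁, hK₁E, hper⟩ := ht.exists_perturbation h hb hr'0 hr'r hη
  obtain ⟨K₂, hK₂, hK₂U, hflow⟩ := exists_mem_flowDomain_perturbation h hr'r.le ht.drift_analytic
    Real.two_pi_pos hP.isOpen (fun q hq t => ⟨(hP.flow q hq t).1, (hP.flow q hq t).2.1⟩) hS hSU hFS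
  refine ⟨K₁ ∪ K₂, _, hK₁.union hK₂, union_subset (hK₁E.trans hP.tube_subset) hK₂U, hWo,
    inter_subset_left, hEW', fun P hKP => ?_⟩
  obtain ⟨C, hC, hpert⟩ := hper P (subset_union_left.trans hKP) m
  have hflow' := hflow P (subset_union_right.trans hKP) m C
  set l := ‖(innerSL ℝ : Target n →L[ℝ] Target n →L[ℝ] ℝ)‖
  set B := (r' + 1) * (l * C) + 1 with hB
  have hB0 : 0 < B := by positivity
  obtain ⟨δ, hδ, hδ'⟩ := exists_between (lt_min (show 0 < 1 / (4 * (N : ℝ)) by positivity)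
    (show 0 < r₁ / 4 / 56 by positivity))
  obtain ⟨hδ₁, hδ₂⟩ : δ < 1 / (4 * (N : ℝ)) ∧ δ < r₁ / 4 / 56 := by simpa using hδ'
  rw [lt_div_iff₀ (by positivity)] at hδ₁
  obtain ⟨ε₀, hε₀, hev⟩ := mem_nhdsGT_iff_exists_Ioc_subset.1 (hpert.and (hflow'.and
    ((eventually_mul_lt B hδ).and (eventually_mul_lt C hδ))))
  refine ⟨ε₀, hε₀, B, hB0, δ, hδ, (hev ⟨hε₀, le_rfl⟩).2.2.1.le, fun ε Ωt Ft hε hεε₀ h' hc => ?_⟩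
  obtain ⟨h₁, h₂, -, h₄⟩ := hev ⟨hε, hεε₀⟩
  obtain ⟨bt, Et, htt, hbt, hEt, hEt'⟩ := h₁ Ωt Ft h' hc
  have h0t : (0 : Coords n) ∈ tubeDom (r₁ / 4) r' := ⟨by simpa using hr₁, by simpa using hr'0⟩
  obtain ⟨y, -, hy, hEy⟩ := hEt 0 h0t
  obtain ⟨Jt, Ut, hPt, hSUt⟩ := htt.exists_periodicTube h' hP.count_pos hP.period_eq hSc
    (h₂ Ωt Ft bt h' hc fun ζ hζ => (hbt ζ hζ).mono (Nat.zero_le m) le_rfl) h0t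
    (hKS (Or.inr ⟨y, mem_closedBall_zero_iff.2 (by rw [sub_zero] at hy; linarith), hEy.symm⟩))
  obtain ⟨Φt, hΦt⟩ := hPt.exists_circleAction h'
  obtain ⟨G, α, hα, hcur, hG, hform⟩ := hPt.exists_formula h'
  have hsub := ball_subset_ball (x := (0 : Target n)) hr'r.le
  refine ⟨Ut, ball 0 r', Jt, Φt, ⟨hPt.isOpen, subset_closure.trans (subset_union_left.trans
    (hKS.trans hSUt)), hPt.image_eq.symm, isOpen_ball, subset_closure.trans
    (subset_union_right.trans hr'), hsub, hPt.action_analytic, fun z hz j hj => ?_, hΦt⟩,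
    fun J' Φ' hJ' hJJ' hΦ' => ?_, ⟨_, G, α, hcur, fun t ht' => ?_, hα, hG, hform⟩,
    fun Z c G α hZo hZc hZV hc hcW hα hG => ?_⟩
  · refine (hP.funCkClose hPt hr'r.le hbt z hz j hj).trans ?_
    rw [hB]
    nlinarith
  · obtain ⟨h5, h6⟩ := hPt.action_unique h' (κ := 2 * δ) (by linarith) (by linarith) hJ' (by
      filter_upwards [ball_mem_nhds (0 : Target n) hr'0] with z hz
      have h6 := norm_gradient_sub_le (hP.hasGradient z (hsub hz)) (hJ' z hz).differentiableAt
        (hJJ' z hz 1 (Nat.le_add_left 1 m))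
      have h7 := (hbt z (mem_ball_zero_iff.1 hz)).norm_le
      rw [norm_sub_rev] at h7
      have h8 := norm_add_le (gradient J' z - b z) (b z - bt z)
      rw [sub_add_sub_cancel] at h8
      linarith) hΦt hΦ'
    exact ⟨⟨_, h5⟩, h6⟩
  · obtain ⟨x, -, hx, hxE⟩ := hEt (t • axis n, 0) (mem_tubeDom_axis (by positivity) t (by simpa))
    have h5 := hη₁W (x - (t • axis n, 0)) (mem_ball_zero_iff.2 (by linarith)) t ht'
    rw [add_sub_cancel] at h5
    simp only [hxE]
    exact h5
  · obtain ⟨z, hz, hzW⟩ := hcW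
    refine htt.mineurArnoldFormula h' hP.period_eq (ρ := 2 * ρ) (by linarith) (by linarith)
      (by linarith) hPt.action_analytic hPt.hasGradient hZo hZc hZV hc ⟨z, hz, fun t ht' => ?_⟩ hα hG
    obtain ⟨x, hx, hxE⟩ := (hzW t ht').2
    obtain ⟨y, hy, hyE⟩ := hEt' x (mem_tubeDom_of_near hx (by linarith) (by linarith))
    refine ⟨y, ?_, hyE.trans hxE⟩
    have h5 := norm_add_le (y - x) (x - (t • axis n, 0))
    rw [sub_add_sub_cancel] at h5
    simp only at hx
    linarith

end Persistence

end Integrable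

end

theorem mainTheorem1 {n : ℕ} [NeZero n]
    {M : Type*} [TopologicalSpace M] [T2Space M] [SecondCountableTopology M]
    [ChartedSpace (Model n) M] [IsManifold 𝓘(ℝ, Model n) ω M]
    (Ω : DForm n M 2) (F : M → Target n) (hsys : IsIntegrableSystem Ω F)
    (m₀ : M) (hm₀ : F m₀ = 0) (hsing : momentumRank F m₀ < n)
    -- (i) a regular point of the singular fibre
    (m₁ : M) (hm₁ : F m₁ = 0) (hreg : momentumRank F m₁ = n)
    -- (ii) the family of periodic trajectories of the Hamiltonian vector field of `f₁`
    (γ : ℝ → ℝ → M)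
    (hγ_cont : ContinuousOn (fun p : ℝ × ℝ => γ p.1 p.2) (Ioc 0 1 ×ˢ univ))
    (hγ_traj : ∀ u ∈ Ioc (0 : ℝ) 1,
      IsMIntegralCurve (I := 𝓘(ℝ, Model n)) (γ u) (hamVF Ω (fun p => F p 0)))
    (hγ_per : ∀ u ∈ Ioc (0 : ℝ) 1, Function.Periodic (γ u) (2 * Real.pi))
    (hγ_orb : ∀ u ∈ Ioc (0 : ℝ) 1, range (γ u) ⊆ localOrbit Ω F m₁)
    (hγ_m₁ : m₁ ∈ range (γ 1))
    (γ₀ : ℝ → M)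
    (hγ₀_traj : IsMIntegralCurve (I := 𝓘(ℝ, Model n)) γ₀ (hamVF Ω (fun p => F p 0)))
    (hγ₀_per : ∃ T > 0, Function.Periodic γ₀ T)
    (hγ₀_m₀ : m₀ ∈ range γ₀)
    (hγ₀_sub : range γ₀ ⊆ familyClosure γ)
    -- the trajectories of this vector field through points of `C` are complete
    (hC : ∀ p ∈ familyClosure γ, ∃ σ : ℝ → M, σ 0 = p ∧
      IsMIntegralCurve (I := 𝓘(ℝ, Model n)) σ (hamVF Ω (fun p => F p 0))) :
    ∃ (U : Set M) (V : Set (Target n)) (J : Target n → ℝ)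
      (Φ : AddCircle (2 * Real.pi) → M → M),
      -- (a) existence of the action
      (IsOpen U ∧ familyClosure γ ⊆ U ∧ V = F '' U ∧ IsOpen V ∧
        AnalyticOnNhd ℝ J V ∧
        (fun z => J z - z 0) =O[𝓝 0] (fun z => ‖z‖ ^ 2) ∧
        IsHamiltonianCircleAction Ω F U (fun p => J (F p)) Φ) ∧
      -- (a) uniqueness of the action
      (∀ (J' : Target n → ℝ) (Φ' : AddCircle (2 * Real.pi) → M → M),
        AnalyticOnNhd ℝ J' V →
        (fun z => J' z - z 0) =O[𝓝 0] (fun z => ‖z‖ ^ 2) →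
        IsHamiltonianCircleAction Ω F U (fun p => J' (F p)) Φ' →
        EqOn J' J V ∧ ∀ θ, EqOn (Φ' θ) (Φ θ) U) ∧
      -- (a) the integral formula: it computes the action function on all of `V`, ...
      (∃ (c : Target n → ℝ → M) (G : Set M) (α : DForm n M 1),
        IsClosedCurveFamily F V c ∧ c 0 = γ 1 ∧ IsAnalyticPrimitiveOn Ω α G ∧
        (∀ z ∈ V, range (c z) ⊆ G) ∧ MineurArnoldFormula α V c J) ∧
      -- ... and it holds for every choice of the curves and of the primitive
      (∀ (Z : Set (Target n)) (c : Target n → ℝ → M) (G : Set M) (α : DForm n M 1),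
        IsOpen Z → IsConnected Z → 0 ∈ Z → Z ⊆ V →
        IsClosedCurveFamily F Z c → c 0 = γ 1 → IsAnalyticPrimitiveOn Ω α G →
        (∀ z ∈ Z, range (c z) ⊆ G) → MineurArnoldFormula α Z c J) ∧
      -- (b) persistence
      (∀ (k : ℕ) (U' : Set M) (V' : Set (Target n)) (W : Set (ℝ × M)), 2 ≤ k →
        U' ∈ 𝓝ˢ (familyClosure γ) → IsCompact (closure U') → closure U' ⊆ U →
        V' ∈ 𝓝 0 → IsCompact (closure V') → closure V' ⊆ V →
        -- `W` is a neighbourhood of (the graph of) the closed curve `γ₁`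
        IsOpen W → (∀ t ∈ Icc 0 (2 * Real.pi), (t, γ 1 t) ∈ W) →
        ∃ (K : Set M) (W' : Set (ℝ × M)), IsCompact K ∧ K ⊆ U ∧
          IsOpen W' ∧ W' ⊆ W ∧ (∀ t ∈ Icc 0 (2 * Real.pi), (t, γ 1 t) ∈ W') ∧
          ∀ P : CompactPieces n M, K ⊆ ⋃ i, P.piece i →
          ∃ ε₀ > 0, ∃ B > 0, ∃ δ > 0, B * ε₀ ≤ δ ∧
          ∀ (ε : ℝ) (Ωt : DForm n M 2) (Ft : M → Target n), 0 < ε → ε ≤ ε₀ →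
            IsIntegrableSystem Ωt Ft → SystemCkClose P k ε Ω Ωt F Ft →
            ∃ (Ut : Set M) (Vt : Set (Target n)) (Jt : Target n → ℝ)
              (Φt : AddCircle (2 * Real.pi) → M → M),
              -- existence of the perturbed action, with `B * ε`-close action function
              (IsOpen Ut ∧ U' ⊆ Ut ∧ Vt = Ft '' Ut ∧ IsOpen Vt ∧ V' ⊆ Vt ∧ Vt ⊆ V ∧
                AnalyticOnNhd ℝ Jt Vt ∧ FunCkClose Vt k (B * ε) J Jt ∧
                IsHamiltonianCircleAction Ωt Ft Ut (fun p => Jt (Ft p)) Φt) ∧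
              -- uniqueness of the perturbed action
              (∀ (J' : Target n → ℝ) (Φ' : AddCircle (2 * Real.pi) → M → M),
                AnalyticOnNhd ℝ J' Vt → FunCkClose Vt k δ J J' →
                IsHamiltonianCircleAction Ωt Ft Ut (fun p => J' (Ft p)) Φ' →
                (∃ const : ℝ, ∀ z ∈ Vt, J' z = Jt z + const) ∧
                  ∀ θ, EqOn (Φ' θ) (Φt θ) Ut) ∧
              -- the integral formula for the perturbed action function
              (∃ (c : Target n → ℝ → M) (G : Set M) (α : DForm n M 1),
                IsClosedCurveFamily Ft Vt c ∧
                (∀ t ∈ Icc 0 (2 * Real.pi), (t, c 0 t) ∈ W') ∧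
                IsAnalyticPrimitiveOn Ωt α G ∧
                (∀ z ∈ Vt, range (c z) ⊆ G) ∧ MineurArnoldFormula α Vt c Jt) ∧
              (∀ (Z : Set (Target n)) (c : Target n → ℝ → M) (G : Set M) (α : DForm n M 1),
                IsOpen Z → IsConnected Z → Z ⊆ Vt → IsClosedCurveFamily Ft Z c →
                (∃ z ∈ Z, ∀ t ∈ Icc 0 (2 * Real.pi), (t, c z t) ∈ W') →
                IsAnalyticPrimitiveOn Ωt α G →
                (∀ z ∈ Z, range (c z) ⊆ G) → MineurArnoldFormula α Z c Jt)) := by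
  obtain ⟨p, r₁, r₂, b, E, N, J, U, hP, hb0, hb, hE, hCU⟩ := exists_periodicTube hsys hm₁ hreg
    hγ_cont hγ_traj hγ_per hγ_orb hγ_m₁ hC
  have ht := hP.tube
  have h0 : (0 : Target n) ∈ Metric.ball 0 r₂ := Metric.mem_ball_self ht.base_pos
  obtain ⟨Φ, hΦ⟩ := hP.exists_circleAction hsys
  obtain ⟨G, α, hα, hcur, hG, hform⟩ := hP.exists_formula hsys
  have hg : HasGradientAt J (axis n) 0 := hb0 ▸ hP.hasGradient 0 h0
  refine ⟨U, Metric.ball 0 r₂, J, Φ, ⟨hP.isOpen, hCU, hP.image_eq.symm, Metric.isOpen_ball,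
    hP.action_analytic, isBigO_sub_apply_zero (hP.action_analytic 0 h0) hP.action_zero hg, hΦ⟩,
    fun J' Φ' hJ' hJO hΦ' => ?_, ⟨_, G, α, hcur, funext hE, hα, hG, hform⟩,
    fun Z c G α hZo hZc h0Z hZV hc hc0 hα hG => ?_, fun k U' V' W hk _ hU' hU'U _ hV' hV'V hW hγW => ?_⟩
  · obtain ⟨hJ0, hJg⟩ := gradient_eq_axis hJO
    have hN : (0 : ℝ) < N := Nat.cast_pos.2 hP.count_pos
    obtain ⟨κ, hκ, hκ'⟩ := exists_between (lt_min (show 0 < 1 / (2 * (N : ℝ)) by positivity)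
      (show 0 < r₁ / 28 by linarith [ht.width_pos]))
    obtain ⟨hκ₁, hκ₂⟩ := lt_min_iff.1 hκ'
    rw [lt_div_iff₀ (by positivity)] at hκ₁
    have h1 : ContinuousAt (fun z => ‖gradient J' z - b z‖) 0 :=
      ((((InnerProductSpace.toDual ℝ (Target n)).symm.continuous.continuousAt.comp
        (hJ' 0 h0).fderiv.continuousAt)).sub
        (ht.drift_analytic 0 (mem_ball_zero_iff.1 h0)).continuousAt).norm
    obtain ⟨h2, h3⟩ := hP.action_unique hsys (κ := κ) (by linarith) (by linarith) hJ'
      ((h1.eventually_lt continuousAt_const (by simpa [hJg.gradient, hb0] using hκ)).mono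
        fun _ h => h.le) hΦ hΦ'
    exact ⟨fun z hz => by rw [h2 z hz, hJ0, add_zero], h3⟩
  · set ρ := min (r₁ / 2) (min r₂ (p / 2))
    have hρ : 0 < ρ := lt_min (half_pos ht.width_pos)
      (lt_min ht.base_pos (half_pos ht.period_pos))
    have h1 : ρ ≤ r₁ / 2 := min_le_left _ _
    have h2 : ρ ≤ r₂ := (min_le_right _ _).trans (min_le_left _ _)
    have h3 : ρ ≤ p / 2 := (min_le_right _ _).trans (min_le_right _ _)
    refine ht.mineurArnoldFormula hsys hP.period_eq (ρ := ρ) (by linarith) h2 (by linarith)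
      hP.action_analytic hP.hasGradient hZo hZc hZV hc
      ⟨0, h0Z, fun t _ => ⟨(t • axis n, 0), by simpa using hρ, ?_⟩⟩ hα hG
    rw [hE, hc0]
  · obtain ⟨m, rfl⟩ := Nat.exists_eq_add_of_le' (one_le_two.trans hk)
    simp only [← hE] at hγW ⊢
    exact hP.persistence hsys hb hU' hU'U hV' hV'V hW hγW
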